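/- Let $h$ be a non-negative multiplicative function such that $\mathcal H(s)=\sum_{n\ge1}\mu^2(n)h(n)n^{-s}$ converges absolutely for $\Re s>1$. Assume that there are constants $L,c_0>0$ such that $\mathcal H(s)=\zeta(s)^2\mathcal H^*(s)$ for $\Re s>1$, where $\mathcal H^*$ is holomorphic for $\Re s\ge 1-c_0$, and such that $\mathcal H^*(s)\neq0$ and $|1/\mathcal H^*(s)|\le L$ for all $s=\sigma+it$ with $\sigma\ge 1-c_0$ and $\sigma\ge 1-\frac{1}{L\log(|t|+2)}$. Assume also that $$\Big|\sum_{p\le x}\frac{h(p)\log p}{p}-2\log x\Big|\le L\quad(x\ge3),\qquad \sum_p h(p)^2p^{2c_0-2}<+\infty,$$ where $p$ runs over primes. Let $\Psi:\mathbf R\to\mathbf R$ be a fixed non-negative smooth function supported in $[1,2]$ with $\int_{\mathbf R}\Psi(x)\,dx=1$. For $X,D,z\ge3$ put $P(z)=\prod_{p<z}p$, $$\varrho_d=\mu(d)\Big(\frac{\log(\sqrt D/d)}{\log\sqrt D}\Big)^2\ (d\le\sqrt D),\qquad \varrho_d=0\ (d>\sqrt D),$$ $$S(X,z;h,\varrho)=\sum_{n\ge1}\Psi\Big(\frac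 nX\Big)\mu^2(n)h(n)\Big(\sum_{d\mid(n,P(z))}\varrho_d\Big)^2 .$$ Let $\sigma$ be the continuous solution on $]0,\infty[$ of $$\sigma(s)=\frac{s^2}{8e^{2\gamma}}\ (0<s\le2),\qquad (s^{-2}\sigma(s))'=-2s^{-3}\sigma(s-2)\ (s>2),$$ and let $\mathfrak f$ be the continuous solution on $]0,\infty[$ of $$\mathfrak f(s)=2\ (0<s\le2),\qquad s\,\mathfrak f'(s)=2\mathfrak f(s-2)\ (s>2);$$ put $\sigma(s)=\mathfrak f(s)=0$ for $s\le0$. Here $\gamma$ is Euler's constant. Define $$c_1(\tau)=\int_0^1\sigma'((1-u)\tau)\,\mathfrak f(u\tau)^2\,du,$$ $$c_2(\tau)=\int_0^1\!\!\int_0^1\sigma'((1-u)\tau)\,\mathfrak f(u\tau-2v)\{2\mathfrak f(u\tau)-\mathfrak f(u\tau-2v)\}\,du\,dv,$$ $$\mathfrak S(\vartheta,\tau)=16e^{2\gamma}\Big(\frac{c_1(\tau)}{4\tau\vartheta^2}+\frac{c_2(\tau)}{\tau^2\vartheta}\Big).$$ Then for every $A>0$, as $X\to\infty$, $$S(X,z;h,\varrho)=(1+o(1))\,\mathfrak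 S(\vartheta,\tau)\,\frac{X}{\log X},$$ uniformly in all $D,z\ge3$ with $X\le D^A$ and $X\le z^A$ for which $\tau=\log D/\log z$ and the number $\vartheta$ defined by $\sqrt D=X^\vartheta\exp(-\sqrt{\log X})$ satisfies $0<\vartheta<\frac12$. That is, the $o(1)$ depends only on $h$, $\mathcal H^*$, $L$, $c_0$, $\Psi$, $A$ and $X$. -/

import Mathlib

open scoped ContDiff

namespace SelbergSieve

open Set Filter Topology MeasureTheory

/-! ### Existence and uniqueness for linear delay equations (method of steps) -/

/-- `F` vanishes on `]-∞, 0]`, is continuous on `]0, ∞[`, equals `φ` on `]0, 2]`, and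
satisfies `(p F)'(s) = q(s) F(s - 2)` for `s > 2`. -/
def IsDelaySolution (φ p q F : ℝ → ℝ) : Prop :=
  (∀ s, s ≤ 0 → F s = 0) ∧ ContinuousOn F (Ioi 0) ∧
    (∀ s, 0 < s → s ≤ 2 → F s = φ s) ∧
    ∀ s, 2 < s → HasDerivAt (fun t => p t * F t) (q s * F (s - 2)) s

theorem exists_delay_aux (φ P Q : ℝ → ℝ) (hφ : Continuous φ) (hP : Continuous P)
    (hP0 : ∀ s, P s ≠ 0) (hPc : ∀ s, s ≤ 2 → P s = P 2) (hQ : Continuous Q) :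
    ∃ G : ℝ → ℝ, Continuous G ∧ (∀ s, s ≤ 2 → G s = φ s) ∧
      ∀ s, 2 ≤ s → P s * G s = P 2 * φ 2 + ∫ t in (2 : ℝ)..s, Q t * G (t - 2) := by
  let T : (ℝ → ℝ) → ℝ → ℝ := fun G s =>
    φ (min s 2) - φ 2 + (P 2 * φ 2 + ∫ t in (2 : ℝ)..(max s 2), Q t * G (t - 2)) / P s
  have hTc : ∀ G, Continuous G → Continuous (T G) := by
    intro G hG
    have h1 : Continuous fun x : ℝ => ∫ t in (2 : ℝ)..x, Q t * G (t - 2) :=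
      intervalIntegral.continuous_primitive
        (fun a b => Continuous.intervalIntegrable (by fun_prop) a b) 2
    have h2 : Continuous fun s : ℝ => ∫ t in (2 : ℝ)..(max s 2), Q t * G (t - 2) :=
      h1.comp (by fun_prop : Continuous fun s : ℝ => max s 2)
    exact ((hφ.comp (by fun_prop)).sub continuous_const).add
      ((continuous_const.add h2).div hP hP0)
  have hT2 : ∀ G s, s ≤ 2 → T G s = φ s := by
    intro G s hs
    have := hP0 2
    simp only [T, min_eq_left hs, max_eq_right hs, hPc s hs, intervalIntegral.integral_same]
    field_simp
    ring
  have hTe : ∀ G s, 2 ≤ s →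
      P s * T G s = P 2 * φ 2 + ∫ t in (2 : ℝ)..s, Q t * G (t - 2) := by
    intro G s hs
    have := hP0 s
    simp only [T, min_eq_right hs, max_eq_left hs]
    field_simp
    ring
  let g : ℕ → ℝ → ℝ := fun n => T^[n] φ
  have hgs : ∀ n, g (n + 1) = T (g n) := fun n => Function.iterate_succ_apply' T n φ
  have hgc : ∀ n, Continuous (g n) := by
    intro n
    induction n with
    | zero => exact hφ
    | succ n ih => rw [hgs]; exact hTc _ ih
  have hcongr : ∀ G H s, (∀ t, t ≤ s - 2 → G t = H t) → T G s = T H s := by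
    intro G H s h
    rcases le_total s 2 with hs | hs
    · rw [hT2 _ _ hs, hT2 _ _ hs]
    · have : P s * T G s = P s * T H s := by
        rw [hTe _ _ hs, hTe _ _ hs]
        congr 1
        apply intervalIntegral.integral_congr
        intro t ht
        rw [uIcc_of_le hs] at ht
        simp only
        rw [h (t - 2) (by linarith [ht.2])]
      exact mul_left_cancel₀ (hP0 s) this
  have hstep : ∀ (n : ℕ) (s : ℝ), s ≤ 2 * ((n : ℝ) + 1) → g (n + 1) s = g n s := by
    intro n
    induction n with
    | zero =>
      intro s hs
      rw [hgs, hT2 _ _ (by simpa using hs)]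
      rfl
    | succ n ih =>
      intro s hs
      rw [hgs (n + 1), hgs n]
      refine hcongr _ _ _ fun t ht => ?_
      have := ih t (by push_cast at hs; linarith)
      rwa [hgs n] at this
  have hstab : ∀ (n k : ℕ) (s : ℝ), s ≤ 2 * ((n : ℝ) + 1) → g (n + k) s = g n s := by
    intro n k s hs
    induction k with
    | zero => rfl
    | succ k ih =>
      rw [← ih, ← add_assoc]
      refine hstep _ _ (hs.trans ?_)
      push_cast
      have : (0 : ℝ) ≤ k := Nat.cast_nonneg k
      linarith
  let G : ℝ → ℝ := fun s => g ⌈s⌉₊ s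
  have hG : ∀ (n : ℕ) (s : ℝ), s ≤ 2 * ((n : ℝ) + 1) → G s = g n s := by
    intro n s hs
    have h0 : s ≤ 2 * ((⌈s⌉₊ : ℝ) + 1) := by
      have h1 := Nat.le_ceil s
      have h2 : (0 : ℝ) ≤ ⌈s⌉₊ := Nat.cast_nonneg _
      linarith
    have h1 := hstab n ⌈s⌉₊ s hs
    have h2 := hstab ⌈s⌉₊ n s h0
    rw [add_comm] at h1
    exact h2.symm.trans h1
  refine ⟨G, ?_, ?_, ?_⟩
  · rw [continuous_iff_continuousAt]
    intro s
    have h1 : s < 2 * ((⌈s⌉₊ : ℝ) + 1) := by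
      have h1 := Nat.le_ceil s
      have h2 : (0 : ℝ) ≤ ⌈s⌉₊ := Nat.cast_nonneg _
      linarith
    refine (hgc ⌈s⌉₊).continuousAt.congr ?_
    filter_upwards [Iio_mem_nhds h1] with t ht
    exact (hG _ _ (le_of_lt ht)).symm
  · intro s hs
    rw [hG 0 s (by simpa using hs)]
    rfl
  · intro s hs
    have h1 : s ≤ 2 * ((⌈s⌉₊ : ℝ) + 1) := by
      have h1 := Nat.le_ceil s
      have h2 : (0 : ℝ) ≤ ⌈s⌉₊ := Nat.cast_nonneg _
      linarith
    rw [hG (⌈s⌉₊ + 1) s (by push_cast; linarith), hgs, hTe _ _ hs]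
    congr 1
    apply intervalIntegral.integral_congr
    intro t ht
    rw [uIcc_of_le hs] at ht
    simp only
    rw [hG ⌈s⌉₊ (t - 2) (by linarith [ht.2])]

theorem existsUnique_delay (φ p q : ℝ → ℝ) (hφ : Continuous φ) (hp : ContinuousOn p (Ioi 0))
    (hp0 : ∀ s, 0 < s → p s ≠ 0) (hq : ContinuousOn q (Ioi 0)) :
    ∃! F, IsDelaySolution φ p q F := by
  have hmax : Continuous fun s : ℝ => max s 2 := by fun_prop
  have hmaxpos : ∀ s : ℝ, max s 2 ∈ Ioi (0 : ℝ) := fun s =>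
    mem_Ioi.2 (lt_max_of_lt_right two_pos)
  have hP : Continuous fun s => p (max s 2) := hp.comp_continuous hmax hmaxpos
  have hQ : Continuous fun s => q (max s 2) := hq.comp_continuous hmax hmaxpos
  obtain ⟨G, hGc, hG2, hGe⟩ := exists_delay_aux φ _ _ hφ hP (fun s => hp0 _ (hmaxpos s))
    (fun s hs => by simp [hs]) hQ
  have hex : ∃ F, IsDelaySolution φ p q F := by
    refine ⟨fun s => if s ≤ 0 then 0 else G s, ?_, ?_, ?_, ?_⟩
    · intro s hs
      simp [hs]
    · refine hGc.continuousOn.congr fun s hs => ?_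
      simp [not_le.2 (mem_Ioi.1 hs)]
    · intro s hs hs2
      simp [not_le.2 hs, hG2 s hs2]
    · intro s hs
      have hc : Continuous fun t => q (max t 2) * G (t - 2) :=
        hQ.mul (hGc.comp (by fun_prop))
      have h1 := (intervalIntegral.integral_hasDerivAt_right (hc.intervalIntegrable 2 s)
        hc.stronglyMeasurable.stronglyMeasurableAtFilter hc.continuousAt).const_add
        (p (max 2 2) * φ 2)
      have hsub : ¬ (s - 2 ≤ 0) := by linarith
      simp only [hsub, if_false]
      rw [max_eq_left hs.le] at h1
      refine h1.congr_of_eventuallyEq ?_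
      filter_upwards [Ioi_mem_nhds hs] with t ht
      have ht' : (2 : ℝ) < t := ht
      have h2 := hGe t ht'.le
      rw [max_eq_left ht'.le] at h2
      have ht0 : ¬ (t ≤ 0) := by linarith
      simp only [ht0, if_false]
      exact h2
  have huniq : ∀ F₁ F₂, IsDelaySolution φ p q F₁ → IsDelaySolution φ p q F₂ →
      ∀ n : ℕ, ∀ s, s ≤ 2 * ((n : ℝ) + 1) → F₁ s = F₂ s := by
    rintro F₁ F₂ ⟨a1, b1, c1, d1⟩ ⟨a2, b2, c2, d2⟩ n
    have base : ∀ s, s ≤ 2 → F₁ s = F₂ s := by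
      intro s hs
      rcases le_or_gt s 0 with h | h
      · rw [a1 s h, a2 s h]
      · rw [c1 s h hs, c2 s h hs]
    induction n with
    | zero => intro s hs; exact base s (by simpa using hs)
    | succ n ih =>
      intro s hs
      rcases le_or_gt s 2 with h | h
      · exact base s h
      have hsubset : Icc 2 s ⊆ Ioi (0 : ℝ) := fun t ht => lt_of_lt_of_le two_pos ht.1
      obtain ⟨c, hc, he⟩ := exists_hasDerivAt_eq_slope
        (fun t => p t * F₁ t - p t * F₂ t) (fun _ => 0) h
        (((hp.mul b1).sub (hp.mul b2)).mono hsubset)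
        (fun t ht => by
          have h3 := (d1 t ht.1).sub (d2 t ht.1)
          rw [ih (t - 2) (by push_cast at hs; linarith [ht.2]), sub_self] at h3
          exact h3)
      have hne : s - 2 ≠ 0 := by linarith
      rw [eq_div_iff hne, base 2 le_rfl] at he
      have h4 : p s * F₁ s = p s * F₂ s := by linarith
      exact mul_left_cancel₀ (hp0 s (by linarith)) h4
  have hmain : ∀ F₁ F₂, IsDelaySolution φ p q F₁ → IsDelaySolution φ p q F₂ → F₁ = F₂ := by
    intro F₁ F₂ h1 h2
    funext s
    refine huniq F₁ F₂ h1 h2 ⌈s⌉₊ s ?_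
    have h1 := Nat.le_ceil s
    have h2 : (0 : ℝ) ≤ ⌈s⌉₊ := Nat.cast_nonneg _
    linarith
  obtain ⟨F, hF⟩ := hex
  exact ⟨F, hF, fun F' hF' => hmain F' F hF' hF⟩

/-! ### The two sieve functions -/

/-- `σ` is the continuous solution of `σ(s) = s² / (8 e^{2γ})` on `]0, 2]` and
`(s⁻² σ(s))' = -2 s⁻³ σ(s - 2)` on `]2, ∞[`, extended by `0` to `]-∞, 0]`. -/
structure IsSieveSigma (σ : ℝ → ℝ) : Prop where
  zero : ∀ s, s ≤ 0 → σ s = 0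
  cont : ContinuousOn σ (Ioi 0)
  init : ∀ s, 0 < s → s ≤ 2 → σ s = s ^ 2 / (8 * Real.exp (2 * Real.eulerMascheroniConstant))
  delay : ∀ s, 2 < s → HasDerivAt (fun t => σ t / t ^ 2) (-2 * σ (s - 2) / s ^ 3) s

/-- `f` is the continuous solution of `f(s) = 2` on `]0, 2]` and `s f'(s) = 2 f(s - 2)` on
`]2, ∞[`, extended by `0` to `]-∞, 0]`. -/
structure IsSieveF (f : ℝ → ℝ) : Prop where
  zero : ∀ s, s ≤ 0 → f s = 0
  cont : ContinuousOn f (Ioi 0)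
  init : ∀ s, 0 < s → s ≤ 2 → f s = 2
  diff : ∀ s, 2 < s → DifferentiableAt ℝ f s
  delay : ∀ s, 2 < s → s * deriv f s = 2 * f (s - 2)

theorem isSieveSigma_iff (σ : ℝ → ℝ) : IsSieveSigma σ ↔
    IsDelaySolution (fun s => s ^ 2 / (8 * Real.exp (2 * Real.eulerMascheroniConstant)))
      (fun s => (s ^ 2)⁻¹) (fun s => -2 / s ^ 3) σ := by
  have e1 : (fun t => σ t / t ^ 2) = fun t => (t ^ 2)⁻¹ * σ t := by
    funext t
    rw [div_eq_inv_mul]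
  have e2 : ∀ s, -2 * σ (s - 2) / s ^ 3 = -2 / s ^ 3 * σ (s - 2) := fun s => by ring
  constructor
  · rintro ⟨h1, h2, h3, h4⟩
    refine ⟨h1, h2, h3, fun s hs => ?_⟩
    have := h4 s hs
    rwa [e1, e2] at this
  · rintro ⟨h1, h2, h3, h4⟩
    refine ⟨h1, h2, h3, fun s hs => ?_⟩
    rw [e1, e2]
    exact h4 s hs

theorem isSieveF_iff (f : ℝ → ℝ) : IsSieveF f ↔
    IsDelaySolution (fun _ => 2) (fun _ => 1) (fun s => 2 / s) f := by
  constructor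
  · rintro ⟨h1, h2, h3, h4, h5⟩
    refine ⟨h1, h2, h3, fun s hs => ?_⟩
    have h6 := (h4 s hs).hasDerivAt
    have h7 : deriv f s = 2 / s * f (s - 2) := by
      have hs0 : s ≠ 0 := by linarith
      have := h5 s hs
      field_simp
      linarith
    rw [h7] at h6
    simpa using h6
  · rintro ⟨h1, h2, h3, h4⟩
    have h5 : ∀ s, 2 < s → HasDerivAt f (2 / s * f (s - 2)) s := fun s hs => by
      simpa using h4 s hs
    refine ⟨h1, h2, h3, fun s hs => (h5 s hs).differentiableAt, fun s hs => ?_⟩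
    have hs0 : s ≠ 0 := by linarith
    rw [(h5 s hs).deriv]
    field_simp

theorem existsUnique_sieveSigma : ∃! σ, IsSieveSigma σ := by
  simp only [isSieveSigma_iff]
  refine existsUnique_delay _ _ _ (by fun_prop) ?_ ?_ ?_
  · exact ContinuousOn.inv₀ (by fun_prop) fun s hs => pow_ne_zero _ (ne_of_gt hs)
  · exact fun s hs => inv_ne_zero (pow_ne_zero _ hs.ne')
  · exact ContinuousOn.div (by fun_prop) (by fun_prop) fun s hs => pow_ne_zero _ (ne_of_gt hs)

theorem existsUnique_sieveF : ∃! f, IsSieveF f := by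
  simp only [isSieveF_iff]
  refine existsUnique_delay _ _ _ (by fun_prop) (by fun_prop) (fun _ _ => one_ne_zero) ?_
  exact ContinuousOn.div (by fun_prop) (by fun_prop) fun s hs => ne_of_gt hs

/-- The sieve function `σ`. -/
noncomputable def sieveSigma : ℝ → ℝ := existsUnique_sieveSigma.exists.choose

theorem sieveSigma_spec : IsSieveSigma sieveSigma := existsUnique_sieveSigma.exists.choose_spec

/-- The sieve function `𝔣`. -/
noncomputable def sieveF : ℝ → ℝ := existsUnique_sieveF.exists.choose

theorem sieveF_spec : IsSieveF sieveF := existsUnique_sieveF.exists.choose_spec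

/-! ### The constant `𝔖(ϑ, τ)` -/

noncomputable def c₁ (τ : ℝ) : ℝ :=
  ∫ u in (0 : ℝ)..1, deriv sieveSigma ((1 - u) * τ) * sieveF (u * τ) ^ 2

noncomputable def c₂ (τ : ℝ) : ℝ :=
  ∫ v in (0 : ℝ)..1, ∫ u in (0 : ℝ)..1,
    deriv sieveSigma ((1 - u) * τ) * sieveF (u * τ - 2 * v) *
      (2 * sieveF (u * τ) - sieveF (u * τ - 2 * v))

noncomputable def singularConst (ϑ τ : ℝ) : ℝ :=
  16 * Real.exp (2 * Real.eulerMascheroniConstant) *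
    (c₁ τ / (4 * τ * ϑ ^ 2) + c₂ τ / (τ ^ 2 * ϑ))

/-! ### The sieve weights and the sifted sum -/

/-- `P(z)`, the product of the primes `p < z`. -/
noncomputable def primeProd (z : ℝ) : ℕ :=
  ∏ p ∈ (Finset.range ⌈z⌉₊).filter Nat.Prime, p

/-- `ϱ_d = μ(d) (log(√D / d) / log √D)²` for `d ≤ √D`, and `0` for `d > √D`. -/
noncomputable def rho (D : ℝ) (d : ℕ) : ℝ :=
  if (d : ℝ) ≤ √D then
    (ArithmeticFunction.moebius d : ℝ) * (Real.log (√D / d) / Real.log √D) ^ 2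
  else 0

/-- `∑_n Ψ(n / X) μ²(n) h(n) (∑_{d ∣ (n, P(z))} ϱ_d)²`. The term `n = 0` vanishes as `μ(0) = 0`. -/
noncomputable def sieveSum (Ψ : ℝ → ℝ) (h : ArithmeticFunction ℝ) (X D z : ℝ) : ℝ :=
  ∑' n : ℕ, Ψ (n / X) * (ArithmeticFunction.moebius n : ℝ) ^ 2 * h n *
    (∑ d ∈ (Nat.gcd n (primeProd z)).divisors, rho D d) ^ 2

end SelbergSieve

noncomputable section

namespace SelbergSieve

open Set Filter Topology MeasureTheory
open scoped FourierTransform ContDiff Convolution Real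
open Real (exp log exp_pos norm_eq_abs log_natCast_nonneg log_pos log_le_log add_one_le_exp
  exp_log log_le_iff_le_exp rpow_le_rpow_of_exponent_le coe_toNNReal norm_of_nonneg rpow_natCast)
open Complex (I norm_real sub_re sub_im add_re add_im one_re one_im abs_re_le_norm abs_im_le_norm
  re_ofReal_mul im_ofReal_mul ofReal_re)
open Nat (prime_of_mem_primesBelow mem_primesBelow primeFactors_prod)
open intervalIntegral (integral_of_le integral_add_adjacent_intervals integral_comp_sub_mul
  integral_eq_sub_of_hasDerivAt)
open ArithmeticFunction (moebius)
open Finset (sum_congr mul_sum sum_le_sum mem_filter mem_powerset prod_insert sum_add_distrib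
  sum_sub_distrib prod_nonneg sum_filter abs_sum_le_sum_abs sum_le_sum_of_subset_of_nonneg sum_mul
  prod_le_prod prod_mul_distrib notMem_erase)

/-- The terms of the Euler–Maclaurin series of `(s - 1) ζ(s)`. -/
def zetaTerm (n : ℕ) (s : ℂ) : ℂ :=
  (s - 1) * ((n : ℂ) + 1) ^ (-s) + ((n : ℂ) + 1) ^ (1 - s) - (n : ℂ) ^ (1 - s)

theorem hasDerivAt_ofReal_cpow {x : ℝ} (hx : 0 < x) (r : ℂ) :
    HasDerivAt (fun y : ℝ => (y : ℂ) ^ r) (r * (x : ℂ) ^ (r - 1)) x := by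
  have h1 : HasDerivAt (fun z : ℂ => z ^ r) (r * (x : ℂ) ^ (r - 1)) (x : ℂ) := by
    simpa using (hasDerivAt_id (x : ℂ)).cpow_const (c := r) (Or.inl (by simpa using hx))
  exact h1.comp_ofReal

theorem norm_cpow_sub_cpow_le {n x y : ℝ} (hn : 0 < n) (hx : n ≤ x) (hy : n ≤ y)
    (hxy : |x - y| ≤ 1) {s : ℂ} (hs : 0 < s.re) :
    ‖(x : ℂ) ^ (-s) - (y : ℂ) ^ (-s)‖ ≤ ‖s‖ * n ^ (-s.re - 1) := by
  have h := (convex_Ici n).norm_image_sub_le_of_norm_hasDerivWithin_le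
    (f := fun y : ℝ => (y : ℂ) ^ (-s)) (f' := fun y => -s * (y : ℂ) ^ (-s - 1))
    (C := ‖s‖ * n ^ (-s.re - 1))
    (fun z hz => (hasDerivAt_ofReal_cpow (hn.trans_le hz) (-s)).hasDerivWithinAt) ?_ hy hx
  · refine h.trans ?_
    rw [norm_eq_abs]
    have : 0 ≤ ‖s‖ * n ^ (-s.re - 1) := by positivity
    nlinarith
  · intro z hz
    have hz0 : 0 < z := hn.trans_le hz
    rw [norm_mul, norm_neg, Complex.norm_cpow_eq_rpow_re_of_pos hz0]
    gcongr
    simp only [sub_re, Complex.neg_re, one_re]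
    exact Real.rpow_le_rpow_of_nonpos hn hz (by linarith)

theorem norm_zetaTerm_le {n : ℕ} (hn : 1 ≤ n) {s : ℂ} (hs : 0 < s.re) :
    ‖zetaTerm n s‖ ≤ ‖s - 1‖ * ‖s‖ * (n : ℝ) ^ (-s.re - 1) := by
  have hn0 : (0 : ℝ) < n := by exact_mod_cast hn
  set v : ℝ → ℂ := fun x => (s - 1) * ((n : ℂ) + 1) ^ (-s) * ((x : ℂ) - n) + (x : ℂ) ^ (1 - s)
    with hv
  have hd : ∀ x : ℝ, x ∈ Icc (n : ℝ) (n + 1) → HasDerivWithinAt v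
      ((s - 1) * ((((n : ℝ) + 1 : ℝ) : ℂ) ^ (-s) - (x : ℂ) ^ (-s))) (Icc (n : ℝ) (n + 1)) x := by
    intro x hx
    have hx0 : 0 < x := hn0.trans_le hx.1
    have h1 := hasDerivAt_ofReal_cpow hx0 (1 - s)
    have h2 : HasDerivAt (fun x : ℝ => (s - 1) * ((n : ℂ) + 1) ^ (-s) * ((x : ℂ) - n))
        ((s - 1) * ((n : ℂ) + 1) ^ (-s) * 1) x :=
      ((hasDerivAt_id (x : ℂ)).comp_ofReal.sub_const (n : ℂ)).const_mul _
    have h3 := (h2.add h1).hasDerivWithinAt (s := Icc (n : ℝ) (n + 1))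
    refine h3.congr_deriv ?_
    rw [show (1 - s - 1 : ℂ) = -s by ring]
    push_cast
    ring
  have h := (convex_Icc (n : ℝ) (n + 1)).norm_image_sub_le_of_norm_hasDerivWithin_le
    (C := ‖s - 1‖ * ‖s‖ * (n : ℝ) ^ (-s.re - 1)) hd ?_ (left_mem_Icc.2 (by linarith))
    (right_mem_Icc.2 (by linarith))
  · have h4 : v (n + 1) - v n = zetaTerm n s := by
      simp only [hv, zetaTerm]
      push_cast
      ring
    have h5 : ((n : ℝ) + 1) - n = 1 := by ring
    rw [h4, h5, norm_one, mul_one] at h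
    exact h
  · intro x hx
    rw [norm_mul, mul_assoc]
    gcongr
    refine norm_cpow_sub_cpow_le hn0 (by linarith) hx.1 ?_ hs
    rw [abs_le]
    constructor <;> linarith [hx.1, hx.2]

theorem differentiable_zetaTerm {n : ℕ} (hn : 1 ≤ n) : Differentiable ℂ (zetaTerm n) := by
  have h1 : (n : ℂ) ≠ 0 := by exact_mod_cast (by lia : n ≠ 0)
  have h2 : (n : ℂ) + 1 ≠ 0 := by exact_mod_cast (by lia : n + 1 ≠ 0)
  intro s
  unfold zetaTerm
  refine DifferentiableAt.sub (DifferentiableAt.add (DifferentiableAt.mul (by fun_prop) ?_) ?_) ?_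
  · exact DifferentiableAt.const_cpow (by fun_prop) (Or.inl h2)
  · exact DifferentiableAt.const_cpow (by fun_prop) (Or.inl h2)
  · exact DifferentiableAt.const_cpow (by fun_prop) (Or.inl h1)

theorem summable_zetaTerm_bound {σ : ℝ} (hσ : 0 < σ) (N : ℕ) :
    Summable fun n : ℕ => ((n + N : ℕ) : ℝ) ^ (-σ - 1) := by
  have h := Real.summable_nat_rpow.2 (show -σ - 1 < -1 by linarith)
  exact (summable_nat_add_iff N).2 h

theorem differentiableOn_tsum_zetaTerm {N : ℕ} (hN : 1 ≤ N) :
    DifferentiableOn ℂ (fun s => ∑' n : ℕ, zetaTerm (n + N) s) {s : ℂ | 0 < s.re} := by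
  intro s hs
  set σ := s.re / 2 with hσ
  have hσ0 : 0 < σ := half_pos hs
  set U : Set ℂ := {z | σ < z.re} ∩ Metric.ball s 1 with hU
  have hUo : IsOpen U := (isOpen_lt continuous_const Complex.continuous_re).inter Metric.isOpen_ball
  have hsU : s ∈ U := by
    refine ⟨?_, Metric.mem_ball_self one_pos⟩
    change σ < s.re
    have : 0 < s.re := hs
    linarith
  have h := Complex.differentiableOn_tsum_of_summable_norm (U := U)
    (F := fun (n : ℕ) s => zetaTerm (n + N) s)
    (u := fun n : ℕ => ((‖s‖ + 2) * (‖s‖ + 2)) * ((n + N : ℕ) : ℝ) ^ (-σ - 1))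
    ((summable_zetaTerm_bound hσ0 N).mul_left _)
    (fun n => (differentiable_zetaTerm (by lia)).differentiableOn) hUo ?_
  · exact (h.differentiableAt (hUo.mem_nhds hsU)).differentiableWithinAt
  · intro n z hz
    have hz1 : σ < z.re := hz.1
    have hz2 : ‖z - s‖ < 1 := by simpa [dist_eq_norm] using hz.2
    have hz3 : ‖z‖ ≤ ‖s‖ + 1 := by
      have := norm_add_le (z - s) s
      rw [sub_add_cancel] at this
      linarith
    have hz4 : ‖z - 1‖ ≤ ‖s‖ + 2 := by
      have := norm_sub_le z 1
      rw [norm_one] at this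
      linarith
    refine (norm_zetaTerm_le (by lia) (hσ0.trans hz1)).trans ?_
    have hp : (1 : ℝ) ≤ ((n + N : ℕ) : ℝ) := by exact_mod_cast (by lia : 1 ≤ n + N)
    gcongr
    · linarith

theorem riemannZeta₁_eq {N : ℕ} (hN : 1 ≤ N) {s : ℂ} (hs : 0 < s.re) :
    riemannZeta₁ s = (s - 1) * ∑ n ∈ Finset.range N, ((n : ℂ) + 1) ^ (-s) + (N : ℂ) ^ (1 - s)
      + ∑' n : ℕ, zetaTerm (n + N) s := by
  have hpre : IsPreconnected {s : ℂ | 0 < s.re} := (convex_halfSpace_re_gt 0).isPreconnected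
  have hopen : IsOpen {s : ℂ | 0 < s.re} := isOpen_lt continuous_const Complex.continuous_re
  have hN0 : (N : ℂ) ≠ 0 := by exact_mod_cast (by lia : N ≠ 0)
  have hR : DifferentiableOn ℂ (fun s : ℂ => (s - 1) * ∑ n ∈ Finset.range N, ((n : ℂ) + 1) ^ (-s)
      + (N : ℂ) ^ (1 - s) + ∑' n : ℕ, zetaTerm (n + N) s) {s : ℂ | 0 < s.re} := by
    refine DifferentiableOn.add (Differentiable.differentiableOn ?_)
      (differentiableOn_tsum_zetaTerm hN)
    intro s
    refine DifferentiableAt.add (DifferentiableAt.mul (by fun_prop) ?_) ?_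
    · refine DifferentiableAt.fun_sum fun n _ => ?_
      exact DifferentiableAt.const_cpow (by fun_prop)
        (Or.inl (by exact_mod_cast (by lia : n + 1 ≠ 0)))
    · exact DifferentiableAt.const_cpow (by fun_prop) (Or.inl hN0)
  have hL : DifferentiableOn ℂ riemannZeta₁ {s : ℂ | 0 < s.re} :=
    differentiable_riemannZeta₁.differentiableOn
  refine (hL.analyticOnNhd hopen).eqOn_of_preconnected_of_eventuallyEq (hR.analyticOnNhd hopen)
    hpre (z₀ := 2) (by simp) ?_ hs
  have h2 : {s : ℂ | 1 < s.re} ∈ 𝓝 (2 : ℂ) :=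
    (isOpen_lt continuous_const Complex.continuous_re).mem_nhds (by simp)
  filter_upwards [h2] with s hs1
  have hs1 : 1 < s.re := hs1
  have hne : s ≠ 1 := by rintro rfl; simp at hs1
  have hz : riemannZeta₁ s = (s - 1) * riemannZeta s := by
    rw [riemannZeta_eq_inv_sub_mul hne, ← mul_assoc, mul_inv_cancel₀ (sub_ne_zero.2 hne), one_mul]
  have hsum1 : Summable fun n : ℕ => ((n : ℂ) + 1) ^ (-s) := by
    have := (summable_nat_add_iff 1).2 (Complex.summable_one_div_nat_cpow.2 hs1)
    refine this.congr fun n => ?_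
    rw [Complex.cpow_neg]
    push_cast
    simp
  have hzs : riemannZeta s = ∑' n : ℕ, ((n : ℂ) + 1) ^ (-s) := by
    rw [zeta_eq_tsum_one_div_nat_add_one_cpow hs1]
    refine tsum_congr fun n => ?_
    rw [Complex.cpow_neg, one_div]
  have htel : HasSum (fun n : ℕ => ((((n + N : ℕ) : ℂ) + 1) ^ (1 - s) - ((n + N : ℕ) : ℂ) ^ (1 - s)))
      (0 - (N : ℂ) ^ (1 - s)) := by
    have hlim : Tendsto (fun n : ℕ => ((n + N : ℕ) : ℂ) ^ (1 - s)) atTop (𝓝 0) := by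
      rw [tendsto_zero_iff_norm_tendsto_zero]
      have : Tendsto (fun n : ℕ => ((n + N : ℕ) : ℝ) ^ (-(s.re - 1))) atTop (𝓝 0) :=
        (tendsto_rpow_neg_atTop (by linarith)).comp
          (tendsto_natCast_atTop_atTop.comp (tendsto_add_atTop_nat N))
      refine this.congr fun n => ?_
      have hp : (0 : ℝ) < ((n + N : ℕ) : ℝ) := by exact_mod_cast (by lia : 0 < n + N)
      have := Complex.norm_cpow_eq_rpow_re_of_pos hp (1 - s)
      simp only [Complex.ofReal_natCast] at this
      rw [this]
      congr 1
      simp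
    have hs' : Summable fun n : ℕ =>
        ((((n + N : ℕ) : ℂ) + 1) ^ (1 - s) - ((n + N : ℕ) : ℂ) ^ (1 - s)) := by
      have hz1 : Summable fun n : ℕ => zetaTerm (n + N) s := by
        refine Summable.of_norm_bounded (g := fun n : ℕ =>
          (‖s - 1‖ * ‖s‖) * ((n + N : ℕ) : ℝ) ^ (-s.re - 1))
          ((summable_zetaTerm_bound (by linarith) N).mul_left _) fun n => ?_
        exact norm_zetaTerm_le (by lia) (by linarith)
      have hz2 := ((summable_nat_add_iff N).2 hsum1).mul_left (s - 1)
      refine (hz1.sub hz2).congr fun n => ?_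
      simp only [zetaTerm]
      ring
    rw [hs'.hasSum_iff_tendsto_nat]
    have : ∀ n : ℕ, ∑ i ∈ Finset.range n,
        ((((i + N : ℕ) : ℂ) + 1) ^ (1 - s) - ((i + N : ℕ) : ℂ) ^ (1 - s))
        = ((n + N : ℕ) : ℂ) ^ (1 - s) - (N : ℂ) ^ (1 - s) := by
      intro n
      have := Finset.sum_range_sub (fun i : ℕ => ((i + N : ℕ) : ℂ) ^ (1 - s)) n
      simp only [zero_add] at this
      rw [← this]
      refine sum_congr rfl fun i _ => ?_
      congr 2
      push_cast
      ring
    simp only [this]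
    exact hlim.sub_const _
  have hz3 : ∑' n : ℕ, zetaTerm (n + N) s = (s - 1) * (∑' n : ℕ, (((n + N : ℕ) : ℂ) + 1) ^ (-s))
      + (0 - (N : ℂ) ^ (1 - s)) := by
    rw [← tsum_mul_left, ← htel.tsum_eq, ← Summable.tsum_add
      (((summable_nat_add_iff N).2 hsum1).mul_left (s - 1)) htel.summable]
    refine tsum_congr fun n => ?_
    simp only [zetaTerm]
    ring
  rw [hz3, hz, hzs, ← hsum1.sum_add_tsum_nat_add N]
  ring

/-- A convexity-free bound for `ζ` slightly to the left of the line `Re s = 1`. -/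
theorem exists_norm_riemannZeta_le :
    ∃ C : ℝ, 0 < C ∧ ∀ s : ℂ, 15 / 16 ≤ s.re → s.re ≤ 2 → 1 ≤ |s.im| →
      ‖riemannZeta s‖ ≤ C * |s.im| ^ (1 / 8 : ℝ) := by
  set Z : ℝ := ∑' n : ℕ, ((n + 1 : ℕ) : ℝ) ^ (-(17 / 16) : ℝ) with hZ
  have hZs : Summable fun n : ℕ => ((n + 1 : ℕ) : ℝ) ^ (-(17 / 16) : ℝ) :=
    (summable_nat_add_iff 1).2 (Real.summable_nat_rpow.2 (by norm_num))
  have hZ0 : 0 ≤ Z := tsum_nonneg fun n => by positivity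
  refine ⟨(5 * Z + 1) * 2, by positivity, fun s h1 h2 ht => ?_⟩
  set t := |s.im| with htdef
  set N : ℕ := ⌈t⌉₊ with hN
  have hNt : t ≤ N := Nat.le_ceil t
  have hN1 : 1 ≤ N := Nat.one_le_ceil_iff.2 (by linarith)
  have hN1r : (1 : ℝ) ≤ N := by exact_mod_cast hN1
  have hN2 : (N : ℝ) ≤ 2 * t := by
    have := Nat.ceil_lt_add_one (by linarith : 0 ≤ t)
    linarith
  have hN0 : (0 : ℝ) < N := by linarith
  have hne : s ≠ 1 := by
    rintro rfl
    simp at htdef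
    linarith
  have hs1 : t ≤ ‖s - 1‖ := by
    have := abs_im_le_norm (s - 1)
    simpa using this
  have hs0 : ‖s‖ ≤ 2 + t := by
    refine (Complex.norm_le_abs_re_add_abs_im s).trans ?_
    rw [abs_of_nonneg (by linarith)]
    linarith
  have hspos : 0 < ‖s - 1‖ := by linarith
  have hkey : ‖riemannZeta₁ s‖ ≤ ‖s - 1‖ * ((N : ℝ) ^ (1 / 8 : ℝ) * (5 * Z + 1)) := by
    rw [riemannZeta₁_eq hN1 (by linarith)]
    have e1 : ‖∑ n ∈ Finset.range N, ((n : ℂ) + 1) ^ (-s)‖ ≤ (N : ℝ) ^ (1 / 8 : ℝ) * Z := by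
      refine (norm_sum_le _ _).trans ?_
      calc ∑ n ∈ Finset.range N, ‖((n : ℂ) + 1) ^ (-s)‖
          ≤ ∑ n ∈ Finset.range N, (N : ℝ) ^ (1 / 8 : ℝ) * ((n + 1 : ℕ) : ℝ) ^ (-(17 / 16) : ℝ) := by
            refine sum_le_sum fun n hn => ?_
            have hp : (1 : ℝ) ≤ ((n + 1 : ℕ) : ℝ) := by exact_mod_cast Nat.succ_pos n
            have hle : ((n + 1 : ℕ) : ℝ) ≤ N := by exact_mod_cast Finset.mem_range.1 hn
            have := Complex.norm_cpow_eq_rpow_re_of_pos (by linarith : 0 < ((n + 1 : ℕ) : ℝ)) (-s)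
            push_cast at this
            rw [this]
            have e : -s.re ≤ 1 / 8 + -(17 / 16) := by linarith
            have hp' : (1 : ℝ) ≤ (n : ℝ) + 1 := by simp
            calc ((n : ℝ) + 1) ^ (-s).re ≤ ((n : ℝ) + 1) ^ (1 / 8 + -(17 / 16) : ℝ) :=
                  rpow_le_rpow_of_exponent_le hp' (by simpa using e)
              _ = ((n : ℝ) + 1) ^ (1 / 8 : ℝ) * ((n : ℝ) + 1) ^ (-(17 / 16) : ℝ) :=
                  Real.rpow_add (by linarith) _ _
              _ ≤ _ := by
                  push_cast at hle ⊢
                  gcongr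
        _ = (N : ℝ) ^ (1 / 8 : ℝ) * ∑ n ∈ Finset.range N, ((n + 1 : ℕ) : ℝ) ^ (-(17 / 16) : ℝ) := by
            rw [mul_sum]
        _ ≤ _ := by
            gcongr
            exact hZs.sum_le_tsum _ fun n _ => by positivity
    have e2 : ‖(N : ℂ) ^ (1 - s)‖ ≤ ‖s - 1‖ * (N : ℝ) ^ (1 / 8 : ℝ) := by
      have := Complex.norm_cpow_eq_rpow_re_of_pos hN0 (1 - s)
      simp only [Complex.ofReal_natCast] at this
      rw [this]
      calc (N : ℝ) ^ (1 - s).re ≤ 1 * (N : ℝ) ^ (1 / 8 : ℝ) := by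
            rw [one_mul]
            refine rpow_le_rpow_of_exponent_le hN1r ?_
            simp only [sub_re, one_re]
            linarith
        _ ≤ _ := by gcongr; linarith
    have e3 : ‖∑' n : ℕ, zetaTerm (n + N) s‖ ≤ ‖s - 1‖ * ((N : ℝ) ^ (1 / 8 : ℝ) * (4 * Z)) := by
      have hb : ∀ n : ℕ, ‖zetaTerm (n + N) s‖ ≤
          ‖s - 1‖ * ((N : ℝ) ^ (1 / 8 : ℝ) * 4) * ((n + 1 : ℕ) : ℝ) ^ (-(17 / 16) : ℝ) := by
        intro n
        refine (norm_zetaTerm_le (by lia) (by linarith)).trans ?_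
        have hNn : (N : ℝ) ≤ ((n + N : ℕ) : ℝ) := by push_cast; linarith [Nat.cast_nonneg (α := ℝ) n]
        have hnN : ((n + 1 : ℕ) : ℝ) ≤ ((n + N : ℕ) : ℝ) := by push_cast; linarith
        have hp : (0 : ℝ) < ((n + 1 : ℕ) : ℝ) := by positivity
        have a1 : ((n + N : ℕ) : ℝ) ^ (-s.re - 1) ≤
            (N : ℝ) ^ (-(7 / 8) : ℝ) * ((n + 1 : ℕ) : ℝ) ^ (-(17 / 16) : ℝ) := by
          calc ((n + N : ℕ) : ℝ) ^ (-s.re - 1)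
              ≤ ((n + N : ℕ) : ℝ) ^ (-(7 / 8) + -(17 / 16) : ℝ) :=
                rpow_le_rpow_of_exponent_le (by linarith) (by linarith)
            _ = ((n + N : ℕ) : ℝ) ^ (-(7 / 8) : ℝ) * ((n + N : ℕ) : ℝ) ^ (-(17 / 16) : ℝ) :=
                Real.rpow_add (by linarith) _ _
            _ ≤ _ := by
                refine mul_le_mul (Real.rpow_le_rpow_of_nonpos hN0 hNn (by norm_num))
                  (Real.rpow_le_rpow_of_nonpos hp hnN (by norm_num)) (by positivity)
                  (by positivity)
        have a2 : ‖s‖ ≤ 4 * N := by linarith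
        have a3 : (N : ℝ) * (N : ℝ) ^ (-(7 / 8) : ℝ) = (N : ℝ) ^ (1 / 8 : ℝ) := by
          nth_rewrite 1 [← Real.rpow_one (N : ℝ)]
          rw [← Real.rpow_add hN0]
          norm_num
        calc ‖s - 1‖ * ‖s‖ * ((n + N : ℕ) : ℝ) ^ (-s.re - 1)
            ≤ ‖s - 1‖ * (4 * N) *
              ((N : ℝ) ^ (-(7 / 8) : ℝ) * ((n + 1 : ℕ) : ℝ) ^ (-(17 / 16) : ℝ)) := by gcongr
          _ = ‖s - 1‖ * ((N * (N : ℝ) ^ (-(7 / 8) : ℝ)) * 4) *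
                ((n + 1 : ℕ) : ℝ) ^ (-(17 / 16) : ℝ) := by ring
          _ = _ := by rw [a3]
      refine (tsum_of_norm_bounded (hZs.mul_left _).hasSum hb).trans (le_of_eq ?_)
      rw [tsum_mul_left]
      ring
    calc _ ≤ ‖s - 1‖ * ((N : ℝ) ^ (1 / 8 : ℝ) * Z) + ‖s - 1‖ * (N : ℝ) ^ (1 / 8 : ℝ)
          + ‖s - 1‖ * ((N : ℝ) ^ (1 / 8 : ℝ) * (4 * Z)) := by
          refine norm_add₃_le.trans (add_le_add (add_le_add ?_ e2) e3)
          rw [norm_mul]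
          gcongr
      _ = _ := by ring
  have hz : riemannZeta s = (s - 1)⁻¹ * riemannZeta₁ s := riemannZeta_eq_inv_sub_mul hne
  rw [hz, norm_mul, norm_inv, inv_mul_le_iff₀ hspos]
  refine hkey.trans ?_
  have hfin : (N : ℝ) ^ (1 / 8 : ℝ) ≤ 2 * t ^ (1 / 8 : ℝ) := by
    calc (N : ℝ) ^ (1 / 8 : ℝ) ≤ (2 * t) ^ (1 / 8 : ℝ) := by gcongr
      _ = 2 ^ (1 / 8 : ℝ) * t ^ (1 / 8 : ℝ) := Real.mul_rpow (by norm_num) (by linarith)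
      _ ≤ 2 ^ (1 : ℝ) * t ^ (1 / 8 : ℝ) := by
          gcongr
          · norm_num
          · norm_num
      _ = _ := by norm_num
  calc ‖s - 1‖ * ((N : ℝ) ^ (1 / 8 : ℝ) * (5 * Z + 1))
      ≤ ‖s - 1‖ * (2 * t ^ (1 / 8 : ℝ) * (5 * Z + 1)) := by gcongr
    _ = _ := by ring

/-- Polynomial growth of `(s - 1) ζ(s)` near the line `Re s = 1`. -/
theorem exists_norm_riemannZeta₁_le :
    ∃ C : ℝ, 0 < C ∧ ∀ s : ℂ, 15 / 16 ≤ s.re → s.re ≤ 2 →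
      ‖riemannZeta₁ s‖ ≤ C * (1 + |s.im|) ^ 2 := by
  obtain ⟨C, hC, h⟩ := exists_norm_riemannZeta_le
  have hK : IsCompact (Set.Icc (15 / 16 : ℝ) 2 ×ℂ Set.Icc (-1 : ℝ) 1) :=
    isCompact_Icc.reProdIm isCompact_Icc
  obtain ⟨C', hC'⟩ := hK.exists_bound_of_continuousOn
    (differentiable_riemannZeta₁.continuous.continuousOn)
  refine ⟨2 * C + |C'|, by positivity, fun s h1 h2 => ?_⟩
  have ha := abs_nonneg s.im
  rcases le_or_gt 1 |s.im| with ht | ht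
  · have hne : s ≠ 1 := by
      rintro rfl
      norm_num at ht
    have hz : riemannZeta₁ s = (s - 1) * riemannZeta s := by
      rw [riemannZeta_eq_inv_sub_mul hne, ← mul_assoc, mul_inv_cancel₀ (sub_ne_zero.2 hne), one_mul]
    have e1 : ‖s - 1‖ ≤ 1 + |s.im| := by
      refine (Complex.norm_le_abs_re_add_abs_im _).trans ?_
      simp only [sub_re, one_re, sub_im, one_im, sub_zero]
      have : |s.re - 1| ≤ 1 := by rw [abs_le]; constructor <;> linarith
      linarith
    have e2 : |s.im| ^ (1 / 8 : ℝ) ≤ 1 + |s.im| := by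
      calc |s.im| ^ (1 / 8 : ℝ) ≤ |s.im| ^ (1 : ℝ) :=
            rpow_le_rpow_of_exponent_le ht (by norm_num)
        _ ≤ _ := by rw [Real.rpow_one]; linarith
    rw [hz, norm_mul]
    calc ‖s - 1‖ * ‖riemannZeta s‖ ≤ (1 + |s.im|) * (C * (1 + |s.im|)) := by
          gcongr
          exact (h s h1 h2 ht).trans (by gcongr)
      _ = C * (1 + |s.im|) ^ 2 := by ring
      _ ≤ _ := by
          gcongr
          linarith [abs_nonneg C']
  · have := hC' s (by
      rw [Complex.mem_reProdIm]
      exact ⟨⟨h1, h2⟩, abs_le.1 ht.le⟩)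
    calc ‖riemannZeta₁ s‖ ≤ |C'| * 1 := by linarith [le_abs_self C']
      _ ≤ (2 * C + |C'|) * (1 + |s.im|) ^ 2 := by
          gcongr
          · linarith
          · nlinarith

theorem norm_riemannZeta_product_ge_one {x : ℝ} (hx : 0 < x) (y : ℝ) :
    1 ≤ ‖riemannZeta (1 + x)‖ ^ 3 * ‖riemannZeta (1 + x + I * y)‖ ^ 4 *
      ‖riemannZeta (1 + x + 2 * I * y)‖ := by
  have h := DirichletCharacter.norm_LFunction_product_ge_one (N := 1) 1 hx y
  simp only [DirichletCharacter.LFunctionTrivChar, one_pow,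
    DirichletCharacter.LFunction_modOne_eq] at h
  simpa only [norm_mul, norm_pow] using h

theorem exists_norm_deriv_riemannZeta_le :
    ∃ C : ℝ, 0 < C ∧ ∀ s : ℂ, 1 ≤ s.re → s.re ≤ 3 / 2 → 2 ≤ |s.im| →
      ‖deriv riemannZeta s‖ ≤ C * |s.im| ^ (1 / 8 : ℝ) := by
  obtain ⟨C, hC, h⟩ := exists_norm_riemannZeta_le
  refine ⟨32 * C, by positivity, fun s h1 h2 ht => ?_⟩
  have hball : ∀ z ∈ Metric.closedBall s (1 / 16), 15 / 16 ≤ z.re ∧ z.re ≤ 2 ∧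
      1 ≤ |z.im| ∧ |z.im| ≤ 2 * |s.im| := by
    intro z hz
    have hz' : ‖z - s‖ ≤ 1 / 16 := by simpa [dist_eq_norm] using hz
    have e1 := abs_le.1 ((abs_re_le_norm (z - s)).trans hz')
    have e2 := (abs_im_le_norm (z - s)).trans hz'
    simp only [sub_re, sub_im] at e1 e2
    have e3 := abs_sub_abs_le_abs_sub z.im s.im
    have e4 := abs_sub_abs_le_abs_sub s.im z.im
    rw [abs_sub_comm] at e4
    refine ⟨by linarith [e1.1], by linarith [e1.2], by linarith, by linarith⟩
  have hd : DiffContOnCl ℂ riemannZeta (Metric.ball s (1 / 16)) := by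
    refine DifferentiableOn.diffContOnCl ?_
    intro z hz
    rw [closure_ball _ (by norm_num)] at hz
    refine (differentiableAt_riemannZeta ?_).differentiableWithinAt
    rintro rfl
    have := (hball 1 hz).2.2.1
    norm_num at this
  have := Complex.norm_deriv_le_of_forall_mem_sphere_norm_le (c := s) (R := 1 / 16)
    (C := 2 * C * |s.im| ^ (1 / 8 : ℝ)) (by norm_num) hd ?_
  · refine this.trans (le_of_eq ?_)
    ring
  · intro z hz
    obtain ⟨a1, a2, a3, a4⟩ := hball z (Metric.sphere_subset_closedBall hz)
    refine (h z a1 a2 a3).trans ?_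
    have : |z.im| ^ (1 / 8 : ℝ) ≤ 2 * |s.im| ^ (1 / 8 : ℝ) := by
      calc |z.im| ^ (1 / 8 : ℝ) ≤ (2 * |s.im|) ^ (1 / 8 : ℝ) := by gcongr
        _ = 2 ^ (1 / 8 : ℝ) * |s.im| ^ (1 / 8 : ℝ) := Real.mul_rpow (by norm_num) (by linarith)
        _ ≤ 2 ^ (1 : ℝ) * |s.im| ^ (1 / 8 : ℝ) := by
            gcongr
            · norm_num
            · norm_num
        _ = _ := by norm_num
    nlinarith

theorem exists_norm_riemannZeta_one_add_le :
    ∃ C : ℝ, 0 < C ∧ ∀ x : ℝ, 0 < x → x ≤ 1 → ‖riemannZeta (1 + x)‖ ≤ C / x := by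
  obtain ⟨C, hC, h⟩ := exists_norm_riemannZeta₁_le
  refine ⟨C, hC, fun x hx hx1 => ?_⟩
  have hne : (1 + x : ℂ) ≠ 1 := by
    simpa using hx.ne'
  have := h (1 + x) (by simp; linarith) (by simp; linarith)
  rw [riemannZeta_eq_inv_sub_mul hne, norm_mul]
  simp only [add_sub_cancel_left, norm_inv, norm_real, norm_eq_abs, abs_of_pos hx]
  simp only [add_im, one_im, Complex.ofReal_im, add_zero, abs_zero, one_pow,
    mul_one] at this
  rw [inv_mul_eq_div]
  gcongr

theorem exists_le_norm_riemannZeta :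
    ∃ c : ℝ, 0 < c ∧ ∀ x t : ℝ, 0 ≤ x → x ≤ 1 / 2 → 2 ≤ |t| →
      c * |t| ^ (-(1 / 2) : ℝ) ≤ ‖riemannZeta (1 + x + I * t)‖ := by
  obtain ⟨C₁, hC₁, h₁⟩ := exists_norm_riemannZeta_one_add_le
  obtain ⟨C₂, hC₂, h₂⟩ := exists_norm_riemannZeta_le
  obtain ⟨C₃, hC₃, h₃⟩ := exists_norm_deriv_riemannZeta_le
  set K : ℝ := C₁ ^ 3 * (C₂ * 2) with hK
  have hK0 : 0 < K := by positivity
  set c : ℝ := min (1 / 2) (1 / (16 * K * C₃ ^ 4)) with hc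
  have hc0 : 0 < c := lt_min (by norm_num) (by positivity)
  have hc1 : c ≤ 1 / 2 := min_le_left _ _
  have hc2 : c * (16 * K * C₃ ^ 4) ≤ 1 := by
    have := min_le_right (1 / 2) (1 / (16 * K * C₃ ^ 4))
    rwa [← hc, le_div_iff₀ (by positivity)] at this
  refine ⟨c * C₃, by positivity, fun x t hx0 hx1 ht => ?_⟩
  set T := |t| with hT
  have hT0 : 0 < T := by linarith
  set x₀ : ℝ := c * T ^ (-(5 / 8) : ℝ) with hx₀
  have hx₀0 : 0 < x₀ := by positivity
  have hx₀1 : x₀ ≤ 1 / 2 := by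
    have : T ^ (-(5 / 8) : ℝ) ≤ 1 := Real.rpow_le_one_of_one_le_of_nonpos (by linarith) (by norm_num)
    nlinarith
  have hbig : ∀ y : ℝ, x₀ ≤ y → y ≤ 1 / 2 →
      2 * c * C₃ * T ^ (-(1 / 2) : ℝ) ≤ ‖riemannZeta (1 + y + I * t)‖ := by
    intro y hy0 hy1
    have hy : 0 < y := hx₀0.trans_le hy0
    have a1 := norm_riemannZeta_product_ge_one hy t
    have a2 := h₁ y hy (by linarith)
    have a3 := h₂ (1 + y + 2 * I * t) (by simp; linarith) (by simp; linarith)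
      (by simp [abs_mul]; linarith)
    have a4 : |(1 + y + 2 * I * t : ℂ).im| ^ (1 / 8 : ℝ) ≤ 2 * T ^ (1 / 8 : ℝ) := by
      have : |(1 + y + 2 * I * t : ℂ).im| = 2 * T := by simp [abs_mul, hT]
      rw [this]
      calc (2 * T) ^ (1 / 8 : ℝ) = 2 ^ (1 / 8 : ℝ) * T ^ (1 / 8 : ℝ) :=
            Real.mul_rpow (by norm_num) (by linarith)
        _ ≤ 2 ^ (1 : ℝ) * T ^ (1 / 8 : ℝ) := by
            gcongr
            · norm_num
            · norm_num
        _ = _ := by norm_num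
    set m := ‖riemannZeta (1 + y + I * t)‖ with hm
    have hm0 : 0 ≤ m := norm_nonneg _
    have a5 : 1 ≤ (C₁ / x₀) ^ 3 * m ^ 4 * (C₂ * (2 * T ^ (1 / 8 : ℝ))) := by
      refine a1.trans ?_
      have b1 : ‖riemannZeta (1 + y)‖ ≤ C₁ / x₀ := a2.trans (by gcongr)
      have b2 : ‖riemannZeta (1 + y + 2 * I * t)‖ ≤ C₂ * (2 * T ^ (1 / 8 : ℝ)) :=
        a3.trans (by gcongr)
      gcongr
    have e0 : x₀ ^ 3 = c ^ 3 * T ^ (-(15 / 8) : ℝ) := by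
      rw [hx₀, mul_pow, ← rpow_natCast (T ^ (-(5 / 8) : ℝ)), ← Real.rpow_mul hT0.le]
      norm_num
    have e1 : (C₁ / x₀) ^ 3 * m ^ 4 * (C₂ * (2 * T ^ (1 / 8 : ℝ)))
        = K * m ^ 4 * T ^ (1 / 8 : ℝ) / x₀ ^ 3 := by
      rw [hK]; field_simp
    rw [e1, le_div_iff₀ (by positivity), one_mul, e0] at a5
    have e2 : T ^ (-(15 / 8) : ℝ) = T ^ (1 / 8 : ℝ) * T ^ (-2 : ℝ) := by
      rw [← Real.rpow_add hT0]; norm_num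
    rw [e2] at a5
    have hT8 : 0 < T ^ (1 / 8 : ℝ) := by positivity
    have a6 : c ^ 3 * T ^ (-2 : ℝ) ≤ K * m ^ 4 := by
      refine le_of_mul_le_mul_right ?_ hT8
      linarith
    have e3 : (2 * c * C₃ * T ^ (-(1 / 2) : ℝ)) ^ 4 = 16 * c ^ 4 * C₃ ^ 4 * T ^ (-2 : ℝ) := by
      rw [mul_pow, ← rpow_natCast (T ^ (-(1 / 2) : ℝ)), ← Real.rpow_mul hT0.le]
      norm_num
      ring_nf
      simp
    refine le_of_pow_le_pow_left₀ (n := 4) (by norm_num) hm0 ?_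
    rw [e3]
    refine le_of_mul_le_mul_left ?_ hK0
    refine le_trans ?_ a6
    have hT2 : 0 < c ^ 3 * T ^ (-2 : ℝ) := by positivity
    calc K * (16 * c ^ 4 * C₃ ^ 4 * T ^ (-2 : ℝ))
        = (c * (16 * K * C₃ ^ 4)) * (c ^ 3 * T ^ (-2 : ℝ)) := by ring
      _ ≤ 1 * (c ^ 3 * T ^ (-2 : ℝ)) := by gcongr
      _ = _ := one_mul _
  rcases le_or_gt x₀ x with hxx | hxx
  · refine le_trans ?_ (hbig x hxx hx1)
    have : 0 < c * C₃ * T ^ (-(1 / 2) : ℝ) := by positivity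
    linarith
  · have hb := hbig x₀ le_rfl hx₀1
    have hder : ∀ y ∈ Icc (0 : ℝ) (1 / 2), HasDerivWithinAt
        (fun y : ℝ => riemannZeta (1 + y + I * t))
        (deriv riemannZeta (1 + y + I * t)) (Icc (0 : ℝ) (1 / 2)) y := by
      intro y _
      have hne : (1 + y + I * t : ℂ) ≠ 1 := by
        intro h
        have := congrArg Complex.im h
        simp at this
        rw [this] at hT
        simp at hT
        linarith
      have h1 := (differentiableAt_riemannZeta hne).hasDerivAt
      have h2 : HasDerivAt (fun z : ℂ => 1 + z + I * t) 1 (y : ℂ) :=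
        ((hasDerivAt_id (y : ℂ)).const_add 1).add_const _
      have h3 := (HasDerivAt.comp (y : ℂ) (h₂ := riemannZeta) h1 h2).comp_ofReal
      rw [mul_one] at h3
      exact h3.hasDerivWithinAt
    have hmv := (convex_Icc (0 : ℝ) (1 / 2)).norm_image_sub_le_of_norm_hasDerivWithin_le
      (C := C₃ * T ^ (1 / 8 : ℝ)) hder (fun y hy => by
        have := h₃ (1 + y + I * t) (by simpa using hy.1)
          (by simp; linarith [hy.2]) (by simpa [← hT] using ht)
        simpa [← hT] using this) (x := x) (y := x₀) ⟨hx0, hx1⟩ ⟨hx₀0.le, hx₀1⟩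
    have e4 : C₃ * T ^ (1 / 8 : ℝ) * ‖x₀ - x‖ ≤ c * C₃ * T ^ (-(1 / 2) : ℝ) := by
      have : ‖x₀ - x‖ ≤ x₀ := by
        rw [norm_eq_abs, abs_of_nonneg (by linarith)]; linarith
      calc C₃ * T ^ (1 / 8 : ℝ) * ‖x₀ - x‖ ≤ C₃ * T ^ (1 / 8 : ℝ) * x₀ := by gcongr
        _ = c * C₃ * (T ^ (1 / 8 : ℝ) * T ^ (-(5 / 8) : ℝ)) := by rw [hx₀]; ring
        _ = _ := by rw [← Real.rpow_add hT0]; norm_num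
    have e5 := norm_sub_norm_le (riemannZeta (1 + x₀ + I * t))
      (riemannZeta (1 + x + I * t))
    linarith

/-- A lower bound for `(s - 1) ζ(s)` on `1 ≤ Re s ≤ 3 / 2`. -/
theorem exists_le_norm_riemannZeta₁ :
    ∃ c : ℝ, 0 < c ∧ ∀ s : ℂ, 1 ≤ s.re → s.re ≤ 3 / 2 →
      c * (1 + |s.im|) ^ (1 / 2 : ℝ) ≤ ‖riemannZeta₁ s‖ := by
  obtain ⟨c, hc, h⟩ := exists_le_norm_riemannZeta
  have hK : IsCompact (Set.Icc (1 : ℝ) (3 / 2) ×ℂ Set.Icc (-2 : ℝ) 2) :=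
    isCompact_Icc.reProdIm isCompact_Icc
  have hne0 : ∀ s : ℂ, 1 ≤ s.re → riemannZeta₁ s ≠ 0 := by
    intro s hs
    by_cases h1 : s = 1
    · rw [h1]; simp
    · intro h0
      apply riemannZeta_ne_zero_of_one_le_re hs
      rw [riemannZeta_eq_inv_sub_mul h1, h0, mul_zero]
  obtain ⟨s₀, hs₀, hmin⟩ := hK.exists_isMinOn ⟨1, by simp [Complex.mem_reProdIm]; norm_num⟩
    (differentiable_riemannZeta₁.continuous.norm.continuousOn)
  set m := ‖riemannZeta₁ s₀‖ with hm
  have hm0 : 0 < m := norm_pos_iff.2 (hne0 s₀ (by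
    rw [Complex.mem_reProdIm] at hs₀; exact hs₀.1.1))
  refine ⟨min (c / 4) (m / 4), by positivity, fun s h1 h2 => ?_⟩
  have ha := abs_nonneg s.im
  rcases le_or_gt 2 |s.im| with ht | ht
  · have hne : s ≠ 1 := by
      rintro rfl
      norm_num at ht
    have hz : riemannZeta₁ s = (s - 1) * riemannZeta s := by
      rw [riemannZeta_eq_inv_sub_mul hne, ← mul_assoc, mul_inv_cancel₀ (sub_ne_zero.2 hne), one_mul]
    have e1 : |s.im| ≤ ‖s - 1‖ := by simpa using abs_im_le_norm (s - 1)
    have e2 := h (s.re - 1) s.im (by linarith) (by linarith) ht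
    have e3 : (1 + ((s.re - 1 : ℝ) : ℂ) + I * s.im) = s := by
      apply Complex.ext <;> simp
    rw [e3] at e2
    have hT0 : 0 < |s.im| := by linarith
    have e4 : (1 + |s.im|) ^ (1 / 2 : ℝ) ≤ 4 * |s.im| ^ (1 / 2 : ℝ) := by
      calc (1 + |s.im|) ^ (1 / 2 : ℝ) ≤ (4 * |s.im|) ^ (1 / 2 : ℝ) := by gcongr; linarith
        _ = 4 ^ (1 / 2 : ℝ) * |s.im| ^ (1 / 2 : ℝ) := Real.mul_rpow (by norm_num) ha
        _ ≤ 4 ^ (1 : ℝ) * |s.im| ^ (1 / 2 : ℝ) := by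
            gcongr
            · norm_num
            · norm_num
        _ = _ := by norm_num
    rw [hz, norm_mul]
    calc min (c / 4) (m / 4) * (1 + |s.im|) ^ (1 / 2 : ℝ)
        ≤ c / 4 * (4 * |s.im| ^ (1 / 2 : ℝ)) := by gcongr; exact min_le_left _ _
      _ = |s.im| ^ (1 : ℝ) * (c * |s.im| ^ (-(1 / 2) : ℝ)) := by
          rw [show (1 / 2 : ℝ) = 1 + -(1 / 2) by norm_num, Real.rpow_add hT0]
          norm_num
          ring
      _ ≤ _ := by
          rw [Real.rpow_one]
          gcongr
  · have hmem : s ∈ Set.Icc (1 : ℝ) (3 / 2) ×ℂ Set.Icc (-2 : ℝ) 2 := by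
      rw [Complex.mem_reProdIm]
      exact ⟨⟨h1, h2⟩, abs_le.1 ht.le⟩
    have e1 : m ≤ ‖riemannZeta₁ s‖ := hmin hmem
    have e2 : (1 + |s.im|) ^ (1 / 2 : ℝ) ≤ 4 := by
      calc (1 + |s.im|) ^ (1 / 2 : ℝ) ≤ (1 + |s.im|) ^ (1 : ℝ) :=
            rpow_le_rpow_of_exponent_le (by linarith) (by norm_num)
        _ ≤ 4 := by rw [Real.rpow_one]; linarith
    calc min (c / 4) (m / 4) * (1 + |s.im|) ^ (1 / 2 : ℝ) ≤ m / 4 * 4 := by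
          gcongr; exact min_le_right _ _
      _ = m := by ring
      _ ≤ _ := e1

/-- The hypotheses on the multiplicative function `h` and the factor `H*`. -/
structure SieveHyp (h : ArithmeticFunction ℝ) (Hstar : ℂ → ℂ) (L c₀ : ℝ) : Prop where
  mul : h.IsMultiplicative
  nonneg : ∀ n, 0 ≤ h n
  L_pos : 0 < L
  c_pos : 0 < c₀
  summable : ∀ s : ℂ, 1 < s.re →
    LSeriesSummable (fun n => (moebius n : ℂ) ^ 2 * (h n : ℂ)) s
  factor : ∀ s : ℂ, 1 < s.re →
    LSeries (fun n => (moebius n : ℂ) ^ 2 * (h n : ℂ)) s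
      = riemannZeta s ^ 2 * Hstar s
  hol : DifferentiableOn ℂ Hstar {s : ℂ | 1 - c₀ ≤ s.re}
  zerofree : ∀ s : ℂ, 1 - c₀ ≤ s.re → 1 - 1 / (L * log (|s.im| + 2)) ≤ s.re →
    Hstar s ≠ 0 ∧ ‖1 / Hstar s‖ ≤ L
  first : ∀ x : ℝ, 3 ≤ x →
    |(∑ p ∈ (Finset.Icc 1 ⌊x⌋₊).filter Nat.Prime, h p * log p / p) - 2 * log x| ≤ L
  second : Summable fun p : Nat.Primes => h p ^ 2 * ((p : ℕ) : ℝ) ^ (2 * c₀ - 2)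

/-- A holomorphic function without zeros in a disc whose inverse is bounded there is itself
bounded in a smaller disc in terms of its value at the centre. -/
theorem norm_le_of_norm_inv_le {G : ℂ → ℂ} {z₀ : ℂ} {R L : ℝ} (hR : 0 < R)
    (hG : DifferentiableOn ℂ G (Metric.ball z₀ R)) (h0 : ∀ z ∈ Metric.ball z₀ R, G z ≠ 0)
    (hL : ∀ z ∈ Metric.ball z₀ R, ‖1 / G z‖ ≤ L) {z : ℂ} (hz : ‖z - z₀‖ ≤ 2 / 3 * R) :
    ‖G z‖ ≤ ‖G z₀‖ * (exp 1 * (L * ‖G z₀‖)) ^ 4 := by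
  have hz₀ : z₀ ∈ Metric.ball z₀ R := Metric.mem_ball_self hR
  have hG0 : 0 < ‖G z₀‖ := norm_pos_iff.2 (h0 _ hz₀)
  have hLG : 1 ≤ L * ‖G z₀‖ := by
    have := hL _ hz₀
    rwa [norm_div, norm_one, div_le_iff₀ hG0] at this
  have hQ : DifferentiableOn ℂ (fun z => - (deriv G z / G z)) (Metric.ball z₀ R) :=
    ((hG.deriv Metric.isOpen_ball).div hG h0).neg
  obtain ⟨f, hf⟩ := hQ.isExactOn_ball
  have hGd : ∀ w ∈ Metric.ball z₀ R, HasDerivAt G (deriv G w) w := fun w hw =>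
    (hG.differentiableAt (Metric.isOpen_ball.mem_nhds hw)).hasDerivAt
  set F : ℂ → ℂ := fun w => f (z₀ + w) - f z₀ with hF
  have hmem : ∀ w, w ∈ Metric.ball (0 : ℂ) R → z₀ + w ∈ Metric.ball z₀ R := by
    intro w hw
    simpa [dist_eq_norm] using hw
  have hconst : ∀ w ∈ Metric.ball z₀ R, Complex.exp (f w - f z₀) * G w = G z₀ := by
    intro w hw
    have hd : ∀ v ∈ Metric.ball z₀ R,
        HasDerivAt (fun v => Complex.exp (f v - f z₀) * G v) 0 v := by
      intro v hv
      have h1 := (((hf v hv).sub_const (f z₀)).cexp).mul (hGd v hv)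
      refine h1.congr_deriv ?_
      have := h0 v hv
      field_simp
      ring
    have := (convex_ball z₀ R).is_const_of_fderivWithin_eq_zero (𝕜 := ℂ)
      (f := fun v => Complex.exp (f v - f z₀) * G v)
      (fun v hv => (hd v hv).differentiableAt.differentiableWithinAt)
      (fun v hv => by
        rw [fderivWithin_of_isOpen Metric.isOpen_ball hv]
        simpa using (hd v hv).hasFDerivAt.fderiv) hw hz₀
    simpa using this
  set M := log (L * ‖G z₀‖) + 1 with hM
  have hM0 : 0 < M := by have := Real.log_nonneg hLG; linarith
  have hre : ∀ w ∈ Metric.ball z₀ R, exp ((f w - f z₀).re) = ‖G z₀‖ / ‖G w‖ := by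
    intro w hw
    rw [← Complex.norm_exp, eq_div_iff (norm_ne_zero_iff.2 (h0 w hw)), ← norm_mul, hconst w hw]
  have hmaps : Set.MapsTo F (Metric.ball 0 R) {z | z.re ≤ M} := by
    intro w hw
    change (f (z₀ + w) - f z₀).re ≤ M
    rw [← Real.exp_le_exp, hre _ (hmem w hw), hM, Real.exp_add, exp_log (by linarith)]
    have h1 := hL _ (hmem w hw)
    rw [norm_div, norm_one] at h1
    calc ‖G z₀‖ / ‖G (z₀ + w)‖ = (1 / ‖G (z₀ + w)‖) * ‖G z₀‖ := by ring
      _ ≤ L * ‖G z₀‖ * 1 := by rw [mul_one]; gcongr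
      _ ≤ _ := by
          gcongr
          exact Real.one_le_exp (by norm_num)
  have hFd : DifferentiableOn ℂ F (Metric.ball 0 R) := by
    intro w hw
    have h1 := (hf _ (hmem w hw))
    have h2 : HasDerivAt (fun v => z₀ + v) 1 w := (hasDerivAt_id w).const_add z₀
    exact ((h1.comp w h2).sub_const (f z₀)).differentiableAt.differentiableWithinAt
  have hzm : z - z₀ ∈ Metric.ball (0 : ℂ) R := by
    rw [mem_ball_zero_iff]
    linarith
  have hBC := Complex.borelCaratheodory_zero hM0 hFd hmaps hR hzm (by simp [hF])
  have hzmem : z ∈ Metric.ball z₀ R := by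
    have := hmem _ hzm
    rwa [add_sub_cancel] at this
  have hF2 : ‖F (z - z₀)‖ ≤ 4 * M := by
    refine hBC.trans ?_
    rw [div_le_iff₀ (by linarith)]
    nlinarith [norm_nonneg (z - z₀)]
  have hF3 : -(4 * M) ≤ (f z - f z₀).re := by
    have h1 : F (z - z₀) = f z - f z₀ := by simp [hF]
    rw [h1] at hF2
    linarith [(abs_le.1 ((abs_re_le_norm _).trans hF2)).1]
  have h4 : exp (-(4 * M)) ≤ ‖G z₀‖ / ‖G z‖ := by
    rw [← hre z hzmem]
    exact Real.exp_le_exp.2 hF3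
  have hGz : 0 < ‖G z‖ := norm_pos_iff.2 (h0 z hzmem)
  rw [Real.exp_neg, inv_eq_one_div, div_le_div_iff₀ (exp_pos _) hGz, one_mul] at h4
  have h5 : exp (4 * M) = (exp 1 * (L * ‖G z₀‖)) ^ 4 := by
    have h6 : exp 1 * (L * ‖G z₀‖) = exp M := by
      rw [hM, Real.exp_add, exp_log (by linarith), mul_comm]
    rw [h6, ← Real.exp_nat_mul]
    norm_num
  rw [← h5]
  exact h4

variable {h : ArithmeticFunction ℝ} {Hstar : ℂ → ℂ} {L c₀ : ℝ}

/-- The coefficients `μ²(n) h(n)`. -/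
def sqfreeCoeff (h : ArithmeticFunction ℝ) (n : ℕ) : ℝ :=
  (moebius n : ℝ) ^ 2 * h n

theorem ofReal_sqfreeCoeff (h : ArithmeticFunction ℝ) :
    (fun n => (moebius n : ℂ) ^ 2 * (h n : ℂ)) =
      fun n => (sqfreeCoeff h n : ℂ) := by
  funext n
  simp [sqfreeCoeff]

theorem sqfreeCoeff_nonneg (hh : SieveHyp h Hstar L c₀) (n : ℕ) : 0 ≤ sqfreeCoeff h n :=
  mul_nonneg (sq_nonneg _) (hh.nonneg n)

theorem SieveHyp.differentiableAt (hh : SieveHyp h Hstar L c₀) {s : ℂ} (hs : 1 - c₀ < s.re) :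
    DifferentiableAt ℂ Hstar s :=
  hh.hol.differentiableAt (mem_of_superset
    ((isOpen_lt continuous_const Complex.continuous_re).mem_nhds hs) fun z (hz : 1 - c₀ < z.re) => hz.le)

theorem SieveHyp.norm_LSeries_le (hh : SieveHyp h Hstar L c₀) {s : ℂ} (hs : 1 < s.re) :
    ‖LSeries (fun n => (sqfreeCoeff h n : ℂ)) s‖ ≤
      ‖LSeries (fun n => (sqfreeCoeff h n : ℂ)) (s.re : ℂ)‖ := by
  have hs1 := hh.summable s hs
  have hs2 := hh.summable (s.re : ℂ) (by simpa using hs)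
  rw [ofReal_sqfreeCoeff] at hs1 hs2
  have hterm : ∀ n, LSeries.term (fun n => (sqfreeCoeff h n : ℂ)) (s.re : ℂ) n
      = (‖LSeries.term (fun n => (sqfreeCoeff h n : ℂ)) s n‖ : ℝ) := by
    intro n
    rw [LSeries.norm_term_eq, LSeries.term_def]
    split_ifs with hn
    · simp
    · rw [norm_real, norm_of_nonneg (sqfreeCoeff_nonneg hh n), Complex.ofReal_div,
        Complex.ofReal_cpow (Nat.cast_nonneg n)]
      simp
  unfold LSeries
  simp_rw [hterm]
  rw [← Complex.ofReal_tsum, norm_real]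
  exact (norm_tsum_le_tsum_norm hs1.norm).trans (le_abs_self _)

/-- Polynomial growth of `H*` slightly to the left of the line `Re s = 1`. -/
theorem SieveHyp.exists_norm_Hstar_le (hh : SieveHyp h Hstar L c₀) :
    ∃ c C : ℝ, 0 < c ∧ c ≤ 1 / 16 ∧ c < c₀ ∧ 0 < C ∧ ∀ s : ℂ,
      1 - c / log (|s.im| + 4) ≤ s.re → s.re ≤ 3 / 2 →
      ‖Hstar s‖ ≤ C * (1 + |s.im|) ^ 20 := by
  have hL := hh.L_pos
  have hc := hh.c_pos
  obtain ⟨C₁, hC₁, h₁⟩ := exists_norm_riemannZeta_one_add_le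
  obtain ⟨m, hm, h₂⟩ := exists_le_norm_riemannZeta₁
  obtain ⟨C₃, hC₃⟩ := (isCompact_Icc (a := (1 : ℝ)) (b := 2)).exists_bound_of_continuousOn
    (f := fun x : ℝ => Hstar x) (by
      intro x hx
      have h3 := (hh.differentiableAt (s := (x : ℂ)) (by simp; linarith [hx.1])).continuousAt
      exact (h3.comp (f := fun y : ℝ => (y : ℂ)) Complex.continuous_ofReal.continuousAt).continuousWithinAt)
  -- the bound to the right of the line
  set K : ℝ := C₁ ^ 2 * (|C₃| + 1) / m ^ 2 with hK
  have hK0 : 0 < K := by positivity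
  have hright : ∀ s : ℂ, 1 < s.re → s.re ≤ 3 / 2 →
      ‖Hstar s‖ ≤ K * (1 + |s.im|) ^ 2 / (s.re - 1) ^ 2 := by
    intro s hs1 hs2
    have hne : s ≠ 1 := by rintro rfl; simp at hs1
    have hx : 0 < s.re - 1 := by linarith
    have ha := abs_nonneg s.im
    have e1 := hh.norm_LSeries_le hs1
    rw [← ofReal_sqfreeCoeff, hh.factor s hs1, hh.factor (s.re : ℂ) (by simpa using hs1),
      norm_mul, norm_mul, norm_pow, norm_pow] at e1
    have e2 := h₁ (s.re - 1) hx (by linarith)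
    have e3 : (1 + ((s.re - 1 : ℝ) : ℂ)) = (s.re : ℂ) := by push_cast; ring
    rw [e3] at e2
    have e4 := hC₃ s.re ⟨hs1.le, by linarith⟩
    have e5 := h₂ s hs1.le hs2
    have e6 : m ≤ ‖riemannZeta₁ s‖ := by
      refine le_trans ?_ e5
      have : (1 : ℝ) ≤ (1 + |s.im|) ^ (1 / 2 : ℝ) := Real.one_le_rpow (by linarith) (by norm_num)
      nlinarith
    have e7 : ‖s - 1‖ ≤ 1 + |s.im| := by
      refine (Complex.norm_le_abs_re_add_abs_im _).trans ?_
      simp only [sub_re, one_re, sub_im, one_im, sub_zero]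
      rw [abs_of_pos hx]
      linarith
    have e8 : m / (1 + |s.im|) ≤ ‖riemannZeta s‖ := by
      rw [riemannZeta_eq_inv_sub_mul hne, norm_mul, norm_inv, inv_mul_eq_div]
      have : 0 < ‖s - 1‖ := norm_pos_iff.2 (sub_ne_zero.2 hne)
      gcongr
    have e9 : (m / (1 + |s.im|)) ^ 2 * ‖Hstar s‖ ≤ (C₁ / (s.re - 1)) ^ 2 * (|C₃| + 1) := by
      calc (m / (1 + |s.im|)) ^ 2 * ‖Hstar s‖ ≤ ‖riemannZeta s‖ ^ 2 * ‖Hstar s‖ := by gcongr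
        _ ≤ _ := e1
        _ ≤ _ := by
          gcongr
          linarith [le_abs_self C₃]
    rw [div_pow, div_pow, div_mul_eq_mul_div, div_mul_eq_mul_div,
      div_le_div_iff₀ (by positivity) (by positivity)] at e9
    rw [hK, le_div_iff₀ (by positivity), div_mul_eq_mul_div, le_div_iff₀ (by positivity)]
    linarith
  set c : ℝ := min (1 / 16) (min (c₀ / 4) (1 / (4 * L))) with hcdef
  have hc0 : 0 < c := by positivity
  have hc1 : c ≤ 1 / 16 := min_le_left _ _
  have hc2 : c ≤ c₀ / 4 := (min_le_right _ _).trans (min_le_left _ _)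
  have hc3 : c ≤ 1 / (4 * L) := (min_le_right _ _).trans (min_le_right _ _)
  have hc3' : c * (4 * L) ≤ 1 := by rwa [le_div_iff₀ (by positivity)] at hc3
  set K' : ℝ := K * 16 / c ^ 2 with hK'
  have hK'0 : 0 < K' := by positivity
  refine ⟨c, K' + K' * (exp 1 * (L * K')) ^ 4, hc0, hc1, by linarith, by positivity, ?_⟩
  intro s hs1 hs2
  have ha := abs_nonneg s.im
  set ℓ := log (|s.im| + 4) with hℓ
  have hℓ1 : 1 ≤ ℓ := by
    rw [Real.le_log_iff_exp_le (by linarith)]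
    linarith [Real.exp_one_lt_d9]
  have hℓ2 : ℓ ≤ 4 * (1 + |s.im|) := by
    have := Real.log_le_sub_one_of_pos (show 0 < |s.im| + 4 by linarith)
    linarith
  set r := c / ℓ with hr
  have hr0 : 0 < r := by positivity
  have hr1 : r ≤ c := div_le_self hc0.le hℓ1
  have hri : K / r ^ 2 ≤ K' * (1 + |s.im|) ^ 2 := by
    calc K / r ^ 2 = K * ℓ ^ 2 / c ^ 2 := by rw [hr, div_pow, div_div_eq_mul_div]
      _ ≤ K * (4 * (1 + |s.im|)) ^ 2 / c ^ 2 := by gcongr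
      _ = _ := by rw [hK']; ring
  have hright' : ∀ z : ℂ, z.im = s.im → 1 + r ≤ z.re → z.re ≤ 3 / 2 →
      ‖Hstar z‖ ≤ K' * (1 + |s.im|) ^ 4 := by
    intro z hzi hz1 hz2
    have hle : r ≤ z.re - 1 := by linarith
    calc ‖Hstar z‖ ≤ K * (1 + |z.im|) ^ 2 / (z.re - 1) ^ 2 := hright z (by linarith) hz2
      _ = K / (z.re - 1) ^ 2 * (1 + |s.im|) ^ 2 := by rw [hzi]; ring
      _ ≤ K / r ^ 2 * (1 + |s.im|) ^ 2 := by gcongr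
      _ ≤ K' * (1 + |s.im|) ^ 2 * (1 + |s.im|) ^ 2 := by gcongr
      _ = _ := by ring
  have hone : 1 ≤ 1 + |s.im| := by linarith
  rcases le_or_gt (1 + r) s.re with hsr | hsr
  · calc ‖Hstar s‖ ≤ K' * (1 + |s.im|) ^ 4 := hright' s rfl hsr hs2
      _ ≤ _ := by
        gcongr
        · have : 0 ≤ K' * (exp 1 * (L * K')) ^ 4 := by positivity
          linarith
        · norm_num
  · set z₀ : ℂ := ⟨1 + r, s.im⟩ with hz₀
    have hball : ∀ z ∈ Metric.ball z₀ (3 * r), 1 - c₀ < z.re ∧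
        1 - 1 / (L * log (|z.im| + 2)) ≤ z.re := by
      intro z hz
      have hz' : ‖z - z₀‖ < 3 * r := by simpa [dist_eq_norm] using hz
      have e1 := abs_lt.1 ((abs_re_le_norm (z - z₀)).trans_lt hz')
      have e2 := (abs_im_le_norm (z - z₀)).trans_lt hz'
      simp only [sub_re, sub_im, hz₀] at e1 e2
      have e3 := abs_sub_abs_le_abs_sub z.im s.im
      have e4 : log (|z.im| + 2) ≤ ℓ :=
        log_le_log (by positivity) (by linarith)
      have e5 : 0 < log (|z.im| + 2) := log_pos (by linarith [abs_nonneg z.im])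
      refine ⟨by linarith [e1.1], ?_⟩
      have e6 : 2 * r ≤ 1 / (L * log (|z.im| + 2)) := by
        calc 2 * r ≤ 1 / (L * ℓ) := by
              rw [le_div_iff₀ (by positivity), hr]
              field_simp
              linarith
          _ ≤ _ := by gcongr
      linarith [e1.1]
    have hzs : ‖s - z₀‖ ≤ 2 / 3 * (3 * r) := by
      refine (Complex.norm_le_abs_re_add_abs_im _).trans ?_
      simp only [sub_re, sub_im, hz₀, sub_self, abs_zero, add_zero]
      rw [abs_le]
      constructor <;> linarith
    have := norm_le_of_norm_inv_le (G := Hstar) (z₀ := z₀) (R := 3 * r) (L := L) (by positivity)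
      (fun z hz => (hh.differentiableAt (hball z hz).1).differentiableWithinAt)
      (fun z hz => (hh.zerofree z (hball z hz).1.le (hball z hz).2).1)
      (fun z hz => (hh.zerofree z (hball z hz).1.le (hball z hz).2).2) hzs
    have hz0b := hright' z₀ rfl le_rfl (by simp only [hz₀]; linarith)
    calc ‖Hstar s‖ ≤ ‖Hstar z₀‖ * (exp 1 * (L * ‖Hstar z₀‖)) ^ 4 := this
      _ ≤ (K' * (1 + |s.im|) ^ 4) * (exp 1 * (L * (K' * (1 + |s.im|) ^ 4))) ^ 4 := by gcongr
      _ = K' * (exp 1 * (L * K')) ^ 4 * (1 + |s.im|) ^ 20 := by ring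
      _ ≤ _ := by
        gcongr
        linarith

/-- The density `h(n) / n`. -/
def dens (h : ArithmeticFunction ℝ) (n : ℕ) : ℝ := h n / n

theorem SieveHyp.dens_nonneg (hh : SieveHyp h Hstar L c₀) (n : ℕ) : 0 ≤ dens h n :=
  div_nonneg (hh.nonneg n) (Nat.cast_nonneg n)

theorem SieveHyp.summable_dens_sq_rpow (hh : SieveHyp h Hstar L c₀) :
    Summable fun p : Nat.Primes => dens h p ^ 2 * ((p : ℕ) : ℝ) ^ (2 * c₀) := by
  refine hh.second.congr fun p => ?_
  have hp : (0 : ℝ) < ((p : ℕ) : ℝ) := by exact_mod_cast p.2.pos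
  rw [Real.rpow_sub hp, dens]
  norm_num
  field_simp

theorem SieveHyp.summable_dens_sq (hh : SieveHyp h Hstar L c₀) :
    Summable fun p : Nat.Primes => dens h p ^ 2 := by
  refine hh.summable_dens_sq_rpow.of_nonneg_of_le (fun p => sq_nonneg _) fun p => ?_
  have hp : (1 : ℝ) ≤ ((p : ℕ) : ℝ) := by exact_mod_cast p.2.one_le
  have := Real.one_le_rpow hp (by have := hh.c_pos; linarith : 0 ≤ 2 * c₀)
  nlinarith [sq_nonneg (dens h p)]

theorem isMultiplicative_term (hh : SieveHyp h Hstar L c₀) (s : ℂ) {m n : ℕ}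
    (hmn : Nat.Coprime m n) :
    LSeries.term (fun n => (sqfreeCoeff h n : ℂ)) s (m * n) =
      LSeries.term (fun n => (sqfreeCoeff h n : ℂ)) s m *
        LSeries.term (fun n => (sqfreeCoeff h n : ℂ)) s n := by
  rcases eq_or_ne m 0 with rfl | hm
  · simp
  rcases eq_or_ne n 0 with rfl | hn
  · simp
  rw [LSeries.term_of_ne_zero (mul_ne_zero hm hn), LSeries.term_of_ne_zero hm,
    LSeries.term_of_ne_zero hn]
  have h1 : sqfreeCoeff h (m * n) = sqfreeCoeff h m * sqfreeCoeff h n := by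
    simp only [sqfreeCoeff, ArithmeticFunction.isMultiplicative_moebius.map_mul_of_coprime hmn,
      hh.mul.map_mul_of_coprime hmn]
    push_cast
    ring
  rw [h1, Nat.cast_mul, Complex.natCast_mul_natCast_cpow]
  push_cast
  field_simp

theorem sqfreeCoeff_prime (h : ArithmeticFunction ℝ) {p : ℕ} (hp : p.Prime) :
    sqfreeCoeff h p = h p := by
  simp [sqfreeCoeff, ArithmeticFunction.moebius_apply_prime hp]

theorem tsum_term_prime_pow (hh : SieveHyp h Hstar L c₀) (s : ℂ) {p : ℕ} (hp : p.Prime) :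
    ∑' e : ℕ, LSeries.term (fun n => (sqfreeCoeff h n : ℂ)) s (p ^ e) =
      1 + h p * (p : ℂ) ^ (-s) := by
  rw [tsum_eq_sum (s := Finset.range 2)]
  · rw [Finset.sum_range_succ, Finset.sum_range_one, pow_zero, pow_one,
      LSeries.term_of_ne_zero one_ne_zero, LSeries.term_of_ne_zero hp.ne_zero,
      sqfreeCoeff_prime h hp, Complex.cpow_neg, div_eq_mul_inv]
    simp [sqfreeCoeff, hh.mul.map_one, div_eq_mul_inv]
  · intro e he
    have he2 : 1 < e := by simpa using he
    rw [LSeries.term_of_ne_zero (pow_ne_zero _ hp.ne_zero)]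
    have : sqfreeCoeff h (p ^ e) = 0 := by
      rw [sqfreeCoeff, ArithmeticFunction.moebius_apply_prime_pow hp (by lia), if_neg (by lia)]
      simp
    simp [this]

theorem SieveHyp.eulerProduct (hh : SieveHyp h Hstar L c₀) {s : ℂ} (hs : 1 < s.re) :
    Tendsto (fun n : ℕ => ∏ p ∈ n.primesBelow, (1 + h p * (p : ℂ) ^ (-s))) atTop
      (𝓝 (LSeries (fun n => (sqfreeCoeff h n : ℂ)) s)) := by
  have hs1 := hh.summable s hs
  rw [ofReal_sqfreeCoeff] at hs1
  have := EulerProduct.eulerProduct (f := LSeries.term (fun n => (sqfreeCoeff h n : ℂ)) s)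
    (by rw [LSeries.term_of_ne_zero one_ne_zero]; simp [sqfreeCoeff, hh.mul.map_one])
    (fun {m n} => isMultiplicative_term hh s) hs1.norm (LSeries.term_zero _ _)
  refine this.congr fun n => Finset.prod_congr rfl fun p hp => ?_
  exact tsum_term_prime_pow hh s (prime_of_mem_primesBelow hp)

theorem SieveHyp.LSeries_ne_zero (hh : SieveHyp h Hstar L c₀) {s : ℂ} (hs : 1 < s.re) :
    LSeries (fun n => (sqfreeCoeff h n : ℂ)) s ≠ 0 := by
  rw [← ofReal_sqfreeCoeff, hh.factor s hs]
  refine mul_ne_zero (pow_ne_zero _ (riemannZeta_ne_zero_of_one_le_re hs.le)) ?_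
  refine (hh.zerofree s (by linarith [hh.c_pos]) ?_).1
  have : 0 < 1 / (L * log (|s.im| + 2)) :=
    one_div_pos.2 (mul_pos hh.L_pos (log_pos (by linarith [abs_nonneg s.im])))
  linarith

theorem natCast_cpow_neg {p : ℕ} (hp : p.Prime) (σ t : ℝ) :
    (p : ℂ) ^ (-(σ + t * I : ℂ)) =
      ((p : ℝ) ^ (-σ) : ℝ) * Complex.exp (-(t * log p : ℝ) * I) := by
  have hp0 : (p : ℂ) ≠ 0 := by exact_mod_cast hp.ne_zero
  rw [Complex.cpow_def_of_ne_zero hp0, Real.rpow_def_of_pos (by exact_mod_cast hp.pos),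
    Complex.ofReal_exp, ← Complex.exp_add, ← Complex.natCast_log]
  congr 1
  push_cast
  ring

theorem SieveHyp.le_of_dens (hh : SieveHyp h Hstar L c₀) {p : ℕ} (hp : p.Prime) : h p ≤ p := by
  by_contra! hlt
  have hp1 : (1 : ℝ) < p := by exact_mod_cast hp.one_lt
  have hlog : 0 < log p := log_pos hp1
  have hh0 : 0 < h p := by linarith
  set σ : ℝ := log (h p) / log p with hσ
  have hσ1 : 1 < σ := by
    rw [hσ, lt_div_iff₀ hlog, one_mul]
    exact Real.log_lt_log (by linarith) hlt
  set s : ℂ := σ + (π / log p : ℝ) * I with hs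
  have hsre : s.re = σ := by rw [hs, add_re, re_ofReal_mul]; simp
  have hfac : 1 + h p * (p : ℂ) ^ (-s) = 0 := by
    rw [hs, natCast_cpow_neg hp, div_mul_cancel₀ _ hlog.ne', neg_mul, Complex.exp_neg,
      Complex.exp_pi_mul_I, Real.rpow_neg (by linarith)]
    have : (p : ℝ) ^ σ = h p := by
      rw [Real.rpow_def_of_pos (by linarith), hσ, mul_div_cancel₀ _ hlog.ne', exp_log hh0]
    rw [this]
    have : (h p : ℂ) ≠ 0 := by exact_mod_cast hh0.ne'
    push_cast
    field_simp
    norm_num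
  have h1 := hh.eulerProduct (s := s) (by rw [hsre]; exact hσ1)
  refine hh.LSeries_ne_zero (s := s) (by rw [hsre]; exact hσ1) (tendsto_nhds_unique h1 ?_)
  refine tendsto_const_nhds.congr' ?_
  filter_upwards [eventually_gt_atTop p] with n hn
  exact (Finset.prod_eq_zero (mem_primesBelow.2 ⟨hn, hp⟩) hfac).symm

theorem abs_log_norm_one_add_sub_le {z : ℂ} (hz : ‖z‖ ≤ 1 / 2) :
    |log ‖1 + z‖ - z.re| ≤ ‖z‖ ^ 2 := by
  have h1 := Complex.norm_log_one_add_sub_self_le (z := z) (by linarith)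
  have h2 : (Complex.log (1 + z) - z).re = log ‖1 + z‖ - z.re := by
    rw [sub_re, Complex.log_re]
  rw [← h2]
  refine (abs_re_le_norm _).trans (h1.trans ?_)
  have : (1 - ‖z‖)⁻¹ ≤ 2 := by
    rw [inv_le_comm₀ (by linarith) (by norm_num)]
    linarith
  nlinarith [sq_nonneg ‖z‖]

/-- Positivity of a Fejér kernel. -/
theorem fejer_nonneg (θ : ℝ) :
    0 ≤ 5 - 8 * Real.cos θ + 6 * Real.cos (2 * θ) - 4 * Real.cos (3 * θ)
      + 2 * Real.cos (4 * θ) := by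
  have e4 : Real.cos (4 * θ) = 2 * (2 * Real.cos θ ^ 2 - 1) ^ 2 - 1 := by
    rw [show 4 * θ = 2 * (2 * θ) by ring, Real.cos_two_mul, Real.cos_two_mul]
  rw [Real.cos_two_mul, Real.cos_three_mul, e4]
  have : 5 - 8 * Real.cos θ + 6 * (2 * Real.cos θ ^ 2 - 1)
      - 4 * (4 * Real.cos θ ^ 3 - 3 * Real.cos θ) + 2 * (2 * (2 * Real.cos θ ^ 2 - 1) ^ 2 - 1)
      = (4 * Real.cos θ ^ 2 - 2 * Real.cos θ - 1) ^ 2 := by ring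
  rw [this]
  positivity

theorem fejer_factor {x θ : ℝ} (hx0 : 0 ≤ x) (hx : x ≤ 1 / 2) :
    exp (-(25 * x ^ 2)) *
      (‖1 + x * Complex.exp (-(1 * θ : ℝ) * I)‖ ^ 8 *
       ‖1 + x * Complex.exp (-(3 * θ : ℝ) * I)‖ ^ 4) ≤
      ‖1 + x * Complex.exp (-(0 * θ : ℝ) * I)‖ ^ 5 *
       ‖1 + x * Complex.exp (-(2 * θ : ℝ) * I)‖ ^ 6 *
       ‖1 + x * Complex.exp (-(4 * θ : ℝ) * I)‖ ^ 2 := by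
  set z : ℝ → ℂ := fun k => x * Complex.exp (-(k * θ : ℝ) * I) with hz
  have hnorm : ∀ k, ‖z k‖ = x := by
    intro k
    simp only [hz]
    rw [norm_mul, norm_real, norm_of_nonneg hx0, ← Complex.ofReal_neg,
      Complex.norm_exp_ofReal_mul_I, mul_one]
  have hre : ∀ k, (z k).re = x * Real.cos (k * θ) := by
    intro k
    simp only [hz]
    rw [re_ofReal_mul, ← Complex.ofReal_neg, Complex.exp_ofReal_mul_I_re, Real.cos_neg]
  have hpos : ∀ k, 0 < ‖1 + z k‖ := by
    intro k
    have := norm_sub_norm_le (1 : ℂ) (-z k)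
    rw [norm_neg, hnorm, sub_neg_eq_add, norm_one] at this
    linarith
  have hlog : ∀ k, |log ‖1 + z k‖ - x * Real.cos (k * θ)| ≤ x ^ 2 := by
    intro k
    have := abs_log_norm_one_add_sub_le (z := z k) (by rw [hnorm]; exact hx)
    rwa [hre, hnorm] at this
  change _ * (‖1 + z 1‖ ^ 8 * ‖1 + z 3‖ ^ 4) ≤ ‖1 + z 0‖ ^ 5 * ‖1 + z 2‖ ^ 6 * ‖1 + z 4‖ ^ 2
  have p0 := hpos 0
  have p1 := hpos 1
  have p2 := hpos 2
  have p3 := hpos 3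
  have p4 := hpos 4
  rw [← Real.log_le_log_iff (by positivity) (by positivity), Real.log_mul (by positivity)
    (by positivity), Real.log_mul (by positivity) (by positivity), Real.log_mul (by positivity)
    (by positivity), Real.log_mul (by positivity) (by positivity), Real.log_exp]
  simp only [Real.log_pow]
  have l0 := abs_le.1 (hlog 0)
  have l1 := abs_le.1 (hlog 1)
  have l2 := abs_le.1 (hlog 2)
  have l3 := abs_le.1 (hlog 3)
  have l4 := abs_le.1 (hlog 4)
  have hf := mul_nonneg hx0 (fejer_nonneg θ)
  simp only [one_mul, zero_mul, Real.cos_zero] at l0 l1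
  push_cast
  nlinarith [l0.1, l1.2, l2.1, l3.2, l4.1]

theorem one_add_natCast_cpow_ne_zero {p q : ℕ} (hp : p.Prime) (hq : q.Prime) {j : ℕ} (hj : 0 < j)
    {a : ℝ} (ha : 0 ≤ a) :
    1 + (a : ℂ) * (q : ℂ) ^ (-(((1 : ℝ) : ℂ) +
      ((2 * j : ℕ) * (π / log p) : ℝ) * I)) ≠ 0 := by
  intro h0
  have hlp : 0 < log p := log_pos (by exact_mod_cast hp.one_lt)
  have hlq : 0 < log q := log_pos (by exact_mod_cast hq.one_lt)
  rw [natCast_cpow_neg hq, ← mul_assoc, ← Complex.ofReal_mul] at h0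
  set x : ℝ := a * (q : ℝ) ^ (-1 : ℝ) with hx
  set θ : ℝ := (2 * j : ℕ) * (π / log p) * log q with hθ
  have hx0 : 0 ≤ x := by positivity
  have e1 : (x : ℂ) * Complex.exp (-(θ : ℂ) * I) = -1 := by linear_combination h0
  have e2 := congrArg norm e1
  rw [norm_mul, norm_real, norm_of_nonneg hx0, ← Complex.ofReal_neg,
    Complex.norm_exp_ofReal_mul_I, mul_one, norm_neg, norm_one] at e2
  rw [e2, Complex.ofReal_one, one_mul, ← Complex.exp_pi_mul_I,
    Complex.exp_eq_exp_iff_exists_int] at e1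
  obtain ⟨m, hm⟩ := e1
  have e3 := congrArg Complex.im hm
  have e4 : (m : ℂ) * (2 * π * I) = ((m * (2 * π) : ℝ) : ℂ) * I := by
    push_cast; ring
  rw [e4, ← Complex.ofReal_neg, add_im, im_ofReal_mul, im_ofReal_mul,
    im_ofReal_mul, Complex.I_im] at e3
  have e5 : (2 * j : ℕ) * log q = -(2 * m + 1) * log p := by
    have hpi := Real.pi_pos
    have : (2 * j : ℕ) * (π / log p) * log q
        = π * ((2 * j : ℕ) * log q / log p) := by field_simp
    rw [hθ, this] at e3
    have e6 : (2 * j : ℕ) * log q / log p = -(2 * m + 1) := by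
      have : π * ((2 * j : ℕ) * log q / log p) = π * (-(2 * m + 1)) := by
        linarith
      exact mul_left_cancel₀ hpi.ne' this
    rw [div_eq_iff hlp.ne'] at e6
    exact e6
  have hmneg : 0 < -(2 * m + 1) := by
    by_contra! hle
    have h1 : (-(2 * (m : ℝ) + 1)) ≤ 0 := by exact_mod_cast hle
    have h2 : (0 : ℝ) < (2 * j : ℕ) * log q := by
      have : (0 : ℝ) < (2 * j : ℕ) := by exact_mod_cast (by lia : 0 < 2 * j)
      positivity
    nlinarith
  obtain ⟨n, hn⟩ := Int.eq_ofNat_of_zero_le hmneg.le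
  have hn' : (-(2 * (m : ℝ) + 1)) = (n : ℝ) := by exact_mod_cast hn
  rw [hn', ← Real.log_pow, ← Real.log_pow] at e5
  have hq0 : (0 : ℝ) < q := by exact_mod_cast hq.pos
  have hp0 : (0 : ℝ) < p := by exact_mod_cast hp.pos
  have e6 : (q : ℝ) ^ (2 * j) = (p : ℝ) ^ n := Real.log_injOn_pos (Set.mem_Ioi.2 (by positivity))
    (Set.mem_Ioi.2 (by positivity)) e5
  have e7 : q ^ (2 * j) = p ^ n := by exact_mod_cast e6
  have hdvd : p ∣ q ^ (2 * j) := e7 ▸ dvd_pow_self p (by lia)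
  have hpq : p = q := (Nat.prime_dvd_prime_iff_eq hp hq).1 (hp.dvd_of_dvd_pow hdvd)
  rw [hpq] at e7
  have := Nat.pow_right_injective hq.two_le e7
  lia

theorem SieveHyp.exists_dens_le_half (hh : SieveHyp h Hstar L c₀) :
    ∃ Q : ℕ, ∀ p : ℕ, p.Prime → Q ≤ p → dens h p ≤ 1 / 2 := by
  have h1 := hh.summable_dens_sq.tendsto_cofinite_zero.eventually_lt_const
    (show (0 : ℝ) < (1 / 2) ^ 2 by norm_num)
  rw [Filter.eventually_cofinite] at h1
  obtain ⟨Q, hQ⟩ := (h1.image (fun p : Nat.Primes => (p : ℕ))).bddAbove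
  refine ⟨Q + 1, fun p hp hpQ => ?_⟩
  by_contra! hlt
  have : p ≤ Q := hQ ⟨⟨p, hp⟩, by
    simp only [not_lt]
    exact pow_le_pow_left₀ (by norm_num) hlt.le 2, rfl⟩
  lia

theorem fejer_prod (hh : SieveHyp h Hstar L c₀) {Q : ℕ}
    (hQ : ∀ p : ℕ, p.Prime → Q ≤ p → dens h p ≤ 1 / 2) {σ : ℝ} (hσ : 1 < σ) (t₀ : ℝ)
    {n : ℕ} (hn : Q ≤ n) :
    let F : ℕ → ℕ → ℝ := fun n k =>
      ∏ q ∈ n.primesBelow, ‖1 + (h q : ℂ) * (q : ℂ) ^ (-((σ : ℂ) + (k * t₀ : ℝ) * I))‖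
    exp (-(25 * ∑' p : Nat.Primes, dens h p ^ 2)) * (F n 1 ^ 8 * F n 3 ^ 4) *
      (F Q 0 ^ 5 * F Q 2 ^ 6 * F Q 4 ^ 2) ≤
      (F n 0 ^ 5 * F n 2 ^ 6 * F n 4 ^ 2) * (F Q 1 ^ 8 * F Q 3 ^ 4) := by
  intro F
  have hsub : Q.primesBelow ⊆ n.primesBelow := by
    intro q hq
    rw [mem_primesBelow] at hq ⊢
    exact ⟨hq.1.trans_le hn, hq.2⟩
  set B : ℕ → ℝ := fun k => ∏ q ∈ n.primesBelow \ Q.primesBelow,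
    ‖1 + (h q : ℂ) * (q : ℂ) ^ (-((σ : ℂ) + (k * t₀ : ℝ) * I))‖ with hB
  have hF : ∀ k, F n k = B k * F Q k := fun k => (Finset.prod_sdiff hsub).symm
  have hB0 : ∀ k, 0 ≤ B k := fun k => prod_nonneg fun _ _ => norm_nonneg _
  have hFQ : ∀ k, 0 ≤ F Q k := fun k => prod_nonneg fun _ _ => norm_nonneg _
  have hfac : exp (-(25 * ∑' p : Nat.Primes, dens h p ^ 2)) * (B 1 ^ 8 * B 3 ^ 4) ≤
      B 0 ^ 5 * B 2 ^ 6 * B 4 ^ 2 := by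
    have e1 : exp (-(25 * ∑' p : Nat.Primes, dens h p ^ 2)) ≤
        ∏ q ∈ n.primesBelow \ Q.primesBelow, exp (-(25 * (h q * (q : ℝ) ^ (-σ)) ^ 2)) := by
      rw [← Real.exp_sum, Real.exp_le_exp, Finset.sum_neg_distrib, ← mul_sum]
      have : ∑ q ∈ n.primesBelow \ Q.primesBelow, (h q * (q : ℝ) ^ (-σ)) ^ 2 ≤
          ∑' p : Nat.Primes, dens h p ^ 2 := by
        have hpr : ∀ q ∈ n.primesBelow \ Q.primesBelow, q.Prime := fun q hq =>
          prime_of_mem_primesBelow (Finset.mem_sdiff.1 hq).1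
        calc ∑ q ∈ n.primesBelow \ Q.primesBelow, (h q * (q : ℝ) ^ (-σ)) ^ 2
            ≤ ∑ q ∈ n.primesBelow \ Q.primesBelow, dens h q ^ 2 := by
              refine sum_le_sum fun q hq => ?_
              have hq1 : (1 : ℝ) ≤ q := by exact_mod_cast (hpr q hq).one_le
              have := hh.nonneg q
              refine pow_le_pow_left₀ (by positivity) ?_ 2
              rw [dens, div_eq_mul_inv, ← Real.rpow_neg_one]
              gcongr
          _ = ∑ q ∈ ((n.primesBelow \ Q.primesBelow).subtype Nat.Prime : Finset Nat.Primes),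
                dens h q ^ 2 :=
              (Finset.sum_subtype_of_mem (fun q => dens h q ^ 2) hpr).symm
          _ ≤ _ := Summable.sum_le_tsum (ι := Nat.Primes) (f := fun q => dens h q ^ 2) _
              (fun _ _ => sq_nonneg _) hh.summable_dens_sq
      linarith
    calc _ ≤ (∏ q ∈ n.primesBelow \ Q.primesBelow,
          exp (-(25 * (h q * (q : ℝ) ^ (-σ)) ^ 2))) * (B 1 ^ 8 * B 3 ^ 4) := by
          have := hB0 1
          have := hB0 3
          gcongr
      _ ≤ _ := by
          simp only [hB, ← Finset.prod_pow, ← prod_mul_distrib]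
          refine prod_le_prod (fun _ _ => by positivity) fun q hq => ?_
          rw [Finset.mem_sdiff, mem_primesBelow, mem_primesBelow] at hq
          have hqp := hq.1.2
          have hqQ : Q ≤ q := by
            by_contra! hlt
            exact hq.2 ⟨hlt, hqp⟩
          have hq1 : (1 : ℝ) ≤ q := by exact_mod_cast hqp.one_le
          have hh0 := hh.nonneg q
          have hx : h q * (q : ℝ) ^ (-σ) ≤ 1 / 2 := by
            refine le_trans ?_ (hQ q hqp hqQ)
            rw [dens, div_eq_mul_inv, ← Real.rpow_neg_one]
            gcongr
          have := fejer_factor (x := h q * (q : ℝ) ^ (-σ)) (θ := t₀ * log q)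
            (by positivity) hx
          have hk : ∀ k : ℕ, (h q : ℂ) * (q : ℂ) ^ (-((σ : ℂ) + (k * t₀ : ℝ) * I)) =
              ((h q * (q : ℝ) ^ (-σ) : ℝ) : ℂ) *
                Complex.exp (-(((k : ℝ) * (t₀ * log q) : ℝ) : ℂ) * I) := by
            intro k
            rw [natCast_cpow_neg hqp, ← mul_assoc, Complex.ofReal_mul (h q), mul_assoc (k : ℝ)]
          simp only [hk]
          exact_mod_cast this
  have n0 := hFQ 0
  have n1 := hFQ 1
  have n2 := hFQ 2
  have n3 := hFQ 3
  have n4 := hFQ 4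
  simp only [hF]
  have hP : 0 ≤ F Q 0 ^ 5 * F Q 2 ^ 6 * F Q 4 ^ 2 * (F Q 1 ^ 8 * F Q 3 ^ 4) := by positivity
  have := mul_le_mul_of_nonneg_right hfac hP
  refine le_trans (le_of_eq ?_) (this.trans (le_of_eq ?_)) <;> ring

theorem SieveHyp.dens_lt_one (hh : SieveHyp h Hstar L c₀) {p : ℕ} (hp : p.Prime) :
    dens h p < 1 := by
  have hp0 : (0 : ℝ) < p := by exact_mod_cast hp.pos
  rw [dens, div_lt_one hp0]
  refine lt_of_le_of_ne (hh.le_of_dens hp) fun heq => ?_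
  have hlp : 0 < log p := log_pos (by exact_mod_cast hp.one_lt)
  have hc := hh.c_pos
  obtain ⟨Q', hQ'⟩ := hh.exists_dens_le_half
  set Q := max Q' (p + 1) with hQdef
  have hQ : ∀ q : ℕ, q.Prime → Q ≤ q → dens h q ≤ 1 / 2 := fun q hq hle =>
    hQ' q hq ((le_max_left _ _).trans hle)
  have hpQ : p ∈ Q.primesBelow :=
    mem_primesBelow.2 ⟨lt_of_lt_of_le (Nat.lt_succ_self p) (le_max_right _ _), hp⟩
  set t₀ : ℝ := π / log p with ht₀
  have ht0 : 0 < t₀ := div_pos Real.pi_pos hlp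
  set w : ℕ → ℝ → ℂ := fun k σ => (σ : ℂ) + (k * t₀ : ℝ) * I with hw
  have hwre : ∀ k σ, (w k σ).re = σ := fun k σ => by
    simp only [hw, add_re, ofReal_re, re_ofReal_mul, Complex.I_re, mul_zero,
      add_zero]
  have hwim : ∀ k σ, (w k σ).im = k * t₀ := fun k σ => by
    simp only [hw, add_im, Complex.ofReal_im, im_ofReal_mul, Complex.I_im, mul_one,
      zero_add]
  have hwc : ∀ k, Continuous (w k) := fun k =>
    Complex.continuous_ofReal.add continuous_const
  set S : ℕ → ℝ → ℝ := fun k σ => ∏ q ∈ Q.primesBelow, ‖1 + (h q : ℂ) * (q : ℂ) ^ (-(w k σ))‖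
    with hS
  set N : ℕ → ℝ → ℝ := fun k σ => ‖riemannZeta (w k σ) ^ 2 * Hstar (w k σ)‖ with hN
  set κ := exp (-(25 * ∑' p : Nat.Primes, dens h p ^ 2)) with hκ
  have hκ0 : 0 < κ := exp_pos _
  have key : ∀ σ : ℝ, 1 < σ → κ * (N 1 σ ^ 8 * N 3 σ ^ 4) * (S 0 σ ^ 5 * S 2 σ ^ 6 * S 4 σ ^ 2) ≤
      (N 0 σ ^ 5 * N 2 σ ^ 6 * N 4 σ ^ 2) * (S 1 σ ^ 8 * S 3 σ ^ 4) := by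
    intro σ hσ
    have hlim : ∀ k, Tendsto (fun n : ℕ => ∏ q ∈ n.primesBelow,
        ‖1 + (h q : ℂ) * (q : ℂ) ^ (-(w k σ))‖) atTop (𝓝 (N k σ)) := by
      intro k
      have h1 := (hh.eulerProduct (s := w k σ) (by rw [hwre]; exact hσ)).norm
      rw [← ofReal_sqfreeCoeff, hh.factor _ (by rw [hwre]; exact hσ)] at h1
      exact h1.congr fun n => norm_prod _ _
    refine le_of_tendsto_of_tendsto
      (((((hlim 1).pow 8).mul ((hlim 3).pow 4)).const_mul κ).mul_const _)
      (((((hlim 0).pow 5).mul ((hlim 2).pow 6)).mul ((hlim 4).pow 2)).mul_const _) ?_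
    filter_upwards [eventually_ge_atTop Q] with n hn
    exact fejer_prod hh hQ hσ t₀ hn
  -- continuity at `σ = 1`
  have hNc : ∀ k : ℕ, 0 < k → ContinuousAt (N k) 1 := by
    intro k hk
    have hne : w k 1 ≠ 1 := by
      intro h0
      have := congrArg Complex.im h0
      rw [hwim, one_im] at this
      have hk' : (0 : ℝ) < k := by exact_mod_cast hk
      nlinarith [mul_pos hk' ht0]
    have h1 : ContinuousAt (fun s => riemannZeta s ^ 2 * Hstar s) (w k 1) :=
      ((differentiableAt_riemannZeta hne).pow 2 |>.mul
        (hh.differentiableAt (by rw [hwre]; linarith))).continuousAt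
    exact (h1.comp (f := w k) (hwc k).continuousAt).norm
  have hNpos : ∀ k : ℕ, 0 < N k 1 := by
    intro k
    refine norm_pos_iff.2 (mul_ne_zero (pow_ne_zero _
      (riemannZeta_ne_zero_of_one_le_re (by rw [hwre]))) ?_)
    refine (hh.zerofree _ (by rw [hwre]; linarith) ?_).1
    rw [hwre]
    have : 0 < 1 / (L * log (|(w k 1).im| + 2)) :=
      one_div_pos.2 (mul_pos hh.L_pos (log_pos (by linarith [abs_nonneg (w k 1).im])))
    linarith
  have hSc : ∀ k, Continuous (S k) := by
    intro k
    refine continuous_finsetProd _ fun q hq => ?_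
    have hq0 : (q : ℂ) ≠ 0 := by exact_mod_cast (prime_of_mem_primesBelow hq).ne_zero
    exact (continuous_const.add (continuous_const.mul
      ((hwc k).neg.const_cpow (Or.inl hq0)))).norm
  have hS0 : 0 < S 0 1 := by
    refine Finset.prod_pos fun q hq => norm_pos_iff.2 ?_
    have hqp := prime_of_mem_primesBelow hq
    simp only [hw, natCast_cpow_neg hqp]
    simp only [Nat.cast_zero, zero_mul, Complex.ofReal_zero, neg_zero, Complex.exp_zero, mul_one]
    have h1 : (0 : ℝ) < 1 + h q * (q : ℝ) ^ (-1 : ℝ) := by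
      have := hh.nonneg q
      positivity
    exact_mod_cast h1.ne'
  have hSe : ∀ j : ℕ, 0 < j → 0 < S (2 * j) 1 := by
    intro j hj
    refine Finset.prod_pos fun q hq => norm_pos_iff.2 ?_
    exact one_add_natCast_cpow_ne_zero hp (prime_of_mem_primesBelow hq) hj (hh.nonneg q)
  -- small factors
  set B : ℝ := log p * ∏ q ∈ Q.primesBelow, (1 + h q) with hB
  have hodd : ∀ j : ℕ, ∀ σ : ℝ, 1 < σ → S (2 * j + 1) σ ≤ (σ - 1) * B := by
    intro j σ hσ
    have e1 : ‖1 + (h p : ℂ) * (p : ℂ) ^ (-(w (2 * j + 1) σ))‖ ≤ (σ - 1) * log p := by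
      simp only [hw, natCast_cpow_neg hp]
      have e2 : Complex.exp (-(((2 * j + 1 : ℕ) * t₀ * log p : ℝ) : ℂ) * I) = -1 := by
        have : (((2 * j + 1 : ℕ) * t₀ * log p : ℝ) : ℂ) = π + j * (2 * π) := by
          rw [ht₀, mul_assoc, div_mul_cancel₀ _ hlp.ne']
          push_cast
          ring
        rw [this, neg_mul, Complex.exp_neg, add_mul, Complex.exp_add, Complex.exp_pi_mul_I,
          show (j : ℂ) * (2 * π) * I = j * (2 * π * I) by ring,
          Complex.exp_nat_mul_two_pi_mul_I]
        norm_num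
      rw [e2, heq]
      have e3 : (1 : ℂ) + ((p : ℝ) : ℂ) * (((p : ℝ) ^ (-σ) : ℝ) * -1)
          = ((1 - (p : ℝ) ^ (1 - σ) : ℝ) : ℂ) := by
        rw [sub_eq_add_neg (1 : ℝ) σ, Real.rpow_add hp0, Real.rpow_one]
        push_cast
        ring
      rw [e3, norm_real, norm_eq_abs, Real.rpow_def_of_pos hp0]
      have e4 := add_one_le_exp (log p * (1 - σ))
      have e5 : exp (log p * (1 - σ)) ≤ 1 := by
        rw [Real.exp_le_one_iff]
        nlinarith
      rw [abs_of_nonneg (by linarith)]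
      linarith
    have e6 : ∏ q ∈ Q.primesBelow.erase p, ‖1 + (h q : ℂ) * (q : ℂ) ^ (-(w (2 * j + 1) σ))‖ ≤
        ∏ q ∈ Q.primesBelow.erase p, (1 + h q) := by
      refine prod_le_prod (fun _ _ => norm_nonneg _) fun q hq => ?_
      have hqp := prime_of_mem_primesBelow (Finset.mem_of_mem_erase hq)
      have hq1 : (1 : ℝ) ≤ q := by exact_mod_cast hqp.one_le
      refine (norm_add_le _ _).trans ?_
      rw [norm_one, norm_mul, norm_real, norm_of_nonneg (hh.nonneg q)]
      have e7 : ‖(q : ℂ) ^ (-(w (2 * j + 1) σ))‖ ≤ 1 := by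
        have := Complex.norm_cpow_eq_rpow_re_of_pos (by linarith : (0 : ℝ) < q)
          (-(w (2 * j + 1) σ))
        simp only [Complex.ofReal_natCast] at this
        rw [this, Complex.neg_re, hwre]
        exact Real.rpow_le_one_of_one_le_of_nonpos hq1 (by linarith)
      have := mul_le_mul_of_nonneg_left e7 (hh.nonneg q)
      linarith
    have hpos : 0 ≤ ∏ q ∈ Q.primesBelow.erase p, (1 + h q) :=
      prod_nonneg fun q _ => by linarith [hh.nonneg q]
    have e8 : ∏ q ∈ Q.primesBelow.erase p, (1 + h q) ≤ ∏ q ∈ Q.primesBelow, (1 + h q) := by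
      rw [← Finset.mul_prod_erase _ _ hpQ]
      exact le_mul_of_one_le_left hpos (by linarith [hh.nonneg p])
    simp only [hS]
    rw [← Finset.mul_prod_erase _ _ hpQ, hB]
    calc _ ≤ ((σ - 1) * log p) * ∏ q ∈ Q.primesBelow.erase p, (1 + h q) := by
          refine mul_le_mul e1 e6 (prod_nonneg fun _ _ => norm_nonneg _) ?_
          have : 0 < σ - 1 := by linarith
          positivity
      _ ≤ ((σ - 1) * log p) * ∏ q ∈ Q.primesBelow, (1 + h q) := by
          have : 0 < σ - 1 := by linarith
          gcongr
      _ = _ := by ring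
  set Z : ℝ → ℝ := fun σ => ‖riemannZeta₁ σ ^ 2 * Hstar σ‖ with hZ
  have hZc : ContinuousAt Z 1 := by
    have h1 : ContinuousAt (fun s => riemannZeta₁ s ^ 2 * Hstar s) ((1 : ℝ) : ℂ) :=
      ((differentiable_riemannZeta₁ _).pow 2 |>.mul
        (hh.differentiableAt (by simp [hc]))).continuousAt
    exact (h1.comp (f := fun σ : ℝ => (σ : ℂ)) Complex.continuous_ofReal.continuousAt).norm
  have hN0 : ∀ σ : ℝ, 1 < σ → (σ - 1) ^ 2 * N 0 σ = Z σ := by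
    intro σ hσ
    have hne : (σ : ℂ) ≠ 1 := by exact_mod_cast hσ.ne'
    have e1 : w 0 σ = σ := by simp [hw]
    have e2 : ‖((σ - 1 : ℝ) : ℂ)‖ = σ - 1 := by
      rw [norm_real, norm_of_nonneg (by linarith)]
    have e3 : riemannZeta₁ σ = (σ - 1 : ℝ) * riemannZeta σ := by
      rw [riemannZeta_eq_inv_sub_mul hne, ← mul_assoc]
      push_cast
      rw [mul_inv_cancel₀ (sub_ne_zero.2 hne), one_mul]
    simp only [hN, hZ, e1]
    rw [← e2, ← norm_pow, ← norm_mul, e3]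
    congr 1
    ring
  have hNn : ∀ k σ, 0 ≤ N k σ := fun k σ => norm_nonneg _
  have hSn : ∀ k σ, 0 ≤ S k σ := fun k σ => prod_nonneg fun _ _ => norm_nonneg _
  have key2 : ∀ σ : ℝ, 1 < σ →
      κ * (N 1 σ ^ 8 * N 3 σ ^ 4) * (S 0 σ ^ 5 * S 2 σ ^ 6 * S 4 σ ^ 2) ≤
      (Z σ ^ 5 * N 2 σ ^ 6 * N 4 σ ^ 2) * (B ^ 12 * (σ - 1) ^ 2) := by
    intro σ hσ
    refine (key σ hσ).trans ?_
    rw [← hN0 σ hσ]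
    have h1 := hodd 0 σ hσ
    have h3 := hodd 1 σ hσ
    have n0 := hNn 0 σ
    have n2 := hNn 2 σ
    have n4 := hNn 4 σ
    have s1 := hSn 1 σ
    have s3 := hSn 3 σ
    have hP : 0 ≤ N 0 σ ^ 5 * N 2 σ ^ 6 * N 4 σ ^ 2 := by positivity
    calc _ ≤ (N 0 σ ^ 5 * N 2 σ ^ 6 * N 4 σ ^ 2) * (((σ - 1) * B) ^ 8 * ((σ - 1) * B) ^ 4) := by
          refine mul_le_mul_of_nonneg_left ?_ hP
          exact mul_le_mul (pow_le_pow_left₀ s1 h1 8) (pow_le_pow_left₀ s3 h3 4) (by positivity)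
            (pow_nonneg (s1.trans h1) 8)
      _ = _ := by ring
  have hle := ContinuousWithinAt.closure_le (s := Ioi (1 : ℝ)) (x := 1)
    (by rw [closure_Ioi]; exact Set.mem_Ici.2 le_rfl)
    (ContinuousAt.continuousWithinAt (((((hNc 1 (by norm_num)).pow 8).mul
      ((hNc 3 (by norm_num)).pow 4)).const_mul κ).mul ((((hSc 0).continuousAt.pow 5).mul
      ((hSc 2).continuousAt.pow 6)).mul ((hSc 4).continuousAt.pow 2))))
    (ContinuousAt.continuousWithinAt ((((hZc.pow 5).mul ((hNc 2 (by norm_num)).pow 6)).mul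
      ((hNc 4 (by norm_num)).pow 2)).mul ((by fun_prop :
        ContinuousAt (fun σ : ℝ => B ^ 12 * (σ - 1) ^ 2) 1)))) (fun σ hσ => key2 σ hσ)
  have p1 := hNpos 1
  have p3 := hNpos 3
  have q2 := hSe 1 one_pos
  have q4 := hSe 2 two_pos
  have : 0 < κ * (N 1 1 ^ 8 * N 3 1 ^ 4) * (S 0 1 ^ 5 * S 2 1 ^ 6 * S 4 1 ^ 2) := by
    simp only [Nat.mul_one] at q2 q4
    positivity
  simp only [Pi.mul_apply, Pi.pow_apply, sub_self] at hle
  norm_num at hle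
  linarith

/-- The two-sided Laplace transform. -/
def lap (κ : ℝ → ℂ) (s : ℂ) : ℂ := ∫ v : ℝ, κ v * Complex.exp (-s * v)

/-- The superposition of the translates of `κ` by `log n` with weights `c n`. -/
def logSum (c : ℕ → ℂ) (κ : ℝ → ℂ) (u : ℝ) : ℂ :=
  ∑' n : ℕ, c n * κ (u - log n)

theorem logSum_eq_sum {c : ℕ → ℂ} {κ : ℝ → ℂ} (h0 : ∀ v, v < -1 → κ v = 0) {u : ℝ} {N : ℕ}
    (hN : exp (u + 1) < N) :
    logSum c κ u = ∑ n ∈ Finset.range N, c n * κ (u - log n) := by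
  refine tsum_eq_sum fun n hn => ?_
  have hn' : (N : ℝ) ≤ n := by exact_mod_cast not_lt.1 (fun h => hn (Finset.mem_range.2 h))
  have hlt : u + 1 < log n := by
    rw [Real.lt_log_iff_exp_lt ((exp_pos _).trans (hN.trans_le hn'))]
    exact hN.trans_le hn'
  rw [h0 _ (by linarith), mul_zero]

theorem continuous_logSum {c : ℕ → ℂ} {κ : ℝ → ℂ} (hκ : Continuous κ)
    (h0 : ∀ v, v < -1 → κ v = 0) : Continuous (logSum c κ) := by
  rw [continuous_iff_continuousAt]
  intro u
  obtain ⟨N, hN⟩ := exists_nat_gt (exp (u + 2))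
  have hc : ContinuousAt (fun v => ∑ n ∈ Finset.range N, c n * κ (v - log n)) u := by
    refine Continuous.continuousAt (continuous_finsetSum _ fun n _ => ?_)
    fun_prop
  refine hc.congr ?_
  filter_upwards [Iio_mem_nhds (show u < u + 1 by linarith)] with v hv
  refine (logSum_eq_sum h0 (lt_of_le_of_lt ?_ hN)).symm
  have : v < u + 1 := hv
  exact Real.exp_le_exp.2 (by linarith)

theorem norm_exp_neg_mul (s : ℂ) (v : ℝ) : ‖Complex.exp (-s * v)‖ = exp (-s.re * v) := by
  rw [Complex.norm_exp]
  simp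

theorem lap_logSum {c : ℕ → ℂ} {κ : ℝ → ℂ} (hc0 : c 0 = 0) (hκ : Continuous κ)
    (h0 : ∀ v, v < -1 → κ v = 0) {s : ℂ} (hc : LSeriesSummable c s)
    (hκi : Integrable fun v : ℝ => κ v * Complex.exp (-s * v)) :
    (Integrable fun u : ℝ => logSum c κ u * Complex.exp (-s * u)) ∧
      lap (logSum c κ) s = LSeries c s * lap κ s := by
  set F : ℕ → ℝ → ℂ := fun n u => LSeries.term c s n *
    (κ (u - log n) * Complex.exp (-s * (u - log n : ℝ))) with hF
  have hFi : ∀ n, Integrable (F n) := fun n => (hκi.comp_sub_right (log n)).const_mul _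
  have hFn : ∀ n, ∫ u, ‖F n u‖ = ‖LSeries.term c s n‖ *
      ∫ v : ℝ, ‖κ v * Complex.exp (-s * v)‖ := by
    intro n
    simp only [hF, norm_mul (LSeries.term c s n)]
    rw [integral_const_mul]
    congr 1
    exact integral_sub_right_eq_self (fun v : ℝ => ‖κ v * Complex.exp (-s * v)‖) _
  have hFsum : Summable fun n => ∫ u, ‖F n u‖ := by
    simp only [hFn]
    exact hc.norm.mul_right _
  have hpt : ∀ n u, F n u = c n * κ (u - log n) * Complex.exp (-s * u) := by
    intro n u
    rcases eq_or_ne n 0 with rfl | hn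
    · simp [hF, hc0]
    · have hn0 : (n : ℂ) ≠ 0 := by exact_mod_cast hn
      simp only [hF, LSeries.term_of_ne_zero hn]
      have : Complex.exp (-s * (u - log n : ℝ)) = Complex.exp (-s * u) * (n : ℂ) ^ s := by
        rw [Complex.cpow_def_of_ne_zero hn0, ← Complex.exp_add, ← Complex.natCast_log]
        congr 1
        push_cast
        ring
      rw [this]
      have : (n : ℂ) ^ s ≠ 0 := by simp [Complex.cpow_eq_zero_iff, hn0]
      field_simp
  have htsum : ∀ u, ∑' n, F n u = logSum c κ u * Complex.exp (-s * u) := by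
    intro u
    simp only [hpt, logSum]
    exact tsum_mul_right
  refine ⟨?_, ?_⟩
  · refine ⟨((continuous_logSum hκ h0).mul (by fun_prop)).aestronglyMeasurable, ?_⟩
    have h1 : ∀ n, ∫⁻ u, ‖F n u‖ₑ = ENNReal.ofReal (∫ u, ‖F n u‖) := fun n =>
      (ofReal_integral_norm_eq_lintegral_enorm (hFi n)).symm
    rw [hasFiniteIntegral_iff_enorm]
    calc ∫⁻ u, ‖logSum c κ u * Complex.exp (-s * u)‖ₑ ≤ ∫⁻ u, ∑' n, ‖F n u‖ₑ := by
          refine lintegral_mono fun u => ?_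
          simp only
          rw [← htsum u]
          exact enorm_tsum_le_tsum_enorm
      _ = ∑' n, ∫⁻ u, ‖F n u‖ₑ :=
          lintegral_tsum fun n => (hFi n).aestronglyMeasurable.enorm
      _ < ⊤ := by
          simp only [h1]
          rw [← ENNReal.ofReal_tsum_of_nonneg (fun n => integral_nonneg fun _ => norm_nonneg _) hFsum]
          exact ENNReal.ofReal_lt_top
  · have h1 := integral_tsum_of_summable_integral_norm hFi hFsum
    simp only [htsum] at h1
    rw [lap, ← h1, LSeries, ← tsum_mul_right]
    refine tsum_congr fun n => ?_
    simp only [hF]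
    rw [integral_const_mul]
    congr 1
    exact integral_sub_right_eq_self (fun v : ℝ => κ v * Complex.exp (-s * v)) _

theorem fourier_eq_lap (k : ℝ → ℂ) (δ w : ℝ) :
    𝓕 (fun u : ℝ => k u * Complex.exp (-(δ : ℂ) * u)) w =
      lap k (δ + (2 * π * w : ℝ) * I) := by
  rw [Real.fourier_eq', lap]
  refine integral_congr_ae (ae_of_all _ fun u => ?_)
  simp only [smul_eq_mul]
  rw [mul_comm, mul_assoc, ← Complex.exp_add]
  congr 2
  simp only [RCLike.inner_apply, conj_trivial]
  push_cast
  ring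

/-- Inversion of the Laplace transform on the boundary of its domain of convergence. -/
theorem eq_fourierInv_of_lap {k : ℝ → ℂ} (hk : Continuous k) {K₀ : ℝ → ℂ} {Dom : ℝ → ℝ}
    (hi : ∀ δ : ℝ, 0 < δ → δ ≤ 1 / 2 → Integrable fun u : ℝ => k u * Complex.exp (-(δ : ℂ) * u))
    (hm : ∀ δ : ℝ, 0 < δ → δ ≤ 1 / 2 → AEStronglyMeasurable
      fun w : ℝ => lap k (δ + (2 * π * w : ℝ) * I))
    (hDom : Integrable Dom)
    (hle : ∀ δ : ℝ, 0 < δ → δ ≤ 1 / 2 → ∀ w : ℝ,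
      ‖lap k (δ + (2 * π * w : ℝ) * I)‖ ≤ Dom w)
    (hlim : ∀ᵐ w : ℝ, Tendsto (fun δ : ℝ => lap k (δ + (2 * π * w : ℝ) * I))
      (𝓝[>] 0) (𝓝 (K₀ w))) (u : ℝ) :
    k u = 𝓕⁻ K₀ u := by
  have hev : ∀ᶠ δ : ℝ in 𝓝[>] 0, 0 < δ ∧ δ ≤ 1 / 2 := by
    filter_upwards [Ioc_mem_nhdsGT (show (0 : ℝ) < 1 / 2 by norm_num)] with δ hδ
    exact ⟨hδ.1, hδ.2⟩
  have h1 : Tendsto (fun δ : ℝ => 𝓕⁻ (fun w : ℝ =>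
      lap k (δ + (2 * π * w : ℝ) * I)) u) (𝓝[>] 0) (𝓝 (𝓕⁻ K₀ u)) := by
    simp only [Real.fourierInv_eq']
    refine tendsto_integral_filter_of_dominated_convergence Dom ?_ ?_ hDom ?_
    · filter_upwards [hev] with δ hδ
      have hc1 : Continuous fun w : ℝ => Complex.exp (((2 * π * inner ℝ w u : ℝ) : ℂ)
          * I) := by
        simp only [RCLike.inner_apply, conj_trivial]
        fun_prop
      exact hc1.aestronglyMeasurable.smul (hm δ hδ.1 hδ.2)
    · filter_upwards [hev] with δ hδ
      refine ae_of_all _ fun w => ?_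
      rw [norm_smul, Complex.norm_exp_ofReal_mul_I, one_mul]
      exact hle δ hδ.1 hδ.2 w
    · filter_upwards [hlim] with w hw
      exact hw.const_smul _
  have h2 : Tendsto (fun δ : ℝ => k u * Complex.exp (-(δ : ℂ) * u)) (𝓝[>] 0) (𝓝 (k u)) := by
    have : ContinuousAt (fun δ : ℝ => k u * Complex.exp (-(δ : ℂ) * u)) 0 := by fun_prop
    have h3 := this.tendsto.mono_left (nhdsWithin_le_nhds (s := Ioi 0))
    simpa using h3
  refine tendsto_nhds_unique h2 (h1.congr' ?_)
  filter_upwards [hev] with δ hδ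
  have h3 : (fun w : ℝ => lap k (δ + (2 * π * w : ℝ) * I)) =
      𝓕 (fun u : ℝ => k u * Complex.exp (-(δ : ℂ) * u)) := by
    funext w
    exact (fourier_eq_lap k δ w).symm
  rw [h3]
  have hc : Continuous fun u : ℝ => k u * Complex.exp (-(δ : ℂ) * u) := by fun_prop
  refine congrFun (hc.fourierInv_fourier_eq (hi δ hδ.1 hδ.2) ?_) u
  rw [← h3]
  exact hDom.mono' (hm δ hδ.1 hδ.2) (ae_of_all _ (hle δ hδ.1 hδ.2))

/-! ### Laplace transforms of powers -/

theorem integrableOn_pow_mul_cexp (k : ℕ) {s : ℂ} (hs : 0 < s.re) :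
    IntegrableOn (fun v : ℝ => (v : ℂ) ^ k * Complex.exp (-s * v)) (Ioi 0) := by
  have h1 := integrableOn_rpow_mul_exp_neg_mul_rpow (p := 1) (s := k) (b := s.re)
    (by have : (0 : ℝ) ≤ k := Nat.cast_nonneg k
        linarith) one_pos hs
  refine h1.mono' (Continuous.aestronglyMeasurable (by fun_prop)) ?_
  filter_upwards [ae_restrict_mem measurableSet_Ioi] with v hv
  have hv0 : 0 < v := hv
  rw [norm_mul, norm_pow, norm_real, norm_of_nonneg hv0.le, norm_exp_neg_mul,
    Real.rpow_one, rpow_natCast]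

theorem integral_pow_mul_cexp (k : ℕ) {s : ℂ} (hs : 0 < s.re) :
    ∫ v : ℝ in Ioi 0, (v : ℂ) ^ k * Complex.exp (-s * v) = k.factorial / s ^ (k + 1) := by
  have hs0 : s ≠ 0 := by rintro rfl; simp at hs
  induction k with
  | zero =>
    have := integral_exp_mul_complex_Ioi (a := -s) (by simpa using hs) 0
    simp only [pow_zero, one_mul]
    rw [this]
    simp
  | succ k ih =>
    have hd : ∀ v ∈ Ioi (0 : ℝ), HasDerivAt (fun v : ℝ => (v : ℂ) ^ (k + 1) * Complex.exp (-s * v))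
        ((k + 1) * ((v : ℂ) ^ k * Complex.exp (-s * v)) -
          s * ((v : ℂ) ^ (k + 1) * Complex.exp (-s * v))) v := by
      intro v _
      have h1 : HasDerivAt (fun z : ℂ => z ^ (k + 1) * Complex.exp (-s * z))
          ((k + 1 : ℕ) * (v : ℂ) ^ k * 1 * Complex.exp (-s * v) + (v : ℂ) ^ (k + 1) *
            (Complex.exp (-s * v) * (-s * 1))) (v : ℂ) :=
        ((hasDerivAt_id (v : ℂ)).pow (k + 1)).mul
          (((hasDerivAt_id (v : ℂ)).const_mul (-s)).cexp)
      refine h1.comp_ofReal.congr_deriv ?_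
      push_cast
      ring
    have hi := ((integrableOn_pow_mul_cexp k hs).const_mul ((k : ℂ) + 1)).sub
      ((integrableOn_pow_mul_cexp (k + 1) hs).const_mul s)
    have hlim : Tendsto (fun v : ℝ => (v : ℂ) ^ (k + 1) * Complex.exp (-s * v)) atTop (𝓝 0) := by
      rw [tendsto_zero_iff_norm_tendsto_zero]
      have h1 := tendsto_rpow_mul_exp_neg_mul_atTop_nhds_zero (k + 1 : ℕ) s.re hs
      refine h1.congr' ?_
      filter_upwards [eventually_gt_atTop 0] with v hv
      rw [norm_mul, norm_pow, norm_real, norm_of_nonneg hv.le, norm_exp_neg_mul,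
        rpow_natCast]
    have := integral_Ioi_of_hasDerivAt_of_tendsto
      (Continuous.continuousWithinAt (by fun_prop)) hd hi hlim
    rw [integral_sub ((integrableOn_pow_mul_cexp k hs).const_mul _)
      ((integrableOn_pow_mul_cexp (k + 1) hs).const_mul s), integral_const_mul, integral_const_mul,
      ih] at this
    simp only [Complex.ofReal_zero, ne_eq, Nat.add_eq_zero_iff, one_ne_zero, and_false,
      not_false_eq_true, zero_pow, zero_mul, sub_zero] at this
    have h2 : s * ∫ v : ℝ in Ioi 0, (v : ℂ) ^ (k + 1) * Complex.exp (-s * v) =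
        (k + 1) * (k.factorial / s ^ (k + 1)) := by linear_combination -this
    rw [Nat.factorial_succ, pow_succ s (k + 1)]
    push_cast
    field_simp
    field_simp at h2
    linear_combination h2

theorem integrable_indicator_mul_cexp {m : ℝ → ℂ} {s : ℂ}
    (hm : IntegrableOn (fun v : ℝ => m v * Complex.exp (-s * v)) (Ioi 0)) :
    Integrable fun v : ℝ => (Ioi (0 : ℝ)).indicator m v * Complex.exp (-s * v) := by
  have : (fun v : ℝ => (Ioi (0 : ℝ)).indicator m v * Complex.exp (-s * v)) =
      (Ioi (0 : ℝ)).indicator fun v : ℝ => m v * Complex.exp (-s * v) := by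
    funext v
    by_cases hv : v ∈ Ioi (0 : ℝ) <;> simp [hv]
  rw [this, integrable_indicator_iff measurableSet_Ioi]
  exact hm

theorem lap_indicator (m : ℝ → ℂ) (s : ℂ) :
    lap ((Ioi (0 : ℝ)).indicator m) s = ∫ v : ℝ in Ioi 0, m v * Complex.exp (-s * v) := by
  rw [lap, ← integral_indicator measurableSet_Ioi]
  refine integral_congr_ae (ae_of_all _ fun v => ?_)
  by_cases hv : v ∈ Ioi (0 : ℝ) <;> simp [hv]

/-! ### Rapidly decreasing holomorphic functions near the imaginary axis -/

/-- A zero-free type region around the imaginary axis. -/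
def axisRegion (c : ℝ) : Set ℂ := {s | |s.re| < c / log (|s.im| + 4)}

theorem isOpen_axisRegion (c : ℝ) : IsOpen (axisRegion c) := by
  refine isOpen_lt (by fun_prop) (continuous_const.div ?_ ?_)
  · exact Continuous.log (by fun_prop) fun s => by positivity
  · intro s
    exact (log_pos (by linarith [abs_nonneg s.im])).ne'

theorem one_le_log_add_four (t : ℝ) : 1 ≤ log (|t| + 4) := by
  rw [Real.le_log_iff_exp_le (by positivity)]
  linarith [Real.exp_one_lt_d9, abs_nonneg t]

theorem axis_mem {c : ℝ} (hc : 0 < c) (t : ℝ) : (t : ℂ) * I ∈ axisRegion c := by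
  have := one_le_log_add_four t
  simp only [axisRegion, Set.mem_ofPred_eq, re_ofReal_mul, Complex.I_re, mul_zero, abs_zero,
    im_ofReal_mul, Complex.I_im, mul_one]
  positivity

/-- `F` is holomorphic near the imaginary axis and decreases rapidly there. -/
structure RapidDecay (F : ℂ → ℂ) (c : ℝ) : Prop where
  pos : 0 < c
  le_one : c ≤ 1
  diff : DifferentiableOn ℂ F (axisRegion c)
  bound : ∀ j : ℕ, ∃ C : ℝ, ∀ s ∈ axisRegion c, ‖F s‖ ≤ C / (1 + |s.im|) ^ j

theorem RapidDecay.deriv {F : ℂ → ℂ} {c : ℝ} (hF : RapidDecay F c) :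
    RapidDecay (deriv F) (c / 4) := by
  have hc := hF.pos
  have hc1 := hF.le_one
  have hsub : axisRegion (c / 4) ⊆ axisRegion c := by
    intro s hs
    refine lt_trans (show |s.re| < _ from hs) ?_
    have := one_le_log_add_four s.im
    gcongr
    linarith
  refine ⟨by positivity, by linarith, (hF.diff.deriv (isOpen_axisRegion c)).mono hsub,
    fun j => ?_⟩
  obtain ⟨C, hC⟩ := hF.bound (j + 1)
  refine ⟨|C| * 2 ^ (j + 1) * 32 / c, fun s hs => ?_⟩
  have ha := abs_nonneg s.im
  set ℓ := log (|s.im| + 4) with hℓ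
  have hℓ1 : 1 ≤ ℓ := one_le_log_add_four s.im
  have hℓ2 : ℓ ≤ 4 * (1 + |s.im|) := by
    have := Real.log_le_sub_one_of_pos (show 0 < |s.im| + 4 by linarith)
    linarith
  have hs' : |s.re| < c / 4 / ℓ := hs
  set r := c / (8 * ℓ) with hr
  have hr0 : 0 < r := by positivity
  have hr1 : r ≤ 1 / 8 := by
    rw [hr, div_le_div_iff₀ (by positivity) (by norm_num)]
    nlinarith
  have hball : ∀ z ∈ Metric.closedBall s r, z ∈ axisRegion c ∧ (1 + |s.im|) / 2 ≤ 1 + |z.im| := by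
    intro z hz
    have hz' : ‖z - s‖ ≤ r := by simpa [dist_eq_norm] using hz
    have e1 := (abs_re_le_norm (z - s)).trans hz'
    have e2 := (abs_im_le_norm (z - s)).trans hz'
    simp only [sub_re, sub_im] at e1 e2
    have e3 := abs_sub_abs_le_abs_sub z.im s.im
    have e4 := abs_sub_abs_le_abs_sub s.im z.im
    have e5 := abs_sub_abs_le_abs_sub z.re s.re
    rw [abs_sub_comm] at e4
    refine ⟨?_, by linarith⟩
    have e6 : log (|z.im| + 4) ≤ 2 * ℓ := by
      have e : 2 * ℓ = log ((|s.im| + 4) ^ 2) := by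
        rw [hℓ, Real.log_pow]
        norm_num
      rw [e]
      refine log_le_log (by positivity) ?_
      nlinarith
    have e7 := one_le_log_add_four z.im
    have e8 : c / (2 * ℓ) ≤ c / log (|z.im| + 4) := by gcongr
    have e9 : c / 4 / ℓ + r < c / (2 * ℓ) := by
      rw [hr]
      have : c / 4 / ℓ + c / (8 * ℓ) = 3 / 8 * (c / ℓ) := by field_simp; ring
      have h2 : c / (2 * ℓ) = 1 / 2 * (c / ℓ) := by field_simp
      rw [this, h2]
      have : 0 < c / ℓ := by positivity
      linarith
    change |z.re| < _
    linarith
  have hd : DiffContOnCl ℂ F (Metric.ball s r) := by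
    refine DifferentiableOn.diffContOnCl fun z hz => ?_
    rw [closure_ball _ hr0.ne'] at hz
    exact (hF.diff.differentiableAt
      ((isOpen_axisRegion c).mem_nhds (hball z hz).1)).differentiableWithinAt
  have := Complex.norm_deriv_le_of_forall_mem_sphere_norm_le (c := s) (R := r)
    (C := |C| / ((1 + |s.im|) / 2) ^ (j + 1)) hr0 hd ?_
  · refine this.trans (le_of_eq_of_le (b := |C| * 2 ^ (j + 1) * 8 / c / (1 + |s.im|) ^ (j + 1) * ℓ)
      ?_ ?_)
    · rw [hr, div_pow]
      field_simp
    · calc |C| * 2 ^ (j + 1) * 8 / c / (1 + |s.im|) ^ (j + 1) * ℓ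
          ≤ |C| * 2 ^ (j + 1) * 8 / c / (1 + |s.im|) ^ (j + 1) * (4 * (1 + |s.im|)) := by gcongr
        _ = _ := by
          rw [pow_succ (1 + |s.im|)]
          field_simp
          ring
  · intro z hz
    obtain ⟨h1, h2⟩ := hball z (Metric.sphere_subset_closedBall hz)
    refine (hC z h1).trans ?_
    have := le_abs_self C
    gcongr

theorem RapidDecay.continuous_axis {F : ℂ → ℂ} {c : ℝ} (hF : RapidDecay F c) :
    Continuous fun w : ℝ => F ((2 * π * w : ℝ) * I) := by
  rw [continuous_iff_continuousAt]
  intro w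
  have h1 := (hF.diff.differentiableAt
    ((isOpen_axisRegion c).mem_nhds (axis_mem hF.pos (2 * π * w)))).continuousAt
  exact h1.comp (f := fun w : ℝ => ((2 * π * w : ℝ) : ℂ) * I)
    (Continuous.continuousAt (by fun_prop))

theorem integrable_div_one_add_sq (C : ℝ) :
    Integrable fun w : ℝ => C / (1 + |2 * π * w|) ^ 2 := by
  have h1 : Integrable fun w : ℝ => (1 + ‖w‖) ^ (-2 : ℝ) :=
    integrable_one_add_norm (by simp)
  have h2 : ∀ w : ℝ, (1 + ‖w‖) ^ (-2 : ℝ) = ((1 + |w|) ^ 2)⁻¹ := by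
    intro w
    rw [Real.rpow_neg (by positivity), norm_eq_abs]
    norm_cast
  simp only [h2] at h1
  refine (h1.const_mul |C|).mono' (Measurable.aestronglyMeasurable (by fun_prop))
    (ae_of_all _ fun w => ?_)
  rw [norm_div, norm_pow, norm_eq_abs, norm_eq_abs,
    abs_of_pos (by positivity : 0 < 1 + |2 * π * w|), div_eq_mul_inv]
  have : |w| ≤ |2 * π * w| := by
    rw [abs_mul, abs_of_pos (by positivity : 0 < 2 * π)]
    nlinarith [abs_nonneg w, Real.pi_gt_three]
  exact mul_le_mul_of_nonneg_left (by gcongr) (abs_nonneg C)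

theorem RapidDecay.integrable_axis {F : ℂ → ℂ} {c : ℝ} (hF : RapidDecay F c) :
    Integrable fun w : ℝ => F ((2 * π * w : ℝ) * I) := by
  obtain ⟨C, hC⟩ := hF.bound 2
  refine (integrable_div_one_add_sq C).mono' hF.continuous_axis.aestronglyMeasurable
    (ae_of_all _ fun w => ?_)
  have := hC _ (axis_mem hF.pos (2 * π * w))
  rwa [im_ofReal_mul, Complex.I_im, mul_one] at this

theorem norm_fourierInv_le (f : ℝ → ℂ) (u : ℝ) : ‖𝓕⁻ f u‖ ≤ ∫ w, ‖f w‖ := by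
  rw [Real.fourierInv_eq']
  refine (norm_integral_le_integral_norm _).trans (le_of_eq ?_)
  refine integral_congr_ae (ae_of_all _ fun w => ?_)
  simp only
  rw [norm_smul, Complex.norm_exp_ofReal_mul_I, one_mul]

theorem RapidDecay.mul_fourierInv {F : ℂ → ℂ} {c : ℝ} (hF : RapidDecay F c) (u : ℝ) :
    (u : ℂ) * 𝓕⁻ (fun w : ℝ => F ((2 * π * w : ℝ) * I)) u =
      -𝓕⁻ (fun w : ℝ => _root_.deriv F ((2 * π * w : ℝ) * I)) u := by
  have hpi : (2 * π * I : ℂ) ≠ 0 := by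
    simp [Real.pi_ne_zero]
  have hd : ∀ w : ℝ, HasDerivAt (fun w : ℝ => F ((2 * π * w : ℝ) * I))
      (_root_.deriv F ((2 * π * w : ℝ) * I) * (2 * π * I)) w := by
    intro w
    have h1 := (hF.diff.differentiableAt
      ((isOpen_axisRegion c).mem_nhds (axis_mem hF.pos (2 * π * w)))).hasDerivAt
    have h2 : HasDerivAt (fun z : ℂ => 2 * π * I * z)
        (2 * π * I * 1) (w : ℂ) := (hasDerivAt_id (w : ℂ)).const_mul _
    have e : ((2 * π * w : ℝ) * I : ℂ) = 2 * π * I * (w : ℂ) := by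
      push_cast; ring
    rw [e] at h1 ⊢
    have h3 := (HasDerivAt.comp (w : ℂ) h1 h2).comp_ofReal
    rw [mul_one] at h3
    refine h3.congr_of_eventuallyEq (Eventually.of_forall fun v => ?_)
    simp only [Function.comp_apply]
    congr 1
    push_cast; ring
  have he : ∀ w : ℝ, HasDerivAt (fun w : ℝ => Complex.exp (2 * π * u * I * w))
      (Complex.exp (2 * π * u * I * w) * (2 * π * u * I)) w := by
    intro w
    have h2 : HasDerivAt (fun z : ℂ => 2 * π * u * I * z)
        (2 * π * u * I * 1) (w : ℂ) := (hasDerivAt_id (w : ℂ)).const_mul _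
    have h3 := h2.cexp.comp_ofReal
    rwa [mul_one] at h3
  have hn : ∀ w : ℝ, ‖Complex.exp (2 * π * u * I * w)‖ = 1 := by
    intro w
    have : (2 * π * u * I * w : ℂ) = ((2 * π * u * w : ℝ) : ℂ) * I := by
      push_cast; ring
    rw [this, Complex.norm_exp_ofReal_mul_I]
  have hec : Continuous fun w : ℝ => Complex.exp (2 * π * u * I * w) := by fun_prop
  have hbd : ∀ f : ℝ → ℂ, Integrable f →
      Integrable fun w : ℝ => f w * Complex.exp (2 * π * u * I * w) := by
    intro f hf
    refine hf.mul_bdd (c := 1) hec.aestronglyMeasurable (ae_of_all _ fun w => (hn w).le)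
  have hi := hF.integrable_axis
  have hi' := hF.deriv.integrable_axis
  have key := integral_mul_deriv_eq_deriv_mul_of_integrable (fun w _ => hd w) (fun w _ => he w)
    (by
      have := (hbd _ hi).mul_const (2 * π * u * I)
      refine this.congr (ae_of_all _ fun w => ?_)
      simp only [Pi.mul_apply]
      ring)
    (by exact hbd _ (hi'.mul_const _)) (by exact hbd _ hi)
  rw [Real.fourierInv_eq', Real.fourierInv_eq']
  have hexp : ∀ w : ℝ, Complex.exp ((2 * π * inner ℝ w u : ℝ) * I) =
      Complex.exp (2 * π * u * I * w) := by
    intro w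
    congr 1
    simp only [RCLike.inner_apply, conj_trivial]
    push_cast; ring
  simp only [hexp, smul_eq_mul]
  have k1 : ∫ w : ℝ, F ((2 * π * w : ℝ) * I) *
      (Complex.exp (2 * π * u * I * w) * (2 * π * u * I)) =
      (2 * π * I) * (u * ∫ w : ℝ, Complex.exp (2 * π * u * I * w) *
        F ((2 * π * w : ℝ) * I)) := by
    rw [← integral_const_mul, ← integral_const_mul]
    refine integral_congr_ae (ae_of_all _ fun w => ?_)
    simp only
    ring
  have k2 : ∫ w : ℝ, _root_.deriv F ((2 * π * w : ℝ) * I) *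
      (2 * π * I) * Complex.exp (2 * π * u * I * w) =
      (2 * π * I) * ∫ w : ℝ, Complex.exp (2 * π * u * I * w) *
        _root_.deriv F ((2 * π * w : ℝ) * I) := by
    rw [← integral_const_mul]
    refine integral_congr_ae (ae_of_all _ fun w => ?_)
    simp only
    ring
  rw [k1, k2, ← mul_neg] at key
  exact mul_left_cancel₀ hpi key

theorem RapidDecay.exists_fourierInv_le (B : ℕ) : ∀ {F : ℂ → ℂ} {c : ℝ}, RapidDecay F c →
    ∃ C : ℝ, ∀ u : ℝ,
      |u| ^ B * ‖𝓕⁻ (fun w : ℝ => F ((2 * π * w : ℝ) * I)) u‖ ≤ C := by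
  induction B with
  | zero =>
    intro F c _
    exact ⟨_, fun u => by rw [pow_zero, one_mul]; exact norm_fourierInv_le _ u⟩
  | succ B ih =>
    intro F c hF
    obtain ⟨C, hC⟩ := ih hF.deriv
    refine ⟨C, fun u => ?_⟩
    have h1 := congrArg norm (hF.mul_fourierInv u)
    rw [norm_mul, norm_neg, norm_real, norm_eq_abs] at h1
    rw [pow_succ, mul_assoc, h1]
    exact hC u

/-! ### Laplace transforms of smooth compactly supported functions -/

theorem differentiable_lap {κ : ℝ → ℂ} (hκ : Continuous κ) (hs : HasCompactSupport κ) :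
    Differentiable ℂ (lap κ) := by
  intro s
  have hcs : ∀ g : ℝ → ℝ, HasCompactSupport fun v : ℝ => ‖κ v‖ * g v := fun g =>
    HasCompactSupport.mul_right (f := fun v : ℝ => ‖κ v‖) hs.norm
  have := hasDerivAt_integral_of_dominated_loc_of_deriv_le (μ := volume) (x₀ := s)
    (F := fun (s : ℂ) (v : ℝ) => κ v * Complex.exp (-s * v))
    (F' := fun (s : ℂ) (v : ℝ) => κ v * (Complex.exp (-s * v) * (-v)))
    (bound := fun v => ‖κ v‖ * (exp ((|s.re| + 1) * |v|) * |v|))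
    (Metric.ball_mem_nhds s one_pos)
    (Eventually.of_forall fun x => Continuous.aestronglyMeasurable (by fun_prop))
    (Continuous.integrable_of_hasCompactSupport (by fun_prop) hs.mul_right)
    (Continuous.aestronglyMeasurable (by fun_prop))
    (ae_of_all _ fun v z hz => ?_)
    (Continuous.integrable_of_hasCompactSupport (by fun_prop) (hcs _))
    (ae_of_all _ fun v z _ => ?_)
  · exact this.2.differentiableAt
  · rw [norm_mul, norm_mul, norm_exp_neg_mul, norm_neg, norm_real, norm_eq_abs]
    have h1 : |z.re - s.re| ≤ 1 := by
      have := (abs_re_le_norm (z - s)).trans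
        (le_of_lt (by simpa [dist_eq_norm] using hz))
      simpa using this
    have h2 : |z.re| ≤ |s.re| + 1 := by linarith [abs_sub_abs_le_abs_sub z.re s.re]
    have h3 : -z.re * v ≤ (|s.re| + 1) * |v| := by
      calc -z.re * v ≤ |-z.re * v| := le_abs_self _
        _ = |z.re| * |v| := by rw [abs_mul, abs_neg]
        _ ≤ _ := by gcongr
    gcongr
  · have h1 : HasDerivAt (fun z : ℂ => Complex.exp (-z * v)) (Complex.exp (-z * v) * (-1 * v)) z :=
      ((hasDerivAt_id z).neg.mul_const (v : ℂ)).cexp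
    rw [neg_one_mul] at h1
    exact h1.const_mul _

theorem mul_lap_eq {κ : ℝ → ℂ} (hκ : ContDiff ℝ ∞ κ) (hs : HasCompactSupport κ) (s : ℂ) :
    s * lap κ s = lap (deriv κ) s := by
  have hd : Differentiable ℝ κ := hκ.differentiable (by simp)
  have hc : Continuous (deriv κ) := hκ.continuous_deriv (by simp)
  have hκc := hκ.continuous
  have he : ∀ v : ℝ, HasDerivAt (fun v : ℝ => Complex.exp (-s * v))
      (Complex.exp (-s * v) * (-s)) v := by
    intro v
    have h1 : HasDerivAt (fun z : ℂ => Complex.exp (-s * z)) (Complex.exp (-s * v) * (-s * 1)) v :=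
      ((hasDerivAt_id (v : ℂ)).const_mul (-s)).cexp
    rw [mul_one] at h1
    exact h1.comp_ofReal
  have key := integral_mul_deriv_eq_deriv_mul_of_integrable
    (fun v _ => (hd v).hasDerivAt) (fun v _ => he v)
    (Continuous.integrable_of_hasCompactSupport (by fun_prop) hs.mul_right)
    (Continuous.integrable_of_hasCompactSupport (by fun_prop) hs.deriv.mul_right)
    (Continuous.integrable_of_hasCompactSupport (by fun_prop) hs.mul_right)
  have e : ∫ v : ℝ, κ v * (Complex.exp (-s * v) * (-s)) = -s * lap κ s := by
    rw [lap, ← integral_const_mul]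
    congr 1
    funext v
    ring
  rw [e] at key
  rw [show lap (deriv κ) s = ∫ v : ℝ, deriv κ v * Complex.exp (-s * v) from rfl]
  linear_combination -key

theorem exists_norm_lap_le (j : ℕ) : ∀ {κ : ℝ → ℂ}, ContDiff ℝ ∞ κ → HasCompactSupport κ →
    ∃ C : ℝ, 0 ≤ C ∧ ∀ s : ℂ, |s.re| ≤ 1 → ‖lap κ s‖ ≤ C / (1 + |s.im|) ^ j := by
  induction j with
  | zero =>
    intro κ hκ hs
    have hκc := hκ.continuous
    have hi : Integrable fun v : ℝ => ‖κ v‖ * exp |v| :=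
      Continuous.integrable_of_hasCompactSupport (by fun_prop)
        (HasCompactSupport.mul_right (f := fun v : ℝ => ‖κ v‖) hs.norm)
    refine ⟨∫ v : ℝ, ‖κ v‖ * exp |v|, integral_nonneg fun v => by positivity, fun s hs => ?_⟩
    rw [pow_zero, div_one]
    refine norm_integral_le_of_norm_le hi (ae_of_all _ fun v => ?_)
    rw [norm_mul, norm_exp_neg_mul]
    have h3 : -s.re * v ≤ |v| := by
      calc -s.re * v ≤ |-s.re * v| := le_abs_self _
        _ = |s.re| * |v| := by rw [abs_mul, abs_neg]
        _ ≤ 1 * |v| := by gcongr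
        _ = |v| := one_mul _
    gcongr
  | succ j ih =>
    intro κ hκ hs
    obtain ⟨C₁, h1, H1⟩ := ih hκ hs
    have hd : ContDiff ℝ ∞ (deriv κ) := ContDiff.deriv' (by simpa using hκ)
    obtain ⟨C₂, h2, H2⟩ := ih hd hs.deriv
    refine ⟨C₁ + C₂, by positivity, fun s hre => ?_⟩
    have e1 := H1 s hre
    have e2 := H2 s hre
    rw [← mul_lap_eq hκ hs, norm_mul] at e2
    have e3 : |s.im| * ‖lap κ s‖ ≤ ‖s‖ * ‖lap κ s‖ := by
      gcongr
      exact abs_im_le_norm s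
    have hp : 0 < 1 + |s.im| := by positivity
    rw [pow_succ, ← div_div, le_div_iff₀ hp, add_div]
    linarith

/-! ### The polar part -/

/-- The smoothed polar part attached to the polynomial `a v + b` on the half-line. -/
def polarModel (κ : ℝ → ℂ) (a b : ℂ) : ℝ → ℂ :=
  convolution κ ((Ioi (0 : ℝ)).indicator fun v : ℝ => a * v + b) (ContinuousLinearMap.mul ℝ ℂ)
    volume

theorem lap_polar (a b : ℂ) {s : ℂ} (hs : 0 < s.re) :
    (Integrable fun v : ℝ => (Ioi (0 : ℝ)).indicator (fun v : ℝ => a * v + b) v *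
      Complex.exp (-s * v)) ∧
    ∫ v : ℝ, (Ioi (0 : ℝ)).indicator (fun v : ℝ => a * v + b) v * Complex.exp (-s * v) =
      a / s ^ 2 + b / s := by
  have h0 := integrableOn_pow_mul_cexp 0 hs
  have h1 := integrableOn_pow_mul_cexp 1 hs
  have e : (fun v : ℝ => (a * v + b) * Complex.exp (-s * v)) = fun v : ℝ =>
      a * ((v : ℂ) ^ 1 * Complex.exp (-s * v)) + b * ((v : ℂ) ^ 0 * Complex.exp (-s * v)) := by
    funext v
    ring
  refine ⟨integrable_indicator_mul_cexp (by rw [e]; exact (h1.const_mul a).add (h0.const_mul b)), ?_⟩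
  have := lap_indicator (fun v : ℝ => a * v + b) s
  rw [lap] at this
  rw [this, e, integral_add (h1.const_mul a) (h0.const_mul b), integral_const_mul,
    integral_const_mul, integral_pow_mul_cexp 0 hs, integral_pow_mul_cexp 1 hs]
  simp
  ring

theorem continuous_polarModel {κ : ℝ → ℂ} (hκ : Continuous κ) (hs : HasCompactSupport κ)
    (a b : ℂ) : Continuous (polarModel κ a b) := by
  refine hs.continuous_convolution_left _ hκ ?_
  have : Continuous fun v : ℝ => a * v + b := by fun_prop
  exact this.locallyIntegrable.indicator measurableSet_Ioi

theorem lap_polarModel {κ : ℝ → ℂ} (hκ : Continuous κ) (hcs : HasCompactSupport κ)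
    (a b : ℂ) {s : ℂ} (hs : 0 < s.re) :
    (Integrable fun v : ℝ => polarModel κ a b v * Complex.exp (-s * v)) ∧
      lap (polarModel κ a b) s = lap κ s * (a / s ^ 2 + b / s) := by
  obtain ⟨h1, h2⟩ := lap_polar a b hs
  have h3 : Integrable fun v : ℝ => κ v * Complex.exp (-s * v) :=
    Continuous.integrable_of_hasCompactSupport (by fun_prop) hcs.mul_right
  have e : (fun v : ℝ => polarModel κ a b v * Complex.exp (-s * v)) =
      convolution (fun v : ℝ => κ v * Complex.exp (-s * v)) (fun v : ℝ =>
        (Ioi (0 : ℝ)).indicator (fun v : ℝ => a * v + b) v * Complex.exp (-s * v))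
        (ContinuousLinearMap.mul ℝ ℂ) volume := by
    funext v
    rw [polarModel, convolution_def, convolution_def, ← integral_mul_const]
    refine integral_congr_ae (ae_of_all _ fun t => ?_)
    simp only [ContinuousLinearMap.mul_apply']
    have : Complex.exp (-s * v) = Complex.exp (-s * t) * Complex.exp (-s * (v - t : ℝ)) := by
      rw [← Complex.exp_add]
      congr 1
      push_cast
      ring
    rw [this]
    ring
  refine ⟨by rw [e]; exact h3.integrable_convolution _ h1, ?_⟩
  rw [lap, e, integral_convolution _ h3 h1, ContinuousLinearMap.mul_apply', h2]
  rfl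

theorem polarModel_eq {κ : ℝ → ℂ} (hκ : Continuous κ) (hcs : HasCompactSupport κ)
    (h0 : ∀ v, 0 ≤ v → κ v = 0) (a b : ℂ) {u : ℝ} (hu : 0 ≤ u) :
    polarModel κ a b u = a * (∫ v, κ v) * u + (b * (∫ v, κ v) - a * ∫ v, κ v * v) := by
  have i1 : Integrable κ := hκ.integrable_of_hasCompactSupport hcs
  have i2 : Integrable fun v : ℝ => κ v * v :=
    Continuous.integrable_of_hasCompactSupport (by fun_prop) hcs.mul_right
  have e : polarModel κ a b u = ∫ t, ((a * u + b) * κ t - a * (κ t * t)) := by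
    rw [polarModel, convolution_def]
    refine integral_congr_ae (ae_of_all _ fun t => ?_)
    simp only [ContinuousLinearMap.mul_apply']
    rcases le_or_gt 0 t with ht | ht
    · simp [h0 t ht]
    · rw [indicator_of_mem (show u - t ∈ Ioi (0 : ℝ) from mem_Ioi.2 (by linarith))]
      push_cast
      ring
  rw [e, integral_sub (i1.const_mul _) (i2.const_mul _), integral_const_mul, integral_const_mul]
  ring

/-! ### The remainder of the generating function after removing its polar part -/

/-- `s² H(1 + s)`, as a holomorphic function near `0`. -/
def polarFun (Hstar : ℂ → ℂ) (s : ℂ) : ℂ := riemannZeta₁ (1 + s) ^ 2 * Hstar (1 + s)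

/-- `(P(s) - P(0) - P'(0) s) / s²` for `P` the function `polarFun`. -/
def polarRem (Hstar : ℂ → ℂ) : ℂ → ℂ := dslope (dslope (polarFun Hstar) 0) 0

theorem polarRem_eq (Hstar : ℂ → ℂ) {s : ℂ} (hs : s ≠ 0) :
    polarRem Hstar s = polarFun Hstar s / s ^ 2 -
      (polarFun Hstar 0 / s ^ 2 + deriv (polarFun Hstar) 0 / s) := by
  rw [polarRem, dslope_of_ne _ hs, slope_def_field, dslope_of_ne _ hs, slope_def_field,
    dslope_same]
  field_simp
  ring

theorem polarFun_zero (Hstar : ℂ → ℂ) : polarFun Hstar 0 = Hstar 1 := by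
  simp [polarFun, riemannZeta₁_one]

theorem isOpen_halfPlane (c : ℝ) : IsOpen {s : ℂ | -c < s.re} :=
  isOpen_lt continuous_const Complex.continuous_re

theorem SieveHyp.differentiableOn_polarFun (H : SieveHyp h Hstar L c₀) :
    DifferentiableOn ℂ (polarFun Hstar) {s : ℂ | -c₀ < s.re} := by
  intro s hs
  have hs' : -c₀ < s.re := hs
  have h1 : DifferentiableAt ℂ Hstar (1 + s) := H.differentiableAt (by simp; linarith)
  have h2 : DifferentiableAt ℂ (fun s : ℂ => 1 + s) s := by fun_prop
  have h3 : DifferentiableAt ℂ riemannZeta₁ (1 + s) := differentiable_riemannZeta₁ _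
  exact (((h3.comp s h2).pow 2).mul (h1.comp s h2)).differentiableWithinAt

theorem SieveHyp.differentiableOn_polarRem (H : SieveHyp h Hstar L c₀) :
    DifferentiableOn ℂ (polarRem Hstar) {s : ℂ | -c₀ < s.re} := by
  have hn : {s : ℂ | -c₀ < s.re} ∈ 𝓝 (0 : ℂ) :=
    (isOpen_halfPlane c₀).mem_nhds (by simpa using H.c_pos)
  exact (Complex.differentiableOn_dslope hn).2
    ((Complex.differentiableOn_dslope hn).2 H.differentiableOn_polarFun)

theorem SieveHyp.exists_norm_polarRem_le (H : SieveHyp h Hstar L c₀) :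
    ∃ c C : ℝ, 0 < c ∧ c ≤ 1 / 16 ∧ c < c₀ ∧ 0 < C ∧ ∀ s : ℂ,
      -(c / log (|s.im| + 4)) ≤ s.re → s.re ≤ 1 / 2 →
        ‖polarRem Hstar s‖ ≤ C * (1 + |s.im|) ^ 24 := by
  obtain ⟨c, C₁, hc, hc16, hcc, hC₁, HC₁⟩ := H.exists_norm_Hstar_le
  obtain ⟨C₂, hC₂, HC₂⟩ := exists_norm_riemannZeta₁_le
  have hball : Metric.closedBall (0 : ℂ) (c / 4) ⊆ {s : ℂ | -c₀ < s.re} := by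
    intro s hs
    have h1 : ‖s‖ ≤ c / 4 := by simpa using hs
    have h2 := (abs_le.1 ((abs_re_le_norm s).trans h1)).1
    change -c₀ < s.re
    linarith
  obtain ⟨M, hM⟩ := (isCompact_closedBall (0 : ℂ) (c / 4)).exists_bound_of_continuousOn
    (H.differentiableOn_polarRem.continuousOn.mono hball)
  set p0 := ‖polarFun Hstar 0‖
  set p1 := ‖deriv (polarFun Hstar) 0‖
  refine ⟨c, |M| + (C₂ ^ 2 * C₁ + p0) * (16 / c ^ 2) + p1 * (4 / c) + 1, hc, hc16, hcc,
    by positivity, fun s h1 h2 => ?_⟩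
  have hone : 1 ≤ (1 + |s.im|) ^ 24 := one_le_pow₀ (by linarith [abs_nonneg s.im])
  rcases le_or_gt ‖s‖ (c / 4) with hs | hs
  · have h3 := hM s (by simpa using hs)
    have h4 := le_abs_self M
    calc ‖polarRem Hstar s‖ ≤ |M| * 1 := by linarith
      _ ≤ _ := by
        gcongr
        have : 0 ≤ (C₂ ^ 2 * C₁ + p0) * (16 / c ^ 2) + p1 * (4 / c) := by positivity
        linarith
  · have hs0 : s ≠ 0 := norm_pos_iff.1 (lt_trans (by positivity) hs)
    have hl := one_le_log_add_four s.im
    have hcl : c / log (|s.im| + 4) ≤ 1 / 16 := (div_le_self hc.le hl).trans hc16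
    have e1 := HC₁ (1 + s) (by simp; linarith) (by simp; linarith)
    have e2 := HC₂ (1 + s) (by simp; linarith) (by simp; linarith)
    simp only [add_im, one_im, zero_add] at e1 e2
    have e3 : ‖polarFun Hstar s‖ ≤ C₂ ^ 2 * C₁ * (1 + |s.im|) ^ 24 := by
      rw [polarFun, norm_mul, norm_pow]
      calc _ ≤ (C₂ * (1 + |s.im|) ^ 2) ^ 2 * (C₁ * (1 + |s.im|) ^ 20) := by gcongr
        _ = _ := by ring
    have i1 : 1 / ‖s‖ ≤ 4 / c := by
      rw [div_le_div_iff₀ (by linarith) hc]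
      linarith
    have i2 : 1 / ‖s‖ ^ 2 ≤ 16 / c ^ 2 := by
      have := pow_le_pow_left₀ (by positivity) i1 2
      rw [div_pow, div_pow] at this
      norm_num at this ⊢
      exact this
    rw [polarRem_eq _ hs0]
    calc ‖polarFun Hstar s / s ^ 2 - (polarFun Hstar 0 / s ^ 2 + deriv (polarFun Hstar) 0 / s)‖
        ≤ ‖polarFun Hstar s / s ^ 2‖ + (‖polarFun Hstar 0 / s ^ 2‖ +
          ‖deriv (polarFun Hstar) 0 / s‖) := (norm_sub_le _ _).trans (by
            gcongr
            exact norm_add_le _ _)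
      _ = ‖polarFun Hstar s‖ * (1 / ‖s‖ ^ 2) + (p0 * (1 / ‖s‖ ^ 2) + p1 * (1 / ‖s‖)) := by
        rw [norm_div, norm_div, norm_div, norm_pow]
        ring
      _ ≤ (C₂ ^ 2 * C₁ * (1 + |s.im|) ^ 24) * (16 / c ^ 2) + (p0 * (16 / c ^ 2) * 1 +
          p1 * (4 / c) * 1) := by
        rw [mul_one, mul_one]
        gcongr
      _ ≤ (C₂ ^ 2 * C₁ * (1 + |s.im|) ^ 24) * (16 / c ^ 2) +
          (p0 * (16 / c ^ 2) * (1 + |s.im|) ^ 24 + p1 * (4 / c) * (1 + |s.im|) ^ 24) := by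
        gcongr
      _ = ((C₂ ^ 2 * C₁ + p0) * (16 / c ^ 2) + p1 * (4 / c)) * (1 + |s.im|) ^ 24 := by ring
      _ ≤ _ := by
        refine mul_le_mul_of_nonneg_right ?_ (by positivity)
        linarith [abs_nonneg M]

/-! ### Smoothed sums of the coefficients -/

/-- `∑ Ψ(n / y) μ²(n) h(n)`. -/
def smoothSum (Ψ : ℝ → ℝ) (h : ArithmeticFunction ℝ) (y : ℝ) : ℝ :=
  ∑' n : ℕ, Ψ (n / y) * sqfreeCoeff h n

/-- The kernel `Ψ(e^{-v}) e^{-v}`. -/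
def expKernel (Ψ : ℝ → ℝ) (v : ℝ) : ℂ := (Ψ (exp (-v)) * exp (-v) : ℝ)

structure BumpHyp (Ψ : ℝ → ℝ) : Prop where
  smooth : ContDiff ℝ ∞ Ψ
  nonneg : ∀ x, 0 ≤ Ψ x
  supp : Function.support Ψ ⊆ Set.Icc 1 2
  int : ∫ x, Ψ x = 1

variable {Ψ : ℝ → ℝ}

theorem BumpHyp.eq_zero_of_le_one (HΨ : BumpHyp Ψ) {x : ℝ} (hx : x ≤ 1) : Ψ x = 0 := by
  have h1 : IsClosed {x | Ψ x = 0} := isClosed_eq HΨ.smooth.continuous continuous_const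
  have h2 : Iio (1 : ℝ) ⊆ {x | Ψ x = 0} := fun x hx => by
    by_contra hne
    exact absurd (HΨ.supp hne).1 (not_le.2 hx)
  have h3 := closure_minimal h2 h1
  rw [closure_Iio] at h3
  exact h3 hx

theorem BumpHyp.eq_zero_of_two_lt (HΨ : BumpHyp Ψ) {x : ℝ} (hx : 2 < x) : Ψ x = 0 := by
  by_contra hne
  exact absurd (HΨ.supp hne).2 (not_le.2 hx)

theorem BumpHyp.contDiff_expKernel (HΨ : BumpHyp Ψ) : ContDiff ℝ ∞ (expKernel Ψ) := by
  have h1 : ContDiff ℝ ∞ fun v : ℝ => exp (-v) := by fun_prop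
  exact Complex.ofRealCLM.contDiff.comp ((HΨ.smooth.comp h1).mul h1)

theorem BumpHyp.expKernel_of_nonneg (HΨ : BumpHyp Ψ) {v : ℝ} (hv : 0 ≤ v) :
    expKernel Ψ v = 0 := by
  rw [expKernel, HΨ.eq_zero_of_le_one (Real.exp_le_one_iff.2 (by linarith))]
  simp

theorem BumpHyp.expKernel_of_lt (HΨ : BumpHyp Ψ) {v : ℝ} (hv : v < -1) :
    expKernel Ψ v = 0 := by
  have : 2 < exp (-v) := by
    have := Real.add_one_lt_exp (show -v ≠ 0 by linarith)
    linarith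
  rw [expKernel, HΨ.eq_zero_of_two_lt this]
  simp

theorem BumpHyp.hasCompactSupport_expKernel (HΨ : BumpHyp Ψ) :
    HasCompactSupport (expKernel Ψ) := by
  refine HasCompactSupport.of_support_subset_isCompact (isCompact_Icc (a := (-1 : ℝ)) (b := 0)) ?_
  intro v hv
  constructor
  · by_contra hlt
    exact hv (HΨ.expKernel_of_lt (not_le.1 hlt))
  · by_contra hlt
    exact hv (HΨ.expKernel_of_nonneg (not_le.1 hlt).le)

theorem BumpHyp.integral_expKernel (HΨ : BumpHyp Ψ) : ∫ v, expKernel Ψ v = 1 := by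
  have hd : ∀ v ∈ (univ : Set ℝ), HasDerivWithinAt (fun v : ℝ => exp (-v))
      (exp (-v) * (-1)) univ v := fun v _ =>
    ((hasDerivAt_id v).neg.exp).hasDerivWithinAt
  have himg : (fun v : ℝ => exp (-v)) '' univ = Ioi 0 := by
    ext y
    simp only [image_univ, mem_range, mem_Ioi]
    exact ⟨fun ⟨v, hv⟩ => hv ▸ exp_pos _, fun hy => ⟨-log y, by
      rw [neg_neg, exp_log hy]⟩⟩
  have key := integral_image_eq_integral_abs_deriv_smul MeasurableSet.univ hd
    (fun v _ w _ hvw => by simpa using hvw) Ψ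
  rw [himg, setIntegral_eq_integral_of_forall_compl_eq_zero, HΨ.int, setIntegral_univ] at key
  · simp only [expKernel]
    rw [integral_complex_ofReal, ← Complex.ofReal_one, key]
    congr 2
    funext v
    rw [mul_neg_one, abs_neg, abs_of_pos (exp_pos _), smul_eq_mul, mul_comm]
  · intro x hx
    exact HΨ.eq_zero_of_le_one (le_trans (not_lt.1 hx) zero_le_one)

theorem logSum_expKernel (Ψ : ℝ → ℝ) (h : ArithmeticFunction ℝ) (u : ℝ) :
    logSum (fun n => ((sqfreeCoeff h n / n : ℝ) : ℂ)) (expKernel Ψ) u =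
      ((exp (-u) * smoothSum Ψ h (exp u) : ℝ) : ℂ) := by
  rw [logSum, smoothSum, ← tsum_mul_left, Complex.ofReal_tsum]
  congr 1
  funext n
  rcases Nat.eq_zero_or_pos n with rfl | hn
  · simp [sqfreeCoeff]
  · have hn' : (0 : ℝ) < n := by exact_mod_cast hn
    rw [expKernel, ← Complex.ofReal_mul]
    congr 1
    have : exp (-(u - log n)) = n * exp (-u) := by
      rw [neg_sub, sub_eq_add_neg, Real.exp_add, exp_log hn']
    rw [this, Real.exp_neg, ← div_eq_mul_inv]
    field_simp

theorem term_div_nat (c : ℕ → ℂ) (s : ℂ) (n : ℕ) :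
    LSeries.term (fun n => c n / n) s n = LSeries.term c (1 + s) n := by
  rcases Nat.eq_zero_or_pos n with rfl | hn
  · simp
  · have hn' : (n : ℂ) ≠ 0 := by exact_mod_cast hn.ne'
    rw [LSeries.term_of_ne_zero hn.ne', LSeries.term_of_ne_zero hn.ne', Complex.cpow_add _ _ hn',
      Complex.cpow_one, div_div]

theorem SieveHyp.LSeries_div (H : SieveHyp h Hstar L c₀) {s : ℂ} (hs : 0 < s.re) :
    LSeriesSummable (fun n => ((sqfreeCoeff h n / n : ℝ) : ℂ)) s ∧
      LSeries (fun n => ((sqfreeCoeff h n / n : ℝ) : ℂ)) s = polarFun Hstar s / s ^ 2 := by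
  have hs0 : s ≠ 0 := by rintro rfl; simp at hs
  have hre : 1 < (1 + s).re := by simpa using hs
  have e : (fun n => ((sqfreeCoeff h n / n : ℝ) : ℂ)) = fun n : ℕ => (sqfreeCoeff h n : ℂ) / n := by
    funext n
    push_cast
    rfl
  have h1 := H.summable (1 + s) hre
  have h2 := H.factor (1 + s) hre
  rw [ofReal_sqfreeCoeff] at h1 h2
  have e2 : LSeries.term (fun n : ℕ => (sqfreeCoeff h n : ℂ) / n) s =
      LSeries.term (fun n => (sqfreeCoeff h n : ℂ)) (1 + s) := funext (term_div_nat _ s)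
  rw [e]
  refine ⟨by rw [LSeriesSummable, e2]; exact h1, ?_⟩
  rw [LSeries, e2]
  rw [LSeries] at h2
  rw [h2, polarFun, riemannZeta_eq_inv_sub_mul (by simpa using hs0)]
  have : (1 + s - 1 : ℂ) = s := by ring
  rw [this]
  field_simp

theorem SieveHyp.exists_smoothSum_complex (H : SieveHyp h Hstar L c₀) (HΨ : BumpHyp Ψ) :
    ∃ b : ℂ, ∀ B : ℕ, ∃ C : ℝ, ∀ u : ℝ, 0 ≤ u →
      ‖((exp (-u) * smoothSum Ψ h (exp u) : ℝ) : ℂ) - (Hstar 1 * u + b)‖ ≤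
        C / (1 + u) ^ B := by
  set κ := expKernel Ψ with hκ
  set P0 := polarFun Hstar 0 with hP0
  set P1 := deriv (polarFun Hstar) 0 with hP1
  have hκs := HΨ.contDiff_expKernel
  have hκc : Continuous κ := hκs.continuous
  have hκcs := HΨ.hasCompactSupport_expKernel
  refine ⟨P1 * (∫ v, κ v) - P0 * ∫ v, κ v * v, fun B => ?_⟩
  set cf : ℕ → ℂ := fun n => ((sqfreeCoeff h n / n : ℝ) : ℂ) with hcf
  have hcf0 : cf 0 = 0 := by simp [hcf]
  have h1 : ∀ v, v < -1 → κ v = 0 := fun v hv => HΨ.expKernel_of_lt hv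
  set k : ℝ → ℂ := fun u => logSum cf κ u - polarModel κ P0 P1 u with hk
  set F : ℂ → ℂ := fun s => lap κ s * polarRem Hstar s with hF
  have hlap : ∀ s : ℂ, 0 < s.re → (Integrable fun u : ℝ => k u * Complex.exp (-s * u)) ∧
      lap k s = F s := by
    intro s hs
    have hs0 : s ≠ 0 := by rintro rfl; simp at hs
    obtain ⟨a1, a2⟩ := H.LSeries_div hs
    have hi : Integrable fun v : ℝ => κ v * Complex.exp (-s * v) :=
      Continuous.integrable_of_hasCompactSupport (by fun_prop) hκcs.mul_right
    obtain ⟨b1, b2⟩ := lap_logSum hcf0 hκc h1 a1 hi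
    obtain ⟨d1, d2⟩ := lap_polarModel hκc hκcs P0 P1 hs
    have e : (fun u : ℝ => k u * Complex.exp (-s * u)) = fun u : ℝ =>
        logSum cf κ u * Complex.exp (-s * u) - polarModel κ P0 P1 u * Complex.exp (-s * u) := by
      funext u
      simp only [hk]
      ring
    refine ⟨by rw [e]; exact b1.sub d1, ?_⟩
    rw [lap, e, integral_sub b1 d1]
    rw [lap] at b2 d2
    rw [b2, d2, a2]
    simp only [hF]
    rw [polarRem_eq _ hs0]
    ring
  obtain ⟨c, C, hc, hc16, hcc, hC, hCb⟩ := H.exists_norm_polarRem_le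
  have hFd : DifferentiableOn ℂ F {s : ℂ | -c₀ < s.re} :=
    (differentiable_lap hκc hκcs).differentiableOn.mul H.differentiableOn_polarRem
  have hFb : ∀ j : ℕ, ∃ C' : ℝ, ∀ s : ℂ, -(c / log (|s.im| + 4)) ≤ s.re → s.re ≤ 1 / 2 →
      ‖F s‖ ≤ C' / (1 + |s.im|) ^ j := by
    intro j
    obtain ⟨C', hC', HC'⟩ := exists_norm_lap_le (j + 24) hκs hκcs
    refine ⟨C' * C, fun s h2 h3 => ?_⟩
    have hl := one_le_log_add_four s.im
    have hcl : c / log (|s.im| + 4) ≤ 1 / 16 := (div_le_self hc.le hl).trans hc16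
    have e1 := hCb s h2 h3
    have e2 := HC' s (abs_le.2 ⟨by linarith, by linarith⟩)
    simp only [hF]
    rw [norm_mul]
    calc _ ≤ C' / (1 + |s.im|) ^ (j + 24) * (C * (1 + |s.im|) ^ 24) := by gcongr
      _ = _ := by
        rw [pow_add]
        field_simp
  have hreg : axisRegion c ⊆ {s : ℂ | -(c / log (|s.im| + 4)) ≤ s.re ∧ s.re ≤ 1 / 2} := by
    intro s hs
    have hs' : |s.re| < c / log (|s.im| + 4) := hs
    have hl := one_le_log_add_four s.im
    have hcl : c / log (|s.im| + 4) ≤ 1 / 16 := (div_le_self hc.le hl).trans hc16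
    obtain ⟨h2, h3⟩ := abs_lt.1 hs'
    exact ⟨h2.le, by linarith⟩
  have hRD : RapidDecay F c := by
    refine ⟨hc, by linarith, hFd.mono fun s hs => ?_, fun j => ?_⟩
    · have hl := one_le_log_add_four s.im
      have hcl : c / log (|s.im| + 4) ≤ c := div_le_self hc.le hl
      have := (hreg hs).1
      change -c₀ < s.re
      linarith
    · obtain ⟨C', hC'⟩ := hFb j
      exact ⟨C', fun s hs => hC' s (hreg hs).1 (hreg hs).2⟩
  have hkc : Continuous k :=
    (continuous_logSum hκc h1).sub (continuous_polarModel hκc hκcs P0 P1)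
  have hFc : ContinuousOn F {s : ℂ | -c₀ < s.re} := hFd.continuousOn
  obtain ⟨D, hD⟩ := hFb 2
  have hinv : ∀ u : ℝ, k u = 𝓕⁻ (fun w : ℝ => F ((2 * π * w : ℝ) * I)) u := by
    refine eq_fourierInv_of_lap hkc (Dom := fun w => D / (1 + |2 * π * w|) ^ 2) ?_ ?_
      (integrable_div_one_add_sq D) ?_ ?_
    · intro δ hδ _
      exact (hlap δ (by simpa using hδ)).1
    · intro δ hδ _
      have e : (fun w : ℝ => lap k (δ + (2 * π * w : ℝ) * I)) =
          fun w : ℝ => F (δ + (2 * π * w : ℝ) * I) := by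
        funext w
        exact (hlap _ (by simpa using hδ)).2
      rw [e]
      refine Continuous.aestronglyMeasurable (hFc.comp_continuous (by fun_prop) fun w => ?_)
      change -c₀ < _
      simp only [add_re, ofReal_re, re_ofReal_mul, Complex.I_re, mul_zero,
        add_zero]
      linarith [H.c_pos]
    · intro δ hδ hδ2 w
      rw [(hlap _ (by simpa using hδ)).2]
      have := hD (δ + (2 * π * w : ℝ) * I) (by
        simp only [add_re, ofReal_re, re_ofReal_mul, Complex.I_re, mul_zero,
          add_zero]
        have := one_le_log_add_four ((δ : ℂ) + (2 * π * w : ℝ) * I).im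
        have : 0 < c / log (|((δ : ℂ) + (2 * π * w : ℝ) * I).im| + 4) := by
          positivity
        linarith) (by simpa using hδ2)
      simpa using this
    · refine ae_of_all _ fun w => ?_
      have hmem : (((2 * π * w : ℝ) : ℂ) * I) ∈ {s : ℂ | -c₀ < s.re} := by
        change -c₀ < _
        simp only [re_ofReal_mul, Complex.I_re, mul_zero]
        linarith [H.c_pos]
      have h3 : ContinuousAt F (((2 * π * w : ℝ) : ℂ) * I) :=
        hFc.continuousAt ((isOpen_halfPlane c₀).mem_nhds hmem)
      have h4 : Tendsto (fun δ : ℝ => (δ : ℂ) + (2 * π * w : ℝ) * I) (𝓝[>] 0)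
          (𝓝 (((2 * π * w : ℝ) : ℂ) * I)) := by
        have : Continuous fun δ : ℝ => (δ : ℂ) + (2 * π * w : ℝ) * I := by fun_prop
        have := this.tendsto 0
        simp only [Complex.ofReal_zero, zero_add] at this
        exact this.mono_left nhdsWithin_le_nhds
      refine (h3.tendsto.comp h4).congr' ?_
      filter_upwards [self_mem_nhdsWithin] with δ hδ
      exact (hlap _ (by simpa using hδ)).2.symm
  obtain ⟨D0, hD0⟩ := hRD.exists_fourierInv_le 0
  obtain ⟨DB, hDB⟩ := hRD.exists_fourierInv_le B
  refine ⟨2 ^ B * (|D0| + |DB|), fun u hu => ?_⟩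
  have e1 : ((exp (-u) * smoothSum Ψ h (exp u) : ℝ) : ℂ) -
      (Hstar 1 * u + (P1 * (∫ v, κ v) - P0 * ∫ v, κ v * v)) = k u := by
    simp only [hk]
    rw [polarModel_eq hκc hκcs (fun v hv => HΨ.expKernel_of_nonneg hv) _ _ hu,
      HΨ.integral_expKernel, logSum_expKernel, hP0, polarFun_zero, mul_one, mul_one]
  rw [e1, hinv u, le_div_iff₀ (by positivity), mul_comm]
  have f0 := hD0 u
  have fB := hDB u
  rw [pow_zero, one_mul] at f0
  rw [abs_of_nonneg hu] at fB
  set K := ‖𝓕⁻ (fun w : ℝ => F ((2 * π * w : ℝ) * I)) u‖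
  have hK : 0 ≤ K := norm_nonneg _
  have g0 := le_abs_self D0
  have gB := le_abs_self DB
  rcases le_total u 1 with h2 | h2
  · calc (1 + u) ^ B * K ≤ (2 : ℝ) ^ B * |D0| := by
          gcongr
          · linarith
          · linarith
      _ ≤ _ := by gcongr; linarith [abs_nonneg DB]
  · calc (1 + u) ^ B * K ≤ (2 * u) ^ B * K := by gcongr; linarith
      _ = 2 ^ B * (u ^ B * K) := by rw [mul_pow]; ring
      _ ≤ _ := by gcongr; linarith [abs_nonneg D0]

theorem smoothSum_nonneg (hh : ∀ n, 0 ≤ h n) (HΨ : BumpHyp Ψ) (y : ℝ) :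
    0 ≤ smoothSum Ψ h y :=
  tsum_nonneg fun n => mul_nonneg (HΨ.nonneg _) (mul_nonneg (sq_nonneg _) (hh n))

theorem eq_zero_of_mul_le {a b C : ℝ} (hle : ∀ u : ℝ, 0 ≤ u → a * u + b ≤ C) : a ≤ 0 := by
  by_contra ha
  push Not at ha
  have := hle ((|b| + |C| + 1) / a) (by positivity)
  rw [mul_div_cancel₀ _ ha.ne'] at this
  linarith [neg_abs_le b, le_abs_self C]

/-- Smoothed sums of `μ² h`, with a saving of an arbitrary power of the logarithm. -/
theorem SieveHyp.exists_smoothSum (H : SieveHyp h Hstar L c₀) (HΨ : BumpHyp Ψ) :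
    ∃ a b : ℝ, 0 < a ∧ Hstar 1 = a ∧ ∀ B : ℕ, ∃ C : ℝ, 0 < C ∧ ∀ u : ℝ, 0 ≤ u →
      |exp (-u) * smoothSum Ψ h (exp u) - (a * u + b)| ≤ C / (1 + u) ^ B := by
  obtain ⟨b, hb⟩ := H.exists_smoothSum_complex HΨ
  have hne : Hstar 1 ≠ 0 := by
    refine (H.zerofree 1 (by simpa using H.c_pos.le) ?_).1
    have h1 : 0 < log 2 := log_pos (by norm_num)
    have h2 := H.L_pos
    simp only [one_im, abs_zero, zero_add, one_re]
    have : 0 < 1 / (L * log 2) := by positivity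
    linarith
  obtain ⟨C0, hC0⟩ := hb 0
  have hre : ∀ u : ℝ, 0 ≤ u → |exp (-u) * smoothSum Ψ h (exp u) -
      ((Hstar 1).re * u + b.re)| ≤ C0 ∧ |(Hstar 1).im * u + b.im| ≤ C0 := by
    intro u hu
    have := hC0 u hu
    rw [pow_zero, div_one] at this
    have h1 := (abs_re_le_norm _).trans this
    have h2 := (abs_im_le_norm _).trans this
    simp only [sub_re, ofReal_re, add_re, Complex.re_mul_ofReal,
      sub_im, Complex.ofReal_im, add_im, Complex.im_mul_ofReal, zero_sub,
      abs_neg] at h1 h2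
    exact ⟨h1, h2⟩
  have him : (Hstar 1).im = 0 := by
    refine le_antisymm (eq_zero_of_mul_le fun u hu => (le_abs_self _).trans (hre u hu).2) ?_
    have : -(Hstar 1).im ≤ 0 := eq_zero_of_mul_le (b := -b.im) (C := C0) fun u hu => by
      have := (neg_le_abs _).trans (hre u hu).2
      linarith
    linarith
  have hre0 : -(Hstar 1).re ≤ 0 := eq_zero_of_mul_le (b := -b.re) (C := C0) fun u hu => by
    have h1 := (abs_le.1 (hre u hu).1).2
    have h2 : 0 ≤ exp (-u) * smoothSum Ψ h (exp u) :=
      mul_nonneg (exp_pos _).le (smoothSum_nonneg H.nonneg HΨ _)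
    linarith
  have ha : Hstar 1 = ((Hstar 1).re : ℂ) := Complex.ext (by simp) (by simp [him])
  refine ⟨(Hstar 1).re, b.re, lt_of_le_of_ne (by linarith) fun h0 => hne ?_, ha, fun B => ?_⟩
  · rw [ha, ← h0, Complex.ofReal_zero]
  · obtain ⟨C, hC⟩ := hb B
    refine ⟨|C| + 1, by positivity, fun u hu => ?_⟩
    have := (abs_re_le_norm _).trans (hC u hu)
    simp only [sub_re, ofReal_re, add_re, Complex.re_mul_ofReal] at this
    refine this.trans ?_
    gcongr
    linarith [le_abs_self C]

/-! ### The dual density -/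

/-- `g(p) = (h(p)/p) / (1 + h(p)/p)`. -/
def dualDens (h : ArithmeticFunction ℝ) (p : ℕ) : ℝ := dens h p / (1 + dens h p)

theorem SieveHyp.dualDens_nonneg (H : SieveHyp h Hstar L c₀) (p : ℕ) : 0 ≤ dualDens h p := by
  have := H.dens_nonneg p
  rw [dualDens]
  positivity

theorem SieveHyp.dualDens_le (H : SieveHyp h Hstar L c₀) (p : ℕ) : dualDens h p ≤ dens h p :=
  div_le_self (H.dens_nonneg p) (by linarith [H.dens_nonneg p])

theorem SieveHyp.dens_sub_dualDens (H : SieveHyp h Hstar L c₀) (p : ℕ) :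
    dens h p - dualDens h p = dens h p * dualDens h p := by
  have := H.dens_nonneg p
  rw [dualDens]
  field_simp
  ring

theorem SieveHyp.dens_mul_dualDens_le (H : SieveHyp h Hstar L c₀) (p : ℕ) :
    dens h p * dualDens h p ≤ dens h p ^ 2 := by
  rw [sq]
  exact mul_le_mul_of_nonneg_left (H.dualDens_le p) (H.dens_nonneg p)

theorem SieveHyp.dens_squarefree (H : SieveHyp h Hstar L c₀) {n : ℕ} (hn : Squarefree n) :
    dens h n = ∏ p ∈ n.primeFactors, dens h p := by
  have h1 : h n = ∏ p ∈ n.primeFactors, h p := by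
    conv_lhs => rw [← Nat.prod_primeFactors_of_squarefree hn]
    exact H.mul.map_prod_of_prime _ fun p hp => Nat.prime_of_mem_primeFactors hp
  have h2 : (n : ℝ) = ∏ p ∈ n.primeFactors, (p : ℝ) := by
    conv_lhs => rw [← Nat.prod_primeFactors_of_squarefree hn]
    push_cast
    rfl
  simp only [dens]
  rw [h1, h2, Finset.prod_div_distrib]

theorem sqfreeCoeff_div (h : ArithmeticFunction ℝ) {n : ℕ} (hn : Squarefree n) :
    sqfreeCoeff h n / n = dens h n := by
  have : (moebius n : ℝ) ^ 2 = 1 := by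
    exact_mod_cast ArithmeticFunction.moebius_sq_eq_one_of_squarefree hn
  rw [sqfreeCoeff, this, one_mul, dens]

theorem sqfreeCoeff_of_not (h : ArithmeticFunction ℝ) {n : ℕ} (hn : ¬ Squarefree n) :
    sqfreeCoeff h n = 0 := by
  rw [sqfreeCoeff, ArithmeticFunction.moebius_eq_zero_of_not_squarefree hn]
  simp

/-- `μ(n) ∏_{p ∣ n} g(p)`. -/
def dualCoeff (h : ArithmeticFunction ℝ) (n : ℕ) : ℝ :=
  (moebius n : ℝ) * ∏ p ∈ n.primeFactors, dualDens h p

theorem SieveHyp.abs_dualCoeff_le (H : SieveHyp h Hstar L c₀) (n : ℕ) :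
    |dualCoeff h n| ≤ sqfreeCoeff h n / n := by
  by_cases hn : Squarefree n
  · rw [sqfreeCoeff_div h hn, H.dens_squarefree hn, dualCoeff, abs_mul]
    have : |(moebius n : ℝ)| = 1 := by
      exact_mod_cast (ArithmeticFunction.abs_moebius_eq_one_of_squarefree hn)
    rw [this, one_mul, abs_of_nonneg (prod_nonneg fun p _ => H.dualDens_nonneg p)]
    exact prod_le_prod (fun p _ => H.dualDens_nonneg p) fun p _ => H.dualDens_le p
  · rw [sqfreeCoeff_of_not h hn, dualCoeff, ArithmeticFunction.moebius_eq_zero_of_not_squarefree hn]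
    simp

theorem SieveHyp.summable_dualCoeff (H : SieveHyp h Hstar L c₀) {s : ℂ} (hs : 0 < s.re) :
    LSeriesSummable (fun n => (dualCoeff h n : ℂ)) s := by
  refine ((H.LSeries_div hs).1.norm).of_norm_bounded fun n => ?_
  refine LSeries.norm_term_le s ?_
  rw [norm_real, norm_real, norm_eq_abs, norm_eq_abs]
  exact (H.abs_dualCoeff_le n).trans (le_abs_self _)

theorem term_mul_of_coprime {c : ℕ → ℂ} (hc : ∀ m n : ℕ, Nat.Coprime m n → c (m * n) = c m * c n)
    (s : ℂ) {m n : ℕ} (hmn : Nat.Coprime m n) :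
    LSeries.term c s (m * n) = LSeries.term c s m * LSeries.term c s n := by
  rcases eq_or_ne m 0 with rfl | hm
  · simp
  rcases eq_or_ne n 0 with rfl | hn
  · simp
  rw [LSeries.term_of_ne_zero (mul_ne_zero hm hn), LSeries.term_of_ne_zero hm,
    LSeries.term_of_ne_zero hn, hc m n hmn, Nat.cast_mul, Complex.natCast_mul_natCast_cpow]
  field_simp

theorem dualCoeff_mul (h : ArithmeticFunction ℝ) {m n : ℕ} (hmn : Nat.Coprime m n) :
    dualCoeff h (m * n) = dualCoeff h m * dualCoeff h n := by
  simp only [dualCoeff, ArithmeticFunction.isMultiplicative_moebius.map_mul_of_coprime hmn,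
    hmn.primeFactors_mul, Finset.prod_union hmn.disjoint_primeFactors]
  push_cast
  ring

theorem SieveHyp.eulerProduct_dual (H : SieveHyp h Hstar L c₀) {s : ℂ} (hs : 0 < s.re) :
    Tendsto (fun n : ℕ => ∏ p ∈ n.primesBelow, (1 - dualDens h p * (p : ℂ) ^ (-s))) atTop
      (𝓝 (LSeries (fun n => (dualCoeff h n : ℂ)) s)) := by
  have := EulerProduct.eulerProduct (f := LSeries.term (fun n => (dualCoeff h n : ℂ)) s)
    (by rw [LSeries.term_of_ne_zero one_ne_zero]; simp [dualCoeff])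
    (fun {m n} hmn => term_mul_of_coprime (fun m n hmn => by
      rw [dualCoeff_mul h hmn]; push_cast; rfl) s hmn)
    (H.summable_dualCoeff hs).norm (LSeries.term_zero _ _)
  refine this.congr fun n => Finset.prod_congr rfl fun p hp' => ?_
  have hp := prime_of_mem_primesBelow hp'
  rw [tsum_eq_sum (s := Finset.range 2)]
  · rw [Finset.sum_range_succ, Finset.sum_range_one, pow_zero, pow_one,
      LSeries.term_of_ne_zero one_ne_zero, LSeries.term_of_ne_zero hp.ne_zero,
      Complex.cpow_neg, div_eq_mul_inv]
    simp [dualCoeff, ArithmeticFunction.moebius_apply_prime hp, hp.primeFactors, div_eq_mul_inv,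
      sub_eq_add_neg]
  · intro e he
    have he2 : 1 < e := by simpa using he
    rw [LSeries.term_of_ne_zero (pow_ne_zero _ hp.ne_zero)]
    have : dualCoeff h (p ^ e) = 0 := by
      rw [dualCoeff, ArithmeticFunction.moebius_apply_prime_pow hp (by lia), if_neg (by lia)]
      simp
    simp [this]

theorem SieveHyp.eulerProduct_div (H : SieveHyp h Hstar L c₀) {s : ℂ} (hs : 0 < s.re) :
    Tendsto (fun n : ℕ => ∏ p ∈ n.primesBelow, (1 + dens h p * (p : ℂ) ^ (-s))) atTop
      (𝓝 (polarFun Hstar s / s ^ 2)) := by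
  have h1 := H.eulerProduct (s := 1 + s) (by simpa using hs)
  have h2 := (H.LSeries_div hs).2
  have e : (fun n => ((sqfreeCoeff h n / n : ℝ) : ℂ)) = fun n : ℕ => (sqfreeCoeff h n : ℂ) / n := by
    funext n
    push_cast
    rfl
  rw [e, LSeries, funext (term_div_nat (fun n => (sqfreeCoeff h n : ℂ)) s)] at h2
  rw [LSeries, h2] at h1
  refine h1.congr fun n => Finset.prod_congr rfl fun p hp' => ?_
  have hp0 : (p : ℂ) ≠ 0 := by exact_mod_cast (prime_of_mem_primesBelow hp').ne_zero
  rw [neg_add, Complex.cpow_add _ _ hp0, Complex.cpow_neg_one, dens]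
  push_cast
  ring

/-! ### The correction factor -/

def corrTerm (h : ArithmeticFunction ℝ) (n : ℕ) (s : ℂ) : ℂ :=
  if n.Prime then ((dens h n * dualDens h n : ℝ) : ℂ) * ((n : ℂ) ^ (-s) - ((n : ℂ) ^ (-s)) ^ 2)
  else 0

/-- `∏ (1 - g(p) p^{-s}) (1 + h(p) p^{-1-s})`. -/
def corrProd (h : ArithmeticFunction ℝ) (s : ℂ) : ℂ := ∏' n : ℕ, (1 + corrTerm h n s)

theorem SieveHyp.summable_bound (H : SieveHyp h Hstar L c₀) : Summable fun n : ℕ =>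
    if n.Prime then 2 * (dens h n ^ 2 * (n : ℝ) ^ (2 * c₀)) else 0 := by
  have h1 := (H.summable_dens_sq_rpow.mul_left 2)
  have := (summable_subtype_iff_indicator
    (f := fun n : ℕ => 2 * (dens h n ^ 2 * (n : ℝ) ^ (2 * c₀))) (s := {p | p.Prime})).1 h1
  refine this.congr fun n => ?_
  by_cases hn : n.Prime <;> simp [hn]

theorem SieveHyp.norm_corrTerm_le (H : SieveHyp h Hstar L c₀) (n : ℕ) {s : ℂ}
    (hs : -c₀ < s.re) :
    ‖corrTerm h n s‖ ≤ if n.Prime then 2 * (dens h n ^ 2 * (n : ℝ) ^ (2 * c₀)) else 0 := by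
  rw [corrTerm]
  split_ifs with hn
  · have hn1 : (1 : ℝ) ≤ n := by exact_mod_cast hn.one_le
    have hn0 : (0 : ℝ) < n := by linarith
    have h1 : ‖(n : ℂ) ^ (-s)‖ ≤ (n : ℝ) ^ c₀ := by
      rw [Complex.norm_natCast_cpow_of_pos hn.pos]
      exact rpow_le_rpow_of_exponent_le hn1 (by simp; linarith)
    have h3 : (n : ℝ) ^ c₀ ≤ (n : ℝ) ^ (2 * c₀) :=
      rpow_le_rpow_of_exponent_le hn1 (by linarith [H.c_pos])
    have h4 : ((n : ℝ) ^ c₀) ^ 2 = (n : ℝ) ^ (2 * c₀) := by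
      rw [← rpow_natCast, ← Real.rpow_mul hn0.le, mul_comm]
      norm_num
    have h2 : ‖(n : ℂ) ^ (-s) - ((n : ℂ) ^ (-s)) ^ 2‖ ≤ 2 * (n : ℝ) ^ (2 * c₀) := by
      refine (norm_sub_le _ _).trans ?_
      rw [norm_pow]
      have := pow_le_pow_left₀ (norm_nonneg _) h1 2
      linarith
    have h5 := H.dens_nonneg n
    have h6 := H.dualDens_nonneg n
    rw [norm_mul, norm_real, norm_of_nonneg (by positivity)]
    calc _ ≤ dens h n ^ 2 * (2 * (n : ℝ) ^ (2 * c₀)) := by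
          gcongr
          exact H.dens_mul_dualDens_le n
      _ = _ := by ring
  · simp

theorem differentiable_corrTerm (h : ArithmeticFunction ℝ) (n : ℕ) :
    Differentiable ℂ (corrTerm h n) := by
  by_cases hn : n.Prime
  · have hn0 : (n : ℂ) ≠ 0 := by exact_mod_cast hn.ne_zero
    have : corrTerm h n = fun s => ((dens h n * dualDens h n : ℝ) : ℂ) *
        ((n : ℂ) ^ (-s) - ((n : ℂ) ^ (-s)) ^ 2) := by
      funext s
      simp [corrTerm, hn]
    rw [this]
    have h1 : Differentiable ℂ fun s : ℂ => (n : ℂ) ^ (-s) := fun s =>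
      (differentiableAt_id.neg).const_cpow (Or.inl hn0)
    exact (h1.sub (h1.pow 2)).const_mul _
  · have : corrTerm h n = fun _ => 0 := by
      funext s
      simp [corrTerm, hn]
    rw [this]
    exact differentiable_const _

theorem SieveHyp.hasProd_corr (H : SieveHyp h Hstar L c₀) :
    HasProdLocallyUniformlyOn (fun n s => 1 + corrTerm h n s) (corrProd h)
      {s : ℂ | -c₀ < s.re} :=
  H.summable_bound.hasProdLocallyUniformlyOn_nat_one_add (isOpen_halfPlane c₀)
    (Eventually.of_forall fun n _ hs => H.norm_corrTerm_le n hs)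
    fun n => (differentiable_corrTerm h n).continuous.continuousOn

theorem SieveHyp.tendsto_corrProd (H : SieveHyp h Hstar L c₀) {s : ℂ} (hs : -c₀ < s.re) :
    Tendsto (fun N : ℕ => ∏ n ∈ Finset.range N, (1 + corrTerm h n s)) atTop (𝓝 (corrProd h s)) :=
  (H.hasProd_corr.hasProd hs).tendsto_prod_nat

theorem SieveHyp.differentiableOn_corrProd (H : SieveHyp h Hstar L c₀) :
    DifferentiableOn ℂ (corrProd h) {s : ℂ | -c₀ < s.re} := by
  have h1 := H.hasProd_corr
  rw [hasProdLocallyUniformlyOn_iff_tendstoLocallyUniformlyOn] at h1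
  refine h1.differentiableOn (Eventually.of_forall fun N => ?_) (isOpen_halfPlane c₀)
  refine Differentiable.differentiableOn ?_
  exact Differentiable.fun_finsetProd fun n _ => (differentiable_corrTerm h n).const_add 1

theorem SieveHyp.exists_norm_corrProd_le (H : SieveHyp h Hstar L c₀) :
    ∃ C : ℝ, 0 < C ∧ ∀ s : ℂ, -c₀ < s.re → ‖corrProd h s‖ ≤ C := by
  set S := ∑' n : ℕ, if n.Prime then 2 * (dens h n ^ 2 * (n : ℝ) ^ (2 * c₀)) else 0
  refine ⟨exp S, exp_pos _, fun s hs => ?_⟩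
  refine le_of_tendsto (H.tendsto_corrProd hs).norm (Eventually.of_forall fun N => ?_)
  have h1 := Finset.norm_prod_one_add_sub_one_le (Finset.range N) fun n => corrTerm h n s
  have h2 : ∑ n ∈ Finset.range N, ‖corrTerm h n s‖ ≤ S :=
    (sum_le_sum fun n _ => H.norm_corrTerm_le n hs).trans
      (H.summable_bound.sum_le_tsum _ fun n _ => by split_ifs <;> positivity)
  have h3 := Real.exp_le_exp.2 h2
  have h4 := norm_le_norm_sub_add (∏ n ∈ Finset.range N, (1 + corrTerm h n s)) 1
  rw [norm_one] at h4
  linarith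

theorem corrProd_zero (h : ArithmeticFunction ℝ) : corrProd h 0 = 1 := by
  have : ∀ n, corrTerm h n 0 = 0 := fun n => by simp [corrTerm]
  simp [corrProd, this]

theorem SieveHyp.LSeries_dualCoeff (H : SieveHyp h Hstar L c₀) {s : ℂ} (hs : 0 < s.re) :
    LSeries (fun n => (dualCoeff h n : ℂ)) s * (polarFun Hstar s / s ^ 2) = corrProd h s := by
  refine tendsto_nhds_unique ((H.eulerProduct_dual hs).mul (H.eulerProduct_div hs))
    ((H.tendsto_corrProd (by linarith [H.c_pos] : -c₀ < s.re)).congr fun N => ?_)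
  rw [← prod_mul_distrib, Nat.primesBelow, Finset.prod_filter]
  refine Finset.prod_congr rfl fun p _ => ?_
  split_ifs with hp
  · have := H.dens_sub_dualDens p
    have h2 : (dens h p : ℂ) - dualDens h p = dens h p * dualDens h p := by exact_mod_cast this
    rw [corrTerm, if_pos hp]
    push_cast
    linear_combination (-(p : ℂ) ^ (-s)) * h2
  · simp [corrTerm, hp]

/-! ### The dual sum `∑ μ(m) g(m) log²(x/m)` -/

theorem SieveHyp.exists_le_norm_polarFun (H : SieveHyp h Hstar L c₀) :
    ∃ c : ℝ, 0 < c ∧ ∀ s : ℂ, 0 ≤ s.re → s.re ≤ 1 / 2 →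
      c * (1 + |s.im|) ≤ ‖polarFun Hstar s‖ := by
  obtain ⟨c, hc, HC⟩ := exists_le_norm_riemannZeta₁
  have hL := H.L_pos
  refine ⟨c ^ 2 / L, by positivity, fun s h1 h2 => ?_⟩
  have e1 := HC (1 + s) (by simpa using h1) (by simp; linarith)
  obtain ⟨e2, e3⟩ := H.zerofree (1 + s) (by simp; linarith [H.c_pos]) (by
    have h3 : 0 < log (|(1 + s).im| + 2) := log_pos (by linarith [abs_nonneg (1 + s).im])
    have : 0 < 1 / (L * log (|(1 + s).im| + 2)) := by positivity
    simp only [add_re, one_re]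
    linarith)
  have e4 : 1 / L ≤ ‖Hstar (1 + s)‖ := by
    rw [norm_div, norm_one, div_le_iff₀ (norm_pos_iff.2 e2)] at e3
    rw [div_le_iff₀ hL]
    linarith
  simp only [add_im, one_im, zero_add] at e1
  have e5 : ((1 + |s.im|) ^ (1 / 2 : ℝ)) ^ 2 = 1 + |s.im| := by
    rw [← rpow_natCast, ← Real.rpow_mul (by positivity)]
    norm_num
  rw [polarFun, norm_mul, norm_pow]
  calc c ^ 2 / L * (1 + |s.im|) = (c * (1 + |s.im|) ^ (1 / 2 : ℝ)) ^ 2 * (1 / L) := by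
        rw [mul_pow, e5]
        ring
    _ ≤ _ := by gcongr

/-- `∑ μ(m) g(m) log²(e^u / m)` over `m ≤ e^u`. -/
def dualLogSum (h : ArithmeticFunction ℝ) (u : ℝ) : ℝ :=
  ∑' m : ℕ, dualCoeff h m * (max (u - log m) 0) ^ 2

def sqKernel (v : ℝ) : ℂ := ((max v 0) ^ 2 : ℝ)

theorem continuous_sqKernel : Continuous sqKernel := by
  unfold sqKernel
  fun_prop

theorem sqKernel_eq : sqKernel = (Ioi (0 : ℝ)).indicator fun v : ℝ => (v : ℂ) ^ 2 := by
  funext v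
  by_cases hv : 0 < v
  · simp [sqKernel, hv, hv.le]
  · simp [sqKernel, hv, not_lt.1 hv]

theorem lap_sqKernel {s : ℂ} (hs : 0 < s.re) :
    (Integrable fun v : ℝ => sqKernel v * Complex.exp (-s * v)) ∧
      lap sqKernel s = 2 / s ^ 3 := by
  rw [sqKernel_eq]
  refine ⟨integrable_indicator_mul_cexp (integrableOn_pow_mul_cexp 2 hs), ?_⟩
  rw [lap_indicator, integral_pow_mul_cexp 2 hs]
  norm_num

/-- `1 - e^{-u}` for `u ≥ 0`. -/
def stepModel (u : ℝ) : ℂ := (1 - exp (-max u 0) : ℝ)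

theorem lap_stepModel {s : ℂ} (hs : 0 < s.re) :
    (Integrable fun v : ℝ => stepModel v * Complex.exp (-s * v)) ∧
      lap stepModel s = 1 / s - 1 / (s + 1) := by
  have e : stepModel = (Ioi (0 : ℝ)).indicator fun v : ℝ => 1 - Complex.exp (-v) := by
    funext v
    by_cases hv : 0 < v
    · simp [stepModel, hv, hv.le]
    · simp [stepModel, hv, not_lt.1 hv]
  have hs1 : 0 < (s + 1).re := by simp; linarith
  have i1 := integrableOn_pow_mul_cexp 0 hs
  have i2 := integrableOn_pow_mul_cexp 0 hs1
  have e2 : (fun v : ℝ => (1 - Complex.exp (-v)) * Complex.exp (-s * v)) = fun v : ℝ =>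
      (v : ℂ) ^ 0 * Complex.exp (-s * v) - (v : ℂ) ^ 0 * Complex.exp (-(s + 1) * v) := by
    funext v
    rw [pow_zero, one_mul, one_mul, sub_mul, one_mul, ← Complex.exp_add]
    congr 2
    ring
  rw [e]
  refine ⟨integrable_indicator_mul_cexp (by rw [e2]; exact i1.sub i2), ?_⟩
  rw [lap_indicator, e2, integral_sub i1 i2, integral_pow_mul_cexp 0 hs,
    integral_pow_mul_cexp 0 hs1]
  simp

theorem SieveHyp.exists_dual_remainder (H : SieveHyp h Hstar L c₀) :
    ∃ C : ℝ, 0 < C ∧ ∀ s : ℂ, 0 ≤ s.re → s.re ≤ 1 / 2 → s ≠ 0 →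
      ‖2 / s * (corrProd h s / polarFun Hstar s - 1 / Hstar 1 / (s + 1))‖ ≤
        C / (1 + |s.im|) ^ 2 := by
  obtain ⟨c, hc, hP⟩ := H.exists_le_norm_polarFun
  obtain ⟨CA, hCA, hA⟩ := H.exists_norm_corrProd_le
  have hP0 : polarFun Hstar 0 ≠ 0 := by
    have := hP 0 (by simp) (by norm_num)
    rw [← norm_pos_iff]
    simp at this
    linarith
  set R : ℂ → ℂ := fun s => corrProd h s / polarFun Hstar s - 1 / Hstar 1 / (s + 1) with hR
  have hn : {s : ℂ | -c₀ < s.re} ∈ 𝓝 (0 : ℂ) :=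
    (isOpen_halfPlane c₀).mem_nhds (by simpa using H.c_pos)
  have hRd : DifferentiableAt ℂ R 0 := by
    refine ((H.differentiableOn_corrProd.differentiableAt hn).div
      (H.differentiableOn_polarFun.differentiableAt hn) hP0).sub ?_
    exact (differentiableAt_const _).div (by fun_prop) (by simp)
  have hR0 : R 0 = 0 := by
    simp only [hR]
    rw [corrProd_zero, polarFun_zero]
    simp
  obtain ⟨M, hM⟩ := hRd.hasFDerivAt.isBigO_sub.bound
  obtain ⟨r', hr', hball'⟩ := Metric.eventually_nhds_iff.1 hM
  set r := min r' 1 with hr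
  have hr0 : 0 < r := lt_min hr' one_pos
  have hball : ∀ s : ℂ, ‖s‖ < r → ‖R s‖ ≤ |M| * ‖s‖ := by
    intro s hs
    have := hball' (y := s) (by
      rw [dist_zero_right]
      exact hs.trans_le (min_le_left _ _))
    rw [hR0, sub_zero, sub_zero] at this
    refine this.trans ?_
    gcongr
    exact le_abs_self M
  set E := CA / c + 2 * ‖(1 : ℂ) / Hstar 1‖ with hE
  have hE0 : 0 ≤ E := by positivity
  refine ⟨8 * |M| + 2 * (1 / r + 1) * E + 1, by positivity, fun s h1 h2 hs => ?_⟩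
  have hs0 : 0 < ‖s‖ := norm_pos_iff.2 hs
  have ht := abs_nonneg s.im
  have hts := abs_im_le_norm s
  rw [show ‖2 / s * (corrProd h s / polarFun Hstar s - 1 / Hstar 1 / (s + 1))‖ =
    2 / ‖s‖ * ‖R s‖ by rw [norm_mul, norm_div]; simp [hR], le_div_iff₀ (by positivity)]
  rcases lt_or_ge ‖s‖ r with h3 | h3
  · have e1 := hball s h3
    have h4 : |s.im| ≤ 1 := hts.trans (h3.le.trans (min_le_right _ _))
    calc 2 / ‖s‖ * ‖R s‖ * (1 + |s.im|) ^ 2 ≤ 2 / ‖s‖ * (|M| * ‖s‖) * (1 + 1) ^ 2 := by gcongr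
      _ = 8 * |M| := by
        field_simp
        ring
      _ ≤ _ := by
        have : 0 ≤ 2 * (1 / r + 1) * E := by positivity
        linarith
  · have e1 : ‖corrProd h s / polarFun Hstar s‖ ≤ CA / c / (1 + |s.im|) := by
      rw [norm_div, div_div]
      have := hP s h1 h2
      have := hA s (by linarith [H.c_pos])
      gcongr
    have e2 : (1 + |s.im|) / 2 ≤ ‖s + 1‖ := by
      have i1 := abs_im_le_norm (s + 1)
      have i2 := (le_abs_self _).trans (abs_re_le_norm (s + 1))
      simp only [add_im, one_im, add_zero, add_re, one_re] at i1 i2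
      linarith
    have e3 : ‖1 / Hstar 1 / (s + 1)‖ ≤ 2 * ‖(1 : ℂ) / Hstar 1‖ / (1 + |s.im|) := by
      rw [norm_div]
      calc _ ≤ ‖(1 : ℂ) / Hstar 1‖ / ((1 + |s.im|) / 2) := by gcongr
        _ = _ := by field_simp
    have e4 : ‖R s‖ ≤ E / (1 + |s.im|) := by
      simp only [hR]
      refine (norm_sub_le _ _).trans ((add_le_add e1 e3).trans (le_of_eq ?_))
      rw [hE]
      ring
    have e5 : 1 + |s.im| ≤ (1 / r + 1) * ‖s‖ := by
      have : 1 ≤ 1 / r * ‖s‖ := by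
        rw [one_div_mul_eq_div, le_div_iff₀ hr0]
        linarith
      linarith
    calc 2 / ‖s‖ * ‖R s‖ * (1 + |s.im|) ^ 2
        ≤ 2 / ‖s‖ * (E / (1 + |s.im|)) * ((1 + |s.im|) * ((1 / r + 1) * ‖s‖)) := by
          rw [sq]
          gcongr
      _ = 2 * (1 / r + 1) * E := by field_simp
      _ ≤ _ := by linarith [abs_nonneg M]

theorem tendsto_fourierInv_atTop (f : ℝ → ℂ) : Tendsto (𝓕⁻ f) atTop (𝓝 0) := by
  have h1 := Real.zero_at_infty_fourier f
  have h2 : Tendsto (fun u : ℝ => -u) atTop (cocompact ℝ) :=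
    tendsto_neg_atTop_atBot.mono_right atBot_le_cocompact
  refine (h1.comp h2).congr fun u => ?_
  rw [Real.fourierInv_eq_fourier_neg]
  rfl

theorem SieveHyp.tendsto_dualLogSum (H : SieveHyp h Hstar L c₀) {a : ℝ} (ha : 0 < a)
    (hHa : Hstar 1 = a) : Tendsto (dualLogSum h) atTop (𝓝 (2 / a)) := by
  set cf : ℕ → ℂ := fun n => (dualCoeff h n : ℂ) with hcf
  have hcf0 : cf 0 = 0 := by simp [hcf, dualCoeff]
  have hκ0 : ∀ v, v < -1 → sqKernel v = 0 := fun v hv => by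
    rw [sqKernel_eq]
    exact indicator_of_notMem (by simp; linarith) _
  have hls : ∀ u, logSum cf sqKernel u = (dualLogSum h u : ℂ) := fun u => by
    rw [logSum, dualLogSum, Complex.ofReal_tsum]
    congr 1
    funext n
    simp [hcf, sqKernel]
  set k : ℝ → ℂ := fun u => logSum cf sqKernel u - (2 / a : ℂ) * stepModel u with hk
  set K : ℂ → ℂ := fun s => 2 / s * (corrProd h s / polarFun Hstar s - 1 / Hstar 1 / (s + 1))
    with hK
  obtain ⟨c, hc, hP⟩ := H.exists_le_norm_polarFun
  have hlap : ∀ s : ℂ, 0 < s.re → s.re ≤ 1 / 2 →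
      (Integrable fun u : ℝ => k u * Complex.exp (-s * u)) ∧ lap k s = K s := by
    intro s hs hs2
    have hs0 : s ≠ 0 := by rintro rfl; simp at hs
    have hs1 : s + 1 ≠ 0 := by
      intro h0
      have := congrArg Complex.re h0
      simp at this
      linarith
    obtain ⟨i1, i2⟩ := lap_sqKernel hs
    obtain ⟨b1, b2⟩ := lap_logSum hcf0 continuous_sqKernel hκ0 (H.summable_dualCoeff hs) i1
    obtain ⟨d1, d2⟩ := lap_stepModel hs
    have e : (fun u : ℝ => k u * Complex.exp (-s * u)) = fun u : ℝ =>
        logSum cf sqKernel u * Complex.exp (-s * u) -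
          (2 / a : ℂ) * (stepModel u * Complex.exp (-s * u)) := by
      funext u
      simp only [hk]
      ring
    refine ⟨by rw [e]; exact b1.sub (d1.const_mul _), ?_⟩
    have hP0 : polarFun Hstar s ≠ 0 := by
      rw [← norm_pos_iff]
      exact lt_of_lt_of_le (by positivity) (hP s hs.le hs2)
    have hL := H.LSeries_dualCoeff hs
    rw [lap, e, integral_sub b1 (d1.const_mul _), integral_const_mul]
    rw [lap] at b2 d2
    rw [b2, d2, i2]
    simp only [hK]
    have ha' : (a : ℂ) ≠ 0 := by exact_mod_cast ha.ne'
    rw [← hL, hHa]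
    field_simp
    ring
  have hkc : Continuous k := by
    refine (continuous_logSum continuous_sqKernel hκ0).sub (continuous_const.mul ?_)
    unfold stepModel
    fun_prop
  obtain ⟨D, hD, hKb⟩ := H.exists_dual_remainder
  have hKc : ∀ s : ℂ, 0 ≤ s.re → s.re ≤ 1 / 2 → s ≠ 0 → ContinuousAt K s := by
    intro s h1 h2 h3
    have hn : {s : ℂ | -c₀ < s.re} ∈ 𝓝 s :=
      (isOpen_halfPlane c₀).mem_nhds (show -c₀ < s.re by linarith [H.c_pos])
    have hP0 : polarFun Hstar s ≠ 0 := by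
      rw [← norm_pos_iff]
      exact lt_of_lt_of_le (by positivity) (hP s h1 h2)
    have hs1 : s + 1 ≠ 0 := by
      intro h0
      have := congrArg Complex.re h0
      simp at this
      linarith
    exact (continuousAt_const.div continuousAt_id h3).mul
      (((H.differentiableOn_corrProd.differentiableAt hn).continuousAt.div
        (H.differentiableOn_polarFun.differentiableAt hn).continuousAt hP0).sub
        (continuousAt_const.div (by fun_prop) hs1))
  have hre : ∀ δ w : ℝ, ((δ : ℂ) + (2 * π * w : ℝ) * I).re = δ := fun δ w => by
    simp
  have him : ∀ δ w : ℝ, ((δ : ℂ) + (2 * π * w : ℝ) * I).im = 2 * π * w :=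
    fun δ w => by simp
  have hne : ∀ δ w : ℝ, 0 < δ → ((δ : ℂ) + (2 * π * w : ℝ) * I) ≠ 0 := by
    intro δ w hδ h0
    have := hre δ w
    rw [h0] at this
    simp at this
    linarith
  have hinv : ∀ u : ℝ, k u = 𝓕⁻ (fun w : ℝ => K ((2 * π * w : ℝ) * I)) u := by
    refine eq_fourierInv_of_lap hkc (Dom := fun w => D / (1 + |2 * π * w|) ^ 2) ?_ ?_
      (integrable_div_one_add_sq D) ?_ ?_
    · intro δ hδ hδ2
      exact (hlap δ (by simpa using hδ) (by simpa using hδ2)).1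
    · intro δ hδ hδ2
      have e : (fun w : ℝ => lap k (δ + (2 * π * w : ℝ) * I)) =
          fun w : ℝ => K (δ + (2 * π * w : ℝ) * I) := by
        funext w
        exact (hlap _ (by rwa [hre]) (by rwa [hre])).2
      rw [e]
      refine Continuous.aestronglyMeasurable (continuous_iff_continuousAt.2 fun w => ?_)
      exact (hKc _ (by rw [hre]; exact hδ.le) (by rwa [hre]) (hne δ w hδ)).comp
        (f := fun w : ℝ => (δ : ℂ) + (2 * π * w : ℝ) * I)
        (Continuous.continuousAt (by fun_prop))
    · intro δ hδ hδ2 w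
      rw [(hlap _ (by rwa [hre]) (by rwa [hre])).2]
      have := hKb _ (by rw [hre]; exact hδ.le) (by rwa [hre]) (hne δ w hδ)
      rwa [him] at this
    · have hae : ∀ᵐ w : ℝ, w ≠ 0 := by simp [ae_iff, measure_singleton]
      filter_upwards [hae] with w hw
      have hw0 : (((2 * π * w : ℝ) : ℂ) * I) ≠ 0 := by
        simp [Real.pi_ne_zero, hw]
      have h3 := hKc (((2 * π * w : ℝ) : ℂ) * I) (by simp) (by simp) hw0
      have h4 : Tendsto (fun δ : ℝ => (δ : ℂ) + (2 * π * w : ℝ) * I) (𝓝[>] 0)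
          (𝓝 (((2 * π * w : ℝ) : ℂ) * I)) := by
        have : Continuous fun δ : ℝ => (δ : ℂ) + (2 * π * w : ℝ) * I := by fun_prop
        have := this.tendsto 0
        simp only [Complex.ofReal_zero, zero_add] at this
        exact this.mono_left nhdsWithin_le_nhds
      refine (h3.tendsto.comp h4).congr' ?_
      filter_upwards [Ioc_mem_nhdsGT (show (0 : ℝ) < 1 / 2 by norm_num)] with δ hδ
      exact (hlap _ (by rw [hre]; exact hδ.1) (by rw [hre]; exact hδ.2)).2.symm
  have hk0 : Tendsto k atTop (𝓝 0) := by
    rw [show k = 𝓕⁻ (fun w : ℝ => K ((2 * π * w : ℝ) * I)) from funext hinv]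
    exact tendsto_fourierInv_atTop _
  have hre0 : Tendsto (fun u => (k u).re) atTop (𝓝 0) := by
    have := (Complex.continuous_re.tendsto 0).comp hk0
    simpa [Function.comp_def] using this
  have hmod : Tendsto (fun u : ℝ => 2 / a * (1 - exp (-max u 0))) atTop (𝓝 (2 / a)) := by
    have h1 : Tendsto (fun u : ℝ => -max u 0) atTop atBot :=
      tendsto_neg_atTop_atBot.comp (tendsto_atTop_mono (fun u => le_max_left u 0) tendsto_id)
    have h2 := ((Real.tendsto_exp_atBot.comp h1).const_sub 1).const_mul (2 / a)
    simpa using h2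
  have := hre0.add hmod
  rw [zero_add] at this
  refine this.congr fun u => ?_
  have e : k u = ((dualLogSum h u - 2 / a * (1 - exp (-max u 0)) : ℝ) : ℂ) := by
    simp only [hk]
    rw [hls, stepModel]
    push_cast
    ring
  rw [e, ofReal_re]
  ring

/-! ### Partial summation against an approximate distribution function -/

theorem abs_sum_sub_integral_le {ι : Type*} (s : Finset ι) (c r : ι → ℝ) {α β η V : ℝ}
    (hαβ : α ≤ β) (hη : 0 ≤ η) (hr : ∀ i ∈ s, α ≤ r i) {Φ ψ : ℝ → ℝ} {K₁ K₂ : NNReal}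
    (hΦ : LipschitzOnWith K₁ Φ (Icc α β)) (hψ : LipschitzOnWith K₂ ψ (Icc α β)) (hΦα : Φ α = 0)
    (hA : ∀ x ∈ Icc α β, |∑ i ∈ s with r i ≤ x, c i - Φ x| ≤ η)
    (hV : ∫ x in α..β, |deriv ψ x| ≤ V) :
    |∑ i ∈ s with r i ≤ β, c i * ψ (r i) - ∫ x in α..β, deriv Φ x * ψ x| ≤
      η * (|ψ β| + V) := by
  have hΦac : AbsolutelyContinuousOnInterval Φ α β :=
    LipschitzOnWith.absolutelyContinuousOnInterval (by rwa [uIcc_of_le hαβ])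
  have hψac : AbsolutelyContinuousOnInterval ψ α β :=
    LipschitzOnWith.absolutelyContinuousOnInterval (by rwa [uIcc_of_le hαβ])
  have hψi := hψac.intervalIntegrable_deriv
  have h1 := hψac.integral_mul_deriv_eq_deriv_mul hΦac
  have hpt : ∀ i ∈ s, r i ≤ β → ∫ x in α..β, (if r i ≤ x then deriv ψ x else 0) =
      ψ β - ψ (r i) := by
    intro i hi hiβ
    have hαi := hr i hi
    have e : (fun x => if r i ≤ x then deriv ψ x else 0) = (Ici (r i)).indicator (deriv ψ) := by
      funext x
      simp [indicator_apply]
    have hii : IntervalIntegrable ((Ici (r i)).indicator (deriv ψ)) volume α β := by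
      rw [intervalIntegrable_iff] at hψi ⊢
      exact hψi.indicator measurableSet_Ici
    have a1 : uIcc α (r i) ⊆ uIcc α β := by
      rw [uIcc_of_le hαi, uIcc_of_le hαβ]
      exact Icc_subset_Icc_right hiβ
    have a2 : uIcc (r i) β ⊆ uIcc α β := by
      rw [uIcc_of_le hiβ, uIcc_of_le hαβ]
      exact Icc_subset_Icc_left hαi
    rw [e, ← integral_add_adjacent_intervals (hii.mono_set a1) (hii.mono_set a2)]
    have z1 : ∫ x in α..r i, (Ici (r i)).indicator (deriv ψ) x = 0 := by
      rw [integral_of_le hαi, integral_Ioc_eq_integral_Ioo]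
      refine setIntegral_eq_zero_of_forall_eq_zero fun x hx => ?_
      exact indicator_of_notMem (by simpa using hx.2) _
    have z2 : ∫ x in r i..β, (Ici (r i)).indicator (deriv ψ) x = ∫ x in r i..β, deriv ψ x := by
      refine intervalIntegral.integral_congr fun x hx => ?_
      rw [uIcc_of_le hiβ] at hx
      exact indicator_of_mem (mem_Ici.2 hx.1) _
    rw [z1, z2, zero_add, (hψac.mono a2).integral_deriv_eq_sub]
  have hint : ∀ i ∈ s, IntervalIntegrable (fun x => if r i ≤ x then deriv ψ x else 0)
      volume α β := by
    intro i _
    have e : (fun x => if r i ≤ x then deriv ψ x else 0) = (Ici (r i)).indicator (deriv ψ) := by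
      funext x
      simp [indicator_apply]
    rw [e]
    rw [intervalIntegrable_iff] at hψi ⊢
    exact hψi.indicator measurableSet_Ici
  set A : ℝ → ℝ := fun x => ∑ i ∈ s with r i ≤ x, c i with hAdef
  have hAi : ∀ x ∈ Icc α β, A x * deriv ψ x =
      ∑ i ∈ s with r i ≤ β, c i * (if r i ≤ x then deriv ψ x else 0) := by
    intro x hx
    simp only [hAdef]
    rw [sum_mul]
    simp only [mul_ite, mul_zero]
    rw [← sum_filter, Finset.filter_filter]
    congr 1
    ext i
    simp only [mem_filter, and_congr_right_iff]
    exact fun _ => ⟨fun h => ⟨h.trans hx.2, h⟩, fun h => h.2⟩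
  have hAint : IntervalIntegrable (fun x => A x * deriv ψ x) volume α β := by
    refine IntervalIntegrable.congr (f := fun x =>
      ∑ i ∈ s with r i ≤ β, c i * (if r i ≤ x then deriv ψ x else 0)) ?_ ?_
    · intro x hx
      rw [uIoc_of_le hαβ] at hx
      exact (hAi x ⟨hx.1.le, hx.2⟩).symm
    · have := IntervalIntegrable.sum (Finset.filter (fun i => r i ≤ β) s)
        (f := fun i x => c i * (if r i ≤ x then deriv ψ x else 0)) fun i hi =>
        (hint i (mem_filter.1 hi).1).const_mul (c i)
      refine this.congr fun x _ => ?_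
      simp
  have hsum : ∑ i ∈ s with r i ≤ β, c i * ψ (r i) = A β * ψ β - ∫ x in α..β, A x * deriv ψ x := by
    have e1 : ∫ x in α..β, A x * deriv ψ x =
        ∑ i ∈ s with r i ≤ β, c i * (ψ β - ψ (r i)) := by
      rw [intervalIntegral.integral_congr (g := fun x =>
        ∑ i ∈ s with r i ≤ β, c i * (if r i ≤ x then deriv ψ x else 0)) fun x hx => by
          rw [uIcc_of_le hαβ] at hx
          exact hAi x hx, intervalIntegral.integral_finsetSum fun i hi =>
        (hint i (mem_filter.1 hi).1).const_mul _]
      refine sum_congr rfl fun i hi => ?_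
      rw [intervalIntegral.integral_const_mul, hpt i (mem_filter.1 hi).1
        (mem_filter.1 hi).2]
    rw [e1]
    simp only [hAdef]
    rw [sum_mul, ← sum_sub_distrib]
    exact sum_congr rfl fun i _ => by ring
  have hΦψ : IntervalIntegrable (fun x => Φ x * deriv ψ x) volume α β :=
    hψi.continuousOn_mul hΦac.continuousOn
  have h2 : ∫ x in α..β, deriv Φ x * ψ x = Φ β * ψ β - ∫ x in α..β, Φ x * deriv ψ x := by
    have e1 : ∫ x in α..β, deriv Φ x * ψ x = ∫ x in α..β, ψ x * deriv Φ x :=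
      intervalIntegral.integral_congr fun x _ => mul_comm _ _
    have e2 : ∫ x in α..β, deriv ψ x * Φ x = ∫ x in α..β, Φ x * deriv ψ x :=
      intervalIntegral.integral_congr fun x _ => mul_comm _ _
    rw [e1, h1, e2, hΦα]
    ring
  have h3 : ∑ i ∈ s with r i ≤ β, c i * ψ (r i) - ∫ x in α..β, deriv Φ x * ψ x =
      (A β - Φ β) * ψ β - ∫ x in α..β, (A x - Φ x) * deriv ψ x := by
    have e : ∫ x in α..β, (A x - Φ x) * deriv ψ x =
        (∫ x in α..β, A x * deriv ψ x) - ∫ x in α..β, Φ x * deriv ψ x := by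
      rw [← intervalIntegral.integral_sub hAint hΦψ]
      exact intervalIntegral.integral_congr fun x _ => sub_mul _ _ _
    rw [hsum, h2, e]
    ring
  rw [h3]
  have h4 : |∫ x in α..β, (A x - Φ x) * deriv ψ x| ≤ η * V := by
    calc |∫ x in α..β, (A x - Φ x) * deriv ψ x| ≤ ∫ x in α..β, η * |deriv ψ x| := by
          rw [← norm_eq_abs]
          refine intervalIntegral.norm_integral_le_of_norm_le hαβ (ae_of_all _ fun x hx => ?_)
            (hψi.abs.const_mul η)
          rw [norm_eq_abs, abs_mul]
          exact mul_le_mul_of_nonneg_right (hA x ⟨hx.1.le, hx.2⟩) (abs_nonneg _)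
      _ = η * ∫ x in α..β, |deriv ψ x| := intervalIntegral.integral_const_mul _ _
      _ ≤ η * V := by gcongr
  have h5 : |(A β - Φ β) * ψ β| ≤ η * |ψ β| := by
    rw [abs_mul]
    exact mul_le_mul_of_nonneg_right (hA β ⟨hαβ, le_rfl⟩) (abs_nonneg _)
  calc _ ≤ |(A β - Φ β) * ψ β| + |∫ x in α..β, (A x - Φ x) * deriv ψ x| := abs_sub _ _
    _ ≤ _ := by linarith

theorem integral_abs_deriv_le {ψ : ℝ → ℝ} {α β : ℝ} (hαβ : α ≤ β) {K : NNReal}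
    (hψ : LipschitzOnWith K ψ (Icc α β)) : ∫ x in α..β, |deriv ψ x| ≤ K * (β - α) := by
  have h : ∀ x ∈ Ioo α β, |deriv ψ x| ≤ K := fun x hx => by
    rw [← norm_eq_abs]
    exact norm_deriv_le_of_lipschitzOn (Icc_mem_nhds hx.1 hx.2) hψ
  have h2 : |(∫ x in α..β, |deriv ψ x|)| ≤ K * |β - α| := by
    have := intervalIntegral.norm_integral_le_of_norm_le_const_ae (a := α) (b := β) (C := K)
      (f := fun x => |deriv ψ x|) (by
        have hne : ∀ᵐ x : ℝ, x ≠ β := by simp [ae_iff, measure_singleton]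
        filter_upwards [hne] with x hx hx'
        rw [uIoc_of_le hαβ] at hx'
        rw [norm_eq_abs, abs_abs]
        exact h x ⟨hx'.1, lt_of_le_of_ne hx'.2 hx⟩)
    rwa [norm_eq_abs] at this
  rw [abs_of_nonneg (sub_nonneg.2 hαβ)] at h2
  exact (le_abs_self _).trans h2

/-! ### Sums over square-free numbers supported on a finite set of primes -/

/-- `∑ log p` over `p ∈ t`. -/
def logW (t : Finset ℕ) : ℝ := ∑ p ∈ t, log p

/-- `∑ w(t) k(u - log t)` over subsets `t` of `S`. -/
def sieveOp (w : ℕ → ℝ) (k : ℝ → ℝ) (S : Finset ℕ) (u : ℝ) : ℝ :=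
  ∑ t ∈ S.powerset, (∏ p ∈ t, w p) * k (u - logW t)

theorem logW_nonneg (t : Finset ℕ) : 0 ≤ logW t :=
  Finset.sum_nonneg fun p _ => log_natCast_nonneg p

theorem logW_insert {p : ℕ} {t : Finset ℕ} (hp : p ∉ t) :
    logW (insert p t) = log p + logW t := Finset.sum_insert hp

theorem sum_powerset_insert_eq {S : Finset ℕ} {p : ℕ} (hp : p ∉ S) (F : Finset ℕ → ℝ) :
    ∑ t ∈ (insert p S).powerset, F t = ∑ t ∈ S.powerset, (F t + F (insert p t)) := by
  rw [Finset.sum_powerset_insert hp, sum_add_distrib]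

theorem sieveOp_insert (w : ℕ → ℝ) (k : ℝ → ℝ) {S : Finset ℕ} {p : ℕ} (hp : p ∉ S) (u : ℝ) :
    sieveOp w k (insert p S) u = sieveOp w k S u + w p * sieveOp w k S (u - log p) := by
  rw [sieveOp, sum_powerset_insert_eq hp, sum_add_distrib, sieveOp, sieveOp, mul_sum]
  congr 1
  refine sum_congr rfl fun t ht => ?_
  have hpt : p ∉ t := fun h => hp (mem_powerset.1 ht h)
  rw [prod_insert hpt, logW_insert hpt, sub_add_eq_sub_sub]
  ring

theorem sieveOp_of_neg (w : ℕ → ℝ) {k : ℝ → ℝ} (hk : ∀ v, v < 0 → k v = 0) (S : Finset ℕ) {u : ℝ}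
    (hu : u < 0) : sieveOp w k S u = 0 :=
  Finset.sum_eq_zero fun t _ => by rw [hk _ (by linarith [logW_nonneg t]), mul_zero]

/-- Buchstab's identity. -/
theorem sieveOp_primesBelow (w : ℕ → ℝ) (k : ℝ → ℝ) (u : ℝ) {M N : ℕ} (hMN : M ≤ N) :
    sieveOp w k N.primesBelow u = sieveOp w k M.primesBelow u +
      ∑ p ∈ (Finset.Ico M N).filter Nat.Prime,
        w p * sieveOp w k p.primesBelow (u - log p) := by
  induction N, hMN using Nat.le_induction with
  | base => simp
  | succ N hN ih =>
    have e : (Finset.Ico M (N + 1)).filter Nat.Prime =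
        if N.Prime then insert N ((Finset.Ico M N).filter Nat.Prime)
          else (Finset.Ico M N).filter Nat.Prime := by
      rw [← Finset.insert_Ico_right_eq_Ico_add_one hN, Finset.filter_insert]
    rw [Nat.primesBelow_succ, e]
    split_ifs with hp
    · rw [sieveOp_insert w k (fun h => (Nat.lt_of_mem_primesBelow h).false), ih, Finset.sum_insert (by simp)]
      ring
    · exact ih

/-! ### Weights of dimension two -/

/-- `w` satisfies `∑_{p ≤ e^r} w(p) log p = 2 r + O(M)`. -/
structure MertensWeight (w : ℕ → ℝ) (M : ℝ) : Prop where
  nonneg : ∀ p, 0 ≤ w p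
  bound : ∀ r : ℝ, 0 ≤ r →
    |∑ p ∈ (⌊exp r⌋₊ + 1).primesBelow, w p * log p - 2 * r| ≤ M

theorem log_le_iff_lt_floor {p : ℕ} (hp : 0 < p) (r : ℝ) :
    log p ≤ r ↔ p < ⌊exp r⌋₊ + 1 := by
  rw [Nat.lt_succ_iff, Nat.le_floor_iff (exp_pos r).le,
    log_le_iff_le_exp (by exact_mod_cast hp)]

theorem MertensWeight.M_nonneg {w : ℕ → ℝ} {M : ℝ} (hw : MertensWeight w M) : 0 ≤ M :=
  (abs_nonneg _).trans (hw.bound 0 le_rfl)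

theorem MertensWeight.sum_le {w : ℕ → ℝ} {M : ℝ} (hw : MertensWeight w M) {S : Finset ℕ}
    (hS : ∀ p ∈ S, p.Prime) {r : ℝ} (hr : 0 ≤ r) :
    ∑ p ∈ S with log (p : ℕ) ≤ r, w p * log p ≤ 2 * r + M := by
  have h1 := (abs_le.1 (hw.bound r hr)).2
  refine le_trans (sum_le_sum_of_subset_of_nonneg ?_ fun p _ _ =>
    mul_nonneg (hw.nonneg p) (log_natCast_nonneg p)) (by linarith)
  intro p hp
  obtain ⟨hp1, hp2⟩ := mem_filter.1 hp
  exact mem_primesBelow.2 ⟨(log_le_iff_lt_floor (hS p hp1).pos r).1 hp2, hS p hp1⟩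

theorem MertensWeight.abs_sum_Ico_sub_le {w : ℕ → ℝ} {M : ℝ} (hw : MertensWeight w M) {m N : ℕ}
    (hm : 1 ≤ m) {u : ℝ} (hu : log m ≤ u) (hN : exp u < N) :
    |∑ p ∈ ((Finset.Ico m N).filter Nat.Prime).filter (fun p : ℕ => log p ≤ u),
      w p * log p - 2 * (u - log m)| ≤ 2 * M + 2 := by
  have hm0 : (0 : ℝ) < m := by exact_mod_cast hm
  have hu0 : 0 ≤ u := (log_natCast_nonneg m).trans hu
  have h1 := hw.bound u hu0
  have hbelow : |∑ p ∈ m.primesBelow, w p * log p - 2 * log m| ≤ M + 2 := by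
    rcases Nat.lt_or_ge m 2 with h2 | h2
    · have hm1 : m = 1 := by lia
      subst hm1
      have := hw.M_nonneg
      simp only [Nat.primesBelow_one, Finset.sum_empty, Nat.cast_one, Real.log_one, mul_zero,
        sub_zero, abs_zero]
      linarith
    · have hm1 : (1 : ℝ) ≤ ((m - 1 : ℕ) : ℝ) := by exact_mod_cast (by lia : 1 ≤ m - 1)
      have h3 := hw.bound (log ((m - 1 : ℕ) : ℝ)) (log_natCast_nonneg _)
      rw [exp_log (by linarith), Nat.floor_natCast, Nat.sub_add_cancel (by lia)] at h3
      have h4 : log ((m - 1 : ℕ) : ℝ) ≤ log m :=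
        log_le_log (by linarith) (by exact_mod_cast Nat.sub_le m 1)
      have h5 : log m ≤ log ((m - 1 : ℕ) : ℝ) + 1 := by
        have : log m ≤ log (2 * ((m - 1 : ℕ) : ℝ)) := by
          refine log_le_log hm0 ?_
          exact_mod_cast (by lia : m ≤ 2 * (m - 1))
        rw [Real.log_mul (by norm_num) (by linarith)] at this
        linarith [Real.log_two_lt_d9]
      rw [abs_le] at h3 ⊢
      constructor <;> linarith [h3.1, h3.2]
  have hsplit : ∑ p ∈ (⌊exp u⌋₊ + 1).primesBelow, w p * log p =
      ∑ p ∈ m.primesBelow, w p * log p +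
      ∑ p ∈ ((Finset.Ico m N).filter Nat.Prime).filter (fun p : ℕ => log p ≤ u),
        w p * log p := by
    rw [← Finset.sum_union]
    · refine sum_congr ?_ fun _ _ => rfl
      ext p
      simp only [Finset.mem_union, mem_primesBelow, mem_filter, Finset.mem_Ico]
      constructor
      · rintro ⟨h2, hp⟩
        have h3 := (log_le_iff_lt_floor hp.pos u).2 h2
        rcases Nat.lt_or_ge p m with h4 | h4
        · exact Or.inl ⟨h4, hp⟩
        · refine Or.inr ⟨⟨⟨h4, ?_⟩, hp⟩, h3⟩
          rw [log_le_iff_le_exp (by exact_mod_cast hp.pos)] at h3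
          exact_mod_cast h3.trans_lt hN
      · rintro (⟨h4, hp⟩ | ⟨⟨⟨_, _⟩, hp⟩, h3⟩)
        · refine ⟨(log_le_iff_lt_floor hp.pos u).1 (le_trans ?_ hu), hp⟩
          exact log_le_log (by exact_mod_cast hp.pos) (by exact_mod_cast h4.le)
        · exact ⟨(log_le_iff_lt_floor hp.pos u).1 h3, hp⟩
    · rw [Finset.disjoint_left]
      intro p hp1 hp2
      have := Nat.lt_of_mem_primesBelow hp1
      have := (Finset.mem_Ico.1 (mem_filter.1 (mem_filter.1 hp2).1).1).1
      lia
  rw [hsplit] at h1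
  rw [abs_le] at h1 hbelow ⊢
  constructor <;> linarith [h1.1, h1.2, hbelow.1, hbelow.2]

theorem lipschitzOnWith_of_hasDerivAt {ψ ψ' : ℝ → ℝ} {α β K : ℝ}
    (hd : ∀ x ∈ Icc α β, HasDerivAt ψ (ψ' x) x) (hK : ∀ x ∈ Icc α β, |ψ' x| ≤ K) :
    LipschitzOnWith K.toNNReal ψ (Icc α β) := by
  refine (convex_Icc α β).lipschitzOnWith_of_nnnorm_hasDerivWithin_le (f' := ψ')
    (fun x hx => (hd x hx).hasDerivWithinAt) fun x hx => ?_
  rw [← NNReal.coe_le_coe, coe_nnnorm, norm_eq_abs]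
  exact (hK x hx).trans (Real.le_coe_toNNReal K)

theorem MertensWeight.abs_sum_sub_integral_le {w : ℕ → ℝ} {M : ℝ} (hw : MertensWeight w M)
    {m N : ℕ} (hm : 1 ≤ m) {u : ℝ} (hu : log m ≤ u) (hN : exp u < N) {ψ : ℝ → ℝ}
    {K : NNReal} (hψ : LipschitzOnWith K ψ (Icc (log m) u)) {V : ℝ}
    (hV : ∫ x in log m..u, |deriv ψ x| ≤ V) :
    |∑ p ∈ ((Finset.Ico m N).filter Nat.Prime).filter (fun p : ℕ => log p ≤ u),
      w p * log p * ψ (log p) - 2 * ∫ x in log m..u, ψ x| ≤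
        (2 * M + 2) * (|ψ u| + V) := by
  have hm0 : (0 : ℝ) < m := by exact_mod_cast hm
  have hd : ∀ x : ℝ, HasDerivAt (fun x => 2 * (x - log m)) 2 x := fun x => by
    simpa using ((hasDerivAt_id x).sub_const (log m)).const_mul 2
  have key := SelbergSieve.abs_sum_sub_integral_le ((Finset.Ico m N).filter Nat.Prime)
    (fun p => w p * log p) (fun p => log p) hu
    (by linarith [hw.M_nonneg] : 0 ≤ 2 * M + 2)
    (fun p hp => log_le_log hm0 (by
      exact_mod_cast (Finset.mem_Ico.1 (mem_filter.1 hp).1).1))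
    (Φ := fun x => 2 * (x - log m)) (lipschitzOnWith_of_hasDerivAt (K := 2)
      (fun x _ => hd x) (fun x _ => by simp)) hψ (by simp)
    (fun x hx => hw.abs_sum_Ico_sub_le hm hx.1
      ((Real.exp_le_exp.2 hx.2).trans_lt hN)) hV
  have e : ∫ x in log m..u, deriv (fun x => 2 * (x - log m)) x * ψ x =
      2 * ∫ x in log m..u, ψ x := by
    rw [← intervalIntegral.integral_const_mul]
    refine intervalIntegral.integral_congr fun x _ => ?_
    rw [(hd x).deriv]
  rwa [e] at key

theorem integral_abs_deriv_eq_of_nonneg {ψ ψ' : ℝ → ℝ} {α β : ℝ} (hαβ : α ≤ β)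
    (hd : ∀ x ∈ Icc α β, HasDerivAt ψ (ψ' x) x) (h0 : ∀ x ∈ Icc α β, 0 ≤ ψ' x)
    (hc : ContinuousOn ψ' (Icc α β)) : ∫ x in α..β, |deriv ψ x| = ψ β - ψ α := by
  rw [← uIcc_of_le hαβ] at hd h0 hc
  rw [← integral_eq_sub_of_hasDerivAt hd hc.intervalIntegrable]
  refine intervalIntegral.integral_congr fun x hx => ?_
  rw [(hd x hx).deriv, abs_of_nonneg (h0 x hx)]

theorem MertensWeight.exists_sum_exp_le {w : ℕ → ℝ} {M : ℝ} (hw : MertensWeight w M) {δ : ℝ}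
    (hδ : 0 < δ) : ∃ C : ℝ, 0 < C ∧ ∀ (S : Finset ℕ), (∀ p ∈ S, p.Prime) → ∀ r : ℝ, 0 ≤ r →
      ∑ p ∈ S with log (p : ℕ) ≤ r, w p * log p * exp (-δ * (r - log p)) ≤ C := by
  have hM := hw.M_nonneg
  refine ⟨2 / δ + (2 * M + 2) * 2, by positivity, fun S hS r hr => ?_⟩
  obtain ⟨N, hN⟩ := exists_nat_gt (exp r)
  have hd : ∀ x ∈ Icc (log (1 : ℕ)) r, HasDerivAt (fun x => exp (-δ * (r - x)))
      (exp (-δ * (r - x)) * δ) x := fun x _ => by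
    have h1 : HasDerivAt (fun x => -δ * (r - x)) (-δ * (-1)) x :=
      ((hasDerivAt_id x).const_sub r).const_mul (-δ)
    rw [mul_neg_one, neg_neg] at h1
    exact h1.exp
  have hle : ∀ x ∈ Icc (log (1 : ℕ)) r, exp (-δ * (r - x)) ≤ 1 := fun x hx => by
    rw [Real.exp_le_one_iff]
    have := hx.2
    nlinarith
  have h0r : log (1 : ℕ) ≤ r := by simpa using hr
  have key := hw.abs_sum_sub_integral_le le_rfl h0r hN
    (lipschitzOnWith_of_hasDerivAt (K := δ) hd fun x hx => by
      rw [abs_of_pos (by positivity)]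
      have := hle x hx
      nlinarith)
    (integral_abs_deriv_eq_of_nonneg h0r hd (fun x _ => by positivity)
      (Continuous.continuousOn (by fun_prop))).le
  have hint : ∫ x in log (1 : ℕ)..r, exp (-δ * (r - x)) ≤ 1 / δ := by
    have h1 : ∫ x in log (1 : ℕ)..r, exp (-δ * (r - x)) * δ =
        exp (-δ * (r - r)) - exp (-δ * (r - log (1 : ℕ))) :=
      integral_eq_sub_of_hasDerivAt
        (fun x hx => hd x (by rwa [uIcc_of_le h0r] at hx))
        (Continuous.intervalIntegrable (by fun_prop) _ _)
    rw [intervalIntegral.integral_mul_const, sub_self, mul_zero, Real.exp_zero] at h1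
    rw [le_div_iff₀ hδ, h1]
    linarith [exp_pos (-δ * (r - log (1 : ℕ)))]
  have h2 := (abs_le.1 key).2
  have h3 := exp_pos (-δ * (r - log (1 : ℕ)))
  simp only [sub_self, mul_zero, Real.exp_zero, abs_one] at h2
  have h4 : (2 * M + 2) * (1 + (1 - exp (-δ * (r - log (1 : ℕ))))) ≤
      (2 * M + 2) * 2 := by gcongr; linarith
  have h5 : 2 * (1 / δ) = 2 / δ := by ring
  refine le_trans (sum_le_sum_of_subset_of_nonneg (t :=
    ((Finset.Ico 1 N).filter Nat.Prime).filter (fun p : ℕ => log p ≤ r)) ?_ fun p _ _ =>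
    mul_nonneg (mul_nonneg (hw.nonneg p) (log_natCast_nonneg p)) (exp_pos _).le)
    ((sub_le_iff_le_add.1 h2).trans ?_)
  · intro p hp
    obtain ⟨hp1, hp2⟩ := mem_filter.1 hp
    have hpp := hS p hp1
    refine mem_filter.2 ⟨mem_filter.2 ⟨Finset.mem_Ico.2 ⟨hpp.one_le, ?_⟩, hpp⟩, hp2⟩
    rw [log_le_iff_le_exp (by exact_mod_cast hpp.pos)] at hp2
    exact_mod_cast hp2.trans_lt hN
  · have h6 := mul_le_mul_of_nonneg_left hint (zero_le_two (α := ℝ))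
    rw [h5] at h6
    exact (add_le_add h4 h6).trans_eq (add_comm _ _)

theorem MertensWeight.exists_sum_le_log {w : ℕ → ℝ} {M : ℝ} (hw : MertensWeight w M) :
    ∃ C : ℝ, 0 < C ∧ ∀ (S : Finset ℕ), (∀ p ∈ S, p.Prime) → ∀ r : ℝ, 0 ≤ r →
      ∑ p ∈ S with log (p : ℕ) ≤ r, w p ≤ 2 * log (1 + r) + C := by
  have hM := hw.M_nonneg
  set α := log (2 : ℕ) with hα
  have hα1 : 1 / 2 < α := by
    rw [hα, Nat.cast_ofNat]
    linarith [Real.log_two_gt_d9]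
  have hα2 : α < 1 := by
    rw [hα, Nat.cast_ofNat]
    linarith [Real.log_two_lt_d9]
  refine ⟨2 * log 2 + (2 * M + 2) * 2, by positivity, fun S hS r hr => ?_⟩
  rcases lt_or_ge r α with hlt | hge
  · have : ∑ p ∈ S with log (p : ℕ) ≤ r, w p = 0 := by
      refine Finset.sum_eq_zero fun p hp => ?_
      obtain ⟨hp1, hp2⟩ := mem_filter.1 hp
      have : α ≤ log p := log_le_log (by norm_num) (by exact_mod_cast (hS p hp1).two_le)
      linarith
    rw [this]
    have := Real.log_nonneg (show 1 ≤ 1 + r by linarith)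
    positivity
  obtain ⟨N, hN⟩ := exists_nat_gt (exp r)
  have hx0 : ∀ x ∈ Icc α r, 0 < x := fun x hx => by linarith [hx.1]
  have hd : ∀ x ∈ Icc α r, HasDerivAt (fun x : ℝ => x⁻¹) (-(x ^ 2)⁻¹) x := fun x hx =>
    hasDerivAt_inv (hx0 x hx).ne'
  have hd' : ∀ x ∈ Icc α r, HasDerivAt (fun x : ℝ => -x⁻¹) ((x ^ 2)⁻¹) x := fun x hx => by
    have := (hd x hx).neg
    rwa [neg_neg] at this
  have hV : ∫ x in α..r, |deriv (fun x : ℝ => x⁻¹) x| = -r⁻¹ - -α⁻¹ := by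
    rw [← integral_abs_deriv_eq_of_nonneg hge hd' (fun x _ => by positivity)
      (ContinuousOn.inv₀ (by fun_prop) fun x hx => pow_ne_zero _ (hx0 x hx).ne')]
    refine intervalIntegral.integral_congr fun x hx => ?_
    rw [uIcc_of_le hge] at hx
    rw [(hd x hx).deriv, (hd' x hx).deriv, abs_neg]
  have key := hw.abs_sum_sub_integral_le one_le_two hge hN
    (lipschitzOnWith_of_hasDerivAt (K := (α ^ 2)⁻¹) hd fun x hx => by
      have := hx0 x hx
      have := hx.1
      rw [abs_neg, abs_of_pos (by positivity)]
      gcongr) hV.le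
  rw [integral_inv_of_pos (by linarith) (by linarith)] at key
  have h2 := (abs_le.1 key).2
  have h3 : |r⁻¹| + (-r⁻¹ - -α⁻¹) ≤ 2 := by
    rw [abs_of_pos (inv_pos.2 (by linarith))]
    have : α⁻¹ ≤ 2 := by
      rw [inv_le_comm₀ (by linarith) two_pos]
      linarith
    linarith
  have h4 : (2 * M + 2) * (|r⁻¹| + (-r⁻¹ - -α⁻¹)) ≤ (2 * M + 2) * 2 := by gcongr
  have h5 : log (r / α) ≤ log 2 + log (1 + r) := by
    rw [← Real.log_mul (by norm_num) (by linarith)]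
    refine log_le_log (div_pos (by linarith) (by linarith)) ?_
    rw [div_le_iff₀ (by linarith)]
    nlinarith
  refine le_trans (sum_le_sum_of_subset_of_nonneg (t :=
    ((Finset.Ico 2 N).filter Nat.Prime).filter (fun p : ℕ => log p ≤ r)) ?_
    fun p _ _ => hw.nonneg p) ?_
  · intro p hp
    obtain ⟨hp1, hp2⟩ := mem_filter.1 hp
    have hpp := hS p hp1
    refine mem_filter.2 ⟨mem_filter.2 ⟨Finset.mem_Ico.2 ⟨hpp.two_le, ?_⟩, hpp⟩, hp2⟩
    rw [log_le_iff_le_exp (by exact_mod_cast hpp.pos)] at hp2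
    exact_mod_cast hp2.trans_lt hN
  · have e : ∑ p ∈ ((Finset.Ico 2 N).filter Nat.Prime).filter (fun p : ℕ => log p ≤ r), w p =
        ∑ p ∈ ((Finset.Ico 2 N).filter Nat.Prime).filter (fun p : ℕ => log p ≤ r),
          w p * log p * (log p)⁻¹ := by
      refine sum_congr rfl fun p hp => ?_
      have hp2 := (Finset.mem_Ico.1 (mem_filter.1 (mem_filter.1 hp).1).1).1
      have : 0 < log p := log_pos (by exact_mod_cast hp2)
      rw [mul_assoc, mul_inv_cancel₀ this.ne', mul_one]
    rw [e]
    rw [hα] at h5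
    linarith

/-! ### Sums of multiplicative weights -/

/-- The kernel `e^{-δ v}` on `v ≥ 0`. -/
def expStep (δ v : ℝ) : ℝ := if 0 ≤ v then exp (-δ * v) else 0

theorem expStep_of_nonneg (δ : ℝ) {v : ℝ} (hv : 0 ≤ v) : expStep δ v = exp (-δ * v) :=
  if_pos hv

theorem expStep_of_neg (δ : ℝ) {v : ℝ} (hv : v < 0) : expStep δ v = 0 := if_neg (not_le.2 hv)

theorem expStep_nonneg (δ v : ℝ) : 0 ≤ expStep δ v := by
  rw [expStep]
  split_ifs <;> positivity

theorem expStep_zero (v : ℝ) : expStep 0 v = if 0 ≤ v then 1 else 0 := by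
  simp [expStep]

theorem prod_w_nonneg {w : ℕ → ℝ} (hw : ∀ p, 0 ≤ w p) (t : Finset ℕ) : 0 ≤ ∏ p ∈ t, w p :=
  prod_nonneg fun p _ => hw p

theorem log_le_logW {p : ℕ} {t : Finset ℕ} (hp : p ∈ t) : log p ≤ logW t :=
  Finset.single_le_sum (f := fun p : ℕ => log p) (fun p _ => log_natCast_nonneg p) hp

theorem MertensWeight.exists_sieveOp_step_le {w : ℕ → ℝ} {M : ℝ} (hw : MertensWeight w M) :
    ∃ C : ℝ, 0 < C ∧ ∀ (S : Finset ℕ), (∀ p ∈ S, p.Prime) → ∀ r : ℝ, 0 ≤ r →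
      sieveOp w (expStep 0) S r ≤ C * (1 + r) ^ 2 := by
  obtain ⟨C, hC, H⟩ := hw.exists_sum_le_log
  refine ⟨exp C, exp_pos _, fun S hS r hr => ?_⟩
  set S' := S.filter fun p : ℕ => log p ≤ r with hS'
  have h1 : sieveOp w (expStep 0) S r ≤ ∑ t ∈ S'.powerset, ∏ p ∈ t, w p := by
    rw [sieveOp, ← Finset.sum_filter_add_sum_filter_not S.powerset (fun t => t ⊆ S')]
    have z : ∑ t ∈ S.powerset with ¬t ⊆ S', (∏ p ∈ t, w p) * expStep 0 (r - logW t) = 0 := by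
      refine Finset.sum_eq_zero fun t ht => ?_
      obtain ⟨ht1, ht2⟩ := mem_filter.1 ht
      rw [Finset.not_subset] at ht2
      obtain ⟨p, hp, hp'⟩ := ht2
      have : r < log p := by
        by_contra hle
        exact hp' (mem_filter.2 ⟨mem_powerset.1 ht1 hp, not_lt.1 hle⟩)
      rw [expStep_of_neg _ (by linarith [log_le_logW hp]), mul_zero]
    rw [z, add_zero]
    refine (sum_le_sum (g := fun t => ∏ p ∈ t, w p) fun t _ => ?_).trans
      (sum_le_sum_of_subset_of_nonneg (fun t ht =>
        mem_powerset.2 (mem_filter.1 ht).2) fun t _ _ => prod_w_nonneg hw.nonneg t)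
    refine mul_le_of_le_one_right (prod_w_nonneg hw.nonneg t) ?_
    rw [expStep_zero]
    split_ifs <;> norm_num
  have h2 : ∑ t ∈ S'.powerset, ∏ p ∈ t, w p = ∏ p ∈ S', (1 + w p) := by
    rw [Finset.prod_one_add]
  have h3 : ∏ p ∈ S', (1 + w p) ≤ exp (∑ p ∈ S', w p) := by
    rw [Real.exp_sum]
    refine prod_le_prod (fun p _ => by linarith [hw.nonneg p]) fun p _ => ?_
    linarith [add_one_le_exp (w p)]
  have h4 := Real.exp_le_exp.2 (H S hS r hr)
  have h5 : exp (2 * log (1 + r) + C) = exp C * (1 + r) ^ 2 := by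
    rw [Real.exp_add, two_mul, Real.exp_add, exp_log (by linarith)]
    ring
  rw [h2] at h1
  linarith

theorem sum_powerset_sum_mem (S : Finset ℕ) (F : ℕ → Finset ℕ → ℝ) :
    ∑ t ∈ S.powerset, ∑ p ∈ t, F p t =
      ∑ p ∈ S, ∑ t ∈ (S.erase p).powerset, F p (insert p t) := by
  have h1 : ∀ t ∈ S.powerset, ∑ p ∈ t, F p t = ∑ p ∈ S, if p ∈ t then F p t else 0 := by
    intro t ht
    rw [← sum_filter, Finset.filter_mem_eq_inter,
      Finset.inter_eq_right.2 (mem_powerset.1 ht)]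
  rw [sum_congr rfl h1, Finset.sum_comm]
  refine sum_congr rfl fun p hp => ?_
  conv_lhs => rw [← Finset.insert_erase hp]
  rw [sum_powerset_insert_eq (notMem_erase p S)]
  refine sum_congr rfl fun t ht => ?_
  have : p ∉ t := fun h => notMem_erase p S (mem_powerset.1 ht h)
  simp [this]

theorem MertensWeight.exists_sieveOp_exp_le {w : ℕ → ℝ} {M : ℝ} (hw : MertensWeight w M) {δ : ℝ}
    (hδ : 0 < δ) : ∃ C : ℝ, 0 < C ∧ ∀ (S : Finset ℕ), (∀ p ∈ S, p.Prime) → ∀ r : ℝ, 0 ≤ r →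
      sieveOp w (expStep δ) S r ≤ C * (1 + r) := by
  obtain ⟨C₁, hC₁, H₁⟩ := hw.exists_sieveOp_step_le
  obtain ⟨C₂, hC₂, H₂⟩ := hw.exists_sum_exp_le hδ
  refine ⟨C₁ * (1 + 1 / δ + C₂), by positivity, fun S hS r hr => ?_⟩
  set D := sieveOp w (expStep δ) S r with hD
  set V := sieveOp w (expStep 0) S r with hV
  have hVle : V ≤ C₁ * (1 + r) ^ 2 := H₁ S hS r hr
  have hstep : ∀ v, expStep δ v ≤ expStep 0 v := fun v => by
    rcases le_or_gt 0 v with hv | hv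
    · rw [expStep_of_nonneg _ hv, expStep_of_nonneg _ hv]
      refine Real.exp_le_exp.2 ?_
      nlinarith
    · rw [expStep_of_neg _ hv, expStep_of_neg _ hv]
  have h1 : D ≤ V := sum_le_sum fun t _ =>
    mul_le_mul_of_nonneg_left (hstep _) (prod_w_nonneg hw.nonneg t)
  have h2 : r * D = ∑ t ∈ S.powerset, (∏ p ∈ t, w p) * ((r - logW t) * expStep δ (r - logW t)) +
      ∑ t ∈ S.powerset, ∑ p ∈ t, log p * ((∏ p ∈ t, w p) * expStep δ (r - logW t)) := by
    rw [hD, sieveOp, mul_sum, ← sum_add_distrib]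
    refine sum_congr rfl fun t _ => ?_
    rw [← sum_mul]
    change _ = _ + logW t * _
    ring
  have h3 : ∑ t ∈ S.powerset, (∏ p ∈ t, w p) * ((r - logW t) * expStep δ (r - logW t)) ≤
      1 / δ * V := by
    rw [hV, sieveOp, mul_sum]
    refine sum_le_sum fun t _ => ?_
    have : (r - logW t) * expStep δ (r - logW t) ≤ 1 / δ * expStep 0 (r - logW t) := by
      rcases le_or_gt 0 (r - logW t) with hv | hv
      · rw [expStep_of_nonneg _ hv, expStep_of_nonneg _ hv, neg_zero, zero_mul, Real.exp_zero,
          mul_one, neg_mul, Real.exp_neg, ← div_eq_mul_inv, div_le_iff₀ (exp_pos _),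
          one_div_mul_eq_div, le_div_iff₀ hδ]
        linarith [add_one_le_exp (δ * (r - logW t))]
      · rw [expStep_of_neg _ hv, expStep_of_neg _ hv]
        simp
    calc _ ≤ (∏ p ∈ t, w p) * (1 / δ * expStep 0 (r - logW t)) :=
          mul_le_mul_of_nonneg_left this (prod_w_nonneg hw.nonneg t)
      _ = _ := by ring
  have h4 : ∑ t ∈ S.powerset, ∑ p ∈ t, log p * ((∏ p ∈ t, w p) * expStep δ (r - logW t)) ≤
      C₂ * V := by
    rw [sum_powerset_sum_mem S fun p t => log p * ((∏ p ∈ t, w p) * expStep δ (r - logW t))]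
    calc _ ≤ ∑ p ∈ S, ∑ t ∈ S.powerset, (∏ q ∈ t, w q) *
          (w p * log p * expStep δ (r - logW t - log p)) := by
          refine sum_le_sum fun p _ => ?_
          refine (le_of_eq (sum_congr rfl fun t ht => ?_)).trans
            (sum_le_sum_of_subset_of_nonneg
              (Finset.powerset_mono.2 (Finset.erase_subset p S)) fun t _ _ => ?_)
          · have hpt : p ∉ t := fun h => notMem_erase p S (mem_powerset.1 ht h)
            rw [prod_insert hpt, logW_insert hpt,
              show r - (log p + logW t) = r - logW t - log p by ring]
            ring
          · have := prod_w_nonneg hw.nonneg t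
            have := hw.nonneg p
            have := log_natCast_nonneg p
            have := expStep_nonneg δ (r - logW t - log p)
            positivity
      _ = ∑ t ∈ S.powerset, (∏ q ∈ t, w q) *
          ∑ p ∈ S, w p * log p * expStep δ (r - logW t - log p) := by
          rw [Finset.sum_comm]
          refine sum_congr rfl fun t _ => ?_
          rw [mul_sum]
      _ ≤ ∑ t ∈ S.powerset, (∏ q ∈ t, w q) * (C₂ * expStep 0 (r - logW t)) := by
          refine sum_le_sum fun t _ =>
            mul_le_mul_of_nonneg_left ?_ (prod_w_nonneg hw.nonneg t)
          rcases le_or_gt 0 (r - logW t) with hv | hv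
          · rw [expStep_of_nonneg 0 hv, neg_zero, zero_mul, Real.exp_zero, mul_one]
            refine le_trans (le_of_eq ?_) (H₂ S hS (r - logW t) hv)
            rw [sum_filter]
            refine sum_congr rfl fun p _ => ?_
            rw [expStep]
            simp only [sub_nonneg]
            split_ifs <;> simp
          · rw [expStep_of_neg 0 hv, mul_zero]
            refine le_of_eq (show ∑ p ∈ S, _ = (0 : ℝ) from Finset.sum_eq_zero fun p _ => ?_)
            rw [expStep_of_neg _ (by linarith [log_natCast_nonneg p]), mul_zero]
      _ = C₂ * V := by
          rw [hV, sieveOp, mul_sum]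
          exact sum_congr rfl fun t _ => by ring
  have h5 : (1 + r) * D ≤ (1 + 1 / δ + C₂) * V := by
    rw [add_mul, one_mul, h2]
    linarith
  have h6 : (1 + 1 / δ + C₂) * V ≤ (1 + 1 / δ + C₂) * (C₁ * (1 + r) ^ 2) := by gcongr
  have h7 : (1 + r) * D ≤ (1 + r) * (C₁ * (1 + 1 / δ + C₂) * (1 + r)) := by
    calc _ ≤ _ := h5.trans h6
      _ = _ := by ring
  exact le_of_mul_le_mul_left h7 (by linarith)

/-! ### The densities as weights of dimension two -/

theorem MertensWeight.of_abs_sub_le {w w' : ℕ → ℝ} {M E : ℝ} (hw : MertensWeight w M)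
    (hw' : ∀ p, 0 ≤ w' p) (hE : ∀ S : Finset ℕ, (∀ p ∈ S, p.Prime) →
      ∑ p ∈ S, |w' p - w p| * log p ≤ E) : MertensWeight w' (M + E) := by
  refine ⟨hw', fun r hr => ?_⟩
  set S := (⌊exp r⌋₊ + 1).primesBelow
  have h1 := hw.bound r hr
  have h2 := hE S fun p hp => prime_of_mem_primesBelow hp
  have h3 : |∑ p ∈ S, w' p * log p - ∑ p ∈ S, w p * log p| ≤
      ∑ p ∈ S, |w' p - w p| * log p := by
    rw [← sum_sub_distrib]
    refine (abs_sum_le_sum_abs _ _).trans (le_of_eq (sum_congr rfl fun p _ => ?_))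
    rw [← sub_mul, abs_mul, abs_of_nonneg (log_natCast_nonneg p)]
  rw [abs_le] at *
  constructor <;> linarith [h1.1, h1.2, h3.1, h3.2]

theorem SieveHyp.mertensWeight_dens (H : SieveHyp h Hstar L c₀) :
    MertensWeight (dens h) (L + 3) := by
  have hset : ∀ r : ℝ, ∑ p ∈ (⌊exp r⌋₊ + 1).primesBelow, dens h p * log p =
      ∑ p ∈ (Finset.Icc 1 ⌊exp r⌋₊).filter Nat.Prime, h p * log p / p := by
    intro r
    refine sum_congr ?_ fun p _ => by rw [dens]; ring
    ext p
    simp only [mem_primesBelow, mem_filter, Finset.mem_Icc]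
    exact ⟨fun ⟨h1, h2⟩ => ⟨⟨h2.one_le, by lia⟩, h2⟩, fun ⟨⟨_, h1⟩, h2⟩ => ⟨by lia, h2⟩⟩
  refine ⟨H.dens_nonneg, fun r hr => ?_⟩
  have hlog3 : log 3 ≤ 3 / 2 := by
    rw [log_le_iff_le_exp (by norm_num)]
    have h1 : exp (3 / 2) = exp 1 * exp (1 / 2) := by
      rw [← Real.exp_add]
      norm_num
    rw [h1]
    nlinarith [Real.exp_one_gt_d9, add_one_le_exp (1 / 2 : ℝ)]
  rcases le_or_gt (log 3) r with h3 | h3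
  · rw [hset]
    have := H.first (exp r) (by rwa [← log_le_iff_le_exp (by norm_num)])
    rw [Real.log_exp] at this
    linarith
  · have h4 := H.first 3 le_rfl
    have h5 := hset (log 3)
    rw [exp_log (by norm_num)] at h5
    rw [← h5] at h4
    have h6 : ∑ p ∈ (⌊exp r⌋₊ + 1).primesBelow, dens h p * log p ≤
        ∑ p ∈ (⌊(3 : ℝ)⌋₊ + 1).primesBelow, dens h p * log p := by
      refine sum_le_sum_of_subset_of_nonneg (Nat.primesBelow_mono ?_) fun p _ _ =>
        mul_nonneg (H.dens_nonneg p) (log_natCast_nonneg p)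
      have : exp r ≤ 3 := by
        rw [← Real.le_log_iff_exp_le (by norm_num)]
        exact h3.le
      gcongr
    have h7 : 0 ≤ ∑ p ∈ (⌊exp r⌋₊ + 1).primesBelow, dens h p * log p :=
      Finset.sum_nonneg fun p _ => mul_nonneg (H.dens_nonneg p) (log_natCast_nonneg p)
    have := H.L_pos
    rw [abs_le] at *
    constructor <;> linarith [h4.2]

theorem SieveHyp.exists_sum_sq_le (H : SieveHyp h Hstar L c₀) :
    ∃ E : ℝ, 0 ≤ E ∧ ∀ S : Finset ℕ, (∀ p ∈ S, p.Prime) →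
      ∑ p ∈ S, dens h p ^ 2 * (p : ℝ) ^ c₀ * log p ≤ E := by
  have hs := H.summable_bound
  have hc := H.c_pos
  refine ⟨(∑' n : ℕ, if n.Prime then 2 * (dens h n ^ 2 * (n : ℝ) ^ (2 * c₀)) else 0) / c₀,
    div_nonneg (tsum_nonneg fun n => by split_ifs <;> positivity) hc.le, fun S hS => ?_⟩
  rw [le_div_iff₀ hc, sum_mul]
  refine le_trans (sum_le_sum fun p hp => ?_)
    (hs.sum_le_tsum S fun n _ => by split_ifs <;> positivity)
  rw [if_pos (hS p hp)]
  have hp0 : (0 : ℝ) < p := by exact_mod_cast (hS p hp).pos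
  have h1 := Real.log_le_rpow_div hp0.le hc
  rw [le_div_iff₀ hc] at h1
  have h2 : (p : ℝ) ^ c₀ * (p : ℝ) ^ c₀ = (p : ℝ) ^ (2 * c₀) := by
    rw [← Real.rpow_add hp0, two_mul]
  have h3 : 0 ≤ dens h p ^ 2 * (p : ℝ) ^ c₀ := by positivity
  calc dens h p ^ 2 * (p : ℝ) ^ c₀ * log p * c₀
      = dens h p ^ 2 * (p : ℝ) ^ c₀ * (log p * c₀) := by ring
    _ ≤ dens h p ^ 2 * (p : ℝ) ^ c₀ * (p : ℝ) ^ c₀ := mul_le_mul_of_nonneg_left h1 h3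
    _ = dens h p ^ 2 * (p : ℝ) ^ (2 * c₀) := by rw [mul_assoc, h2]
    _ ≤ _ := by
      have : 0 ≤ dens h p ^ 2 * (p : ℝ) ^ (2 * c₀) := by positivity
      linarith

theorem SieveHyp.exists_mertens_of_le (H : SieveHyp h Hstar L c₀) {w : ℕ → ℝ} (hw : ∀ p, 0 ≤ w p)
    {K : ℝ} (hK : ∀ p, p.Prime → |w p - dens h p| ≤ K * (dens h p ^ 2 * (p : ℝ) ^ c₀)) :
    ∃ M, MertensWeight w M := by
  obtain ⟨E, hE, HE⟩ := H.exists_sum_sq_le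
  refine ⟨_, H.mertensWeight_dens.of_abs_sub_le (E := |K| * E) hw fun S hS => ?_⟩
  refine le_trans (sum_le_sum (g := fun p : ℕ => |K| * (dens h p ^ 2 * (p : ℝ) ^ c₀ *
    log p)) fun p hp => ?_) ?_
  · have h1 := hK p (hS p hp)
    have h2 : K * (dens h p ^ 2 * (p : ℝ) ^ c₀) ≤ |K| * (dens h p ^ 2 * (p : ℝ) ^ c₀) :=
      mul_le_mul_of_nonneg_right (le_abs_self K) (by positivity)
    calc _ ≤ |K| * (dens h p ^ 2 * (p : ℝ) ^ c₀) * log p :=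
          mul_le_mul_of_nonneg_right (h1.trans h2) (log_natCast_nonneg p)
      _ = _ := by ring
  · rw [← mul_sum]
    exact mul_le_mul_of_nonneg_left (HE S hS) (abs_nonneg K)

theorem one_le_prime_rpow {p : ℕ} (hp : p.Prime) {δ : ℝ} (hδ : 0 ≤ δ) : 1 ≤ (p : ℝ) ^ δ :=
  Real.one_le_rpow (by exact_mod_cast hp.one_le) hδ

theorem SieveHyp.exists_mertens_dualDens (H : SieveHyp h Hstar L c₀) :
    ∃ M, MertensWeight (dualDens h) M := by
  refine H.exists_mertens_of_le (K := 1) H.dualDens_nonneg fun p hp => ?_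
  have h1 := H.dens_sub_dualDens p
  have h2 := H.dens_mul_dualDens_le p
  have h3 := H.dualDens_le p
  have h4 := one_le_prime_rpow hp H.c_pos.le
  rw [abs_sub_comm, abs_of_nonneg (by linarith), h1, one_mul]
  nlinarith [sq_nonneg (dens h p)]

theorem SieveHyp.exists_delta (H : SieveHyp h Hstar L c₀) :
    ∃ δ ρ : ℝ, 0 < δ ∧ δ ≤ c₀ ∧ ρ < 1 ∧ ∀ p : ℕ, p.Prime → dens h p * (p : ℝ) ^ δ ≤ ρ := by
  have hc := H.c_pos
  have h1 := H.summable_dens_sq_rpow.tendsto_cofinite_zero.eventually_lt_const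
    (show (0 : ℝ) < (1 / 2) ^ 2 by norm_num)
  rw [Filter.eventually_cofinite] at h1
  obtain ⟨Q, hQ⟩ := (h1.image (fun p : Nat.Primes => (p : ℕ))).bddAbove
  have hlarge : ∀ p : ℕ, p.Prime → Q + 1 ≤ p → dens h p * (p : ℝ) ^ c₀ ≤ 1 / 2 := by
    intro p hp hpQ
    have hp0 : (0 : ℝ) < p := by exact_mod_cast hp.pos
    by_contra hlt
    have : p ≤ Q := hQ ⟨⟨p, hp⟩, ?_, rfl⟩
    · lia
    · simp only [not_lt]
      push Not at hlt
      have h2 := pow_le_pow_left₀ (by norm_num) hlt.le 2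
      rwa [mul_pow, ← rpow_natCast ((p : ℝ) ^ c₀), ← Real.rpow_mul hp0.le, Nat.cast_ofNat,
        mul_comm c₀] at h2
  have hev : ∀ᶠ δ : ℝ in 𝓝[>] 0, ∀ p ∈ (Q + 1).primesBelow, dens h p * (p : ℝ) ^ δ < 1 := by
    rw [Filter.eventually_all_finset]
    intro p hp
    have hpp := prime_of_mem_primesBelow hp
    have hp0 : (p : ℝ) ≠ 0 := by exact_mod_cast hpp.ne_zero
    have hc : ContinuousAt (fun δ : ℝ => dens h p * (p : ℝ) ^ δ) 0 :=
      continuousAt_const.mul (Real.continuousAt_const_rpow hp0)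
    have := hc.tendsto.eventually_lt_const (show dens h p * (p : ℝ) ^ (0 : ℝ) < 1 by
      rw [Real.rpow_zero, mul_one]
      exact H.dens_lt_one hpp)
    exact this.filter_mono nhdsWithin_le_nhds
  obtain ⟨δ, hδ1, hδ2⟩ := (hev.and (Ioc_mem_nhdsGT hc)).exists
  have hfin : ∀ n, n ≤ Q + 1 → ∃ ρ : ℝ, ρ < 1 ∧ 1 / 2 ≤ ρ ∧
      ∀ p ∈ n.primesBelow, dens h p * (p : ℝ) ^ δ ≤ ρ := by
    intro n
    induction n with
    | zero => exact fun _ => ⟨1 / 2, by norm_num, le_rfl, by simp⟩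
    | succ n ih =>
      intro hn
      obtain ⟨ρ, r1, r2, r3⟩ := ih (by lia)
      by_cases hp : n.Prime
      · refine ⟨max ρ (dens h n * (n : ℝ) ^ δ), max_lt r1 (hδ1 n ?_), r2.trans (le_max_left _ _),
          fun p hp' => ?_⟩
        · exact mem_primesBelow.2 ⟨by lia, hp⟩
        · rw [Nat.primesBelow_succ, if_pos hp, Finset.mem_insert] at hp'
          rcases hp' with rfl | hp'
          · exact le_max_right _ _
          · exact (r3 p hp').trans (le_max_left _ _)
      · refine ⟨ρ, r1, r2, ?_⟩
        rwa [Nat.primesBelow_succ, if_neg hp]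
  obtain ⟨ρ, r1, r2, r3⟩ := hfin (Q + 1) le_rfl
  refine ⟨δ, ρ, hδ2.1, hδ2.2, r1, fun p hp => ?_⟩
  rcases Nat.lt_or_ge p (Q + 1) with hpQ | hpQ
  · exact r3 p (mem_primesBelow.2 ⟨hpQ, hp⟩)
  · refine le_trans (le_trans ?_ (hlarge p hp hpQ)) r2
    refine mul_le_mul_of_nonneg_left ?_ (H.dens_nonneg p)
    exact rpow_le_rpow_of_exponent_le (by exact_mod_cast hp.one_le) hδ2.2

/-- The local factor of the error terms. -/
def thetaFactor (w : ℕ → ℝ) (δ : ℝ) (p : ℕ) : ℝ := |1 - w p * (p : ℝ) ^ δ|⁻¹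

theorem thetaFactor_nonneg (w : ℕ → ℝ) (δ : ℝ) (p : ℕ) : 0 ≤ thetaFactor w δ p := by
  rw [thetaFactor]
  positivity

theorem thetaFactor_eq {w : ℕ → ℝ} {δ : ℝ} {p : ℕ} (hp : w p * (p : ℝ) ^ δ < 1) :
    thetaFactor w δ p = (1 - w p * (p : ℝ) ^ δ)⁻¹ := by
  rw [thetaFactor, abs_of_pos (by linarith)]

theorem SieveHyp.exists_mertens_theta_dens (H : SieveHyp h Hstar L c₀) {δ ρ : ℝ} (hδ : 0 < δ)
    (hδc : δ ≤ c₀) (hρ : ρ < 1) (hle : ∀ p : ℕ, p.Prime → dens h p * (p : ℝ) ^ δ ≤ ρ) :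
    ∃ M, MertensWeight (fun p => dens h p * thetaFactor (dens h) δ p) M := by
  refine H.exists_mertens_of_le (K := (1 - ρ)⁻¹)
    (fun p => mul_nonneg (H.dens_nonneg p) (thetaFactor_nonneg _ _ p)) fun p hp => ?_
  have h1 := hle p hp
  have h2 := H.dens_nonneg p
  set P := (p : ℝ) ^ δ with hP
  have hP1 : 1 ≤ P := one_le_prime_rpow hp hδ.le
  have hPc : P ≤ (p : ℝ) ^ c₀ :=
    rpow_le_rpow_of_exponent_le (by exact_mod_cast hp.one_le) hδc
  have h3 : 0 < 1 - dens h p * P := by linarith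
  rw [thetaFactor_eq (by linarith : dens h p * (p : ℝ) ^ δ < 1), ← hP]
  have e : dens h p * (1 - dens h p * P)⁻¹ - dens h p =
      (1 - dens h p * P)⁻¹ * (dens h p ^ 2 * P) := by
    field_simp
    ring
  rw [e, abs_of_nonneg (by positivity)]
  have h4 : (1 - dens h p * P)⁻¹ ≤ (1 - ρ)⁻¹ := by gcongr
  have : 0 ≤ (1 - ρ)⁻¹ := inv_nonneg.2 (by linarith)
  gcongr

/-- The weight `g (1 - g) θ²` that governs the error terms of the main sums. -/
def errWeight (h : ArithmeticFunction ℝ) (δ : ℝ) (p : ℕ) : ℝ :=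
  dualDens h p * (1 - dualDens h p) * thetaFactor (dualDens h) δ p ^ 2

theorem SieveHyp.dualDens_lt_one (H : SieveHyp h Hstar L c₀) (p : ℕ) : dualDens h p < 1 := by
  have h1 := H.dens_nonneg p
  rw [dualDens, div_lt_one (by linarith)]
  linarith

theorem SieveHyp.exists_mertens_errWeight (H : SieveHyp h Hstar L c₀) {δ ρ : ℝ} (hδ : 0 < δ)
    (hδc : δ ≤ c₀) (hρ : ρ < 1) (hle : ∀ p : ℕ, p.Prime → dens h p * (p : ℝ) ^ δ ≤ ρ) :
    ∃ M, MertensWeight (errWeight h δ) M := by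
  refine H.exists_mertens_of_le (K := 1 + 4 * ((1 - ρ)⁻¹) ^ 2)
    (fun p => ?_) fun p hp => ?_
  · have h1 := H.dualDens_nonneg p
    have h2 := H.dualDens_lt_one p
    have h3 := sq_nonneg (thetaFactor (dualDens h) δ p)
    have h4 : 0 ≤ 1 - dualDens h p := by linarith
    rw [errWeight]
    positivity
  have h1 := hle p hp
  have h2 := H.dens_nonneg p
  have g0 := H.dualDens_nonneg p
  have g1 := H.dualDens_le p
  have g2 := H.dualDens_lt_one p
  have g3 := H.dens_sub_dualDens p
  have g4 := H.dens_mul_dualDens_le p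
  rw [errWeight]
  set g := dualDens h p with hg
  set P := (p : ℝ) ^ δ with hP
  have hP1 : 1 ≤ P := one_le_prime_rpow hp hδ.le
  have hPc : P ≤ (p : ℝ) ^ c₀ :=
    rpow_le_rpow_of_exponent_le (by exact_mod_cast hp.one_le) hδc
  have hgP : g * P ≤ ρ := le_trans (by gcongr) h1
  have h3 : 0 < 1 - g * P := by linarith
  rw [thetaFactor_eq (by rw [← hg, ← hP]; linarith), ← hg, ← hP]
  have e : g * (1 - g) * ((1 - g * P)⁻¹) ^ 2 - g =
      ((1 - g * P)⁻¹) ^ 2 * (g * (2 * (g * P) - g - (g * P) ^ 2)) := by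
    field_simp
    ring
  have hgP0 : 0 ≤ g * P := by positivity
  have hggP : g ≤ g * P := le_mul_of_one_le_right g0 hP1
  have h5 : |2 * (g * P) - g - (g * P) ^ 2| ≤ 4 * (g * P) := by
    have : (g * P) ^ 2 ≤ g * P := by nlinarith
    have := sq_nonneg (g * P)
    rw [abs_le]
    constructor <;> linarith
  have h6 : |g * (1 - g) * ((1 - g * P)⁻¹) ^ 2 - g| ≤
      4 * ((1 - ρ)⁻¹) ^ 2 * (dens h p ^ 2 * P) := by
    rw [e, abs_mul, abs_mul, abs_of_nonneg g0, abs_of_nonneg (by positivity)]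
    have h4 : (1 - g * P)⁻¹ ≤ (1 - ρ)⁻¹ := by gcongr
    calc _ ≤ ((1 - ρ)⁻¹) ^ 2 * (g * (4 * (g * P))) := by gcongr
      _ = 4 * ((1 - ρ)⁻¹) ^ 2 * (g ^ 2 * P) := by ring
      _ ≤ _ := by gcongr
  have h7 : |g - dens h p| ≤ dens h p ^ 2 * P := by
    rw [abs_sub_comm, abs_of_nonneg (by linarith), g3]
    nlinarith [sq_nonneg (dens h p)]
  calc _ ≤ |g * (1 - g) * ((1 - g * P)⁻¹) ^ 2 - g| + |g - dens h p| := abs_sub_le _ _ _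
    _ ≤ (1 + 4 * ((1 - ρ)⁻¹) ^ 2) * (dens h p ^ 2 * P) := by linarith
    _ ≤ _ := by gcongr

/-! ### Functions solving a delay equation -/

theorem exists_lipschitzOn_mul {f g : ℝ → ℝ} {a b : ℝ} (hf : ∃ K, LipschitzOnWith K f (Icc a b))
    (hg : ∃ K, LipschitzOnWith K g (Icc a b)) :
    ∃ K, LipschitzOnWith K (fun x => f x * g x) (Icc a b) := by
  obtain ⟨K, hK⟩ := hf
  obtain ⟨K', hK'⟩ := hg
  obtain ⟨A, hA⟩ := isCompact_Icc.exists_bound_of_continuousOn hK.continuousOn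
  obtain ⟨A', hA'⟩ := isCompact_Icc.exists_bound_of_continuousOn hK'.continuousOn
  refine ⟨(|A| * K' + |A'| * K).toNNReal, LipschitzOnWith.of_dist_le_mul fun x hx y hy => ?_⟩
  rw [coe_toNNReal _ (by positivity)]
  have h1 := hK.dist_le_mul x hx y hy
  have h2 := hK'.dist_le_mul x hx y hy
  have h3 := (hA x hx).trans (le_abs_self A)
  have h4 := (hA' y hy).trans (le_abs_self A')
  rw [Real.dist_eq] at h1 h2 ⊢
  rw [norm_eq_abs] at h3 h4
  calc |f x * g x - f y * g y| = |f x * (g x - g y) + (f x - f y) * g y| := by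
        congr 1
        ring
    _ ≤ |f x| * |g x - g y| + |f x - f y| * |g y| := by
        rw [← abs_mul, ← abs_mul]
        exact abs_add_le _ _
    _ ≤ |A| * (K' * dist x y) + K * dist x y * |A'| := by gcongr
    _ = _ := by ring

/-- `φ` is constant up to `2` and satisfies `φ'(s) = -2 κ φ(s - 2) (1 - 2/s)^d / s` afterwards. -/
structure DelayFun (d : ℕ) (κ c : ℝ) (φ : ℝ → ℝ) : Prop where
  cont : Continuous φ
  init : ∀ s, s ≤ 2 → φ s = c
  deriv : ∀ s, 2 < s → HasDerivAt φ (-2 * κ * φ (s - 2) * (1 - 2 / s) ^ d / s) s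

theorem DelayFun.exists_lipschitzOn {d : ℕ} {κ c : ℝ} {φ : ℝ → ℝ} (hφ : DelayFun d κ c φ)
    (a b : ℝ) : ∃ K, LipschitzOnWith K φ (Icc a b) := by
  obtain ⟨A, hA⟩ := (isCompact_Icc (a := (0 : ℝ)) (b := max b 2)).exists_bound_of_continuousOn
    hφ.cont.continuousOn
  have hder : ∀ s, 2 < s → s ≤ max b 2 →
      |-2 * κ * φ (s - 2) * (1 - 2 / s) ^ d / s| ≤ 2 * |κ| * |A| := by
    intro s hs hsb
    have h1 := (hA (s - 2) ⟨by linarith, by linarith⟩).trans (le_abs_self A)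
    rw [norm_eq_abs] at h1
    have h2 : |1 - 2 / s| ≤ 1 := by
      have : 2 / s ≤ 1 := (div_le_one (by linarith)).2 hs.le
      have : 0 < 2 / s := by positivity
      rw [abs_le]
      constructor <;> linarith
    rw [abs_div, abs_mul, abs_mul, abs_mul, abs_pow, abs_of_pos (by linarith : 0 < s),
      div_le_iff₀ (by linarith)]
    have h3 : |1 - 2 / s| ^ d ≤ 1 := pow_le_one₀ (abs_nonneg _) h2
    calc |(-2 : ℝ)| * |κ| * |φ (s - 2)| * |1 - 2 / s| ^ d ≤ 2 * |κ| * |A| * 1 := by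
          rw [abs_neg, abs_two]
          gcongr
      _ ≤ _ := by
          gcongr
          linarith
  have hmax : ∀ x, φ x = φ (max x 2) := fun x => by
    rcases le_total x 2 with h | h
    · rw [max_eq_right h, hφ.init x h, hφ.init 2 le_rfl]
    · rw [max_eq_left h]
  have hlt : ∀ x y, 2 ≤ x → x < y → y ≤ max b 2 → |φ y - φ x| ≤ 2 * |κ| * |A| * (y - x) := by
    intro x y hx hxy hy
    obtain ⟨s, hs, he⟩ := exists_hasDerivAt_eq_slope φ _ hxy hφ.cont.continuousOn
      fun s hs => hφ.deriv s (lt_of_le_of_lt hx hs.1)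
    have h1 := hder s (lt_of_le_of_lt hx hs.1) (hs.2.le.trans hy)
    rw [he, abs_div, abs_of_pos (sub_pos.2 hxy), div_le_iff₀ (sub_pos.2 hxy)] at h1
    exact h1
  refine ⟨(2 * |κ| * |A|).toNNReal, LipschitzOnWith.of_dist_le_mul fun x hx y hy => ?_⟩
  rw [coe_toNNReal _ (by positivity), Real.dist_eq, Real.dist_eq, hmax x, hmax y]
  have h5 : |max x 2 - max y 2| ≤ |x - y| := abs_max_sub_max_le_abs x y 2
  refine le_trans ?_ (mul_le_mul_of_nonneg_left h5 (by positivity))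
  rcases lt_trichotomy (max x 2) (max y 2) with h | h | h
  · have := hlt _ _ (le_max_right x 2) h (max_le_max_right 2 hy.2)
    rwa [abs_sub_comm, abs_sub_comm (max x 2), abs_of_pos (sub_pos.2 h)]
  · rw [h]
    simp
  · have := hlt _ _ (le_max_right y 2) h (max_le_max_right 2 hx.2)
    rwa [abs_of_pos (sub_pos.2 h)]

/-- The integrand of the delay equation after the substitution `s = 2 / y`. -/
def delayIntegrand (d : ℕ) (φ : ℝ → ℝ) (y : ℝ) : ℝ :=
  (1 - y) ^ d / y * φ (2 / y - 2)

theorem DelayFun.exists_lipschitzOn_integrand {d : ℕ} {κ c : ℝ} {φ : ℝ → ℝ}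
    (hφ : DelayFun d κ c φ) {y₀ : ℝ} (hy₀ : 0 < y₀) :
    ∃ K, LipschitzOnWith K (delayIntegrand d φ) (Icc y₀ 1) := by
  have hne : ∀ y ∈ Icc y₀ 1, y ≠ 0 := fun y hy => (hy₀.trans_le hy.1).ne'
  have h1 : ContDiffOn ℝ 1 (fun y : ℝ => (1 - y) ^ d / y) (Icc y₀ 1) :=
    ContDiffOn.div (by fun_prop) (by fun_prop) hne
  have h2 : ContDiffOn ℝ 1 (fun y : ℝ => 2 / y - 2) (Icc y₀ 1) :=
    (ContDiffOn.div (by fun_prop) (by fun_prop) hne).sub (by fun_prop)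
  have h1' := h1.exists_lipschitzOnWith one_ne_zero (convex_Icc _ _) isCompact_Icc
  obtain ⟨K₂, hK₂⟩ := h2.exists_lipschitzOnWith one_ne_zero (convex_Icc _ _) isCompact_Icc
  obtain ⟨K₃, hK₃⟩ := hφ.exists_lipschitzOn 0 (2 / y₀ - 2)
  refine exists_lipschitzOn_mul h1' ⟨_, hK₃.comp hK₂ fun y hy => ?_⟩
  have hy0 : 0 < y := hy₀.trans_le hy.1
  constructor
  · rw [sub_nonneg, le_div_iff₀ hy0]
    linarith [hy.2]
  · have := hy.1
    have : 2 / y ≤ 2 / y₀ := by gcongr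
    linarith

theorem DelayFun.integral_eq {d : ℕ} {κ c : ℝ} {φ : ℝ → ℝ} (hφ : DelayFun d κ c φ) {y : ℝ}
    (hy : 0 < y) (hy1 : y ≤ 1) :
    c - 2 * κ * ∫ x in y..1, delayIntegrand d φ x = φ (2 / y) := by
  obtain ⟨K, hK⟩ := hφ.exists_lipschitzOn_integrand hy
  have hne : ∀ x ∈ Icc y 1, x ≠ 0 := fun x hx => (hy.trans_le hx.1).ne'
  have hint : IntervalIntegrable (fun x => 2 * κ * delayIntegrand d φ x) volume y 1 :=
    (ContinuousOn.intervalIntegrable (by rw [uIcc_of_le hy1]; exact hK.continuousOn)).const_mul _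
  have := intervalIntegral.integral_eq_sub_of_hasDerivAt_of_le (f := fun x => φ (2 / x)) hy1
    (hφ.cont.comp_continuousOn (ContinuousOn.div (by fun_prop) (by fun_prop) hne))
    (fun x hx => ?_) hint
  · rw [intervalIntegral.integral_const_mul, div_one, hφ.init 2 le_rfl] at this
    linarith
  · have hx0 : 0 < x := hy.trans hx.1
    have h2 : 2 < 2 / x := by
      rw [lt_div_iff₀ hx0]
      linarith [hx.2]
    have h3 : HasDerivAt (fun x : ℝ => 2 / x) (-2 / x ^ 2) x := by
      have := (hasDerivAt_inv hx0.ne').const_mul 2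
      refine (this.congr_deriv ?_).congr_of_eventuallyEq (Eventually.of_forall fun z => ?_)
      · ring
      · simp only
        ring
    refine ((hφ.deriv _ h2).comp x h3).congr_deriv ?_
    rw [delayIntegrand]
    have : 2 / (2 / x) = x := by field_simp
    rw [this]
    field_simp

/-! ### Iterating Buchstab's identity -/

theorem MertensWeight.sum_window_le {w : ℕ → ℝ} {M : ℝ} (hw : MertensWeight w M) {S : Finset ℕ}
    (hS : ∀ p ∈ S, p.Prime) {u U : ℝ} (hu : 0 ≤ u) (hU : 0 ≤ U) (hSu : ∀ p ∈ S, log p ≤ u) :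
    ∑ p ∈ S with u - log (p : ℕ) < U, w p * log p ≤ 2 * U + 2 * M := by
  have hM := hw.M_nonneg
  have hn : ∀ p : ℕ, 0 ≤ w p * log p := fun p =>
    mul_nonneg (hw.nonneg p) (log_natCast_nonneg p)
  rcases lt_or_ge u U with h | h
  · have h1 := hw.sum_le hS hu
    rw [Finset.filter_true_of_mem hSu] at h1
    have h2 := sum_le_sum_of_subset_of_nonneg
      (Finset.filter_subset (fun p : ℕ => u - log p < U) S) fun p _ _ => hn p
    linarith
  · have h1 := (abs_le.1 (hw.bound u hu)).2
    have h2 := (abs_le.1 (hw.bound (u - U) (by linarith))).1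
    have h3 : ∑ p ∈ S with u - log (p : ℕ) < U, w p * log p +
        ∑ p ∈ (⌊exp (u - U)⌋₊ + 1).primesBelow, w p * log p ≤
        ∑ p ∈ (⌊exp u⌋₊ + 1).primesBelow, w p * log p := by
      rw [← Finset.sum_union]
      · refine sum_le_sum_of_subset_of_nonneg ?_ fun p _ _ => hn p
        refine Finset.union_subset (fun p hp => ?_) (Nat.primesBelow_mono ?_)
        · have hp1 := (mem_filter.1 hp).1
          exact mem_primesBelow.2
            ⟨(log_le_iff_lt_floor (hS p hp1).pos u).1 (hSu p hp1), hS p hp1⟩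
        · gcongr
          linarith
      · rw [Finset.disjoint_left]
        intro p hp1 hp2
        have h4 := (mem_filter.1 hp1).2
        have h5 := mem_primesBelow.1 hp2
        have := (log_le_iff_lt_floor h5.2.pos (u - U)).2 h5.1
        linarith
    linarith

theorem half_le_log {m : ℕ} (hm : 2 ≤ m) : 1 / 2 ≤ log m := by
  have : log 2 ≤ log m := log_le_log (by norm_num) (by exact_mod_cast hm)
  linarith [Real.log_two_gt_d9]

theorem DelayFun.sum_main {d : ℕ} {κ c : ℝ} {φ : ℝ → ℝ} (hφ : DelayFun d κ c φ) {v : ℕ → ℝ}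
    {M : ℝ} (hv : MertensWeight v M) {s : ℝ} (hs : 0 ≤ s) :
    ∃ C : ℝ, 0 ≤ C ∧ ∀ m N : ℕ, 2 ≤ m → ∀ u : ℝ, log m ≤ u → 2 * u ≤ (s + 2) * log m →
      exp u < N →
      |c * u ^ d - κ * ∑ p ∈ ((Finset.Ico m N).filter Nat.Prime).filter
        (fun p : ℕ => log p ≤ u), v p * ((u - log p) ^ d * φ (2 * (u - log p) /
          log p)) - u ^ d * φ (2 * u / log m)| ≤ C * (u ^ d / u) := by
  have hM := hv.M_nonneg
  set y₀ := 2 / (s + 2) with hy₀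
  have hy₀0 : 0 < y₀ := by positivity
  have hy₀1 : y₀ ≤ 1 := (div_le_one (by linarith)).2 (by linarith)
  obtain ⟨K, hK⟩ := hφ.exists_lipschitzOn_integrand hy₀0
  refine ⟨|κ| * ((2 * M + 2) * (|delayIntegrand d φ 1| + K)), by positivity,
    fun m N hm u hu hus hN => ?_⟩
  set ℓ := log m with hℓ
  have hℓ2 : 1 / 2 ≤ ℓ := half_le_log hm
  have hu0 : 0 < u := by linarith
  set ψ : ℝ → ℝ := fun x => u ^ d / u * delayIntegrand d φ (u⁻¹ * x) with hψ
  have hmaps : MapsTo (fun x => u⁻¹ * x) (Icc ℓ u) (Icc y₀ 1) := by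
    intro x hx
    change u⁻¹ * x ∈ Icc y₀ 1
    rw [← div_eq_inv_mul]
    constructor
    · rw [hy₀, div_le_div_iff₀ (by linarith) hu0]
      nlinarith [hx.1]
    · exact (div_le_one hu0).2 hx.2
  have hLip : LipschitzOnWith ((u ^ d / u * K * u⁻¹).toNNReal) ψ (Icc ℓ u) := by
    refine LipschitzOnWith.of_dist_le_mul fun x hx y hy => ?_
    rw [coe_toNNReal _ (by positivity)]
    have h1 := hK.dist_le_mul _ (hmaps hx) _ (hmaps hy)
    simp only [Real.dist_eq, hψ] at h1 ⊢
    rw [← mul_sub, abs_mul, abs_of_pos (by positivity : 0 < u ^ d / u)]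
    rw [← mul_sub, abs_mul, abs_of_pos (by positivity : 0 < u⁻¹)] at h1
    calc _ ≤ u ^ d / u * (K * (u⁻¹ * |x - y|)) := by gcongr
      _ = _ := by ring
  have key := hv.abs_sum_sub_integral_le (by lia) hu hN hLip (integral_abs_deriv_le hu hLip)
  rw [coe_toNNReal _ (by positivity)] at key
  have e1 : ∑ p ∈ ((Finset.Ico m N).filter Nat.Prime).filter (fun p : ℕ => log p ≤ u),
      v p * log p * ψ (log p) =
      ∑ p ∈ ((Finset.Ico m N).filter Nat.Prime).filter (fun p : ℕ => log p ≤ u),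
        v p * ((u - log p) ^ d * φ (2 * (u - log p) / log p)) := by
    refine sum_congr rfl fun p hp => ?_
    have hmp := (Finset.mem_Ico.1 (mem_filter.1 (mem_filter.1 hp).1).1).1
    have hp0 : 0 < log p := by linarith [half_le_log (hm.trans hmp)]
    simp only [hψ, delayIntegrand]
    have a1 : 2 / (u⁻¹ * log p) - 2 = 2 * (u - log p) / log p := by
      field_simp
    have a2 : 1 - u⁻¹ * log p = (u - log p) / u := by field_simp
    rw [a1, a2, div_pow]
    field_simp
  have e2 : ∫ x in ℓ..u, ψ x = u ^ d * ∫ y in ℓ / u..1, delayIntegrand d φ y := by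
    simp only [hψ]
    rw [intervalIntegral.integral_const_mul, intervalIntegral.integral_comp_mul_left _
      (inv_ne_zero hu0.ne'), inv_inv, smul_eq_mul, inv_mul_cancel₀ hu0.ne', ← div_eq_inv_mul]
    field_simp
  have e3 := hφ.integral_eq (y := ℓ / u) (by positivity) ((div_le_one hu0).2 hu)
  rw [show 2 / (ℓ / u) = 2 * u / ℓ by field_simp] at e3
  rw [e1, e2] at key
  have e4 : (2 * M + 2) * (|ψ u| + u ^ d / u * K * u⁻¹ * (u - ℓ)) ≤
      (2 * M + 2) * (|delayIntegrand d φ 1| + K) * (u ^ d / u) := by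
    have b1 : |ψ u| = u ^ d / u * |delayIntegrand d φ 1| := by
      simp only [hψ]
      rw [inv_mul_cancel₀ hu0.ne', abs_mul, abs_of_pos (by positivity)]
    have b2 : u ^ d / u * K * u⁻¹ * (u - ℓ) ≤ u ^ d / u * K := by
      have : u⁻¹ * (u - ℓ) ≤ 1 := by
        rw [← div_eq_inv_mul, div_le_one hu0]
        linarith
      calc _ = u ^ d / u * K * (u⁻¹ * (u - ℓ)) := by ring
        _ ≤ u ^ d / u * K * 1 := by gcongr
        _ = _ := mul_one _
    rw [b1]
    calc _ ≤ (2 * M + 2) * (u ^ d / u * |delayIntegrand d φ 1| + u ^ d / u * K) := by gcongr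
      _ = _ := by ring
  rw [← e3]
  set S₁ := ∑ p ∈ ((Finset.Ico m N).filter Nat.Prime).filter (fun p : ℕ => log p ≤ u),
    v p * ((u - log p) ^ d * φ (2 * (u - log p) / log p))
  set I := ∫ y in ℓ / u..1, delayIntegrand d φ y
  calc |c * u ^ d - κ * S₁ - u ^ d * (c - 2 * κ * I)| = |κ| * |S₁ - 2 * (u ^ d * I)| := by
        rw [← abs_mul, ← abs_neg]
        congr 1
        ring
    _ ≤ |κ| * ((2 * M + 2) * (|delayIntegrand d φ 1| + K) * (u ^ d / u)) := by
        gcongr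
        exact key.trans e4
    _ = _ := by ring

set_option maxHeartbeats 800000 in
theorem exists_sieveOp_sub_le {d : ℕ} {κ c : ℝ} {φ k : ℝ → ℝ} (hφ : DelayFun d κ c φ) {v : ℕ → ℝ}
    {M : ℝ} (hv : MertensWeight v M) (hk : ∀ x, x < 0 → k x = 0)
    (hinf : ∀ ε : ℝ, 0 < ε → ∃ U β : ℝ, 0 ≤ β ∧ ∀ u : ℝ, 0 ≤ u → ∀ N : ℕ, exp u < N →
      |sieveOp (fun p => κ * v p) k N.primesBelow u - c * u ^ d| ≤
        ε * u ^ d + if u < U then β else 0) (n : ℕ) :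
    ∀ ε : ℝ, 0 < ε → ∃ U β : ℝ, 0 ≤ β ∧ ∀ m : ℕ, 2 ≤ m → ∀ u : ℝ, 0 ≤ u →
      2 * u ≤ 2 * n * log m →
      |sieveOp (fun p => κ * v p) k m.primesBelow u - u ^ d * φ (2 * u / log m)| ≤
        ε * u ^ d + if u < U then β else 0 := by
  have hsmall : ∀ m : ℕ, 2 ≤ m → ∀ u : ℝ, u < log m →
      φ (2 * u / log m) = c ∧ exp u < m := by
    intro m hm u hu
    have hl := half_le_log hm
    refine ⟨hφ.init _ ?_, ?_⟩
    · rw [div_le_iff₀ (by linarith)]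
      linarith
    · rwa [← Real.lt_log_iff_exp_lt (by exact_mod_cast (by lia : 0 < m))]
  induction n with
  | zero =>
    intro ε hε
    obtain ⟨U, β, hβ, H⟩ := hinf ε hε
    refine ⟨U, β, hβ, fun m hm u hu hus => ?_⟩
    have hl := half_le_log hm
    have hu0 : u < log m := by
      simp at hus
      linarith
    obtain ⟨h1, h2⟩ := hsmall m hm u hu0
    rw [h1, mul_comm (u ^ d)]
    exact H u hu m h2
  | succ n ih =>
    intro ε hε
    have hM := hv.M_nonneg
    set s : ℝ := 2 * n with hs
    have hs0 : 0 ≤ s := by positivity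
    set C₁ : ℝ := |κ| * (s + 2 + 2 * M) + 1 with hC₁
    have hC₁0 : 0 < C₁ := by positivity
    obtain ⟨U₀, β₀, hβ₀, H₀⟩ := hinf (ε / 4) (by positivity)
    obtain ⟨U₁, β₁, hβ₁, H₁⟩ := ih (ε / (4 * C₁)) (by positivity)
    obtain ⟨C₃, hC₃, H₃⟩ := hφ.sum_main hv hs0
    set C₂ : ℝ := |κ| * (β₁ * (2 * |U₁| + 2 * M)) with hC₂
    have hC₂0 : 0 ≤ C₂ := by positivity
    set U : ℝ := max U₀ (max 1 (max (4 * (C₂ * (s + 2)) / ε) (4 * C₃ / ε))) with hU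
    refine ⟨U, β₀ + 2 * C₂ + 2 * C₃ * U ^ d, by positivity, fun m hm u hu hus => ?_⟩
    have hU0 : U₀ ≤ U := le_max_left _ _
    have hU1 : 1 ≤ U := (le_max_left _ _).trans (le_max_right _ _)
    have hU2 : 4 * (C₂ * (s + 2)) / ε ≤ U :=
      (le_max_left _ _).trans ((le_max_right _ _).trans (le_max_right _ _))
    have hU3 : 4 * C₃ / ε ≤ U :=
      (le_max_right _ _).trans ((le_max_right _ _).trans (le_max_right _ _))
    have hl := half_le_log hm
    have hud : 0 ≤ u ^ d := pow_nonneg hu d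
    have hβ : β₀ ≤ β₀ + 2 * C₂ + 2 * C₃ * U ^ d := by
      have : 0 ≤ 2 * C₃ * U ^ d := by positivity
      linarith
    rcases lt_or_ge u (log m) with hum | hum
    · obtain ⟨h1, h2⟩ := hsmall m hm u hum
      rw [h1, mul_comm (u ^ d)]
      refine (H₀ u hu m h2).trans (add_le_add (by nlinarith) ?_)
      split_ifs with a b b
      · exact hβ
      · linarith
      · exact hβ₀.trans hβ
      · exact le_rfl
    have hu0 : 0 < u := by linarith
    have hus' : 2 * u ≤ (s + 2) * log m := by
      rw [hs]
      push_cast at hus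
      linarith
    obtain ⟨N, hN⟩ := exists_nat_gt (exp u)
    have hmN : m ≤ N := by
      have : (m : ℝ) ≤ exp u := by
        rwa [← log_le_iff_le_exp (by exact_mod_cast (by lia : 0 < m))]
      exact_mod_cast (this.trans_lt hN).le
    have hB := sieveOp_primesBelow (fun p => κ * v p) k u hmN
    set T := ((Finset.Ico m N).filter Nat.Prime).filter (fun p : ℕ => log p ≤ u) with hT
    have hTm : ∀ p ∈ T, m ≤ p ∧ p.Prime ∧ log p ≤ u := fun p hp =>
      ⟨(Finset.mem_Ico.1 (mem_filter.1 (mem_filter.1 hp).1).1).1,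
        (mem_filter.1 (mem_filter.1 hp).1).2, (mem_filter.1 hp).2⟩
    have hTl : ∀ p ∈ T, log m ≤ log p := fun p hp =>
      log_le_log (by exact_mod_cast (by lia : 0 < m)) (by exact_mod_cast (hTm p hp).1)
    have hB2 : ∑ p ∈ (Finset.Ico m N).filter Nat.Prime, κ * v p *
        sieveOp (fun p => κ * v p) k p.primesBelow (u - log p) =
        κ * ∑ p ∈ T, v p * sieveOp (fun p => κ * v p) k p.primesBelow (u - log p) := by
      rw [mul_sum, hT, sum_filter (fun p : ℕ => log p ≤ u)]
      refine sum_congr rfl fun p _ => ?_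
      split_ifs with hp
      · ring
      · rw [sieveOp_of_neg _ hk _ (by linarith), mul_zero]
    rw [hB2] at hB
    have hsumv : ∑ p ∈ T, v p ≤ s + 2 + 2 * M := by
      have h1 := hv.sum_le (S := T) (fun p hp => (hTm p hp).2.1) hu
      rw [Finset.filter_true_of_mem fun p hp => (hTm p hp).2.2] at h1
      have h2 : log m * ∑ p ∈ T, v p ≤ ∑ p ∈ T, v p * log p := by
        rw [mul_sum]
        refine sum_le_sum fun p hp => ?_
        rw [mul_comm]
        exact mul_le_mul_of_nonneg_left (hTl p hp) (hv.nonneg p)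
      have h3 : log m * ∑ p ∈ T, v p ≤ log m * (s + 2 + 2 * M) := by nlinarith
      exact le_of_mul_le_mul_left h3 (by linarith)
    have hwin : log m * ∑ p ∈ T with u - log (p : ℕ) < U₁, v p ≤
        2 * |U₁| + 2 * M := by
      have h1 := hv.sum_window_le (S := T) (fun p hp => (hTm p hp).2.1) hu (abs_nonneg U₁)
        (fun p hp => (hTm p hp).2.2)
      refine le_trans ?_ h1
      rw [mul_sum]
      refine le_trans (sum_le_sum (g := fun p : ℕ => v p * log p) fun p hp => ?_)
        (sum_le_sum_of_subset_of_nonneg (fun p hp => ?_) fun p _ _ =>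
          mul_nonneg (hv.nonneg p) (log_natCast_nonneg p))
      · rw [mul_comm]
        exact mul_le_mul_of_nonneg_left (hTl p (mem_filter.1 hp).1) (hv.nonneg p)
      · obtain ⟨a, b⟩ := mem_filter.1 hp
        exact mem_filter.2 ⟨a, b.trans_le (le_abs_self _)⟩
    have herr : |κ * ∑ p ∈ T, v p * sieveOp (fun p => κ * v p) k p.primesBelow (u - log p) -
        κ * ∑ p ∈ T, v p * ((u - log p) ^ d * φ (2 * (u - log p) / log p))| ≤
        ε / 4 * u ^ d + C₂ / log m := by
      rw [← mul_sub, abs_mul, ← sum_sub_distrib]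
      have h1 : |∑ p ∈ T, (v p * sieveOp (fun p => κ * v p) k p.primesBelow (u - log p) -
          v p * ((u - log p) ^ d * φ (2 * (u - log p) / log p)))| ≤
          ∑ p ∈ T, v p * (ε / (4 * C₁) * u ^ d + if u - log p < U₁ then β₁ else 0) := by
        refine (abs_sum_le_sum_abs _ _).trans (sum_le_sum fun p hp => ?_)
        obtain ⟨a1, a2, a3⟩ := hTm p hp
        rw [← mul_sub, abs_mul, abs_of_nonneg (hv.nonneg p)]
        refine mul_le_mul_of_nonneg_left ?_ (hv.nonneg p)
        have a4 := hTl p hp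
        refine (H₁ p (hm.trans a1) (u - log p) (by linarith) (by nlinarith)).trans ?_
        gcongr
        linarith
      have h2 : ∑ p ∈ T, v p * (ε / (4 * C₁) * u ^ d + if u - log p < U₁ then β₁ else 0) =
          ε / (4 * C₁) * u ^ d * ∑ p ∈ T, v p +
            β₁ * ∑ p ∈ T with u - log (p : ℕ) < U₁, v p := by
        rw [sum_filter (fun p : ℕ => u - log p < U₁), mul_sum,
          mul_sum, ← sum_add_distrib]
        refine sum_congr rfl fun p _ => ?_
        split_ifs <;> ring
      have h3 : β₁ * ∑ p ∈ T with u - log (p : ℕ) < U₁, v p ≤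
          β₁ * (2 * |U₁| + 2 * M) / log m := by
        rw [le_div_iff₀ (by linarith), mul_assoc, mul_comm _ (log m)]
        exact mul_le_mul_of_nonneg_left hwin hβ₁
      have h4 : |κ| * (ε / (4 * C₁) * u ^ d * ∑ p ∈ T, v p) ≤ ε / 4 * u ^ d := by
        have : |κ| * ∑ p ∈ T, v p ≤ C₁ := by
          have := mul_le_mul_of_nonneg_left hsumv (abs_nonneg κ)
          linarith
        calc _ = ε / (4 * C₁) * u ^ d * (|κ| * ∑ p ∈ T, v p) := by ring
          _ ≤ ε / (4 * C₁) * u ^ d * C₁ := by gcongr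
          _ = _ := by field_simp
      calc _ ≤ |κ| * (ε / (4 * C₁) * u ^ d * ∑ p ∈ T, v p +
            β₁ * (2 * |U₁| + 2 * M) / log m) := by
            refine mul_le_mul_of_nonneg_left ?_ (abs_nonneg κ)
            rw [h2] at h1
            linarith
        _ = |κ| * (ε / (4 * C₁) * u ^ d * ∑ p ∈ T, v p) + C₂ / log m := by
            rw [hC₂]
            ring
        _ ≤ _ := by linarith
    have hmain := H₃ m N hm u hum hus' hN
    rw [← hT] at hmain
    have h0 := H₀ u hu N hN
    rw [hB] at h0
    set W := sieveOp (fun p => κ * v p) k m.primesBelow u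
    set S₁ := κ * ∑ p ∈ T, v p * sieveOp (fun p => κ * v p) k p.primesBelow (u - log p)
    set S₂ := κ * ∑ p ∈ T, v p * ((u - log p) ^ d * φ (2 * (u - log p) / log p))
    have htot : |W - u ^ d * φ (2 * u / log m)| ≤
        (ε / 4 * u ^ d + if u < U₀ then β₀ else 0) + (ε / 4 * u ^ d + C₂ / log m) +
          C₃ * (u ^ d / u) := by
      have : W - u ^ d * φ (2 * u / log m) = (W + S₁ - c * u ^ d) - (S₁ - S₂) +
          (c * u ^ d - S₂ - u ^ d * φ (2 * u / log m)) := by ring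
      rw [this]
      exact (abs_add_le _ _).trans (add_le_add ((abs_sub _ _).trans (add_le_add h0 herr)) hmain)
    refine htot.trans ?_
    rcases lt_or_ge u U with huU | huU
    · rw [if_pos huU]
      have b1 : (if u < U₀ then β₀ else 0) ≤ β₀ := by split_ifs <;> linarith
      have b2 : C₂ / log m ≤ 2 * C₂ := by
        rw [div_le_iff₀ (by linarith)]
        nlinarith
      have b3 : C₃ * (u ^ d / u) ≤ 2 * C₃ * U ^ d := by
        have : u ^ d / u ≤ 2 * U ^ d := by
          rw [div_le_iff₀ hu0]
          have : u ^ d ≤ U ^ d := pow_le_pow_left₀ hu huU.le d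
          have : 0 ≤ U ^ d := by positivity
          nlinarith
        nlinarith
      have : 0 ≤ ε * u ^ d := by positivity
      linarith
    · rw [if_neg (not_lt.2 huU), if_neg (not_lt.2 (hU0.trans huU))]
      have hu1 : 1 ≤ u := hU1.trans huU
      have hd1 : 1 ≤ u ^ d := one_le_pow₀ hu1
      have b2 : C₂ / log m ≤ ε / 4 * u ^ d := by
        have c1 : 4 * (C₂ * (s + 2)) ≤ u * ε := by
          rw [← div_le_iff₀ hε]
          exact hU2.trans huU
        rw [div_le_iff₀ (by linarith)]
        have c2 : ε / 4 * 1 * log m ≤ ε / 4 * u ^ d * log m := by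
          have : 0 ≤ log m := by linarith
          gcongr
        refine le_trans ?_ c2
        have c3 : C₂ * (s + 2) * 4 ≤ ε * ((s + 2) * log m) := by
          have := mul_le_mul_of_nonneg_left (by linarith : u ≤ (s + 2) * log m) hε.le
          linarith
        have c4 : (s + 2) * (C₂ * 4) ≤ (s + 2) * (ε * log m) := by linarith
        have := le_of_mul_le_mul_left c4 (by linarith)
        linarith
      have b3 : C₃ * (u ^ d / u) ≤ ε / 4 * u ^ d := by
        have c1 : 4 * C₃ ≤ u * ε := by
          rw [← div_le_iff₀ hε]
          exact hU3.trans huU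
        rw [← mul_div_assoc, div_le_iff₀ hu0]
        have := mul_le_mul_of_nonneg_right c1 hud
        linarith
      linarith

theorem log_prod_eq_logW {t : Finset ℕ} (ht : ∀ p ∈ t, p.Prime) :
    log ((∏ p ∈ t, p : ℕ) : ℝ) = logW t := by
  rw [Nat.cast_prod, Real.log_prod fun p hp => by exact_mod_cast (ht p hp).ne_zero, logW]

theorem squarefree_prod_primes {t : Finset ℕ} (ht : ∀ p ∈ t, p.Prime) :
    Squarefree (∏ p ∈ t, p) := by
  refine Finset.squarefree_prod_of_pairwise_isCoprime (fun p hp q hq hpq => ?_)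
    fun p hp => (ht p hp).squarefree
  exact Nat.coprime_iff_isRelPrime.1 ((Nat.coprime_primes (ht p hp) (ht q hq)).2 hpq)

theorem tsum_eq_sieveOp {c w : ℕ → ℝ} {k : ℝ → ℝ} (hc0 : ∀ n, ¬ Squarefree n → c n = 0)
    (hc : ∀ n, Squarefree n → c n = ∏ p ∈ n.primeFactors, w p) (hk : ∀ v, v < 0 → k v = 0)
    {u : ℝ} {N : ℕ} (hN : exp u < N) :
    ∑' n : ℕ, c n * k (u - log n) = sieveOp w k N.primesBelow u := by
  have hP : ∀ t ∈ N.primesBelow.powerset, ∀ p ∈ t, p.Prime := fun t ht p hp =>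
    prime_of_mem_primesBelow (mem_powerset.1 ht hp)
  rw [sieveOp, tsum_eq_sum (s := N.primesBelow.powerset.image fun t => ∏ p ∈ t, p),
    Finset.sum_image]
  · refine sum_congr rfl fun t ht => ?_
    rw [hc _ (squarefree_prod_primes (hP t ht)), primeFactors_prod (hP t ht),
      log_prod_eq_logW (hP t ht)]
  · intro t ht t' ht' heq
    rw [← primeFactors_prod (hP t ht), ← primeFactors_prod (hP t' ht')]
    exact congrArg _ heq
  · intro n hn
    by_cases hsq : Squarefree n
    · rw [hk, mul_zero]
      by_contra hlt
      apply hn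
      have hn0 : 0 < n := Nat.pos_of_ne_zero hsq.ne_zero
      have h1 : (n : ℝ) ≤ exp u := by
        rw [← log_le_iff_le_exp (by exact_mod_cast hn0)]
        linarith
      have h2 : n < N := by exact_mod_cast h1.trans_lt hN
      refine Finset.mem_image.2 ⟨n.primeFactors, mem_powerset.2 fun p hp => ?_,
        Nat.prod_primeFactors_of_squarefree hsq⟩
      exact mem_primesBelow.2 ⟨(Nat.le_of_mem_primeFactors hp).trans_lt h2,
        Nat.prime_of_mem_primeFactors hp⟩
    · rw [hc0 n hsq, zero_mul]

theorem dualLogSum_eq_sieveOp {u : ℝ} {N : ℕ} (hN : exp u < N) :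
    dualLogSum h u =
      sieveOp (fun p => -1 * dualDens h p) (fun v => (max v 0) ^ 2) N.primesBelow u := by
  refine tsum_eq_sieveOp (c := dualCoeff h) (k := fun v => (max v 0) ^ 2) (fun n hn => ?_)
    (fun n hn => ?_) (fun v hv => ?_) hN
  · rw [dualCoeff, ArithmeticFunction.moebius_eq_zero_of_not_squarefree hn]
    simp
  · rw [dualCoeff, prod_mul_distrib, Finset.prod_const,
      ArithmeticFunction.moebius_apply_of_squarefree hn,
      (ArithmeticFunction.cardDistinctFactors_eq_cardFactors_iff_squarefree hn.ne_zero).2 hn |>.symm,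
      ArithmeticFunction.cardDistinctFactors_apply]
    push_cast
    rfl
  · simp [max_eq_right hv.le]

theorem BumpHyp.integral_exp_eq (HΨ : BumpHyp Ψ) {n : ℕ} (hn : 1 ≤ n) (α β : ℝ) :
    ∫ v in α..β, exp (-v) * Ψ (n / exp v) =
      (n : ℝ)⁻¹ * ∫ x in n / exp β..n / exp α, Ψ x := by
  have hc := HΨ.smooth.continuous
  have hn0 : (0 : ℝ) < n := by exact_mod_cast hn
  have hF : ∀ x, HasDerivAt (fun x => ∫ y in (0 : ℝ)..x, Ψ y) (Ψ x) x := fun x =>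
    intervalIntegral.integral_hasDerivAt_right (hc.intervalIntegrable _ _)
      hc.stronglyMeasurable.stronglyMeasurableAtFilter hc.continuousAt
  have hd : ∀ v, HasDerivAt (fun v => -((n : ℝ)⁻¹ * ∫ y in (0 : ℝ)..n * exp (-v), Ψ y))
      (exp (-v) * Ψ (n / exp v)) v := fun v => by
    have h1 : HasDerivAt (fun v => (n : ℝ) * exp (-v)) (n * (exp (-v) * -1)) v :=
      ((hasDerivAt_neg v).exp).const_mul _
    have h2 := (((hF _).comp v h1).const_mul (n : ℝ)⁻¹).neg
    refine h2.congr_deriv ?_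
    rw [Real.exp_neg, ← div_eq_mul_inv]
    field_simp
  rw [integral_eq_sub_of_hasDerivAt (fun v _ => hd v)
    (Continuous.intervalIntegrable (by fun_prop (disch := intro; positivity)) _ _)]
  rw [← intervalIntegral.integral_interval_sub_left (hc.intervalIntegrable (0 : ℝ) _)
    (hc.intervalIntegrable (0 : ℝ) (n / exp β)), Real.exp_neg, Real.exp_neg, ← div_eq_mul_inv, ← div_eq_mul_inv]
  ring

theorem BumpHyp.integral_eq_one (HΨ : BumpHyp Ψ) {x y : ℝ} (hx : x ≤ 1) (hy : 2 ≤ y) :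
    ∫ v in x..y, Ψ v = 1 := by
  rw [integral_of_le (by linarith), ← HΨ.int]
  refine setIntegral_eq_integral_of_forall_compl_eq_zero fun v hv => ?_
  by_cases h1 : v ≤ 1
  · exact HΨ.eq_zero_of_le_one h1
  · refine HΨ.eq_zero_of_two_lt (lt_of_not_ge fun h2 => hv ⟨?_, ?_⟩) <;> linarith

theorem BumpHyp.integral_smoothSum (h : ArithmeticFunction ℝ) (HΨ : BumpHyp Ψ) {u : ℝ}
    (hu : -1 ≤ u) {N : ℕ} (hN : 2 * exp u < N) :
    ∫ v in (-1 : ℝ)..u, exp (-v) * smoothSum Ψ h (exp v) =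
      ∑ n ∈ Finset.range N, sqfreeCoeff h n / n * ∫ x in n / exp u..n * exp 1, Ψ x := by
  have hc := HΨ.smooth.continuous
  have h1 : ∀ v ∈ uIcc (-1 : ℝ) u, exp (-v) * smoothSum Ψ h (exp v) =
      ∑ n ∈ Finset.range N, sqfreeCoeff h n * (exp (-v) * Ψ (n / exp v)) := by
    intro v hv
    rw [uIcc_of_le hu] at hv
    rw [smoothSum, tsum_eq_sum (s := Finset.range N), mul_sum]
    · exact sum_congr rfl fun n _ => by ring
    · intro n hn
      rw [HΨ.eq_zero_of_two_lt, zero_mul]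
      rw [lt_div_iff₀ (exp_pos v)]
      have h2 : (N : ℝ) ≤ n := by exact_mod_cast not_lt.1 fun h => hn (Finset.mem_range.2 h)
      have h3 : exp v ≤ exp u := Real.exp_le_exp.2 hv.2
      linarith
  rw [intervalIntegral.integral_congr h1, intervalIntegral.integral_finsetSum]
  · refine sum_congr rfl fun n _ => ?_
    rcases Nat.eq_zero_or_pos n with rfl | hn
    · simp [sqfreeCoeff]
    · rw [intervalIntegral.integral_const_mul, HΨ.integral_exp_eq hn, Real.exp_neg, div_inv_eq_mul]
      ring
  · exact fun n _ => Continuous.intervalIntegrable (by fun_prop (disch := intro; positivity)) _ _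

theorem SieveHyp.sqfreeCoeff_nonneg (H : SieveHyp h Hstar L c₀) (n : ℕ) : 0 ≤ sqfreeCoeff h n := by
  rw [sqfreeCoeff]
  exact mul_nonneg (by positivity) (H.nonneg n)

theorem SieveHyp.sieveOp_dens_eq (H : SieveHyp h Hstar L c₀) {u : ℝ} {N N' : ℕ}
    (hN : exp u < N) (hN' : exp u < N') :
    sieveOp (dens h) (expStep 0) N.primesBelow u =
      ∑ n ∈ Finset.range N', sqfreeCoeff h n / n * expStep 0 (u - log n) := by
  have hk : ∀ v : ℝ, v < 0 → expStep 0 v = 0 := fun v hv => expStep_of_neg 0 hv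
  rw [← tsum_eq_sieveOp (c := fun n => sqfreeCoeff h n / n) (fun n hn => ?_) (fun n hn => ?_) hk hN,
    tsum_eq_sum (s := Finset.range N')]
  · intro n hn
    have h2 : (N' : ℝ) ≤ n := by exact_mod_cast not_lt.1 fun h => hn (Finset.mem_range.2 h)
    have h3 : u < log n := by
      rw [Real.lt_log_iff_exp_lt] <;> linarith [exp_pos u]
    rw [hk _ (by linarith), mul_zero]
  · rw [sqfreeCoeff_of_not h hn, zero_div]
  · rw [sqfreeCoeff_div h hn, H.dens_squarefree hn]

theorem SieveHyp.exists_sieveOp_dens (H : SieveHyp h Hstar L c₀) (HΨ : BumpHyp Ψ) {a : ℝ}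
    (ha : 0 < a) (hHa : Hstar 1 = a) :
    ∃ C : ℝ, 0 ≤ C ∧ ∀ u : ℝ, 0 ≤ u → ∀ N : ℕ, exp u < N →
      |sieveOp (dens h) (expStep 0) N.primesBelow u - a / 2 * u ^ 2| ≤ C * (1 + u) := by
  obtain ⟨a', b, _, ha', hT⟩ := H.exists_smoothSum HΨ
  have haa : a' = a := by
    rw [hHa] at ha'
    exact_mod_cast ha'.symm
  subst haa
  obtain ⟨C, hC, hT⟩ := hT 0
  simp only [pow_zero, div_one] at hT
  set T := fun v => exp (-v) * smoothSum Ψ h (exp v) with hTdef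
  set I := fun u => ∫ v in (-1 : ℝ)..u, T v with hI
  have hc := HΨ.smooth.continuous
  -- continuity of `T`
  have hTc : ContinuousOn T univ := by
    intro v₀ _
    refine ContinuousAt.continuousWithinAt ?_
    obtain ⟨N, hN⟩ := exists_nat_gt (2 * exp (v₀ + 1))
    have h1 : ContinuousAt (fun v => ∑ n ∈ Finset.range N,
        sqfreeCoeff h n * (exp (-v) * Ψ (n / exp v))) v₀ :=
      Continuous.continuousAt (by fun_prop (disch := intro; positivity))
    refine h1.congr ?_
    filter_upwards [Iio_mem_nhds (show v₀ < v₀ + 1 by linarith)] with v hv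
    simp only [hTdef]
    rw [smoothSum, tsum_eq_sum (s := Finset.range N), mul_sum]
    · exact sum_congr rfl fun n _ => by ring
    · intro n hn
      rw [HΨ.eq_zero_of_two_lt, zero_mul]
      rw [lt_div_iff₀ (exp_pos v)]
      have h2 : (N : ℝ) ≤ n := by exact_mod_cast not_lt.1 fun h => hn (Finset.mem_range.2 h)
      have h3 : exp v ≤ exp (v₀ + 1) := Real.exp_le_exp.2 (le_of_lt hv)
      linarith
  have hTi : ∀ α β, IntervalIntegrable T volume α β := fun α β =>
    (hTc.mono (subset_univ _)).intervalIntegrable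
  set D := |I 0| with hD
  have hIb : ∀ u, 0 ≤ u → |I u - a' / 2 * u ^ 2| ≤ D + (C + |b|) * u := by
    intro u hu
    have h1 : I u = I 0 + ∫ v in (0 : ℝ)..u, T v :=
      (integral_add_adjacent_intervals (hTi _ _) (hTi _ _)).symm
    have h2 : ∫ v in (0 : ℝ)..u, a' * v = a' / 2 * u ^ 2 := by
      rw [intervalIntegral.integral_const_mul, integral_id]
      ring
    have h3 : |∫ v in (0 : ℝ)..u, (T v - a' * v)| ≤ (C + |b|) * |u - 0| := by
      rw [← norm_eq_abs]
      refine intervalIntegral.norm_integral_le_of_norm_le_const fun v hv => ?_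
      rw [uIoc_of_le hu] at hv
      have h4 := hT v hv.1.le
      rw [norm_eq_abs]
      calc |T v - a' * v| = |(T v - (a' * v + b)) + b| := by congr 1; ring
        _ ≤ _ := (abs_add_le _ _).trans (by gcongr)
    rw [intervalIntegral.integral_sub (hTi _ _) (Continuous.intervalIntegrable (by fun_prop) _ _),
      h2, sub_zero, abs_of_nonneg hu] at h3
    calc |I u - a' / 2 * u ^ 2| = |I 0 + ((∫ v in (0 : ℝ)..u, T v) - a' / 2 * u ^ 2)| := by
          rw [h1]; congr 1; ring
      _ ≤ _ := (abs_add_le _ _).trans (by gcongr)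
  have hΨ1 : ∀ x y, 0 ≤ x → 0 ≤ y → x ≤ y → 0 ≤ ∫ v in x..y, Ψ v := fun x y _ _ hxy =>
    intervalIntegral.integral_nonneg hxy fun v _ => HΨ.nonneg v
  have hΨ2 : ∀ x y : ℝ, x ≤ y → ∫ v in x..y, Ψ v ≤ 1 := fun x y hxy => by
    rw [← HΨ.integral_eq_one (min_le_right x 1) (le_max_right y 2)]
    refine intervalIntegral.integral_mono_interval (min_le_left _ _) hxy (le_max_left _ _)
      (Eventually.of_forall HΨ.nonneg) (hc.intervalIntegrable _ _)
  have hcomp : ∀ u : ℝ, -1 ≤ u → ∀ n : ℕ, (n : ℝ) / exp u ≤ n * exp 1 := by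
    intro u hu n
    rw [div_eq_mul_inv, ← Real.exp_neg]
    gcongr
    linarith
  have hupper : ∀ u : ℝ, 0 ≤ u → ∀ N : ℕ, exp u < N →
      sieveOp (dens h) (expStep 0) N.primesBelow u ≤ I u := by
    intro u hu N hN
    obtain ⟨N', hN'⟩ := exists_nat_gt (2 * exp u)
    rw [H.sieveOp_dens_eq hN (by linarith [exp_pos u] : exp u < N'), hI]
    simp only [hTdef]
    rw [HΨ.integral_smoothSum h (by linarith) hN']
    refine sum_le_sum fun n _ => ?_
    rcases Nat.eq_zero_or_pos n with rfl | hn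
    · simp
    refine mul_le_mul_of_nonneg_left ?_ (div_nonneg (H.sqfreeCoeff_nonneg n) (by positivity))
    have hn0 : (0 : ℝ) < n := by exact_mod_cast hn
    rw [expStep_zero]
    split_ifs with h0
    · rw [HΨ.integral_eq_one]
      · rw [div_le_one (exp_pos u), ← log_le_iff_le_exp hn0]
        linarith
      · have := add_one_le_exp 1
        have : (1 : ℝ) ≤ n := by exact_mod_cast hn
        nlinarith
    · exact hΨ1 _ _ (by positivity) (by positivity) (hcomp u (by linarith) n)
  have hlower : ∀ u : ℝ, -1 ≤ u → ∀ N : ℕ, 2 * exp u < N →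
      I u ≤ sieveOp (dens h) (expStep 0) N.primesBelow (u + log 2) := by
    intro u hu N hN
    have hexp : exp (u + log 2) = 2 * exp u := by
      rw [Real.exp_add, exp_log two_pos, mul_comm]
    rw [H.sieveOp_dens_eq (N' := N) (by rwa [hexp]) (by rwa [hexp]), hI]
    simp only [hTdef]
    rw [HΨ.integral_smoothSum h hu hN]
    refine sum_le_sum fun n _ => ?_
    rcases Nat.eq_zero_or_pos n with rfl | hn
    · simp
    refine mul_le_mul_of_nonneg_left ?_ (div_nonneg (H.sqfreeCoeff_nonneg n) (by positivity))
    have hn0 : (0 : ℝ) < n := by exact_mod_cast hn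
    rw [expStep_zero]
    split_ifs with h0
    · exact hΨ2 _ _ (hcomp u hu n)
    · refine le_of_eq ?_
      have h2 : 2 < (n : ℝ) / exp u := by
        rw [lt_div_iff₀ (exp_pos u), ← hexp, ← Real.lt_log_iff_exp_lt hn0]
        linarith
      rw [intervalIntegral.integral_congr (g := fun _ => (0 : ℝ))]
      · simp
      · intro x hx
        rw [uIcc_of_le (hcomp u hu n)] at hx
        exact HΨ.eq_zero_of_two_lt (h2.trans_le hx.1)
  have hl2 : log 2 ≤ 1 := by linarith [Real.log_two_lt_d9]
  have hl0 : 0 < log 2 := log_pos (by norm_num)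
  refine ⟨D + C + |b| + 2 * a', by positivity, fun u hu N hN => ?_⟩
  have hup := hupper u hu N hN
  have h1 := abs_le.1 (hIb u hu)
  have hDu : 0 ≤ D * u := by positivity
  have hCu : 0 ≤ (C + |b|) := by positivity
  have hau : 0 ≤ a' * u := by positivity
  refine abs_le.2 ⟨?_, by nlinarith⟩
  rcases lt_or_ge u (log 2) with hlt | hge
  · have h0 : 0 ≤ sieveOp (dens h) (expStep 0) N.primesBelow u :=
      Finset.sum_nonneg fun t _ => mul_nonneg (prod_w_nonneg H.dens_nonneg t) (expStep_nonneg _ _)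
    have : u ^ 2 ≤ 1 := by nlinarith
    nlinarith
  · have h2 := hlower (u - log 2) (by linarith) N (by
      rw [Real.exp_sub, exp_log two_pos]
      linarith)
    rw [sub_add_cancel] at h2
    have h3 := abs_le.1 (hIb (u - log 2) (by linarith))
    have h4 : (C + |b|) * (u - log 2) ≤ (C + |b|) * u := by gcongr; linarith
    have h5 : u ^ 2 - (u - log 2) ^ 2 ≤ 2 * u := by nlinarith
    nlinarith

/-- `𝔣` on `[2, ∞[`, extended by `2` to the left. -/
def fExt (s : ℝ) : ℝ := sieveF (max s 2)

/-- `s⁻² σ(s)`, extended continuously to `]-∞, 0]`. -/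
def sigmaRatio (s : ℝ) : ℝ := sieveSigma (max s 2) / (max s 2) ^ 2

abbrev expGamma : ℝ := exp (2 * Real.eulerMascheroniConstant)

theorem sieveF_eq_fExt {s : ℝ} (hs : 0 < s) : sieveF s = fExt s := by
  rcases le_total s 2 with h2 | h2
  · rw [fExt, max_eq_right h2, sieveF_spec.init s hs h2, sieveF_spec.init 2 two_pos le_rfl]
  · rw [fExt, max_eq_left h2]

theorem fExt_of_le {s : ℝ} (hs : s ≤ 2) : fExt s = 2 := by
  rw [fExt, max_eq_right hs, sieveF_spec.init 2 two_pos le_rfl]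

theorem continuous_fExt : Continuous fExt :=
  sieveF_spec.cont.comp_continuous (by fun_prop) fun s =>
    mem_Ioi.2 (lt_max_of_lt_right two_pos)

theorem hasDerivAt_fExt {s : ℝ} (hs : 2 < s) : HasDerivAt fExt (2 * fExt (s - 2) / s) s := by
  have h1 := (sieveF_spec.diff s hs).hasDerivAt
  have h2 : deriv sieveF s = 2 * fExt (s - 2) / s := by
    rw [eq_div_iff (by linarith), mul_comm, sieveF_spec.delay s hs, sieveF_eq_fExt (by linarith)]
  rw [h2] at h1
  refine h1.congr_of_eventuallyEq ?_
  filter_upwards [Ioi_mem_nhds (show (0 : ℝ) < s by linarith)] with t ht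
  exact (sieveF_eq_fExt ht).symm

theorem sieveSigma_eq (s : ℝ) : sieveSigma s = (max s 0) ^ 2 * sigmaRatio s := by
  have hE := exp_pos (2 * Real.eulerMascheroniConstant)
  rcases le_or_gt s 0 with h0 | h0
  · rw [sieveSigma_spec.zero s h0, max_eq_right h0]
    ring
  rw [max_eq_left h0.le, sigmaRatio]
  rcases le_total s 2 with h2 | h2
  · rw [max_eq_right h2, sieveSigma_spec.init s h0 h2, sieveSigma_spec.init 2 two_pos le_rfl]
    field_simp
  · rw [max_eq_left h2]
    field_simp

theorem sigmaRatio_of_le {s : ℝ} (hs : s ≤ 2) : sigmaRatio s = 1 / (8 * expGamma) := by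
  rw [sigmaRatio, max_eq_right hs, sieveSigma_spec.init 2 two_pos le_rfl]
  field_simp

theorem continuous_sigmaRatio : Continuous sigmaRatio := by
  have h1 : Continuous fun s : ℝ => sieveSigma (max s 2) :=
    sieveSigma_spec.cont.comp_continuous (by fun_prop) fun s =>
    mem_Ioi.2 (lt_max_of_lt_right two_pos)
  refine h1.div (by fun_prop) fun s => ?_
  have : 0 < max s 2 := lt_max_of_lt_right two_pos
  positivity

theorem hasDerivAt_sigmaRatio {s : ℝ} (hs : 2 < s) :
    HasDerivAt sigmaRatio (-2 * sieveSigma (s - 2) / s ^ 3) s := by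
  refine (sieveSigma_spec.delay s hs).congr_of_eventuallyEq ?_
  filter_upwards [Ioi_mem_nhds hs] with t ht
  rw [sigmaRatio, max_eq_left (le_of_lt ht)]

theorem delayFun_fExt {a : ℝ} (ha : 0 < a) : DelayFun 0 (-1) (2 / a) fun s => fExt s / a where
  cont := continuous_fExt.div_const a
  init := fun s hs => by rw [fExt_of_le hs]
  deriv := fun s hs => by
    refine ((hasDerivAt_fExt hs).div_const a).congr_deriv ?_
    field_simp

theorem delayFun_sigmaRatio (a : ℝ) :
    DelayFun 2 1 (a / 2) fun s => 4 * a * expGamma * sigmaRatio s where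
  cont := continuous_const.mul continuous_sigmaRatio
  init := fun s hs => by
    rw [sigmaRatio_of_le hs]
    have := exp_pos (2 * Real.eulerMascheroniConstant)
    field_simp
    ring
  deriv := fun s hs => by
    refine ((hasDerivAt_sigmaRatio hs).const_mul (4 * a * expGamma)).congr_deriv ?_
    rw [sieveSigma_eq, max_eq_left (by linarith)]
    have : s ≠ 0 := by linarith
    field_simp

theorem continuous_sieveSigma : Continuous sieveSigma := by
  have : sieveSigma = fun s => (max s 0) ^ 2 * sigmaRatio s := funext sieveSigma_eq
  rw [this]
  exact (by fun_prop : Continuous fun s : ℝ => (max s 0) ^ 2).mul continuous_sigmaRatio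

theorem hasDerivAt_sieveSigma {s : ℝ} (hs : 2 < s) :
    HasDerivAt sieveSigma (2 / s * (sieveSigma s - sieveSigma (s - 2))) s := by
  have h1 : HasDerivAt (fun t => t ^ 2 * sigmaRatio t) _ s :=
    (hasDerivAt_pow 2 s).mul (hasDerivAt_sigmaRatio hs)
  have h2 : HasDerivAt sieveSigma _ s := h1.congr_of_eventuallyEq (by
    filter_upwards [Ioi_mem_nhds (show (0 : ℝ) < s by linarith)] with t ht
    rw [sieveSigma_eq, max_eq_left (le_of_lt ht)])
  refine h2.congr_deriv ?_
  rw [sieveSigma_eq s, max_eq_left (by linarith)]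
  have : s ≠ 0 := by linarith
  field_simp
  ring

theorem sieveSigma_of_mem {s : ℝ} (h0 : 0 ≤ s) (h2 : s ≤ 2) :
    sieveSigma s = s ^ 2 / (8 * expGamma) := by
  rw [sieveSigma_eq, sigmaRatio_of_le h2, max_eq_left h0]
  ring

theorem sieveSigma_sub_two_lt {s : ℝ} (hs : 2 ≤ s) : sieveSigma (s - 2) < sieveSigma s := by
  by_contra hle
  have hE := exp_pos (2 * Real.eulerMascheroniConstant)
  set B := {s : ℝ | 2 ≤ s ∧ sieveSigma s ≤ sieveSigma (s - 2)} with hB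
  have hBne : B.Nonempty := ⟨s, hs, not_lt.1 hle⟩
  have hBbdd : BddBelow B := ⟨2, fun s hs => hs.1⟩
  have hBcl : IsClosed B := (isClosed_le continuous_const continuous_id).inter
    (isClosed_le continuous_sieveSigma (continuous_sieveSigma.comp (by fun_prop)))
  obtain ⟨h1, h2⟩ := hBcl.csInf_mem hBne hBbdd
  set b := sInf B
  have hlow : ∀ t, 0 ≤ t → t ≤ 2 → sieveSigma t ≤ sieveSigma 2 := fun t ht0 ht2 => by
    rw [sieveSigma_of_mem ht0 ht2, sieveSigma_of_mem zero_le_two le_rfl]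
    gcongr
  have hmono : StrictMonoOn sieveSigma (Icc 2 b) := by
    refine strictMonoOn_of_deriv_pos (convex_Icc 2 b) continuous_sieveSigma.continuousOn ?_
    intro t ht
    rw [interior_Icc] at ht
    rw [(hasDerivAt_sieveSigma ht.1).deriv]
    have h3 : sieveSigma (t - 2) < sieveSigma t := by
      by_contra hn
      exact absurd (csInf_le hBbdd ⟨ht.1.le, not_lt.1 hn⟩) (not_le.2 ht.2)
    have h4 := ht.1
    exact mul_pos (by positivity) (sub_pos.2 h3)
  rcases h1.eq_or_lt with h3 | h3
  · rw [← h3, sub_self, sieveSigma_of_mem le_rfl zero_le_two,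
      sieveSigma_of_mem zero_le_two le_rfl] at h2
    have : 0 < (2 : ℝ) ^ 2 / (8 * expGamma) := by positivity
    simp at h2
    linarith
  · refine absurd h2 (not_le.2 ?_)
    rcases le_total (b - 2) 2 with h4 | h4
    · exact (hlow _ (by linarith) h4).trans_lt (hmono ⟨le_rfl, h1⟩ ⟨h1, le_rfl⟩ h3)
    · exact hmono ⟨h4, by linarith⟩ ⟨h1, le_rfl⟩ (by linarith)

theorem monotone_sieveSigma : Monotone sieveSigma := by
  have hE := exp_pos (2 * Real.eulerMascheroniConstant)
  have h1 : MonotoneOn sieveSigma (Iic 0) := fun s hs t ht _ => by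
    rw [sieveSigma_spec.zero s hs, sieveSigma_spec.zero t ht]
  have h2 : MonotoneOn sieveSigma (Icc 0 2) := fun s hs t ht hst => by
    rw [sieveSigma_of_mem hs.1 hs.2, sieveSigma_of_mem ht.1 ht.2]
    have := hs.1
    gcongr
  have h3 : MonotoneOn sieveSigma (Ici 2) := by
    refine monotoneOn_of_deriv_nonneg (convex_Ici 2) continuous_sieveSigma.continuousOn ?_ ?_
    · intro t ht
      rw [interior_Ici] at ht
      exact (hasDerivAt_sieveSigma ht).differentiableAt.differentiableWithinAt
    · intro t ht
      rw [interior_Ici] at ht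
      rw [(hasDerivAt_sieveSigma ht).deriv]
      have := sieveSigma_sub_two_lt (le_of_lt ht)
      have : (2 : ℝ) < t := ht
      exact mul_nonneg (by positivity) (by linarith)
  have h4 : MonotoneOn sieveSigma (Ici 0) := by
    have := h2.union_right h3 (c := 2) ⟨⟨zero_le_two, le_rfl⟩, fun x hx => hx.2⟩
      ⟨self_mem_Ici, fun x hx => hx⟩
    rwa [Icc_union_Ici_eq_Ici zero_le_two] at this
  have := h1.union_right h4 (c := 0) ⟨self_mem_Iic, fun x hx => hx⟩ ⟨self_mem_Ici, fun x hx => hx⟩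
  rwa [Iic_union_Ici, monotoneOn_univ] at this

theorem sieveSigma_nonneg (s : ℝ) : 0 ≤ sieveSigma s := by
  have := monotone_sieveSigma (min_le_left s 0)
  rwa [sieveSigma_spec.zero _ (min_le_right s 0)] at this

theorem sieveSigma_pos {s : ℝ} (hs : 0 < s) : 0 < sieveSigma s := by
  have hE := exp_pos (2 * Real.eulerMascheroniConstant)
  have h1 : 0 < min s 2 := lt_min hs two_pos
  refine lt_of_lt_of_le ?_ (monotone_sieveSigma (min_le_left s 2))
  rw [sieveSigma_of_mem h1.le (min_le_right s 2)]
  positivity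

theorem antitone_sigmaRatio : Antitone sigmaRatio := by
  have h1 : AntitoneOn sigmaRatio (Iic 2) := fun s hs t ht _ => by
    rw [sigmaRatio_of_le hs, sigmaRatio_of_le ht]
  have h3 : AntitoneOn sigmaRatio (Ici 2) := by
    refine antitoneOn_of_deriv_nonpos (convex_Ici 2) continuous_sigmaRatio.continuousOn ?_ ?_
    · intro t ht
      rw [interior_Ici] at ht
      exact (hasDerivAt_sigmaRatio ht).differentiableAt.differentiableWithinAt
    · intro t ht
      rw [interior_Ici] at ht
      rw [(hasDerivAt_sigmaRatio ht).deriv]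
      have : (2 : ℝ) < t := ht
      have := sieveSigma_nonneg (t - 2)
      refine div_nonpos_of_nonpos_of_nonneg (by linarith) (by positivity)
  have := h1.union_right h3 (c := 2) ⟨self_mem_Iic, fun x hx => hx⟩ ⟨self_mem_Ici, fun x hx => hx⟩
  rwa [Iic_union_Ici, antitoneOn_univ] at this

theorem two_le_fExt (s : ℝ) : 2 ≤ fExt s := by
  have h1 : ∀ n : ℕ, ∀ s : ℝ, s ≤ 2 * n + 2 → 2 ≤ fExt s := by
    intro n
    induction n with
    | zero => exact fun s hs => (fExt_of_le (by simpa using hs)).ge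
    | succ n ih =>
      intro s hs
      rcases le_total s 2 with h2 | h2
      · exact (fExt_of_le h2).ge
      have h3 : MonotoneOn fExt (Icc 2 s) := by
        refine monotoneOn_of_deriv_nonneg (convex_Icc 2 s) continuous_fExt.continuousOn ?_ ?_
        · intro t ht
          rw [interior_Icc] at ht
          exact (hasDerivAt_fExt ht.1).differentiableAt.differentiableWithinAt
        · intro t ht
          rw [interior_Icc] at ht
          rw [(hasDerivAt_fExt ht.1).deriv]
          have h4 := ih (t - 2) (by push_cast at hs; linarith [ht.2])
          have := ht.1
          positivity
      have := h3 ⟨le_rfl, h2⟩ ⟨h2, le_rfl⟩ h2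
      rwa [fExt_of_le le_rfl] at this
  refine h1 ⌈s⌉₊ s ?_
  have h2 := Nat.le_ceil s
  have h3 : (0 : ℝ) ≤ ⌈s⌉₊ := Nat.cast_nonneg _
  linarith

theorem monotone_fExt : Monotone fExt := by
  have h1 : MonotoneOn fExt (Iic 2) := fun s hs t ht _ => by
    rw [fExt_of_le hs, fExt_of_le ht]
  have h3 : MonotoneOn fExt (Ici 2) := by
    refine monotoneOn_of_deriv_nonneg (convex_Ici 2) continuous_fExt.continuousOn ?_ ?_
    · intro t ht
      rw [interior_Ici] at ht
      exact (hasDerivAt_fExt ht).differentiableAt.differentiableWithinAt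
    · intro t ht
      rw [interior_Ici] at ht
      rw [(hasDerivAt_fExt ht).deriv]
      have : (2 : ℝ) < t := ht
      have := two_le_fExt (t - 2)
      positivity
  have := h1.union_right h3 (c := 2) ⟨self_mem_Iic, fun x hx => hx⟩ ⟨self_mem_Ici, fun x hx => hx⟩
  rwa [Iic_union_Ici, monotoneOn_univ] at this

theorem exists_lipschitzOn_fExt (b : ℝ) : ∃ K, LipschitzOnWith K fExt (Icc 0 b) := by
  simpa using (delayFun_fExt one_pos).exists_lipschitzOn 0 b

theorem exists_lipschitzOn_sieveSigma (a b : ℝ) : ∃ K, LipschitzOnWith K sieveSigma (Icc a b) := by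
  have : sieveSigma = fun s => max s 0 * (max s 0 * sigmaRatio s) := by
    funext s
    rw [sieveSigma_eq]
    ring
  rw [this]
  have hmax : ∃ K, LipschitzOnWith K (fun s : ℝ => max s 0) (Icc a b) :=
    ⟨1, (LipschitzWith.id.max_const 0).lipschitzOnWith⟩
  refine exists_lipschitzOn_mul hmax (exists_lipschitzOn_mul hmax ?_)
  have hE := exp_pos (2 * Real.eulerMascheroniConstant)
  have := (delayFun_sigmaRatio (4 * expGamma)⁻¹).exists_lipschitzOn a b
  have h2 : (fun s => 4 * (4 * expGamma)⁻¹ * expGamma * sigmaRatio s) = sigmaRatio := by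
    funext s
    field_simp
  rwa [h2] at this

theorem exists_sieveOp_ceil_sub_le {d : ℕ} {κ c : ℝ} {φ k : ℝ → ℝ} (hφ : DelayFun d κ c φ)
    {v : ℕ → ℝ} {M : ℝ} (hv : MertensWeight v M) (hk : ∀ x, x < 0 → k x = 0)
    (hinf : ∀ ε : ℝ, 0 < ε → ∃ U β : ℝ, 0 ≤ β ∧ ∀ u : ℝ, 0 ≤ u → ∀ N : ℕ, exp u < N →
      |sieveOp (fun p => κ * v p) k N.primesBelow u - c * u ^ d| ≤
        ε * u ^ d + if u < U then β else 0) (n : ℕ) {ε : ℝ} (hε : 0 < ε) :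
    ∃ U β ℓ₀ : ℝ, 0 ≤ β ∧ ∀ z : ℝ, 3 ≤ z → ℓ₀ ≤ log z → ∀ u : ℝ, 0 ≤ u →
      u ≤ n * log z →
      |sieveOp (fun p => κ * v p) k ⌈z⌉₊.primesBelow u - u ^ d * φ (2 * u / log z)| ≤
        ε * u ^ d + if u < U then β else 0 := by
  obtain ⟨U, β, hβ, h1⟩ := exists_sieveOp_sub_le hφ hv hk hinf n (ε / 2) (by positivity)
  obtain ⟨K, hK⟩ := hφ.exists_lipschitzOn 0 (2 * n)
  refine ⟨U, β, 4 * n * K / ε, hβ, fun z hz hℓ u hu hun => ?_⟩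
  set ℓ := log z with hℓdef
  set ℓ' := log ⌈z⌉₊ with hℓ'
  have hz0 : 0 < z := by linarith
  have hzc : z ≤ ⌈z⌉₊ := Nat.le_ceil z
  have hzc2 : (⌈z⌉₊ : ℝ) < z + 1 := Nat.ceil_lt_add_one hz0.le
  have hℓ0 : 0 < ℓ := log_pos (by linarith)
  have hℓℓ : ℓ ≤ ℓ' := log_le_log hz0 hzc
  have hℓ1 : ℓ' ≤ ℓ + 1 := by
    have : ℓ' ≤ log (z * exp 1) := by
      refine log_le_log (by linarith) ?_
      have := add_one_le_exp 1
      nlinarith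
    rwa [Real.log_mul hz0.ne' (exp_pos 1).ne', Real.log_exp] at this
  have hm : 2 ≤ ⌈z⌉₊ := by
    have : (2 : ℝ) ≤ ⌈z⌉₊ := by linarith
    exact_mod_cast this
  have h2 := h1 _ hm u hu (by nlinarith [(Nat.cast_nonneg n : (0 : ℝ) ≤ n)])
  have hmem : 2 * u / ℓ ∈ Icc (0 : ℝ) (2 * n) := by
    refine ⟨by positivity, ?_⟩
    rw [div_le_iff₀ hℓ0]
    linarith
  have hmem' : 2 * u / ℓ' ∈ Icc (0 : ℝ) (2 * n) := by
    refine ⟨div_nonneg (by linarith) (by linarith), le_trans ?_ hmem.2⟩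
    gcongr
  have h3 := hK.dist_le_mul _ hmem' _ hmem
  rw [Real.dist_eq, Real.dist_eq] at h3
  have h4 : |2 * u / ℓ' - 2 * u / ℓ| ≤ 2 * n / ℓ := by
    have hℓ'0 : 0 < ℓ' := by linarith
    have : 2 * u / ℓ' - 2 * u / ℓ = -(2 * u / ℓ * ((ℓ' - ℓ) / ℓ')) := by
      field_simp
      ring
    rw [this, abs_neg, abs_of_nonneg (mul_nonneg hmem.1 (div_nonneg (by linarith) hℓ'0.le))]
    calc _ ≤ 2 * n * (1 / ℓ) := by
          refine mul_le_mul hmem.2 ?_ (div_nonneg (by linarith) hℓ'0.le) (by positivity)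
          gcongr
          linarith
      _ = _ := by ring
  have h5 : K * (2 * n / ℓ) ≤ ε / 2 := by
    rw [div_le_iff₀ hε] at hℓ
    rw [← mul_div_assoc, div_le_iff₀ hℓ0]
    linarith
  have h6 : |u ^ d * φ (2 * u / ℓ') - u ^ d * φ (2 * u / ℓ)| ≤ ε / 2 * u ^ d := by
    rw [← mul_sub, abs_mul, abs_of_nonneg (by positivity), mul_comm]
    refine mul_le_mul_of_nonneg_right (h3.trans (le_trans ?_ h5)) (by positivity)
    exact mul_le_mul_of_nonneg_left h4 K.2
  have h7 := abs_sub_le (sieveOp (fun p => κ * v p) k ⌈z⌉₊.primesBelow u)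
    (u ^ d * φ (2 * u / ℓ')) (u ^ d * φ (2 * u / ℓ))
  linarith

theorem SieveHyp.exists_sieveOp_dens_ceil (H : SieveHyp h Hstar L c₀) (HΨ : BumpHyp Ψ) {a : ℝ}
    (ha : 0 < a) (hHa : Hstar 1 = a) (n : ℕ) {ε : ℝ} (hε : 0 < ε) :
    ∃ β ℓ₀ : ℝ, 0 ≤ β ∧ ∀ z : ℝ, 3 ≤ z → ℓ₀ ≤ log z → ∀ u : ℝ, 0 ≤ u →
      u ≤ n * log z →
      |sieveOp (dens h) (expStep 0) ⌈z⌉₊.primesBelow u -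
        a * expGamma * log z ^ 2 * sieveSigma (2 * u / log z)| ≤ ε * u ^ 2 + β := by
  obtain ⟨C, hC, hG⟩ := H.exists_sieveOp_dens HΨ ha hHa
  obtain ⟨U, β, ℓ₀, hβ, h1⟩ := exists_sieveOp_ceil_sub_le (delayFun_sigmaRatio a) H.mertensWeight_dens
    (k := expStep 0) (fun x hx => expStep_of_neg 0 hx) (fun η hη => by
      refine ⟨max 1 (2 * C / η), C * (1 + max 1 (2 * C / η)), by positivity,
        fun u hu N hN => ?_⟩
      simp only [one_mul]
      refine (hG u hu N hN).trans ?_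
      split_ifs with hlt
      · have : C * (1 + u) ≤ C * (1 + max 1 (2 * C / η)) := by gcongr
        have : 0 ≤ η * u ^ 2 := by positivity
        linarith
      · have h2 : 1 ≤ u := (le_max_left _ _).trans (not_lt.1 hlt)
        have h3 : 2 * C / η ≤ u := (le_max_right _ _).trans (not_lt.1 hlt)
        rw [div_le_iff₀ hη] at h3
        nlinarith) n hε
  refine ⟨β, ℓ₀, hβ, fun z hz hℓ u hu hun => ?_⟩
  have h2 := h1 z hz hℓ u hu hun
  simp only [one_mul] at h2
  have hℓ0 : 0 < log z := log_pos (by linarith)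
  have h3 : a * expGamma * log z ^ 2 * sieveSigma (2 * u / log z) =
      u ^ 2 * (4 * a * expGamma * sigmaRatio (2 * u / log z)) := by
    rw [sieveSigma_eq, max_eq_left (by positivity)]
    field_simp
    ring
  rw [h3]
  refine h2.trans ?_
  split_ifs <;> linarith

theorem SieveHyp.exists_sieveOp_dual_ceil (H : SieveHyp h Hstar L c₀) {a : ℝ}
    (ha : 0 < a) (hHa : Hstar 1 = a) (n : ℕ) {ε : ℝ} (hε : 0 < ε) :
    ∃ U β ℓ₀ : ℝ, 0 ≤ β ∧ ∀ z : ℝ, 3 ≤ z → ℓ₀ ≤ log z → ∀ u : ℝ, 0 ≤ u →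
      u ≤ n * log z →
      |sieveOp (fun p => -1 * dualDens h p) (fun v => (max v 0) ^ 2) ⌈z⌉₊.primesBelow u -
        fExt (2 * u / log z) / a| ≤ ε + if u < U then β else 0 := by
  obtain ⟨M, hM⟩ := H.exists_mertens_dualDens
  have := exists_sieveOp_ceil_sub_le (delayFun_fExt ha) hM
    (k := fun v => (max v 0) ^ 2) (fun x hx => by simp [max_eq_right hx.le]) (fun η hη => by
      obtain ⟨U, hU⟩ := eventually_atTop.1
        (Metric.tendsto_nhds.1 (H.tendsto_dualLogSum ha hHa) η hη)
      obtain ⟨N₀, hN₀⟩ := exists_nat_gt (exp (max U 0))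
      set β := ∑ t ∈ N₀.primesBelow.powerset, |∏ p ∈ t, -1 * dualDens h p| * (max U 0) ^ 2
      refine ⟨max U 0, β + 2 / a, by positivity, fun u hu N hN => ?_⟩
      rw [← dualLogSum_eq_sieveOp hN]
      split_ifs with hlt
      · rw [dualLogSum_eq_sieveOp ((Real.exp_le_exp.2 hlt.le).trans_lt hN₀), pow_zero, mul_one,
          mul_one]
        have h1 : |sieveOp (fun p => -1 * dualDens h p) (fun v => (max v 0) ^ 2)
            N₀.primesBelow u| ≤ β := by
          refine (abs_sum_le_sum_abs _ _).trans (sum_le_sum fun t _ => ?_)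
          rw [abs_mul, abs_of_nonneg (by positivity : (0 : ℝ) ≤ (max (u - logW t) 0) ^ 2)]
          have := logW_nonneg t
          have h5 : max (u - logW t) 0 ≤ max U 0 := max_le (by linarith) (le_max_right _ _)
          exact mul_le_mul_of_nonneg_left (pow_le_pow_left₀ (le_max_right _ _) h5 2) (abs_nonneg _)
        have h2 : |2 / a| = 2 / a := abs_of_pos (by positivity)
        have := abs_sub (sieveOp (fun p => -1 * dualDens h p) (fun v => (max v 0) ^ 2)
            N₀.primesBelow u) (2 / a)
        linarith
      · have := hU u ((le_max_left _ _).trans (not_lt.1 hlt))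
        rw [Real.dist_eq] at this
        simp only [pow_zero, mul_one, add_zero]
        exact this.le) n hε
  simpa using this

theorem prime_rpow_eq_exp {p : ℕ} (hp : p.Prime) (δ : ℝ) :
    (p : ℝ) ^ δ = exp (δ * log p) := by
  rw [Real.rpow_def_of_pos (by exact_mod_cast hp.pos), mul_comm]

theorem one_add_log_le_rpow {p : ℕ} (hp : p.Prime) (δ : ℝ) :
    1 + δ * log p ≤ (p : ℝ) ^ δ := by
  rw [prime_rpow_eq_exp hp, add_comm]
  exact add_one_le_exp _

theorem one_add_sum_le_prod {ι : Type*} (s : Finset ι) {f : ι → ℝ} (hf : ∀ i ∈ s, 0 ≤ f i) :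
    1 + ∑ i ∈ s, f i ≤ ∏ i ∈ s, (1 + f i) := by
  classical
  induction s using Finset.induction_on with
  | empty => simp
  | insert i s hi ih =>
    rw [Finset.sum_insert hi, prod_insert hi]
    have h1 := ih fun j hj => hf j (Finset.mem_insert_of_mem hj)
    have h2 := hf i (Finset.mem_insert_self i s)
    have h3 : 0 ≤ ∑ j ∈ s, f j :=
      Finset.sum_nonneg fun j hj => hf j (Finset.mem_insert_of_mem hj)
    nlinarith

theorem log_prime_pos {p : ℕ} (hp : p.Prime) : 0 < log p :=
  log_pos (by exact_mod_cast hp.one_lt)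

theorem sieveOp_sdiff_sub_le {g : ℕ → ℝ} {k : ℝ → ℝ} {f : ℝ → ℝ} {S : Finset ℕ} {δ ε β V : ℝ}
    (hS : ∀ p ∈ S, p.Prime) (hg : ∀ p, 0 ≤ g p) (hδ : 0 < δ)
    (hgδ : ∀ p ∈ S, g p * (p : ℝ) ^ δ < 1) (hk : ∀ v, v < 0 → k v = 0) (hε : 0 ≤ ε)
    (h0 : ∀ u, 0 ≤ u → u ≤ V →
      |sieveOp (fun p => -1 * g p) k S u - f u| ≤ ε + β * exp (-δ * u))
    (hfb : ∀ u, 0 ≤ u → u ≤ V → |f u| ≤ β)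
    (hfL : ∀ u v, 0 ≤ v → v ≤ u → u ≤ V → |f v - f u| ≤ δ * ε * (u - v)) {q : Finset ℕ}
    (hq : q ⊆ S) {u : ℝ} (hu : 0 ≤ u) (huV : u ≤ V) :
    |sieveOp (fun p => -1 * g p) k (S \ q) u - (∏ p ∈ q, (1 - g p)⁻¹) * f u| ≤
      (∏ p ∈ q, thetaFactor g δ p) * (ε + β * exp (-δ * u)) := by
  induction q using Finset.induction_on generalizing u with
  | empty => simpa using h0 u hu huV
  | insert p q hpq ih =>
    have hpS : p ∈ S := hq (Finset.mem_insert_self p q)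
    have hp := hS p hpS
    have hqS : q ⊆ S := (Finset.subset_insert p q).trans hq
    have hlog := log_prime_pos hp
    have hβ : 0 ≤ β := (abs_nonneg _).trans (hfb u hu huV)
    have h1p := one_le_prime_rpow hp hδ.le
    have hgp := hgδ p hpS
    have hg1 : g p < 1 := by nlinarith [hg p]
    set x := (p : ℝ) ^ δ with hx
    set P := ∏ p ∈ q, (1 - g p)⁻¹ with hP
    set Θ := ∏ p ∈ q, thetaFactor g δ p with hΘ
    set θ := thetaFactor g δ p with hθ
    have hθe : θ = (1 - g p * x)⁻¹ := thetaFactor_eq hgp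
    have hθ1 : θ = 1 + g p * x * θ := by
      rw [hθe]
      have : 1 - g p * x ≠ 0 := by linarith
      field_simp
      ring
    have hθ0 : 0 ≤ θ := thetaFactor_nonneg _ _ _
    have hΘ0 : 0 ≤ Θ := prod_nonneg fun _ _ => thetaFactor_nonneg _ _ _
    have hP0 : 0 ≤ P := prod_nonneg fun r hr => by
      have h2 := hgδ r (hqS hr)
      have h3 := one_le_prime_rpow (hS r (hqS hr)) hδ.le
      exact inv_nonneg.2 (by nlinarith [hg r])
    have hPΘ : P ≤ Θ := prod_le_prod (fun r hr => by
      have h2 := hgδ r (hqS hr)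
      have h3 := one_le_prime_rpow (hS r (hqS hr)) hδ.le
      exact inv_nonneg.2 (by nlinarith [hg r])) fun r hr => by
      have h2 := hgδ r (hqS hr)
      have h3 := one_le_prime_rpow (hS r (hqS hr)) hδ.le
      rw [thetaFactor_eq h2]
      exact inv_anti₀ (by linarith) (by nlinarith [hg r])
    have hiθ : (1 - g p)⁻¹ ≤ θ := by
      rw [hθe]
      exact inv_anti₀ (by linarith) (by nlinarith [hg p])
    have hi0 : 0 ≤ (1 - g p)⁻¹ := inv_nonneg.2 (by linarith)
    have hi1 : (1 - g p)⁻¹ = 1 + g p * (1 - g p)⁻¹ := by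
      have : 1 - g p ≠ 0 := by linarith
      field_simp
      ring
    have hPi : P * (1 - g p)⁻¹ ≤ Θ * θ := mul_le_mul hPΘ hiθ hi0 hΘ0
    have hins : S \ q = insert p (S \ insert p q) := by
      ext r
      simp only [Finset.mem_sdiff, Finset.mem_insert]
      constructor
      · rintro ⟨h1, h2⟩
        by_cases h3 : r = p
        · exact Or.inl h3
        · exact Or.inr ⟨h1, by tauto⟩
      · rintro (rfl | ⟨h1, h2⟩)
        · exact ⟨hpS, hpq⟩
        · exact ⟨h1, by tauto⟩
    set W := sieveOp (fun p => -1 * g p) k (S \ insert p q) with hW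
    have hrec : ∀ u, W u = sieveOp (fun p => -1 * g p) k (S \ q) u + g p * W (u - log p) := by
      intro u
      rw [hins, sieveOp_insert _ _ (by simp)]
      ring
    rw [prod_insert hpq, prod_insert hpq, mul_comm (1 - g p)⁻¹, mul_comm θ]
    have key : ∀ n : ℕ, ∀ u : ℝ, 0 ≤ u → u ≤ V → u < n * log p →
        |W u - P * (1 - g p)⁻¹ * f u| ≤ Θ * θ * (ε + β * exp (-δ * u)) := by
      intro n
      induction n with
      | zero =>
        intro u hu _ hlt
        simp at hlt
        linarith
      | succ n ihn =>
        intro u hu huV hlt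
        have h2 := ih hqS hu huV
        set e := β * exp (-δ * u) with he
        have he0 : 0 ≤ e := by positivity
        have hee : β * exp (-δ * (u - log p)) = e * x := by
          rw [he, hx, prime_rpow_eq_exp hp, mul_assoc, ← Real.exp_add]
          ring_nf
        rw [hrec]
        rcases lt_or_ge u (log p) with hul | hul
        · rw [hW, sieveOp_of_neg _ hk _ (by linarith : u - log p < 0), mul_zero, add_zero]
          have h3 : |f u| ≤ e * x := by
            refine (hfb u hu huV).trans ?_
            rw [← hee]
            have : 1 ≤ exp (-δ * (u - log p)) := by
              rw [Real.one_le_exp_iff]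
              nlinarith
            nlinarith
          set Y := sieveOp (fun p => -1 * g p) k (S \ q) u
          have h4 : Y - P * (1 - g p)⁻¹ * f u = (Y - P * f u) - g p * (P * (1 - g p)⁻¹) * f u := by
            rw [hi1]
            have : 1 - g p ≠ 0 := by linarith
            field_simp
            ring
          rw [h4]
          refine (abs_sub _ _).trans ?_
          rw [abs_mul, abs_of_nonneg (by have := hg p; positivity : 0 ≤ g p * (P * (1 - g p)⁻¹))]
          have h5 : g p * (P * (1 - g p)⁻¹) * |f u| ≤ g p * (Θ * θ) * (e * x) := by
            have := hg p
            gcongr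
          have h6 : Θ * θ * e = Θ * e + g p * (Θ * θ) * (e * x) := by
            calc Θ * θ * e = Θ * (1 + g p * x * θ) * e := by rw [← hθ1]
              _ = _ := by ring
          have h7 : Θ * ε ≤ Θ * θ * ε := by
            have : 1 ≤ θ := by
              have := mul_nonneg (mul_nonneg (hg p) (by linarith : 0 ≤ x)) hθ0
              linarith
            have := mul_le_mul_of_nonneg_left this (mul_nonneg hΘ0 hε)
            linarith
          linarith
        · have h3 := ihn (u - log p) (by linarith) (by linarith) (by push_cast at hlt; linarith)
          rw [hee] at h3
          have h4 := hfL u (u - log p) (by linarith) (by linarith) huV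
          rw [sub_sub_cancel] at h4
          set Y := sieveOp (fun p => -1 * g p) k (S \ q) u
          set Z := W (u - log p)
          set f' := f (u - log p)
          have h5 : Y + g p * Z - P * (1 - g p)⁻¹ * f u = (Y - P * f u) +
              g p * (Z - P * (1 - g p)⁻¹ * f') + g p * (P * (1 - g p)⁻¹) * (f' - f u) := by
            have : 1 - g p ≠ 0 := by linarith
            field_simp
            ring
          rw [h5]
          refine (abs_add_three _ _ _).trans ?_
          rw [abs_mul, abs_mul, abs_of_nonneg (hg p),
            abs_of_nonneg (by have := hg p; positivity : 0 ≤ g p * (P * (1 - g p)⁻¹))]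
          have h6 : g p * |Z - P * (1 - g p)⁻¹ * f'| ≤ g p * (Θ * θ * (ε + e * x)) :=
            mul_le_mul_of_nonneg_left h3 (hg p)
          have h7 : g p * (P * (1 - g p)⁻¹) * |f' - f u| ≤
              g p * (Θ * θ) * (δ * ε * log p) := by
            have := hg p
            gcongr
          have h8 : g p * (Θ * θ) * ε * (1 + δ * log p) ≤ g p * (Θ * θ) * ε * x := by
            have := hg p
            have := one_add_log_le_rpow hp δ
            gcongr
          have h9 : Θ * θ * (ε + e) = Θ * (ε + e) + g p * (Θ * θ) * (e * x) +
              g p * (Θ * θ) * ε * x := by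
            calc Θ * θ * (ε + e) = Θ * (1 + g p * x * θ) * (ε + e) := by rw [← hθ1]
              _ = _ := by ring
          linarith
    obtain ⟨n, hn⟩ := exists_nat_gt (u / log p)
    exact key n u hu huV ((div_lt_iff₀ hlog).1 hn)

open Classical in
/-- `e^{-u}` times the smooth sum restricted to `n` coprime to `d`. -/
def coprimeSum (Ψ : ℝ → ℝ) (h : ArithmeticFunction ℝ) (d : ℕ) (u : ℝ) : ℝ :=
  exp (-u) * ∑' n : ℕ, if n.Coprime d then Ψ (n / exp u) * sqfreeCoeff h n else 0

theorem SieveHyp.sqfreeCoeff_mul (H : SieveHyp h Hstar L c₀) {m n : ℕ} (hmn : m.Coprime n) :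
    sqfreeCoeff h (m * n) = sqfreeCoeff h m * sqfreeCoeff h n := by
  simp only [sqfreeCoeff, H.mul.map_mul_of_coprime hmn,
    ArithmeticFunction.isMultiplicative_moebius.map_mul_of_coprime hmn]
  push_cast
  ring

open Classical in
theorem SieveHyp.coprimeSum_divisible (H : SieveHyp h Hstar L c₀) {d e : ℕ} (he : 0 < e)
    (hsq : Squarefree e) (hed : e.Coprime d) (u : ℝ) :
    exp (-u) * (∑' n : ℕ, if n.Coprime d ∧ e ∣ n then Ψ (n / exp u) * sqfreeCoeff h n
      else 0) = dens h e * coprimeSum Ψ h (e * d) (u - log e) := by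
  have he0 : (0 : ℝ) < e := by exact_mod_cast he
  have hinj : Function.Injective fun m : ℕ => e * m := fun m n hmn =>
    Nat.eq_of_mul_eq_mul_left he hmn
  rw [← hinj.tsum_eq (f := fun n : ℕ => if n.Coprime d ∧ e ∣ n then
    Ψ (n / exp u) * sqfreeCoeff h n else 0)]
  · rw [coprimeSum, ← tsum_mul_left, ← tsum_mul_left, ← tsum_mul_left]
    refine tsum_congr fun m => ?_
    have h1 : (e * m).Coprime d ↔ m.Coprime d := by
      rw [Nat.coprime_mul_iff_left]
      exact and_iff_right hed
    have h2 : m.Coprime (e * d) ↔ m.Coprime e ∧ m.Coprime d := Nat.coprime_mul_iff_right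
    simp only [h1, h2, dvd_mul_right, and_true]
    by_cases hd : m.Coprime d
    swap
    · simp [hd]
    by_cases hm : m.Coprime e
    · rw [if_pos hd, if_pos ⟨hm, hd⟩, H.sqfreeCoeff_mul hm.symm, ← sqfreeCoeff_div h hsq, neg_sub,
        Real.exp_sub, Real.exp_sub, exp_log he0, Real.exp_neg]
      push_cast
      have h3 : (e : ℝ) * m / exp u = m / (exp u / e) := by field_simp
      rw [h3]
      field_simp
    · rw [if_pos hd, if_neg (by tauto), sqfreeCoeff_of_not]
      · simp
      · rw [Nat.squarefree_mul_iff]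
        exact fun hh => hm hh.1.symm
  · intro n hn
    rw [Function.mem_support] at hn
    obtain ⟨m, rfl⟩ := (by by_contra hc; exact hn (if_neg fun hh => hc hh.2) : e ∣ n)
    exact ⟨m, rfl⟩

theorem BumpHyp.finite_support (HΨ : BumpHyp Ψ) (u : ℝ) (F : ℕ → ℝ) (hF : ∀ n : ℕ,
    Ψ (n / exp u) = 0 → F n = 0) : (Function.support F).Finite := by
  refine (Set.finite_Iic ⌊2 * exp u⌋₊).subset fun n hn => ?_
  refine Nat.le_floor ?_
  by_contra hlt
  refine hn (hF n (HΨ.eq_zero_of_two_lt ?_))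
  rw [lt_div_iff₀ (exp_pos u)]
  exact not_le.1 hlt

open Classical in
theorem SieveHyp.coprimeSum_rec (H : SieveHyp h Hstar L c₀) (HΨ : BumpHyp Ψ) {d p : ℕ}
    (hp : p.Prime) (hpd : p.Coprime d) (u : ℝ) :
    coprimeSum Ψ h d u =
      coprimeSum Ψ h (p * d) u + dens h p * coprimeSum Ψ h (p * d) (u - log p) := by
  rw [← H.coprimeSum_divisible hp.pos hp.squarefree hpd, coprimeSum, coprimeSum, ← mul_add,
    ← Summable.tsum_add]
  · congr 1
    refine tsum_congr fun n => ?_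
    have h2 : n.Coprime (p * d) ↔ ¬ p ∣ n ∧ n.Coprime d := by
      rw [Nat.coprime_mul_iff_right, Nat.coprime_comm, hp.coprime_iff_not_dvd]
    by_cases h3 : p ∣ n <;> by_cases h4 : n.Coprime d <;> simp [h2, h3, h4]
  · exact summable_of_hasFiniteSupport (HΨ.finite_support u _ fun n hn => by simp [hn])
  · exact summable_of_hasFiniteSupport (HΨ.finite_support u _ fun n hn => by simp [hn])

theorem coprimeSum_one (u : ℝ) :
    coprimeSum Ψ h 1 u = exp (-u) * smoothSum Ψ h (exp u) := by
  simp [coprimeSum, smoothSum]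

theorem BumpHyp.coprimeSum_eq_zero (HΨ : BumpHyp Ψ) {u : ℝ} (hu : u < -1) (d : ℕ) :
    coprimeSum Ψ h d u = 0 := by
  rw [coprimeSum]
  convert mul_zero _
  convert tsum_zero with n
  rcases Nat.eq_zero_or_pos n with rfl | hn
  · simp [sqfreeCoeff]
  · have hn' : (1 : ℝ) ≤ n := by exact_mod_cast hn
    have h1 : exp u < 1 / 2 := by
      have h2 : exp u * exp (-u) = 1 := by rw [← Real.exp_add]; simp
      nlinarith [add_one_le_exp (-u), exp_pos u]
    rw [HΨ.eq_zero_of_two_lt, zero_mul, ite_self]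
    rw [lt_div_iff₀ (exp_pos u)]
    linarith

theorem SieveHyp.abs_coprimeSum_sub_le (H : SieveHyp h Hstar L c₀) (HΨ : BumpHyp Ψ)
    {a b δ : ℝ} (ha : 0 < a) (hδ : 0 < δ) {E : ℝ → ℝ}
    (hE0 : ∀ u, |exp (-u) * smoothSum Ψ h (exp u) - (a * u + b)| ≤ E u)
    (hEs : ∀ u v, 0 ≤ v → E (u - v) ≤ exp (δ * v) * E u)
    (hEn : ∀ u, u < 0 → a * |u| + |b| + a / δ ≤ E u) {t : Finset ℕ} (ht : ∀ p ∈ t, p.Prime)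
    (hlt : ∀ p ∈ t, dens h p * (p : ℝ) ^ δ < 1) (u : ℝ) :
    |coprimeSum Ψ h (∏ p ∈ t, p) u - (∏ p ∈ t, (1 - dualDens h p)) *
      (a * u + b + a * ∑ p ∈ t, dualDens h p * log p)| ≤
      (∏ p ∈ t, thetaFactor (dens h) δ p) * E u := by
  induction t using Finset.induction_on generalizing u with
  | empty => simpa [coprimeSum_one] using hE0 u
  | insert p t hpt ih =>
    have hp := ht p (Finset.mem_insert_self p t)
    have ht' : ∀ p ∈ t, p.Prime := fun r hr => ht r (Finset.mem_insert_of_mem hr)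
    have hcop : p.Coprime (∏ p ∈ t, p) := Nat.Coprime.prod_right fun r hr =>
      (Nat.coprime_primes hp (ht' r hr)).2 fun hpr => hpt (hpr ▸ hr)
    have ih' := ih ht' fun r hr => hlt r (Finset.mem_insert_of_mem hr)
    have hrec := H.coprimeSum_rec HΨ hp hcop (Ψ := Ψ)
    have hneg : ∀ u, u < -1 → |coprimeSum Ψ h (∏ p ∈ insert p t, p) u -
        (∏ p ∈ insert p t, (1 - dualDens h p)) *
        (a * u + b + a * ∑ p ∈ insert p t, dualDens h p * log p)| ≤
        (∏ p ∈ insert p t, thetaFactor (dens h) δ p) * E u := by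
      intro u hu
      have hm0 : 0 ≤ ∏ p ∈ insert p t, (1 - dualDens h p) := prod_nonneg fun r _ => by
        linarith [H.dualDens_lt_one r]
      have hm1 : ∏ p ∈ insert p t, (1 - dualDens h p) ≤ 1 :=
        Finset.prod_le_one (fun r _ => by linarith [H.dualDens_lt_one r])
          fun r _ => by linarith [H.dualDens_nonneg r]
      have hθ : 1 + δ * ∑ p ∈ insert p t, dualDens h p * log p ≤
          ∏ p ∈ insert p t, thetaFactor (dens h) δ p := by
        rw [mul_sum]
        refine (one_add_sum_le_prod _ fun r _ => ?_).trans
          (prod_le_prod (fun r _ => ?_) fun r hr => ?_)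
        · have := H.dualDens_nonneg r
          have := log_natCast_nonneg r
          positivity
        · have := H.dualDens_nonneg r
          have := log_natCast_nonneg r
          positivity
        · rw [thetaFactor_eq (hlt r hr)]
          have h1 := one_add_log_le_rpow (ht r hr) δ
          have h2 := H.dualDens_le r
          have h3 := H.dualDens_nonneg r
          have h4 := hlt r hr
          have h5 : δ * (dualDens h r * log r) ≤ dens h r * (r : ℝ) ^ δ := by
            calc _ = dualDens h r * (δ * log r) := by ring
              _ ≤ dens h r * (r : ℝ) ^ δ := mul_le_mul h2 (by linarith)
                (mul_nonneg hδ.le (log_natCast_nonneg r)) (H.dens_nonneg r)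
          rw [← one_div, le_div_iff₀ (by linarith)]
          have h6 := H.dens_nonneg r
          nlinarith [mul_nonneg h6 (Real.rpow_nonneg (Nat.cast_nonneg (α := ℝ) r) δ)]
      rw [HΨ.coprimeSum_eq_zero hu, zero_sub, abs_neg, abs_mul, abs_of_nonneg hm0]
      set Θ := ∏ p ∈ insert p t, thetaFactor (dens h) δ p
      set c := ∑ p ∈ insert p t, dualDens h p * log p
      have hc : 0 ≤ c := Finset.sum_nonneg fun r _ =>
        mul_nonneg (H.dualDens_nonneg r) (log_natCast_nonneg r)
      have h1 : |a * u + b + a * c| ≤ a * |u| + |b| + a * c := by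
        refine (abs_add_three _ _ _).trans ?_
        rw [abs_mul, abs_mul, abs_of_pos ha, abs_of_nonneg hc]
      have h2 : a * |u| + |b| + a * c ≤ Θ * (a * |u| + |b| + a / δ) := by
        have h3 : 0 ≤ δ * c := by positivity
        have h4 : (1 + δ * c) * (a * |u| + |b| + a / δ) ≤ Θ * (a * |u| + |b| + a / δ) := by
          gcongr
        have h5 : (1 + δ * c) * (a * |u| + |b| + a / δ) =
            a * |u| + |b| + a * c + (a / δ + δ * c * (a * |u| + |b|)) := by
          field_simp
          ring
        have : 0 ≤ a / δ + δ * c * (a * |u| + |b|) := by positivity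
        linarith
      have h3 : Θ * (a * |u| + |b| + a / δ) ≤ Θ * E u := by
        gcongr
        · exact prod_nonneg fun _ _ => thetaFactor_nonneg _ _ _
        · exact hEn u (by linarith)
      calc _ ≤ 1 * |a * u + b + a * c| := by gcongr
        _ ≤ _ := by linarith
    have hlog := log_prime_pos hp
    have key : ∀ n : ℕ, ∀ u, u < n * log p - 1 →
        |coprimeSum Ψ h (∏ p ∈ insert p t, p) u - (∏ p ∈ insert p t, (1 - dualDens h p)) *
        (a * u + b + a * ∑ p ∈ insert p t, dualDens h p * log p)| ≤
        (∏ p ∈ insert p t, thetaFactor (dens h) δ p) * E u := by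
      intro n
      induction n with
      | zero => exact fun u hu => hneg u (by simpa using hu)
      | succ n ihn =>
        intro u hu
        have h1 := ihn (u - log p) (by push_cast at hu; linarith)
        have h2 := ih' u
        have h3 := hEs u (log p) hlog.le
        rw [prod_insert hpt, prod_insert hpt, prod_insert hpt,
          Finset.sum_insert hpt] at h1 ⊢
        rw [hrec u] at h2
        set T₁ := coprimeSum Ψ h (p * ∏ p ∈ t, p) u
        set T₂ := coprimeSum Ψ h (p * ∏ p ∈ t, p) (u - log p)
        set m := ∏ p ∈ t, (1 - dualDens h p)
        set c := ∑ p ∈ t, dualDens h p * log p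
        set Θ := ∏ p ∈ t, thetaFactor (dens h) δ p
        have hΘ : 0 ≤ Θ := prod_nonneg fun _ _ => thetaFactor_nonneg _ _ _
        set θ := thetaFactor (dens h) δ p with hθ
        have hltp := hlt p (Finset.mem_insert_self p t)
        have hθe : θ = 1 + dens h p * (p : ℝ) ^ δ * θ := by
          rw [hθ, thetaFactor_eq hltp]
          have : 1 - dens h p * (p : ℝ) ^ δ ≠ 0 := by linarith
          field_simp
          ring
        have hj := H.dens_nonneg p
        have hgj := H.dens_sub_dualDens p
        set j := dens h p
        set g := dualDens h p
        have e1 : T₁ - (1 - g) * m * (a * u + b + a * (g * log p + c)) =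
            (T₁ + j * T₂ - m * (a * u + b + a * c)) -
            j * (T₂ - (1 - g) * m * (a * (u - log p) + b + a * (g * log p + c))) := by
          linear_combination m * (-(a * u + b + a * c) + a * log p * (1 - g)) * hgj
        rw [e1]
        refine (abs_sub _ _).trans ?_
        rw [abs_mul, abs_of_nonneg hj]
        have h4 : j * |T₂ - (1 - g) * m * (a * (u - log p) + b + a * (g * log p + c))| ≤
            j * (θ * Θ * ((p : ℝ) ^ δ * E u)) := by
          refine mul_le_mul_of_nonneg_left (h1.trans ?_) hj
          rw [prime_rpow_eq_exp hp]
          exact mul_le_mul_of_nonneg_left h3 (mul_nonneg (thetaFactor_nonneg _ _ _) hΘ)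
        have h5 : θ * Θ * E u = Θ * E u + j * (θ * Θ * ((p : ℝ) ^ δ * E u)) := by
          calc θ * Θ * E u = (1 + j * (p : ℝ) ^ δ * θ) * Θ * E u := by rw [← hθe]
            _ = _ := by ring
        linarith
    obtain ⟨n, hn⟩ := exists_nat_gt ((u + 1) / log p)
    rw [div_lt_iff₀ hlog] at hn
    exact key n u (by linarith)

/-- Diagonalization of the Selberg quadratic form. -/
theorem sum_union_eq (g : ℕ → ℝ) (S : Finset ℕ) (ρ : Finset ℕ → ℝ) :
    ∑ t₁ ∈ S.powerset, ∑ t₂ ∈ S.powerset, ρ t₁ * ρ t₂ * ∏ p ∈ t₁ ∪ t₂, g p =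
      ∑ l ∈ S.powerset, (∏ p ∈ l, g p * (1 - g p)) *
        (∑ m ∈ (S \ l).powerset, (∏ p ∈ m, g p) * ρ (l ∪ m)) ^ 2 := by
  induction S using Finset.induction_on generalizing ρ with
  | empty => simp; ring
  | insert p S hp ih =>
    have hnot : ∀ t ∈ S.powerset, p ∉ t := fun t ht hpt => hp (mem_powerset.1 ht hpt)
    rw [sum_powerset_insert_eq hp, sum_powerset_insert_eq hp, sum_add_distrib,
      sum_add_distrib]
    have h1 := ih (fun t => ρ t + g p * ρ (insert p t))
    have h2 := ih (fun t => ρ (insert p t))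
    have e1 : ∑ l ∈ S.powerset, (∏ p ∈ l, g p * (1 - g p)) *
        (∑ m ∈ (insert p S \ l).powerset, (∏ p ∈ m, g p) * ρ (l ∪ m)) ^ 2 =
        ∑ l ∈ S.powerset, (∏ p ∈ l, g p * (1 - g p)) * (∑ m ∈ (S \ l).powerset,
          (∏ p ∈ m, g p) * (ρ (l ∪ m) + g p * ρ (insert p (l ∪ m)))) ^ 2 := by
      refine sum_congr rfl fun l hl => ?_
      rw [Finset.insert_sdiff_of_notMem _ (hnot l hl), sum_powerset_insert_eq (by simp [hp])]
      congr 2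
      refine sum_congr rfl fun m hm => ?_
      have hpm : p ∉ m := fun hpm => hp (Finset.mem_sdiff.1 (mem_powerset.1 hm hpm)).1
      rw [prod_insert hpm, Finset.union_insert]
      ring
    have e2 : ∑ l ∈ S.powerset, (∏ p ∈ insert p l, g p * (1 - g p)) *
        (∑ m ∈ (insert p S \ insert p l).powerset, (∏ p ∈ m, g p) * ρ (insert p l ∪ m)) ^ 2 =
        g p * (1 - g p) * ∑ l ∈ S.powerset, (∏ p ∈ l, g p * (1 - g p)) *
          (∑ m ∈ (S \ l).powerset, (∏ p ∈ m, g p) * ρ (insert p (l ∪ m))) ^ 2 := by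
      rw [mul_sum]
      refine sum_congr rfl fun l hl => ?_
      rw [prod_insert (hnot l hl)]
      have : insert p S \ insert p l = S \ l := by
        ext r
        simp only [Finset.mem_sdiff, Finset.mem_insert]
        constructor
        · tauto
        · rintro ⟨h3, h4⟩
          exact ⟨Or.inr h3, by rintro (rfl | h5) <;> tauto⟩
      rw [this]
      simp only [Finset.insert_union]
      ring
    rw [e1, e2, ← h1, ← h2, mul_sum, ← sum_add_distrib, ← sum_add_distrib]
    refine sum_congr rfl fun t₁ ht₁ => ?_
    rw [mul_sum, sum_powerset_insert_eq hp, sum_powerset_insert_eq hp,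
      ← sum_add_distrib, ← sum_add_distrib]
    refine sum_congr rfl fun t₂ ht₂ => ?_
    have hp12 : p ∉ t₁ ∪ t₂ := by
      simp [hnot t₁ ht₁, hnot t₂ ht₂]
    simp only [Finset.insert_union, Finset.union_insert, Finset.insert_idem,
      prod_insert hp12]
    ring

theorem sum_prod_union (w : ℕ → ℝ) (S : Finset ℕ) :
    ∑ t₁ ∈ S.powerset, ∑ t₂ ∈ S.powerset, ∏ p ∈ t₁ ∪ t₂, w p = ∏ p ∈ S, (1 + 3 * w p) := by
  induction S using Finset.induction_on with
  | empty => simp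
  | insert p S hp ih =>
    rw [sum_powerset_insert_eq hp, prod_insert hp, ← ih, mul_sum]
    refine sum_congr rfl fun t₁ ht₁ => ?_
    rw [sum_powerset_insert_eq hp, sum_powerset_insert_eq hp, ← sum_add_distrib,
      mul_sum]
    refine sum_congr rfl fun t₂ ht₂ => ?_
    have hp12 : p ∉ t₁ ∪ t₂ := fun hmem => hp <| by
      rcases Finset.mem_union.1 hmem with h1 | h1
      exacts [mem_powerset.1 ht₁ h1, mem_powerset.1 ht₂ h1]
    simp only [Finset.insert_union, Finset.union_insert, Finset.insert_idem,
      prod_insert hp12]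
    ring

/-- The weight `ϱ` as a function of sets of primes, with `r = log √D`. -/
def setRho (r : ℝ) (t : Finset ℕ) : ℝ :=
  (r ^ 2)⁻¹ * (-1) ^ t.card * (max (r - logW t) 0) ^ 2

/-- The dual sieve sum over the sifting primes outside of `q`. -/
def dualOp (h : ArithmeticFunction ℝ) (S q : Finset ℕ) (u : ℝ) : ℝ :=
  sieveOp (fun p => -1 * dualDens h p) (fun v => (max v 0) ^ 2) (S \ q) u

theorem prod_dvd_iff {t : Finset ℕ} (ht : ∀ p ∈ t, p.Prime) (n : ℕ) :
    ∏ p ∈ t, p ∣ n ↔ ∀ p ∈ t, p ∣ n :=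
  ⟨fun hd _ hp => (Finset.dvd_prod_of_mem _ hp).trans hd, fun hd =>
    Finset.prod_primes_dvd n (fun p hp => (ht p hp).prime) hd⟩

theorem rho_prod {D : ℝ} (hD : 0 < D) {t : Finset ℕ} (ht : ∀ p ∈ t, p.Prime) :
    rho D (∏ p ∈ t, p) = setRho (log √D) t := by
  have hsq := squarefree_prod_primes ht
  have hpos : (0 : ℝ) < ((∏ p ∈ t, p : ℕ) : ℝ) := by
    exact_mod_cast Nat.pos_of_ne_zero hsq.ne_zero
  have hD' : 0 < √D := Real.sqrt_pos.2 hD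
  have hlog := log_prod_eq_logW ht
  have hmu : (moebius (∏ p ∈ t, p) : ℝ) = (-1) ^ t.card := by
    rw [ArithmeticFunction.moebius_apply_of_squarefree hsq,
      ← (ArithmeticFunction.cardDistinctFactors_eq_cardFactors_iff_squarefree hsq.ne_zero).2 hsq,
      ArithmeticFunction.cardDistinctFactors_apply]
    push_cast
    have hc : t.card = (∏ p ∈ t, p).primeFactors.card := by rw [primeFactors_prod ht]
    rw [hc]
    rfl
  rw [rho, setRho]
  split_ifs with hle
  · have h1 : logW t ≤ log √D := by
      rw [← hlog]
      exact log_le_log hpos hle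
    rw [hmu, Real.log_div hD'.ne' hpos.ne', hlog, max_eq_left (by linarith), div_pow]
    ring
  · have h1 : log √D ≤ logW t := by
      rw [← hlog]
      exact log_le_log hD' (not_le.1 hle).le
    rw [max_eq_right (by linarith)]
    ring

open Classical in
theorem sum_divisors_rho {D : ℝ} (hD : 0 < D) (z : ℝ) (n : ℕ) :
    ∑ d ∈ (Nat.gcd n (primeProd z)).divisors, rho D d =
      ∑ t ∈ ⌈z⌉₊.primesBelow.powerset, if ∏ p ∈ t, p ∣ n then setRho (log √D) t else 0 := by
  have hP : ∀ t ∈ ⌈z⌉₊.primesBelow.powerset, ∀ p ∈ t, p.Prime := fun t ht p hp =>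
    prime_of_mem_primesBelow (mem_powerset.1 ht hp)
  have hz : primeProd z = ∏ p ∈ ⌈z⌉₊.primesBelow, p := rfl
  have hPz : ∀ p ∈ ⌈z⌉₊.primesBelow, p.Prime := fun p => prime_of_mem_primesBelow
  have hsqz : Squarefree (primeProd z) := squarefree_prod_primes hPz
  rw [← sum_filter]
  symm
  refine Finset.sum_bij' (fun t _ => ∏ p ∈ t, p) (fun d _ => d.primeFactors) ?_ ?_ ?_ ?_ ?_
  · intro t ht
    obtain ⟨h1, h2⟩ := mem_filter.1 ht
    refine Nat.mem_divisors.2 ⟨Nat.dvd_gcd h2 ?_, Nat.gcd_ne_zero_right hsqz.ne_zero⟩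
    exact Finset.prod_dvd_prod_of_subset _ _ _ (mem_powerset.1 h1)
  · intro d hd
    have h1 := Nat.dvd_of_mem_divisors hd
    have h2 := h1.trans (Nat.gcd_dvd_right n (primeProd z))
    refine mem_filter.2 ⟨mem_powerset.2 ?_, ?_⟩
    · have := Nat.primeFactors_mono h2 hsqz.ne_zero
      rwa [hz, primeFactors_prod hPz] at this
    · rw [Nat.prod_primeFactors_of_squarefree (hsqz.squarefree_of_dvd h2)]
      exact h1.trans (Nat.gcd_dvd_left _ _)
  · intro t ht
    exact primeFactors_prod (hP t (mem_filter.1 ht).1)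
  · intro d hd
    exact Nat.prod_primeFactors_of_squarefree (hsqz.squarefree_of_dvd
      ((Nat.dvd_of_mem_divisors hd).trans (Nat.gcd_dvd_right n (primeProd z))))
  · intro t ht
    exact (rho_prod hD (hP t (mem_filter.1 ht).1)).symm

theorem SieveHyp.sieveSum_eq (H : SieveHyp h Hstar L c₀) (HΨ : BumpHyp Ψ) {D : ℝ} (hD : 0 < D)
    (z v : ℝ) : sieveSum Ψ h (exp v) D z = exp v *
      ∑ t₁ ∈ ⌈z⌉₊.primesBelow.powerset, ∑ t₂ ∈ ⌈z⌉₊.primesBelow.powerset,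
        setRho (log √D) t₁ * setRho (log √D) t₂ * ((∏ p ∈ t₁ ∪ t₂, dens h p) *
          coprimeSum Ψ h (∏ p ∈ t₁ ∪ t₂, p) (v - logW (t₁ ∪ t₂))) := by
  classical
  set S := ⌈z⌉₊.primesBelow
  set r := log √D
  have hP : ∀ t ∈ S.powerset, ∀ p ∈ t, p.Prime := fun t ht p hp =>
    prime_of_mem_primesBelow (mem_powerset.1 ht hp)
  have hPu : ∀ t₁ ∈ S.powerset, ∀ t₂ ∈ S.powerset, ∀ p ∈ t₁ ∪ t₂, p.Prime :=
    fun t₁ h₁ t₂ h₂ p hp => (Finset.mem_union.1 hp).elim (hP t₁ h₁ p) (hP t₂ h₂ p)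
  set F : Finset ℕ → Finset ℕ → ℕ → ℝ := fun t₁ t₂ n => setRho r t₁ * setRho r t₂ *
    if n.Coprime 1 ∧ ∏ p ∈ t₁ ∪ t₂, p ∣ n then Ψ (n / exp v) * sqfreeCoeff h n else 0 with hF
  have hFs : ∀ t₁ t₂, Summable (F t₁ t₂) := fun t₁ t₂ =>
    summable_of_hasFiniteSupport (HΨ.finite_support v _ fun n hn => by simp [hF, hn])
  have h1 : sieveSum Ψ h (exp v) D z =
      ∑' n : ℕ, ∑ t₁ ∈ S.powerset, ∑ t₂ ∈ S.powerset, F t₁ t₂ n := by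
    refine tsum_congr fun n => ?_
    rw [sum_divisors_rho hD, pow_two (∑ t ∈ _, _), Finset.sum_mul_sum, mul_sum]
    refine sum_congr rfl fun t₁ ht₁ => ?_
    rw [mul_sum]
    refine sum_congr rfl fun t₂ ht₂ => ?_
    have h2 : ∏ p ∈ t₁ ∪ t₂, p ∣ n ↔ ∏ p ∈ t₁, p ∣ n ∧ ∏ p ∈ t₂, p ∣ n := by
      rw [prod_dvd_iff (hPu t₁ ht₁ t₂ ht₂), prod_dvd_iff (hP t₁ ht₁), prod_dvd_iff (hP t₂ ht₂)]
      simp only [Finset.mem_union, or_imp, forall_and]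
    simp only [hF, h2, sqfreeCoeff]
    by_cases h3 : ∏ p ∈ t₁, p ∣ n <;> by_cases h4 : ∏ p ∈ t₂, p ∣ n <;> (simp [h3, h4]; try ring)
  rw [h1, Summable.tsum_finsetSum fun t₁ _ => summable_sum fun t₂ _ => hFs t₁ t₂, mul_sum]
  refine sum_congr rfl fun t₁ ht₁ => ?_
  rw [Summable.tsum_finsetSum fun t₂ _ => hFs t₁ t₂, mul_sum]
  refine sum_congr rfl fun t₂ ht₂ => ?_
  have hpr := hPu t₁ ht₁ t₂ ht₂
  have hsq := squarefree_prod_primes hpr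
  have h2 := H.coprimeSum_divisible (Ψ := Ψ) (d := 1) (Nat.pos_of_ne_zero hsq.ne_zero) hsq
    (Nat.coprime_one_right _) v
  rw [mul_one, log_prod_eq_logW hpr, H.dens_squarefree hsq, primeFactors_prod hpr] at h2
  rw [← h2]
  simp only [hF]
  rw [tsum_mul_left, Real.exp_neg]
  field_simp

theorem sum_union_sum_mem (g F : ℕ → ℝ) (S : Finset ℕ) (ρ : Finset ℕ → ℝ) :
    ∑ t₁ ∈ S.powerset, ∑ t₂ ∈ S.powerset, ρ t₁ * ρ t₂ *
      ((∏ p ∈ t₁ ∪ t₂, g p) * ∑ p ∈ t₁ ∪ t₂, F p) =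
    ∑ p ∈ S, F p * g p * ∑ l ∈ (S.erase p).powerset, (∏ p ∈ l, g p * (1 - g p)) *
      ((∑ m ∈ (S.erase p \ l).powerset, (∏ p ∈ m, g p) * (ρ (l ∪ m) + ρ (insert p (l ∪ m)))) ^ 2 -
        (∑ m ∈ (S.erase p \ l).powerset, (∏ p ∈ m, g p) * ρ (l ∪ m)) ^ 2) := by
  have h1 : ∀ t₁ ∈ S.powerset, ∀ t₂ ∈ S.powerset, ∑ p ∈ t₁ ∪ t₂, F p =
      ∑ p ∈ S, if p ∈ t₁ ∪ t₂ then F p else 0 := by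
    intro t₁ ht₁ t₂ ht₂
    rw [← sum_filter, Finset.filter_mem_eq_inter, Finset.inter_eq_right.2]
    exact Finset.union_subset (mem_powerset.1 ht₁) (mem_powerset.1 ht₂)
  have h2 : ∑ t₁ ∈ S.powerset, ∑ t₂ ∈ S.powerset, ρ t₁ * ρ t₂ *
      ((∏ p ∈ t₁ ∪ t₂, g p) * ∑ p ∈ t₁ ∪ t₂, F p) =
      ∑ p ∈ S, ∑ t₁ ∈ S.powerset, ∑ t₂ ∈ S.powerset, ρ t₁ * ρ t₂ *
        ((∏ p ∈ t₁ ∪ t₂, g p) * if p ∈ t₁ ∪ t₂ then F p else 0) := by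
    symm
    rw [Finset.sum_comm]
    refine sum_congr rfl fun t₁ ht₁ => ?_
    rw [Finset.sum_comm]
    refine sum_congr rfl fun t₂ ht₂ => ?_
    rw [h1 t₁ ht₁ t₂ ht₂, mul_sum, mul_sum]
  rw [h2]
  refine sum_congr rfl fun p hp => ?_
  rw [sum_congr rfl fun l _ => mul_sub (∏ p ∈ l, g p * (1 - g p)) _ _,
    sum_sub_distrib, ← sum_union_eq g (S.erase p) fun t => ρ t + ρ (insert p t), ← sum_union_eq g (S.erase p) ρ,
    ← sum_sub_distrib, mul_sum]
  conv_lhs => rw [← Finset.insert_erase hp]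
  have hnot := notMem_erase p S
  rw [sum_powerset_insert_eq hnot]
  refine sum_congr rfl fun t₁ ht₁ => ?_
  rw [sum_powerset_insert_eq hnot, sum_powerset_insert_eq hnot, ← sum_add_distrib,
    ← sum_sub_distrib, mul_sum]
  refine sum_congr rfl fun t₂ ht₂ => ?_
  have hp1 : p ∉ t₁ := fun hh => hnot (mem_powerset.1 ht₁ hh)
  have hp2 : p ∉ t₂ := fun hh => hnot (mem_powerset.1 ht₂ hh)
  have hp12 : p ∉ t₁ ∪ t₂ := by simp [hp1, hp2]
  simp only [Finset.insert_union, Finset.union_insert, Finset.insert_idem,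
    prod_insert hp12, hp12, Finset.mem_insert_self, if_true, if_false]
  ring

theorem sum_setRho (h : ArithmeticFunction ℝ) (r : ℝ) (S l : Finset ℕ) :
    ∑ m ∈ (S \ l).powerset, (∏ p ∈ m, dualDens h p) * setRho r (l ∪ m) =
      (r ^ 2)⁻¹ * (-1) ^ l.card * dualOp h S l (r - logW l) := by
  rw [dualOp, sieveOp, mul_sum]
  refine sum_congr rfl fun m hm => ?_
  have hdis : Disjoint l m := Finset.disjoint_left.2 fun p hp hpm =>
    (Finset.mem_sdiff.1 (mem_powerset.1 hm hpm)).2 hp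
  rw [setRho, Finset.card_union_of_disjoint hdis, pow_add, logW, Finset.sum_union hdis,
    prod_mul_distrib, Finset.prod_const, ← logW, ← logW, sub_add_eq_sub_sub]
  ring

def mainZero (h : ArithmeticFunction ℝ) (S : Finset ℕ) (r : ℝ) : ℝ :=
  ∑ l ∈ S.powerset, (∏ p ∈ l, dualDens h p * (1 - dualDens h p)) * dualOp h S l (r - logW l) ^ 2

def mainOne (h : ArithmeticFunction ℝ) (S : Finset ℕ) (r : ℝ) : ℝ :=
  ∑ p ∈ S, dualDens h p * (1 - dualDens h p) * log p *
    ∑ l ∈ (S.erase p).powerset, (∏ p ∈ l, dualDens h p * (1 - dualDens h p)) *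
      (dualOp h S (insert p l) (r - logW l - log p) * (2 * dualOp h S (insert p l) (r - logW l)
        - dualOp h S (insert p l) (r - logW l - log p)))

theorem sum_setRho_main (h : ArithmeticFunction ℝ) (S : Finset ℕ) (r α a : ℝ) :
    ∑ t₁ ∈ S.powerset, ∑ t₂ ∈ S.powerset, setRho r t₁ * setRho r t₂ *
      ((∏ p ∈ t₁ ∪ t₂, dualDens h p) *
        (α - a * ∑ p ∈ t₁ ∪ t₂, (1 - dualDens h p) * log p)) =
      (r ^ 4)⁻¹ * (α * mainZero h S r + a * mainOne h S r) := by
  have e1 : ∑ t₁ ∈ S.powerset, ∑ t₂ ∈ S.powerset, setRho r t₁ * setRho r t₂ *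
      ((∏ p ∈ t₁ ∪ t₂, dualDens h p) *
        (α - a * ∑ p ∈ t₁ ∪ t₂, (1 - dualDens h p) * log p)) =
      α * (∑ t₁ ∈ S.powerset, ∑ t₂ ∈ S.powerset, setRho r t₁ * setRho r t₂ *
        ∏ p ∈ t₁ ∪ t₂, dualDens h p) -
      a * ∑ t₁ ∈ S.powerset, ∑ t₂ ∈ S.powerset, setRho r t₁ * setRho r t₂ *
        ((∏ p ∈ t₁ ∪ t₂, dualDens h p) * ∑ p ∈ t₁ ∪ t₂, (1 - dualDens h p) * log p) := by
    simp only [mul_sum, ← sum_sub_distrib]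
    refine sum_congr rfl fun t₁ _ => sum_congr rfl fun t₂ _ => ?_
    rw [← mul_sum]
    simp only [← mul_sum]
    ring
  have e2 : ∀ n : ℕ, ((-1 : ℝ) ^ n) ^ 2 = 1 := fun n => by rw [← pow_mul, mul_comm, pow_mul]; simp
  have e3 : ∑ t₁ ∈ S.powerset, ∑ t₂ ∈ S.powerset, setRho r t₁ * setRho r t₂ *
        ∏ p ∈ t₁ ∪ t₂, dualDens h p = (r ^ 4)⁻¹ * mainZero h S r := by
    rw [sum_union_eq, mainZero, mul_sum]
    refine sum_congr rfl fun l _ => ?_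
    rw [sum_setRho, mul_pow, mul_pow, e2]
    ring
  have e4 : ∑ t₁ ∈ S.powerset, ∑ t₂ ∈ S.powerset, setRho r t₁ * setRho r t₂ *
        ((∏ p ∈ t₁ ∪ t₂, dualDens h p) * ∑ p ∈ t₁ ∪ t₂, (1 - dualDens h p) * log p) =
      -((r ^ 4)⁻¹ * mainOne h S r) := by
    rw [sum_union_sum_mem, mainOne, mul_sum, ← Finset.sum_neg_distrib]
    refine sum_congr rfl fun p hp => ?_
    rw [mul_sum, mul_sum, mul_sum, ← Finset.sum_neg_distrib]
    refine sum_congr rfl fun l hl => ?_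
    have hpl : p ∉ l := fun hh => notMem_erase p S (mem_powerset.1 hl hh)
    have hset : S.erase p \ l = S \ insert p l := by
      ext q
      simp only [Finset.mem_sdiff, Finset.mem_erase, Finset.mem_insert]
      tauto
    have hset2 : S.erase p \ l = (S.erase p) \ l := rfl
    have f1 : ∑ m ∈ (S.erase p \ l).powerset, (∏ p ∈ m, dualDens h p) * setRho r (l ∪ m) =
        (r ^ 2)⁻¹ * (-1) ^ l.card * dualOp h S (insert p l) (r - logW l) := by
      rw [sum_setRho, dualOp, dualOp, hset]
    have f2 : ∑ m ∈ (S.erase p \ l).powerset, (∏ p ∈ m, dualDens h p) *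
        (setRho r (l ∪ m) + setRho r (insert p (l ∪ m))) = (r ^ 2)⁻¹ * (-1) ^ l.card *
        (dualOp h S (insert p l) (r - logW l) -
          dualOp h S (insert p l) (r - logW l - log p)) := by
      simp only [mul_add, sum_add_distrib]
      rw [f1, hset]
      simp only [← Finset.insert_union]
      rw [sum_setRho, Finset.card_insert_of_notMem hpl, logW_insert hpl, pow_succ,
        sub_add_eq_sub_sub_swap]
      ring
    rw [f1, f2, mul_pow, mul_pow, mul_pow, mul_pow, e2]
    ring
  rw [e1, e3, e4]
  ring

/-- A decay profile that changes by at most `e^{δ v}` under a shift by `v`. -/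
def slowDecay (δ : ℝ) (B : ℕ) (u : ℝ) : ℝ :=
  exp (-δ * min u 0) / (1 + δ / B * max u 0) ^ B

theorem slowDecay_sub_le {δ : ℝ} (hδ : 0 < δ) {B : ℕ} (hB : 0 < B) (u : ℝ) {v : ℝ} (hv : 0 ≤ v) :
    slowDecay δ B (u - v) ≤ exp (δ * v) * slowDecay δ B u := by
  set x := max u 0 with hx
  set y := max (u - v) 0 with hy
  have hy0 : 0 ≤ y := le_max_right _ _
  have hx0 : 0 ≤ x := le_max_right _ _
  have hxy : y ≤ x := max_le_max (by linarith) le_rfl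
  have hB0 : (0 : ℝ) < B := by exact_mod_cast hB
  have e1 : min u 0 = u - x := by linarith [min_add_max u 0]
  have e2 : min (u - v) 0 = u - v - y := by linarith [min_add_max (u - v) 0]
  have hc : 0 < δ / B := by positivity
  have key : (1 + δ / B * x) ^ B ≤ exp (δ * (x - y)) * (1 + δ / B * y) ^ B := by
    have h1 : 1 + δ / B * x ≤ exp (δ / B * (x - y)) * (1 + δ / B * y) := by
      have h2 := add_one_le_exp (δ / B * (x - y))
      have h3 : 0 ≤ δ / B * (x - y) := mul_nonneg hc.le (by linarith)
      have h4 : 0 ≤ δ / B * y := by positivity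
      nlinarith
    have h5 := pow_le_pow_left₀ (by positivity) h1 B
    rw [mul_pow, ← Real.exp_nat_mul] at h5
    have h6 : (B : ℝ) * (δ / B * (x - y)) = δ * (x - y) := by field_simp
    rwa [h6] at h5
  rw [slowDecay, slowDecay, ← hx, ← hy, e1, e2, ← mul_div_assoc, ← Real.exp_add,
    div_le_div_iff₀ (by positivity) (by positivity)]
  calc _ ≤ exp (-δ * (u - v - y)) * (exp (δ * (x - y)) * (1 + δ / B * y) ^ B) := by
        gcongr
    _ = _ := by
        rw [← mul_assoc, ← Real.exp_add]
        ring_nf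

theorem BumpHyp.exists_decay (HΨ : BumpHyp Ψ) {a b δ : ℝ}
    (ha : 0 < a) (hδ : 0 < δ) {B : ℕ} (hB : 0 < B) (hT : ∃ C : ℝ, 0 < C ∧ ∀ u : ℝ, 0 ≤ u →
      |exp (-u) * smoothSum Ψ h (exp u) - (a * u + b)| ≤ C / (1 + u) ^ B) :
    ∃ E : ℝ → ℝ, ∃ C : ℝ, 0 < C ∧
      (∀ u, |exp (-u) * smoothSum Ψ h (exp u) - (a * u + b)| ≤ E u) ∧
      (∀ u v, 0 ≤ v → E (u - v) ≤ exp (δ * v) * E u) ∧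
      (∀ u, u < 0 → a * |u| + |b| + a / δ ≤ E u) ∧ ∀ u, 0 ≤ u → E u ≤ C / (1 + u) ^ B := by
  obtain ⟨C₁, hC₁, hT⟩ := hT
  have hB0 : (0 : ℝ) < B := by exact_mod_cast hB
  set c := δ / B with hc
  have hc0 : 0 < c := by positivity
  obtain ⟨C₂, hC₂⟩ := (isCompact_Icc (a := (1 : ℝ)) (b := 2)).exists_bound_of_continuousOn
    (f := fun x => x * (Ψ x * sqfreeCoeff h 1))
    (Continuous.continuousOn (by have := HΨ.smooth.continuous; fun_prop))
  have hC₂0 : 0 ≤ C₂ := (norm_nonneg _).trans (hC₂ 1 (by norm_num))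
  have hTneg : ∀ u, u < 0 → |exp (-u) * smoothSum Ψ h (exp u)| ≤ C₂ := by
    intro u hu
    have h1 : exp u < 1 := by simpa using Real.exp_lt_exp.2 hu
    rw [smoothSum, tsum_eq_single 1]
    · rw [Nat.cast_one, one_div, ← Real.exp_neg]
      by_cases h2 : exp (-u) ≤ 2
      · exact hC₂ _ ⟨by rw [Real.one_le_exp_iff]; linarith, h2⟩
      · rw [HΨ.eq_zero_of_two_lt (not_le.1 h2)]
        simpa using hC₂0
    · intro n hn
      rcases Nat.eq_zero_or_pos n with rfl | hn0
      · simp [sqfreeCoeff]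
      · rw [HΨ.eq_zero_of_two_lt, zero_mul]
        rw [lt_div_iff₀ (exp_pos u)]
        have : (2 : ℝ) ≤ n := by exact_mod_cast (by lia : 2 ≤ n)
        linarith
  set K := C₁ * (1 + c) ^ B + C₂ + |b| + 2 * (a / δ) with hK
  have hK0 : 0 < K := by positivity
  have hpos : ∀ u, 0 ≤ u → slowDecay δ B u = 1 / (1 + c * u) ^ B := fun u hu => by
    rw [slowDecay, min_eq_right hu, max_eq_left hu, mul_zero, Real.exp_zero]
  have hneg : ∀ u, u < 0 → C₂ + (a * |u| + |b| + a / δ) ≤ K * slowDecay δ B u := fun u hu => by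
    rw [slowDecay, min_eq_left hu.le, max_eq_right hu.le, mul_zero, add_zero, one_pow, div_one,
      abs_of_neg hu]
    have h1 := add_one_le_exp (-δ * u)
    have h2 : 0 ≤ C₁ * (1 + c) ^ B := by positivity
    have h3 : 0 ≤ -δ * u := by nlinarith
    have h4 : a / δ * (-δ * u) = a * -u := by field_simp
    calc _ ≤ K + a / δ * (-δ * u) := by
          have : 0 < a / δ := by positivity
          linarith
      _ ≤ K * (-δ * u + 1) := by
          have : a / δ ≤ K := by
            have : 0 < a / δ := by positivity
            linarith [abs_nonneg b]
          nlinarith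
      _ ≤ _ := by gcongr
  refine ⟨fun u => K * slowDecay δ B u, K * (1 + c⁻¹) ^ B, by positivity, ?_, ?_, ?_, ?_⟩
  · intro u
    rcases lt_or_ge u 0 with hu | hu
    · refine le_trans ?_ (hneg u hu)
      have h1 := hTneg u hu
      have h2 : |a * u + b| ≤ a * |u| + |b| := by
        refine (abs_add_le _ _).trans ?_
        rw [abs_mul, abs_of_pos ha]
      have h3 : 0 < a / δ := by positivity
      linarith [abs_sub (exp (-u) * smoothSum Ψ h (exp u)) (a * u + b)]
    · refine (hT u hu).trans ?_
      beta_reduce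
      rw [hpos u hu, mul_one_div, div_le_div_iff₀ (by positivity) (by positivity)]
      calc C₁ * (1 + c * u) ^ B ≤ C₁ * ((1 + c) * (1 + u)) ^ B := by
            gcongr
            nlinarith
        _ = C₁ * (1 + c) ^ B * (1 + u) ^ B := by rw [mul_pow, mul_assoc]
        _ ≤ K * (1 + u) ^ B := by
            gcongr
            have : 0 < a / δ := by positivity
            linarith [abs_nonneg b]
  · intro u v hv
    have := mul_le_mul_of_nonneg_left (slowDecay_sub_le hδ hB u hv) hK0.le
    linarith
  · intro u hu
    linarith [hneg u hu]
  · intro u hu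
    beta_reduce
    rw [hpos u hu, mul_one_div, div_le_div_iff₀ (by positivity) (by positivity), mul_assoc,
      ← mul_pow]
    gcongr
    have : (1 + c⁻¹) * (1 + c * u) = 1 + u + (c * u + c⁻¹) := by
      field_simp
      ring
    rw [this]
    have : 0 ≤ c * u + c⁻¹ := by positivity
    linarith

theorem abs_setRho_le {r : ℝ} (hr : 0 < r) (t : Finset ℕ) : |setRho r t| ≤ 1 := by
  rw [setRho, abs_mul, abs_mul, abs_pow, abs_neg, abs_one, one_pow, mul_one,
    abs_of_pos (by positivity), abs_of_nonneg (by positivity), inv_mul_le_one₀ (by positivity)]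
  have := logW_nonneg t
  exact pow_le_pow_left₀ (le_max_right _ _) (max_le (by linarith) hr.le) 2

theorem setRho_eq_zero {r : ℝ} {t : Finset ℕ} (ht : r ≤ logW t) : setRho r t = 0 := by
  rw [setRho, max_eq_right (by linarith)]
  ring

theorem SieveHyp.exists_sieveSum_sub_le (H : SieveHyp h Hstar L c₀) (HΨ : BumpHyp Ψ) {a b : ℝ}
    (ha : 0 < a) (hT : ∀ B : ℕ, ∃ C : ℝ, 0 < C ∧ ∀ u : ℝ, 0 ≤ u →
      |exp (-u) * smoothSum Ψ h (exp u) - (a * u + b)| ≤ C / (1 + u) ^ B) :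
    ∃ C : ℝ, 0 < C ∧ ∀ D z v : ℝ, 0 < D → 0 < log √D → 1 ≤ v →
      2 * log √D + 2 * √v ≤ v →
      |sieveSum Ψ h (exp v) D z - exp v * ((log √D ^ 4)⁻¹ *
        ((a * v + b) * mainZero h ⌈z⌉₊.primesBelow (log √D) +
          a * mainOne h ⌈z⌉₊.primesBelow (log √D)))| ≤ exp v * (C / v ^ 2) := by
  obtain ⟨δ, ρ, hδ, hδc, hρ, hle⟩ := H.exists_delta
  obtain ⟨M, hM⟩ := H.exists_mertens_theta_dens hδ hδc hρ hle
  obtain ⟨C₁, hC₁, hsum⟩ := hM.exists_sum_le_log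
  obtain ⟨E, C₂, hC₂, hE0, hEs, hEn, hEu⟩ := HΨ.exists_decay ha hδ (B := 16) (by norm_num) (hT 16)
  refine ⟨exp (3 * C₁) * 64 * C₂, by positivity, fun D z v hD hr hv hrv => ?_⟩
  set S := ⌈z⌉₊.primesBelow
  set r := log √D
  have hS : ∀ p ∈ S, p.Prime := fun p => prime_of_mem_primesBelow
  set S' := S.filter (fun p : ℕ => log p ≤ r) with hS'
  have hP : ∀ t ∈ S.powerset, ∀ p ∈ t, p.Prime := fun t ht p hp => hS p (mem_powerset.1 ht hp)
  have hPu : ∀ t₁ ∈ S.powerset, ∀ t₂ ∈ S.powerset, ∀ p ∈ t₁ ∪ t₂, p.Prime :=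
    fun t₁ h₁ t₂ h₂ p hp => (Finset.mem_union.1 hp).elim (hP t₁ h₁ p) (hP t₂ h₂ p)
  rw [H.sieveSum_eq HΨ hD, ← sum_setRho_main, ← mul_sub, abs_mul, abs_of_pos (exp_pos v)]
  refine mul_le_mul_of_nonneg_left ?_ (exp_pos v).le
  set Est := C₂ / (1 + √v) ^ 16
  have hEst : ∀ u, 2 * √v ≤ u → E u ≤ Est := fun u hu => by
    have hv0 := Real.sqrt_nonneg v
    refine (hEu u (by linarith)).trans ?_
    exact div_le_div_of_nonneg_left hC₂.le (by positivity) (by gcongr; linarith)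
  set w := fun p => dens h p * thetaFactor (dens h) δ p with hw
  set F : Finset ℕ → Finset ℕ → ℝ := fun t₁ t₂ => setRho r t₁ * setRho r t₂ *
    ((∏ p ∈ t₁ ∪ t₂, dens h p) * coprimeSum Ψ h (∏ p ∈ t₁ ∪ t₂, p) (v - logW (t₁ ∪ t₂))) -
    setRho r t₁ * setRho r t₂ * ((∏ p ∈ t₁ ∪ t₂, dualDens h p) *
        (a * v + b - a * ∑ p ∈ t₁ ∪ t₂, (1 - dualDens h p) * log p)) with hF
  have hF0 : ∀ t₁ t₂, (r ≤ logW t₁ ∨ r ≤ logW t₂) → F t₁ t₂ = 0 := by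
    rintro t₁ t₂ (h1 | h1) <;> simp [hF, setRho_eq_zero h1]
  have hw0 : ∀ p, 0 ≤ w p := hM.nonneg
  have hFle : ∀ t₁ ∈ S.powerset, ∀ t₂ ∈ S.powerset, |F t₁ t₂| ≤ (∏ p ∈ t₁ ∪ t₂, w p) * Est := by
    intro t₁ ht₁ t₂ ht₂
    by_cases h1 : r ≤ logW t₁ ∨ r ≤ logW t₂
    · rw [hF0 t₁ t₂ h1, abs_zero]
      have := prod_w_nonneg hw0 (t₁ ∪ t₂)
      positivity
    rw [not_or, not_le, not_le] at h1
    set t := t₁ ∪ t₂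
    have hpr := hPu t₁ ht₁ t₂ ht₂
    have h2 : logW t ≤ logW t₁ + logW t₂ := by
      rw [logW, logW, logW, ← Finset.sum_union_inter]
      exact le_add_of_nonneg_right (logW_nonneg _)
    have h3 := H.abs_coprimeSum_sub_le HΨ ha hδ hE0 hEs hEn hpr
      (fun p hp => (hle p (hpr p hp)).trans_lt hρ) (v - logW t)
    have h4 := hEst (v - logW t) (by linarith)
    have e1 : (∏ p ∈ t, dualDens h p) = (∏ p ∈ t, dens h p) * ∏ p ∈ t, (1 - dualDens h p) := by
      rw [← prod_mul_distrib]
      refine Finset.prod_congr rfl fun p _ => ?_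
      linarith [H.dens_sub_dualDens p]
    have e2 : a * v + b - a * ∑ p ∈ t, (1 - dualDens h p) * log p =
        a * (v - logW t) + b + a * ∑ p ∈ t, dualDens h p * log p := by
      simp only [sub_mul, one_mul, sum_sub_distrib, logW]
      ring
    simp only [hF]
    rw [e1, e2, mul_assoc (∏ p ∈ t, dens h p), ← mul_sub, ← mul_sub, abs_mul, abs_mul, abs_mul,
      abs_of_nonneg (prod_w_nonneg H.dens_nonneg t)]
    have hd := prod_w_nonneg H.dens_nonneg t
    have hth : 0 ≤ ∏ p ∈ t, thetaFactor (dens h) δ p :=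
      prod_w_nonneg (thetaFactor_nonneg (dens h) δ) t
    calc _ ≤ 1 * 1 * ((∏ p ∈ t, dens h p) * ((∏ p ∈ t, thetaFactor (dens h) δ p) * Est)) := by
          gcongr
          · exact abs_setRho_le hr t₁
          · exact abs_setRho_le hr t₂
          · exact h3.trans (by gcongr)
      _ = (∏ p ∈ t, w p) * Est := by
          rw [hw, prod_mul_distrib]
          ring
  have hsub : S' ⊆ S := Finset.filter_subset _ _
  have hnot : ∀ t ∈ S.powerset, t ∉ S'.powerset → r ≤ logW t := by
    intro t ht hnt
    by_contra hlt
    refine hnt (mem_powerset.2 fun p hp => mem_filter.2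
      ⟨mem_powerset.1 ht hp, ?_⟩)
    linarith [log_le_logW hp]
  have hSS := Finset.powerset_mono.2 hsub
  have e1 : ∑ t₁ ∈ S.powerset, ∑ t₂ ∈ S.powerset, F t₁ t₂ =
      ∑ t₁ ∈ S'.powerset, ∑ t₂ ∈ S'.powerset, F t₁ t₂ := by
    rw [← Finset.sum_subset hSS fun t₁ ht₁ hn => Finset.sum_eq_zero fun t₂ _ =>
      hF0 _ _ (Or.inl (hnot t₁ ht₁ hn))]
    refine sum_congr rfl fun t₁ _ => ?_
    rw [← Finset.sum_subset hSS fun t₂ ht₂ hn => hF0 _ _ (Or.inr (hnot t₂ ht₂ hn))]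
  have e2 : |∑ t₁ ∈ S.powerset, ∑ t₂ ∈ S.powerset, F t₁ t₂| ≤ (∏ p ∈ S', (1 + 3 * w p)) * Est := by
    rw [e1, ← sum_prod_union, sum_mul]
    refine (abs_sum_le_sum_abs _ _).trans (sum_le_sum fun t₁ ht₁ => ?_)
    rw [sum_mul]
    exact (abs_sum_le_sum_abs _ _).trans
      (sum_le_sum fun t₂ ht₂ => hFle t₁ (hSS ht₁) t₂ (hSS ht₂))
  have e3 : ∏ p ∈ S', (1 + 3 * w p) ≤ exp (3 * C₁) * (1 + r) ^ 6 := by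
    have h1 : ∏ p ∈ S', (1 + 3 * w p) ≤ exp (∑ p ∈ S', 3 * w p) := by
      rw [Real.exp_sum]
      refine prod_le_prod (fun p _ => by have := hw0 p; positivity) fun p _ => ?_
      rw [add_comm]
      exact add_one_le_exp _
    have h2 := hsum S hS r hr.le
    refine h1.trans ?_
    rw [← mul_sum, ← exp_log (by positivity : 0 < (1 + r) ^ 6), ← Real.exp_add,
      Real.exp_le_exp, Real.log_pow]
    push_cast
    linarith
  have hv0 := Real.sqrt_nonneg v
  have hEst0 : 0 ≤ Est := by positivity
  have e4 : Est ≤ C₂ / v ^ 8 := by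
    refine div_le_div_of_nonneg_left hC₂.le (by positivity) ?_
    calc v ^ 8 = √v ^ 16 := by
          rw [show (16 : ℕ) = 2 * 8 by norm_num, pow_mul, Real.sq_sqrt (by linarith)]
      _ ≤ (1 + √v) ^ 16 := by gcongr; linarith
  refine le_trans (le_of_eq (congrArg abs ?_)) (e2.trans ?_)
  · simp only [hF, sum_sub_distrib]
    rfl
  calc _ ≤ exp (3 * C₁) * (2 * v) ^ 6 * (C₂ / v ^ 8) := by
        refine mul_le_mul (e3.trans ?_) e4 hEst0 (by positivity)
        gcongr
        linarith
    _ = exp (3 * C₁) * 64 * C₂ / v ^ 2 := by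
        have : v ≠ 0 := by linarith
        field_simp
        norm_num

theorem abs_sieveOp_le {w : ℕ → ℝ} (hw : ∀ p, 0 ≤ w p) {k k' : ℝ → ℝ} {u : ℝ}
    (hk : ∀ v ≤ u, |k v| ≤ k' v) (S : Finset ℕ) : |sieveOp w k S u| ≤ sieveOp w k' S u :=
  (abs_sum_le_sum_abs _ _).trans (sum_le_sum fun t _ => by
    rw [abs_mul, abs_of_nonneg (prod_w_nonneg hw t)]
    exact mul_le_mul_of_nonneg_left (hk _ (by linarith [logW_nonneg t])) (prod_w_nonneg hw t))

theorem sieveOp_add_smul (w : ℕ → ℝ) (k k' : ℝ → ℝ) (α β : ℝ) (S : Finset ℕ) (u : ℝ) :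
    sieveOp w (fun v => α * k v + β * k' v) S u = α * sieveOp w k S u + β * sieveOp w k' S u := by
  simp only [sieveOp, mul_sum, ← sum_add_distrib]
  exact sum_congr rfl fun t _ => by ring

/-- The kernel `v ↦ φ(v)²` on `v ≥ 0`. -/
def kerZero (φ : ℝ → ℝ) (v : ℝ) : ℝ := if 0 ≤ v then φ v ^ 2 else 0

/-- The kernel `v ↦ φ(v - x) (2 φ(v) - φ(v - x))` on `v ≥ x`. -/
def kerOne (φ : ℝ → ℝ) (x v : ℝ) : ℝ :=
  if x ≤ v then φ (v - x) * (2 * φ v - φ (v - x)) else 0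

def errKer (δ ε β F v : ℝ) : ℝ :=
  (2 + 2 * F) * ε * expStep 0 v + (2 * β ^ 2 + 2 * F * β) * expStep δ v

theorem abs_quad_sub_le {W₁ W₂ P f₁ f₂ Θ e F : ℝ} (h1 : |W₁ - P * f₁| ≤ Θ * e)
    (h2 : |W₂ - P * f₂| ≤ Θ * e) (hP : 0 ≤ P) (hPΘ : P ≤ Θ) (hf1 : |f₁| ≤ F) (hf2 : |f₂| ≤ F)
    (he : 0 ≤ e) :
    |W₂ * (2 * W₁ - W₂) - P ^ 2 * (f₂ * (2 * f₁ - f₂))| ≤ 3 * (Θ ^ 2 * (e ^ 2 + 2 * F * e)) := by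
  have hF : 0 ≤ F := (abs_nonneg _).trans hf1
  have hΘ : 0 ≤ Θ := hP.trans hPΘ
  have e1 : W₂ * (2 * W₁ - W₂) - P ^ 2 * (f₂ * (2 * f₁ - f₂)) =
      (W₂ - P * f₂) * (2 * (W₁ - P * f₁) - (W₂ - P * f₂)) +
      (W₂ - P * f₂) * (P * (2 * f₁ - f₂)) + P * f₂ * (2 * (W₁ - P * f₁) - (W₂ - P * f₂)) := by ring
  have h3 : ∀ x y B : ℝ, |x| ≤ B → |y| ≤ B → |2 * x - y| ≤ 3 * B := fun x y B hx hy => by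
    rw [abs_le] at *
    constructor <;> linarith
  rw [e1]
  refine (abs_add_three _ _ _).trans ?_
  rw [abs_mul, abs_mul, abs_mul, abs_mul, abs_mul, abs_of_nonneg hP]
  calc _ ≤ Θ * e * (3 * (Θ * e)) + Θ * e * (Θ * (3 * F)) + Θ * F * (3 * (Θ * e)) := by
        gcongr
        · exact h3 _ _ _ h1 h2
        · exact h3 _ _ _ hf1 hf2
        · exact h3 _ _ _ h1 h2
    _ = _ := by ring

theorem add_sq_le_errKer {δ ε β F u : ℝ} (hδ : 0 < δ) (hε : 0 ≤ ε) (hε1 : ε ≤ 1)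
    (hu : 0 ≤ u) : (ε + β * exp (-δ * u)) ^ 2 +
      2 * F * (ε + β * exp (-δ * u)) ≤ errKer δ ε β F u := by
  have h0 : expStep 0 u = 1 := by rw [expStep_zero, if_pos hu]
  rw [errKer, h0, expStep_of_nonneg δ hu]
  have h1 : exp (-δ * u) ≤ 1 := by
    rw [Real.exp_le_one_iff]
    nlinarith
  have h2 := exp_pos (-δ * u)
  set x := exp (-δ * u)
  have h3 : (ε + β * x) ^ 2 ≤ 2 * ε ^ 2 + 2 * (β * x) ^ 2 := by nlinarith [sq_nonneg (ε - β * x)]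
  have h4 : ε ^ 2 ≤ ε := by nlinarith
  have h5 : (β * x) ^ 2 ≤ β ^ 2 * x := by
    rw [mul_pow]
    have : x ^ 2 ≤ x := by nlinarith
    gcongr
  nlinarith

section
variable {S : Finset ℕ} {δ ε β F r : ℝ} {φ : ℝ → ℝ}

theorem SieveHyp.dualOp_of_neg (S q : Finset ℕ) {u : ℝ} (hu : u < 0) : dualOp h S q u = 0 :=
  sieveOp_of_neg _ (fun v hv => by simp [max_eq_right hv.le]) _ hu

theorem SieveHyp.prod_dual (H : SieveHyp h Hstar L c₀) (l : Finset ℕ) :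
    ∏ p ∈ l, dens h p = (∏ p ∈ l, dualDens h p * (1 - dualDens h p)) *
      (∏ p ∈ l, (1 - dualDens h p)⁻¹) ^ 2 := by
  rw [← Finset.prod_pow, ← prod_mul_distrib]
  refine Finset.prod_congr rfl fun p _ => ?_
  have h1 := H.dualDens_lt_one p
  have h2 := H.dens_sub_dualDens p
  have : 1 - dualDens h p ≠ 0 := by linarith
  field_simp
  linarith

theorem SieveHyp.prod_inv_le (H : SieveHyp h Hstar L c₀) (hδ : 0 < δ) {l : Finset ℕ}
    (hl : ∀ p ∈ l, p.Prime) (hlt : ∀ p ∈ l, dualDens h p * (p : ℝ) ^ δ < 1) :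
    0 ≤ ∏ p ∈ l, (1 - dualDens h p)⁻¹ ∧
      ∏ p ∈ l, (1 - dualDens h p)⁻¹ ≤ ∏ p ∈ l, thetaFactor (dualDens h) δ p := by
  have h0 : ∀ p, 0 ≤ (1 - dualDens h p)⁻¹ := fun p =>
    inv_nonneg.2 (by linarith [H.dualDens_lt_one p])
  refine ⟨prod_w_nonneg h0 l, prod_le_prod (fun p _ => h0 p) fun p hp => ?_⟩
  rw [thetaFactor_eq (hlt p hp)]
  exact inv_anti₀ (by linarith [hlt p hp])
    (by nlinarith [one_le_prime_rpow (hl p hp) hδ.le, H.dualDens_nonneg p])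

theorem SieveHyp.abs_dual_term_le (H : SieveHyp h Hstar L c₀) (hS : ∀ p ∈ S, p.Prime) (hδ : 0 < δ)
    (hlt : ∀ p ∈ S, dualDens h p * (p : ℝ) ^ δ < 1) (hε : 0 ≤ ε) (hε1 : ε ≤ 1) (hβ : 0 ≤ β)
    (hW : ∀ q ⊆ S, ∀ u, 0 ≤ u → u ≤ r → |dualOp h S q u - (∏ p ∈ q, (1 - dualDens h p)⁻¹) * φ u| ≤
      (∏ p ∈ q, thetaFactor (dualDens h) δ p) * (ε + β * exp (-δ * u)))
    (hφ : ∀ u ≤ r, |φ u| ≤ F) {q : Finset ℕ} (hq : q ⊆ S) {x v : ℝ} (hx : 0 ≤ x) (hv : v ≤ r) :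
    |(∏ p ∈ q, dualDens h p * (1 - dualDens h p)) *
      (dualOp h S q (v - x) * (2 * dualOp h S q v - dualOp h S q (v - x))) -
      (∏ p ∈ q, dens h p) * kerOne φ x v| ≤
      3 * ((∏ p ∈ q, errWeight h δ p) * errKer δ ε β F (v - x)) := by
  rcases lt_or_ge v x with hvx | hvx
  · rw [kerOne, if_neg (not_le.2 hvx), dualOp_of_neg S q (by linarith : v - x < 0), errKer,
      expStep_of_neg _ (by linarith), expStep_of_neg _ (by linarith)]
    simp
  obtain ⟨hP, hPΘ⟩ := H.prod_inv_le hδ (fun p hp => hS p (hq hp)) fun p hp => hlt p (hq hp)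
  have h1 := hW q hq v (by linarith) hv
  have h2 := hW q hq (v - x) (by linarith) (by linarith)
  have herr := add_sq_le_errKer (β := β) (F := F) hδ hε hε1 (by linarith : 0 ≤ v - x)
  rw [H.prod_dual, kerOne, if_pos hvx, mul_assoc, ← mul_sub, abs_mul, abs_of_nonneg
    (prod_w_nonneg (fun p => mul_nonneg (H.dualDens_nonneg p)
      (by linarith [H.dualDens_lt_one p])) q)]
  set P := ∏ p ∈ q, (1 - dualDens h p)⁻¹
  set Θ := ∏ p ∈ q, thetaFactor (dualDens h) δ p with hΘ
  set e := ε + β * exp (-δ * (v - x))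
  have h3 : Θ * (ε + β * exp (-δ * v)) ≤ Θ * e := by
    refine mul_le_mul_of_nonneg_left ?_ (hP.trans hPΘ)
    have : exp (-δ * v) ≤ exp (-δ * (v - x)) := Real.exp_le_exp.2 (by nlinarith)
    simp only [e]
    gcongr
  have h4 := abs_quad_sub_le (h1.trans h3) h2 hP hPΘ (hφ v hv) (hφ (v - x) (by linarith))
    (by positivity)
  have e1 : ∏ p ∈ q, errWeight h δ p = (∏ p ∈ q, dualDens h p * (1 - dualDens h p)) * Θ ^ 2 := by
    rw [hΘ, ← Finset.prod_pow, ← prod_mul_distrib]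
    rfl
  have hg : 0 ≤ ∏ p ∈ q, dualDens h p * (1 - dualDens h p) :=
    prod_w_nonneg (fun p => mul_nonneg (H.dualDens_nonneg p)
      (by linarith [H.dualDens_lt_one p])) q
  rw [e1]
  calc _ ≤ (∏ p ∈ q, dualDens h p * (1 - dualDens h p)) * (3 * (Θ ^ 2 * errKer δ ε β F (v - x))) := by
        refine mul_le_mul_of_nonneg_left (h4.trans ?_) hg
        gcongr
    _ = _ := by ring

theorem kerOne_zero (φ : ℝ → ℝ) (v : ℝ) : kerOne φ 0 v = kerZero φ v := by
  rw [kerOne, kerZero, sub_zero]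
  split_ifs <;> ring

/-- The main term in `mainOne`. -/
def approxOne (h : ArithmeticFunction ℝ) (S : Finset ℕ) (φ : ℝ → ℝ) (r : ℝ) : ℝ :=
  ∑ p ∈ S, dens h p * log p * sieveOp (dens h) (kerOne φ (log p)) (S.erase p) r

theorem SieveHyp.abs_mainZero_sub_le (H : SieveHyp h Hstar L c₀) (hS : ∀ p ∈ S, p.Prime)
    (hδ : 0 < δ) (hlt : ∀ p ∈ S, dualDens h p * (p : ℝ) ^ δ < 1) (hε : 0 ≤ ε) (hε1 : ε ≤ 1)
    (hβ : 0 ≤ β)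
    (hW : ∀ q ⊆ S, ∀ u, 0 ≤ u → u ≤ r → |dualOp h S q u - (∏ p ∈ q, (1 - dualDens h p)⁻¹) * φ u| ≤
      (∏ p ∈ q, thetaFactor (dualDens h) δ p) * (ε + β * exp (-δ * u)))
    (hφ : ∀ u ≤ r, |φ u| ≤ F) :
    |mainZero h S r - sieveOp (dens h) (kerZero φ) S r| ≤
      3 * sieveOp (errWeight h δ) (errKer δ ε β F) S r := by
  rw [mainZero, sieveOp, sieveOp, ← sum_sub_distrib, mul_sum]
  refine (abs_sum_le_sum_abs _ _).trans (sum_le_sum fun l hl => ?_)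
  have h1 := H.abs_dual_term_le hS hδ hlt hε hε1 hβ hW hφ (mem_powerset.1 hl) le_rfl
    (by linarith [logW_nonneg l] : r - logW l ≤ r)
  rw [kerOne_zero, sub_zero] at h1
  refine le_trans (le_of_eq ?_) h1
  congr 1
  ring

theorem SieveHyp.abs_mainOne_sub_le (H : SieveHyp h Hstar L c₀) (hS : ∀ p ∈ S, p.Prime)
    (hδ : 0 < δ) (hlt : ∀ p ∈ S, dualDens h p * (p : ℝ) ^ δ < 1) (hε : 0 ≤ ε) (hε1 : ε ≤ 1)
    (hβ : 0 ≤ β)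
    (hW : ∀ q ⊆ S, ∀ u, 0 ≤ u → u ≤ r → |dualOp h S q u - (∏ p ∈ q, (1 - dualDens h p)⁻¹) * φ u| ≤
      (∏ p ∈ q, thetaFactor (dualDens h) δ p) * (ε + β * exp (-δ * u)))
    (hφ : ∀ u ≤ r, |φ u| ≤ F) :
    |mainOne h S r - approxOne h S φ r| ≤ 3 * ∑ p ∈ S, errWeight h δ p * log p *
      sieveOp (errWeight h δ) (errKer δ ε β F) (S.erase p) (r - log p) := by
  rw [mainOne, approxOne, ← sum_sub_distrib, mul_sum]
  refine (abs_sum_le_sum_abs _ _).trans (sum_le_sum fun p hp => ?_)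
  rw [sieveOp, sieveOp, mul_sum, mul_sum, ← sum_sub_distrib, mul_sum,
    mul_sum]
  refine (abs_sum_le_sum_abs _ _).trans (sum_le_sum fun l hl => ?_)
  have hpl : p ∉ l := fun hh => notMem_erase p S (mem_powerset.1 hl hh)
  have hlog := log_natCast_nonneg p
  have h1 := H.abs_dual_term_le hS hδ hlt hε hε1 hβ hW hφ
    (Finset.insert_subset hp ((mem_powerset.1 hl).trans (Finset.erase_subset p S)))
    hlog (by linarith [logW_nonneg l] : r - logW l ≤ r)
  rw [prod_insert hpl, prod_insert hpl, prod_insert hpl] at h1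
  have h2 := mul_le_mul_of_nonneg_left h1 hlog
  rw [sub_right_comm r]
  refine le_trans (le_of_eq ?_) (h2.trans (le_of_eq (by ring_nf)))
  conv_rhs => rw [← abs_of_nonneg hlog]
  rw [← abs_mul, abs_of_nonneg hlog]
  congr 1
  ring_nf

end

theorem SieveHyp.exists_main_sub_le (H : SieveHyp h Hstar L c₀) {a : ℝ} (ha : 0 < a)
    (hHa : Hstar 1 = a) (n : ℕ) {η : ℝ} (hη : 0 < η) :
    ∃ r₀ : ℝ, ∀ z r : ℝ, 3 ≤ z → r₀ ≤ r → r ≤ n * log z →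
      |mainZero h ⌈z⌉₊.primesBelow r - sieveOp (dens h)
        (kerZero fun u => fExt (2 * u / log z) / a) ⌈z⌉₊.primesBelow r| ≤ η * r ^ 2 ∧
      |mainOne h ⌈z⌉₊.primesBelow r - approxOne h ⌈z⌉₊.primesBelow
        (fun u => fExt (2 * u / log z) / a) r| ≤ η * r ^ 3 := by
  obtain ⟨δ, ρ, hδ, hδc, hρ, hle⟩ := H.exists_delta
  obtain ⟨M, hM⟩ := H.exists_mertens_errWeight hδ hδc hρ hle
  obtain ⟨C₁, hC₁, hstep⟩ := hM.exists_sieveOp_step_le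
  obtain ⟨C₂, hC₂, hexp⟩ := hM.exists_sieveOp_exp_le hδ
  obtain ⟨K, hK⟩ := exists_lipschitzOn_fExt (2 * n)
  have hM0 := hM.M_nonneg
  set F := fExt (2 * n) / a with hF
  have hF0 : 0 < F := div_pos (by linarith [two_le_fExt (2 * n)]) ha
  set A := (2 + 2 * F) * C₁ with hA
  have hA0 : 0 < A := by positivity
  set ε := min 1 (η / (72 * A)) with hεdef
  have hε : 0 < ε := lt_min one_pos (by positivity)
  have hε1 : ε ≤ 1 := min_le_left _ _
  have hεA : 72 * (A * ε) ≤ η := by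
    have : ε ≤ η / (72 * A) := min_le_right _ _
    rw [le_div_iff₀ (by positivity)] at this
    linarith
  obtain ⟨U, β₀, ℓ₀, hβ₀, hY⟩ := H.exists_sieveOp_dual_ceil ha hHa n hε
  set β := β₀ * exp (δ * U) + F with hβdef
  have hβ : 0 ≤ β := by positivity
  set β' := (2 * β ^ 2 + 2 * F * β) * C₂ with hβ'
  have hβ'0 : 0 ≤ β' := by positivity
  refine ⟨max 1 (max M (max (36 * β' / η) (n * max ℓ₀ (2 * K / (a * δ * ε)) + 1))),
    fun z r hz hr hrn => ?_⟩
  have hr1 : 1 ≤ r := (le_max_left _ _).trans hr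
  have hrM : M ≤ r := (le_max_left _ _).trans ((le_max_right _ _).trans hr)
  have hrβ : 36 * β' / η ≤ r :=
    (le_max_left _ _).trans ((le_max_right _ _).trans ((le_max_right _ _).trans hr))
  have hrℓ : n * max ℓ₀ (2 * K / (a * δ * ε)) + 1 ≤ r :=
    (le_max_right _ _).trans ((le_max_right _ _).trans ((le_max_right _ _).trans hr))
  set ℓ := log z with hℓ
  have hℓ0 : 0 < ℓ := log_pos (by linarith)
  have hmax : max ℓ₀ (2 * K / (a * δ * ε)) ≤ ℓ := by
    by_contra hlt
    have : (n : ℝ) * ℓ ≤ n * max ℓ₀ (2 * K / (a * δ * ε)) :=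
      mul_le_mul_of_nonneg_left (not_le.1 hlt).le (Nat.cast_nonneg n)
    linarith
  have hℓℓ : ℓ₀ ≤ ℓ := (le_max_left _ _).trans hmax
  have hℓK : 2 * K / (a * δ * ε) ≤ ℓ := (le_max_right _ _).trans hmax
  set S := ⌈z⌉₊.primesBelow
  have hS : ∀ p ∈ S, p.Prime := fun p => prime_of_mem_primesBelow
  have hlt : ∀ p ∈ S, dualDens h p * (p : ℝ) ^ δ < 1 := fun p hp => by
    refine lt_of_le_of_lt ?_ ((hle p (hS p hp)).trans_lt hρ)
    have := H.dualDens_le p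
    gcongr
  set φ := fun u => fExt (2 * u / ℓ) / a with hφdef
  have hφF : ∀ u ≤ r, |φ u| ≤ F := fun u hu => by
    have h1 : 0 ≤ φ u := div_nonneg (by linarith [two_le_fExt (2 * u / ℓ)]) ha.le
    rw [abs_of_nonneg h1]
    refine div_le_div_of_nonneg_right (monotone_fExt ?_) ha.le
    rw [div_le_iff₀ hℓ0]
    linarith
  have hφL : ∀ u v, 0 ≤ v → v ≤ u → u ≤ r → |φ v - φ u| ≤ δ * ε * (u - v) := by
    intro u v hv hvu hu
    have hmem : ∀ x, 0 ≤ x → x ≤ r → 2 * x / ℓ ∈ Icc (0 : ℝ) (2 * n) := fun x hx0 hx =>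
      ⟨by positivity, by rw [div_le_iff₀ hℓ0]; linarith⟩
    have h1 := hK.dist_le_mul _ (hmem v hv (hvu.trans hu)) _ (hmem u (hv.trans hvu) hu)
    rw [Real.dist_eq, Real.dist_eq, ← sub_div, ← mul_sub, abs_div, abs_mul,
      abs_of_pos hℓ0, abs_of_nonpos (by linarith : v - u ≤ 0), abs_two] at h1
    simp only [hφdef]
    rw [← sub_div, abs_div, abs_of_pos ha, div_le_iff₀ ha]
    rw [div_le_iff₀ (by positivity)] at hℓK
    refine h1.trans ?_
    rw [← mul_div_assoc, div_le_iff₀ hℓ0]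
    have := mul_le_mul_of_nonneg_right hℓK (by linarith : 0 ≤ u - v)
    linarith
  have hW : ∀ q ⊆ S, ∀ u, 0 ≤ u → u ≤ r →
      |dualOp h S q u - (∏ p ∈ q, (1 - dualDens h p)⁻¹) * φ u| ≤
      (∏ p ∈ q, thetaFactor (dualDens h) δ p) * (ε + β * exp (-δ * u)) := by
    intro q hq u hu hur
    refine sieveOp_sdiff_sub_le hS H.dualDens_nonneg hδ hlt
      (fun v hv => by simp [max_eq_right hv.le]) hε.le (fun u hu hur => ?_)
      (fun u _ hur => (hφF u hur).trans (by linarith [mul_nonneg hβ₀ (exp_pos (δ * U)).le]))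
      hφL hq hu hur
    refine (hY z hz hℓℓ u hu (hur.trans hrn)).trans (add_le_add le_rfl ?_)
    split_ifs with huU
    · have h1 : 1 ≤ exp (δ * U) * exp (-δ * u) := by
        rw [← Real.exp_add, Real.one_le_exp_iff]
        nlinarith
      calc β₀ ≤ β₀ * (exp (δ * U) * exp (-δ * u)) := le_mul_of_one_le_right hβ₀ h1
        _ ≤ β * exp (-δ * u) := by
          rw [← mul_assoc]
          gcongr
          linarith
    · positivity
  have hop : ∀ T : Finset ℕ, (∀ p ∈ T, p.Prime) → ∀ s, 0 ≤ s → s ≤ r →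
      sieveOp (errWeight h δ) (errKer δ ε β F) T s ≤ η / 9 * r ^ 2 := by
    intro T hT s hs hsr
    have e1 : errKer δ ε β F = fun v => (2 + 2 * F) * ε * expStep 0 v +
      (2 * β ^ 2 + 2 * F * β) * expStep δ v := rfl
    rw [e1, sieveOp_add_smul]
    rw [div_le_iff₀ hη] at hrβ
    calc _ ≤ (2 + 2 * F) * ε * (C₁ * (1 + s) ^ 2) + (2 * β ^ 2 + 2 * F * β) * (C₂ * (1 + s)) := by
          gcongr
          · exact hstep T hT s hs
          · exact hexp T hT s hs
      _ ≤ (2 + 2 * F) * ε * (C₁ * (2 * r) ^ 2) + (2 * β ^ 2 + 2 * F * β) * (C₂ * (2 * r)) := by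
          gcongr <;> linarith
      _ = 4 * (A * ε) * r ^ 2 + 2 * β' * r := by rw [hA, hβ']; ring
      _ ≤ η / 18 * r ^ 2 + η / 18 * r ^ 2 := by
          refine add_le_add ?_ ?_
          · gcongr
            linarith
          · nlinarith
      _ = _ := by ring
  constructor
  · refine (H.abs_mainZero_sub_le hS hδ hlt hε.le hε1 hβ hW hφF).trans ?_
    have := hop S hS r (by linarith) le_rfl
    have : 0 ≤ η * r ^ 2 := by positivity
    linarith
  · refine (H.abs_mainOne_sub_le hS hδ hlt hε.le hε1 hβ hW hφF).trans ?_
    have h1 : ∑ p ∈ S, errWeight h δ p * log p *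
        sieveOp (errWeight h δ) (errKer δ ε β F) (S.erase p) (r - log p) ≤
        ∑ p ∈ S with log (p : ℕ) ≤ r, errWeight h δ p * log p * (η / 9 * r ^ 2) := by
      rw [sum_filter]
      refine sum_le_sum fun p hp => ?_
      have h2 : 0 ≤ errWeight h δ p * log p :=
        mul_nonneg (hM.nonneg p) (log_natCast_nonneg p)
      split_ifs with hpr
      · exact mul_le_mul_of_nonneg_left (hop _ (fun q hq => hS q (Finset.mem_of_mem_erase hq)) _
          (by linarith) (by linarith [log_natCast_nonneg p])) h2
      · rw [sieveOp_of_neg _ (fun v hv => ?_) _ (by linarith), mul_zero]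
        rw [errKer, expStep_of_neg _ hv, expStep_of_neg _ hv]
        ring
    rw [← sum_mul] at h1
    have h2 := hM.sum_le hS (by linarith : 0 ≤ r)
    have h3 : (2 * r + M) * (η / 9 * r ^ 2) ≤ 3 * r * (η / 9 * r ^ 2) := by
      gcongr
      linarith
    have h4 := mul_le_mul_of_nonneg_right h2 (by positivity : 0 ≤ η / 9 * r ^ 2)
    linarith

theorem SieveHyp.exists_sieveOp_integral (H : SieveHyp h Hstar L c₀) (HΨ : BumpHyp Ψ) {a : ℝ}
    (ha : 0 < a) (hHa : Hstar 1 = a) (n : ℕ) {ε : ℝ} (hε : 0 < ε) :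
    ∃ r₀ : ℝ, ∀ z r : ℝ, 3 ≤ z → r₀ ≤ r → r ≤ n * log z → ∀ (ψ : ℝ → ℝ) (K : NNReal),
      LipschitzOnWith K ψ (Icc 0 r) →
      |sieveOp (dens h) (fun v => if 0 ≤ v then ψ v else 0) ⌈z⌉₊.primesBelow r -
        2 * a * expGamma * log z * r *
          ∫ u in (0 : ℝ)..1, deriv sieveSigma ((1 - u) * (2 * r / log z)) * ψ (r * u)| ≤
        ε * r ^ 2 * (|ψ 0| + K * r) := by
  obtain ⟨β, ℓ₀, hβ, hG⟩ := H.exists_sieveOp_dens_ceil HΨ ha hHa n (half_pos hε)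
  obtain ⟨Kσ, hKσ⟩ := exists_lipschitzOn_sieveSigma 0 (2 * n)
  refine ⟨max 1 (max (2 * β / ε) (n * ℓ₀ + 1)), fun z r hz hr hrn ψ K hψ => ?_⟩
  have hr1 : 1 ≤ r := (le_max_left _ _).trans hr
  have hrβ : 2 * β / ε ≤ r := (le_max_left _ _).trans ((le_max_right _ _).trans hr)
  have hrℓ : n * ℓ₀ + 1 ≤ r := (le_max_right _ _).trans ((le_max_right _ _).trans hr)
  set ℓ := log z with hℓ
  have hℓ0 : 0 < ℓ := log_pos (by linarith)
  have hℓℓ : ℓ₀ ≤ ℓ := by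
    by_contra hlt
    have : (n : ℝ) * ℓ ≤ n * ℓ₀ := mul_le_mul_of_nonneg_left (not_le.1 hlt).le (Nat.cast_nonneg n)
    linarith
  set S := ⌈z⌉₊.primesBelow
  set Φ : ℝ → ℝ := fun x => a * expGamma * ℓ ^ 2 * sieveSigma (2 / ℓ * x) with hΦ
  have hmaps : MapsTo (fun x => 2 / ℓ * x) (Icc 0 r) (Icc (0 : ℝ) (2 * n)) := fun x hx => by
    refine ⟨by have := hx.1; positivity, ?_⟩
    change 2 / ℓ * x ≤ 2 * n
    rw [div_mul_eq_mul_div, div_le_iff₀ hℓ0]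
    linarith [hx.2]
  have hlin : ∀ c : ℝ, LipschitzWith ‖c‖₊ fun x : ℝ => c * x := fun c =>
    LipschitzWith.of_dist_le_mul fun x y => by
      rw [Real.dist_eq, Real.dist_eq, ← mul_sub, abs_mul]
      rfl
  have hΦL := ((hlin (a * expGamma * ℓ ^ 2)).comp_lipschitzOnWith
    (hKσ.comp (hlin (2 / ℓ)).lipschitzOnWith hmaps))
  have hψL : LipschitzOnWith K (fun x => ψ (r - x)) (Icc 0 r) := by
    refine LipschitzOnWith.of_dist_le_mul fun x hx y hy => ?_
    have := hψ.dist_le_mul (r - x) ⟨by linarith [hx.2], by linarith [hx.1]⟩ (r - y)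
      ⟨by linarith [hy.2], by linarith [hy.1]⟩
    rwa [dist_sub_left] at this
  have key := abs_sum_sub_integral_le S.powerset (fun t => ∏ p ∈ t, dens h p) logW
    (by linarith : (0 : ℝ) ≤ r) (by positivity : 0 ≤ ε * r ^ 2) (fun t _ => logW_nonneg t)
    (Φ := Φ) hΦL hψL (by
      simp only [hΦ]
      rw [mul_zero, sieveSigma_spec.zero 0 le_rfl, mul_zero]) (fun x hx => by
      have h1 := hG z hz hℓℓ x hx.1 (hx.2.trans hrn)
      have h2 : sieveOp (dens h) (expStep 0) S x =
          ∑ t ∈ S.powerset with logW t ≤ x, ∏ p ∈ t, dens h p := by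
        rw [sum_filter, sieveOp]
        refine sum_congr rfl fun t _ => ?_
        rw [expStep_zero]
        simp only [sub_nonneg, mul_ite, mul_one, mul_zero]
      rw [h2, ← div_mul_eq_mul_div] at h1
      refine h1.trans ?_
      rw [div_le_iff₀ hε] at hrβ
      have h3 : x ^ 2 ≤ r ^ 2 := pow_le_pow_left₀ hx.1 hx.2 2
      nlinarith) (integral_abs_deriv_le (by linarith) hψL)
  have e1 : sieveOp (dens h) (fun v => if 0 ≤ v then ψ v else 0) S r =
      ∑ t ∈ S.powerset with logW t ≤ r, (∏ p ∈ t, dens h p) * ψ (r - logW t) := by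
    rw [sum_filter, sieveOp]
    refine sum_congr rfl fun t _ => ?_
    simp only [sub_nonneg, mul_ite, mul_zero]
  have e2 : ∫ x in (0 : ℝ)..r, deriv Φ x * ψ (r - x) = 2 * a * expGamma * ℓ * r *
      ∫ u in (0 : ℝ)..1, deriv sieveSigma ((1 - u) * (2 * r / ℓ)) * ψ (r * u) := by
    have h1 := integral_comp_sub_mul (fun x => deriv Φ x * ψ (r - x))
      (a := 0) (b := 1) (by linarith : r ≠ 0) r
    rw [mul_one, sub_self, mul_zero, sub_zero, smul_eq_mul, eq_inv_mul_iff_mul_eq₀ (by linarith)]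
      at h1
    rw [← h1, mul_assoc _ r, mul_left_comm, ← intervalIntegral.integral_const_mul (2 * a * _ * _)]
    congr 1
    refine intervalIntegral.integral_congr fun u _ => ?_
    have h2 : deriv Φ (r - r * u) = 2 * a * expGamma * ℓ *
        deriv sieveSigma ((1 - u) * (2 * r / ℓ)) := by
      simp only [hΦ]
      rw [deriv_const_mul_field, deriv_comp_mul_left, smul_eq_mul]
      have : 2 / ℓ * (r - r * u) = (1 - u) * (2 * r / ℓ) := by ring
      rw [this]
      field_simp
    rw [h2, sub_sub_cancel]
    ring
  rw [e1, ← e2]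
  rw [sub_self, sub_zero] at key
  exact key

theorem sieveF_eq_indicator : sieveF = (Ioi (0 : ℝ)).indicator fExt := by
  funext s
  by_cases hs : 0 < s
  · rw [indicator_of_mem (mem_Ioi.2 hs), sieveF_eq_fExt hs]
  · rw [indicator_of_notMem (by simpa using hs), sieveF_spec.zero s (not_lt.1 hs)]

theorem measurable_sieveF : Measurable sieveF := by
  rw [sieveF_eq_indicator]
  exact continuous_fExt.measurable.indicator measurableSet_Ioi

theorem sieveF_nonneg (s : ℝ) : 0 ≤ sieveF s := by
  rw [sieveF_eq_indicator]
  exact indicator_nonneg (fun s _ => by linarith [two_le_fExt s]) s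

theorem sieveF_le_fExt {s t : ℝ} (hst : s ≤ t) : sieveF s ≤ fExt t := by
  rcases le_or_gt s 0 with hs | hs
  · rw [sieveF_spec.zero s hs]
    linarith [two_le_fExt t]
  · rw [sieveF_eq_fExt hs]
    exact monotone_fExt hst

theorem intervalIntegrable_sieveF_pow (i : ℕ) (α β : ℝ) :
    IntervalIntegrable (fun x => sieveF x ^ i) volume α β := by
  rw [intervalIntegrable_iff]
  refine Measure.integrableOn_of_bounded (M := fExt (max α β) ^ i) (by simp [uIoc])
    (measurable_sieveF.pow_const i).aestronglyMeasurable ?_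
  filter_upwards [ae_restrict_mem measurableSet_uIoc] with x hx
  rw [norm_pow, norm_eq_abs, abs_of_nonneg (sieveF_nonneg x)]
  exact pow_le_pow_left₀ (sieveF_nonneg x) (sieveF_le_fExt hx.2) i

/-- `∫₀¹ 𝔣(s - 2w) (2 𝔣(s) - 𝔣(s - 2w)) dw`. -/
def shiftMean (s : ℝ) : ℝ :=
  fExt s * (∫ x in (s - 2)..s, sieveF x ^ 1) - 1 / 2 * ∫ x in (s - 2)..s, sieveF x ^ 2

theorem integral_shift (c s : ℝ) : ∫ x in (s - 2)..s, sieveF x * (2 * c - sieveF x) =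
    2 * (c * (∫ x in (s - 2)..s, sieveF x ^ 1) - 1 / 2 * ∫ x in (s - 2)..s, sieveF x ^ 2) := by
  have h1 : (fun x => sieveF x * (2 * c - sieveF x)) =
      fun x => 2 * c * sieveF x ^ 1 - sieveF x ^ 2 := by
    funext x
    ring
  rw [h1, intervalIntegral.integral_sub ((intervalIntegrable_sieveF_pow 1 _ _).const_mul _)
    (intervalIntegrable_sieveF_pow 2 _ _), intervalIntegral.integral_const_mul]
  ring

theorem shiftMean_eq (s : ℝ) :
    ∫ w in (0 : ℝ)..1, sieveF (s - 2 * w) * (2 * fExt s - sieveF (s - 2 * w)) = shiftMean s := by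
  rw [integral_comp_sub_mul (fun x => sieveF x * (2 * fExt s - sieveF x))
    two_ne_zero, mul_one, mul_zero, sub_zero, integral_shift, smul_eq_mul, shiftMean]
  ring

theorem shiftMean_zero : shiftMean 0 = 0 := by
  have h1 : ∀ i : ℕ, i ≠ 0 → ∫ x in (0 - 2 : ℝ)..0, sieveF x ^ i = 0 := fun i hi => by
    rw [intervalIntegral.integral_congr (g := fun _ => (0 : ℝ))]
    · simp
    · intro x hx
      rw [uIcc_of_le (by norm_num)] at hx
      simp [sieveF_spec.zero x hx.2, hi]
  rw [shiftMean, h1 1 one_ne_zero, h1 2 two_ne_zero]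
  ring

theorem exists_lipschitzOn_shiftMean (b : ℝ) : ∃ K, LipschitzOnWith K shiftMean (Icc 0 b) := by
  have hL : ∀ i : ℕ, ∃ K, LipschitzOnWith K (fun s => ∫ x in (s - 2)..s, sieveF x ^ i)
      (Icc 0 b) := by
    intro i
    refine ⟨(2 * fExt b ^ i).toNNReal, LipschitzOnWith.of_dist_le_mul fun s hs t ht => ?_⟩
    have hF := two_le_fExt b
    rw [coe_toNNReal _ (by positivity), Real.dist_eq, Real.dist_eq]
    have hI := intervalIntegrable_sieveF_pow i
    have h1 : ∀ x y : ℝ, x ≤ b → y ≤ b → |∫ v in x..y, sieveF v ^ i| ≤ fExt b ^ i * |y - x| :=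
      fun x y hx hy => by
        rw [← norm_eq_abs]
        refine intervalIntegral.norm_integral_le_of_norm_le_const fun v hv => ?_
        rw [norm_pow, norm_eq_abs, abs_of_nonneg (sieveF_nonneg v)]
        exact pow_le_pow_left₀ (sieveF_nonneg v)
          (sieveF_le_fExt (hv.2.trans (max_le hx hy))) i
    have h2 := integral_add_adjacent_intervals (hI (t - 2) (s - 2)) (hI (s - 2) s)
    have h3 := integral_add_adjacent_intervals (hI (t - 2) t) (hI t s)
    have h4 : (∫ x in (s - 2)..s, sieveF x ^ i) - ∫ x in (t - 2)..t, sieveF x ^ i =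
        (∫ x in t..s, sieveF x ^ i) - ∫ x in (t - 2)..(s - 2), sieveF x ^ i := by linarith
    rw [h4]
    have h5 := h1 t s ht.2 hs.2
    have h6 := h1 (t - 2) (s - 2) (by linarith [ht.2]) (by linarith [hs.2])
    rw [sub_sub_sub_cancel_right] at h6
    linarith [abs_sub (∫ x in t..s, sieveF x ^ i) (∫ x in (t - 2)..(s - 2), sieveF x ^ i)]
  obtain ⟨K₁, h1⟩ := exists_lipschitzOn_mul (exists_lipschitzOn_fExt b) (hL 1)
  obtain ⟨K₂, h2⟩ := exists_lipschitzOn_mul (f := fun _ => 1 / 2)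
    ⟨0, (LipschitzWith.const _).lipschitzOnWith⟩ (hL 2)
  refine ⟨K₁ + K₂, LipschitzOnWith.of_dist_le_mul fun s hs t ht => ?_⟩
  have h3 := h1.dist_le_mul s hs t ht
  have h4 := h2.dist_le_mul s hs t ht
  rw [Real.dist_eq] at h3 h4 ⊢
  rw [shiftMean, shiftMean, sub_sub_sub_comm, NNReal.coe_add, add_mul]
  exact (abs_sub _ _).trans (add_le_add h3 h4)

theorem c₂_eq {τ : ℝ} (hτ : 0 < τ) :
    c₂ τ = ∫ u in (0 : ℝ)..1, deriv sieveSigma ((1 - u) * τ) * shiftMean (τ * u) := by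
  have hswap : c₂ τ = ∫ u in (0 : ℝ)..1, ∫ v in (0 : ℝ)..1,
      deriv sieveSigma ((1 - u) * τ) * sieveF (u * τ - 2 * v) *
        (2 * sieveF (u * τ) - sieveF (u * τ - 2 * v)) := by
    obtain ⟨K, hK⟩ := exists_lipschitzOn_sieveSigma (-1) (τ + 1)
    rw [c₂]
    simp only [integral_of_le zero_le_one]
    refine integral_integral_swap ?_
    have hF := two_le_fExt τ
    refine Integrable.of_bound ?_ (K * fExt τ * (3 * fExt τ)) ?_
    · have hm := measurable_sieveF
      have hd := measurable_deriv sieveSigma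
      refine Measurable.aestronglyMeasurable ?_
      fun_prop
    · rw [Measure.prod_restrict]
      filter_upwards [ae_restrict_mem (measurableSet_Ioc.prod measurableSet_Ioc)] with x hx
      obtain ⟨⟨hv0, hv1⟩, hu0, hu1⟩ := hx
      have h1 : x.2 * τ ≤ τ := by nlinarith
      have h2 : ‖deriv sieveSigma ((1 - x.2) * τ)‖ ≤ K := by
        refine norm_deriv_le_of_lipschitzOn (Icc_mem_nhds ?_ ?_) hK <;> nlinarith
      have h3 : |sieveF (x.2 * τ - 2 * x.1)| ≤ fExt τ := by
        rw [abs_of_nonneg (sieveF_nonneg _)]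
        exact sieveF_le_fExt (by linarith)
      have h4 : |sieveF (x.2 * τ)| ≤ fExt τ := by
        rw [abs_of_nonneg (sieveF_nonneg _)]
        exact sieveF_le_fExt h1
      have h5 : |2 * sieveF (x.2 * τ) - sieveF (x.2 * τ - 2 * x.1)| ≤ 3 * fExt τ := by
        rw [abs_le] at *
        constructor <;> linarith
      simp only [Function.uncurry]
      rw [norm_mul, norm_mul]
      exact mul_le_mul (mul_le_mul h2 h3 (abs_nonneg _) K.2) h5 (abs_nonneg _) (by positivity)
  rw [hswap]
  refine intervalIntegral.integral_congr_ae (Eventually.of_forall fun u hu => ?_)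
  rw [uIoc_of_le zero_le_one] at hu
  simp only [mul_assoc]
  rw [intervalIntegral.integral_const_mul, sieveF_eq_fExt (mul_pos hu.1 hτ), shiftMean_eq,
    mul_comm τ]

theorem c₁_eq {τ : ℝ} (hτ : 0 < τ) :
    c₁ τ = ∫ u in (0 : ℝ)..1, deriv sieveSigma ((1 - u) * τ) * fExt (τ * u) ^ 2 := by
  refine intervalIntegral.integral_congr_ae (Eventually.of_forall fun u hu => ?_)
  rw [uIoc_of_le zero_le_one] at hu
  rw [sieveF_eq_fExt (mul_pos hu.1 hτ), mul_comm τ]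

theorem lipschitzOnWith_scale {g : ℝ → ℝ} {K : NNReal} {b : ℝ} (hK : LipschitzOnWith K g (Icc 0 b))
    {c C r : ℝ} (hc : 0 ≤ c) (hC : 0 ≤ C) (hcr : c * r ≤ b) :
    LipschitzOnWith (C * K * c).toNNReal (fun v => C * g (c * v)) (Icc 0 r) := by
  refine LipschitzOnWith.of_dist_le_mul fun x hx y hy => ?_
  have hm : ∀ x ∈ Icc 0 r, c * x ∈ Icc 0 b := fun x hx =>
    ⟨mul_nonneg hc hx.1, (mul_le_mul_of_nonneg_left hx.2 hc).trans hcr⟩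
  have h1 := mul_le_mul_of_nonneg_left (hK.dist_le_mul _ (hm x hx) _ (hm y hy)) hC
  rw [coe_toNNReal _ (by positivity)]
  rw [Real.dist_eq, Real.dist_eq, ← mul_sub, abs_mul c, abs_of_nonneg hc] at h1
  rw [Real.dist_eq, Real.dist_eq, ← mul_sub, abs_mul, abs_of_nonneg hC]
  linarith

theorem SieveHyp.exists_approxZero (H : SieveHyp h Hstar L c₀) (HΨ : BumpHyp Ψ) {a : ℝ}
    (ha : 0 < a) (hHa : Hstar 1 = a) (n : ℕ) {η : ℝ} (hη : 0 < η) :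
    ∃ r₀ : ℝ, ∀ z r : ℝ, 3 ≤ z → r₀ ≤ r → r ≤ n * log z →
      |sieveOp (dens h) (kerZero fun u => fExt (2 * u / log z) / a) ⌈z⌉₊.primesBelow r -
        2 * expGamma / a * log z * r * c₁ (2 * r / log z)| ≤ η * r ^ 2 := by
  obtain ⟨K, hK⟩ := exists_lipschitzOn_mul (exists_lipschitzOn_fExt (2 * n))
    (exists_lipschitzOn_fExt (2 * n))
  set Q := 4 / a ^ 2 + 2 * n * K / a ^ 2 with hQ
  have hQ0 : 0 < Q := by positivity
  obtain ⟨r₀, h1⟩ := H.exists_sieveOp_integral HΨ ha hHa n (div_pos hη hQ0)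
  refine ⟨max 1 r₀, fun z r hz hr hrn => ?_⟩
  have hr1 : 1 ≤ r := (le_max_left _ _).trans hr
  have hℓ0 : 0 < log z := log_pos (by linarith)
  set ℓ := log z
  have hcr : 2 / ℓ * r ≤ 2 * n := by
    rw [div_mul_eq_mul_div, div_le_iff₀ hℓ0]
    linarith
  have h2 := h1 z r hz ((le_max_right _ _).trans hr) hrn _ _
    (lipschitzOnWith_scale hK (by positivity) (by positivity : 0 ≤ 1 / a ^ 2) hcr)
  have e1 : kerZero (fun u => fExt (2 * u / ℓ) / a) =
      fun v => if 0 ≤ v then 1 / a ^ 2 * (fExt (2 / ℓ * v) * fExt (2 / ℓ * v)) else 0 := by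
    funext v
    rw [kerZero, div_mul_eq_mul_div]
    congr 1
    ring_nf
  have e2 : 2 * expGamma / a * ℓ * r * c₁ (2 * r / ℓ) = 2 * a * expGamma * ℓ * r *
      ∫ u in (0 : ℝ)..1, deriv sieveSigma ((1 - u) * (2 * r / ℓ)) *
        (1 / a ^ 2 * (fExt (2 / ℓ * (r * u)) * fExt (2 / ℓ * (r * u)))) := by
    rw [c₁_eq (by positivity), ← intervalIntegral.integral_const_mul,
      ← intervalIntegral.integral_const_mul]
    refine intervalIntegral.integral_congr fun u _ => ?_
    rw [show 2 / ℓ * (r * u) = 2 * r / ℓ * u by ring]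
    field_simp
  rw [e1, e2]
  refine h2.trans ?_
  have h3 : |1 / a ^ 2 * (fExt (2 / ℓ * 0) * fExt (2 / ℓ * 0))| = 4 / a ^ 2 := by
    rw [mul_zero, fExt_of_le zero_le_two, abs_of_nonneg (by positivity)]
    ring
  have h4 : ((1 / a ^ 2 * K * (2 / ℓ)).toNNReal : ℝ) * r ≤ 2 * n * K / a ^ 2 := by
    rw [coe_toNNReal _ (by positivity)]
    calc _ = 1 / a ^ 2 * K * (2 / ℓ * r) := by ring
      _ ≤ 1 / a ^ 2 * K * (2 * n) := by gcongr
      _ = _ := by ring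
  rw [h3]
  calc _ ≤ η / Q * r ^ 2 * Q := by
        refine mul_le_mul_of_nonneg_left ?_ (by positivity)
        rw [hQ]
        linarith
    _ = _ := by field_simp

theorem MertensWeight.exists_sum_kerOne {w : ℕ → ℝ} {M : ℝ} (hw : MertensWeight w M) {a : ℝ}
    (ha : 0 < a) (n : ℕ) : ∃ C : ℝ, 0 ≤ C ∧ ∀ z v : ℝ, 3 ≤ z → 0 ≤ v → v ≤ n * log z →
      |∑ p ∈ ⌈z⌉₊.primesBelow, w p * log p *
          kerOne (fun u => fExt (2 * u / log z) / a) (log p) v -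
        2 * log z / a ^ 2 * shiftMean (2 / log z * v)| ≤ C := by
  obtain ⟨K, hK⟩ := exists_lipschitzOn_fExt (2 * n)
  have hM := hw.M_nonneg
  set F := fExt (2 * n) with hF
  have hF2 : 2 ≤ F := two_le_fExt _
  refine ⟨(2 * M + 2) * (2 * F ^ 2 / a ^ 2 + 4 * F * K / a ^ 2) + 2 / a ^ 2 * (2 * F ^ 2),
    by positivity, fun z v hz hv hvn => ?_⟩
  have hℓ0 : 0 < log z := log_pos (by linarith)
  set ℓ := log z with hℓ
  set s := 2 / ℓ * v with hs
  have hs0 : 0 ≤ s := by positivity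
  have hsn : s ≤ 2 * n := by
    rw [hs, div_mul_eq_mul_div, div_le_iff₀ hℓ0]
    linarith
  have hzc : z ≤ ⌈z⌉₊ := Nat.le_ceil z
  have hzc2 : (⌈z⌉₊ : ℝ) < z + 1 := Nat.ceil_lt_add_one (by linarith)
  obtain ⟨m, hm⟩ : ∃ m, ⌈z⌉₊ = m + 1 := Nat.exists_eq_succ_of_ne_zero fun h0 => by
    rw [h0] at hzc
    norm_num at hzc
    linarith
  rw [hm] at hzc hzc2
  push_cast at hzc hzc2
  have hm0 : (0 : ℝ) < m := by linarith
  have hy0 : 0 ≤ log m := log_natCast_nonneg m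
  have hyℓ : log m ≤ ℓ := log_le_log hm0 (by linarith)
  have hℓy : ℓ ≤ log m + 1 := by
    have h1 : ℓ ≤ log (m * exp 1) :=
      log_le_log (by linarith) (by nlinarith [add_one_le_exp 1])
    rwa [Real.log_mul hm0.ne' (exp_pos 1).ne', Real.log_exp] at h1
  set u₀ := min v (log m) with hu₀
  have hu₀0 : 0 ≤ u₀ := le_min hv hy0
  have hu₀v : u₀ ≤ v := min_le_left _ _
  have hu₀ℓ : u₀ ≤ ℓ := (min_le_right _ _).trans hyℓ
  obtain ⟨N, hN⟩ := exists_nat_gt (exp u₀)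
  set c := fExt s
  set χ := fun x => 1 / a ^ 2 * (fExt (s - 2 / ℓ * x) * (2 * c - fExt (s - 2 / ℓ * x))) with hχ
  have hmem : ∀ x ∈ Icc 0 u₀, s - 2 / ℓ * x ∈ Icc 0 (2 * (n : ℝ)) := fun x hx => by
    have h1 : 2 / ℓ * x ≤ s := mul_le_mul_of_nonneg_left (hx.2.trans hu₀v) (by positivity)
    have h2 : 0 ≤ 2 / ℓ * x := mul_nonneg (by positivity) hx.1
    constructor <;> linarith
  have hfF : ∀ x : ℝ, x ≤ 2 * n → fExt x ≤ F := fun x hx => monotone_fExt hx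
  have hcF : c ≤ F := hfF s hsn
  have hc2 : 2 ≤ c := two_le_fExt s
  have hχL : LipschitzOnWith (1 / a ^ 2 * (2 * F * (K * (2 / ℓ)))).toNNReal χ
      (Icc (log (1 : ℕ)) u₀) := by
    rw [Nat.cast_one, Real.log_one]
    refine LipschitzOnWith.of_dist_le_mul fun x hx y hy => ?_
    have h1 := hK.dist_le_mul _ (hmem x hx) _ (hmem y hy)
    have h2 := hfF _ (hmem x hx).2
    have h3 := hfF _ (hmem y hy).2
    have h4 := two_le_fExt (s - 2 / ℓ * x)
    have h5 := two_le_fExt (s - 2 / ℓ * y)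
    rw [coe_toNNReal _ (by positivity)]
    rw [dist_sub_left, Real.dist_eq, Real.dist_eq, ← mul_sub (2 / ℓ) x y, abs_mul (2 / ℓ),
      abs_of_pos (by positivity : 0 < 2 / ℓ)] at h1
    rw [Real.dist_eq, Real.dist_eq]
    simp only [hχ]
    set A := fExt (s - 2 / ℓ * x)
    set B := fExt (s - 2 / ℓ * y)
    rw [← mul_sub, show A * (2 * c - A) - B * (2 * c - B) = (2 * c - A - B) * (A - B) by ring,
      abs_mul, abs_mul, abs_of_pos (by positivity : 0 < 1 / a ^ 2)]
    have h6 : |2 * c - A - B| ≤ 2 * F := abs_le.2 ⟨by linarith, by linarith⟩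
    calc _ ≤ 1 / a ^ 2 * (2 * F * (K * (2 / ℓ * |x - y|))) := by gcongr
      _ = _ := by ring
  have key := hw.abs_sum_sub_integral_le le_rfl (by simpa using hu₀0) hN hχL
    (integral_abs_deriv_le (by simpa using hu₀0) hχL)
  rw [Nat.cast_one, Real.log_one, sub_zero, coe_toNNReal _ (by positivity)] at key
  have e1 : ∑ p ∈ ⌈z⌉₊.primesBelow, w p * log p *
      kerOne (fun u => fExt (2 * u / ℓ) / a) (log p) v =
      ∑ p ∈ ((Finset.Ico 1 N).filter Nat.Prime).filter (fun p : ℕ => log p ≤ u₀),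
      w p * log p * χ (log p) := by
    have hset : ((Finset.Ico 1 N).filter Nat.Prime).filter (fun p : ℕ => log p ≤ u₀) =
        ⌈z⌉₊.primesBelow.filter (fun p : ℕ => log p ≤ v) := by
      ext p
      simp only [mem_filter, Finset.mem_Ico, mem_primesBelow, hm, hu₀, le_min_iff]
      constructor
      · rintro ⟨⟨_, hp⟩, h1, h2⟩
        rw [Real.log_le_log_iff (by exact_mod_cast hp.pos) hm0, Nat.cast_le] at h2
        exact ⟨⟨by lia, hp⟩, h1⟩
      · rintro ⟨⟨hpm, hp⟩, h1⟩
        have h2 : log p ≤ log m :=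
          log_le_log (by exact_mod_cast hp.pos) (by exact_mod_cast (by lia : p ≤ m))
        refine ⟨⟨⟨hp.one_lt.le, ?_⟩, hp⟩, h1, h2⟩
        have h3 : (p : ℝ) ≤ exp u₀ := by
          rw [← log_le_iff_le_exp (by exact_mod_cast hp.pos)]
          exact le_min h1 h2
        exact_mod_cast h3.trans_lt hN
    rw [hset, sum_filter]
    refine sum_congr rfl fun p _ => ?_
    rw [kerOne]
    split_ifs
    · have h1 : 2 * (v - log p) / ℓ = s - 2 / ℓ * log p := by rw [hs]; ring
      have h2 : 2 * v / ℓ = s := by rw [hs]; ring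
      simp only [hχ]
      rw [h1, h2, show fExt s = c from rfl]
      field_simp
    · ring
  set g : ℝ → ℝ := fun x => sieveF x * (2 * c - sieveF x) with hg
  have hgi : ∀ α β : ℝ, IntervalIntegrable (fun x => g (s - 2 / ℓ * x)) volume α β := fun α β => by
    have h1 : g = fun x => 2 * c * sieveF x ^ 1 - sieveF x ^ 2 := by
      funext x
      simp only [hg]
      ring
    have h2 : IntervalIntegrable g volume (s - 2 / ℓ * α) (s - 2 / ℓ * β) := by
      rw [h1]
      exact ((intervalIntegrable_sieveF_pow 1 _ _).const_mul _).sub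
        (intervalIntegrable_sieveF_pow 2 _ _)
    have h3 := (h2.comp_sub_left s).comp_mul_left (c := 2 / ℓ)
    simpa [hℓ0.ne'] using h3
  have e2 : ℓ * shiftMean s = ∫ x in (0 : ℝ)..ℓ, g (s - 2 / ℓ * x) := by
    rw [integral_comp_sub_mul g (by positivity : 2 / ℓ ≠ 0), mul_zero, sub_zero,
      div_mul_cancel₀ _ hℓ0.ne', hg, integral_shift, smul_eq_mul, shiftMean, show fExt s = c from rfl]
    field_simp
  have e3 : ∫ x in (0 : ℝ)..u₀, g (s - 2 / ℓ * x) = a ^ 2 * ∫ x in (0 : ℝ)..u₀, χ x := by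
    rw [← intervalIntegral.integral_const_mul]
    refine intervalIntegral.integral_congr_ae ?_
    filter_upwards [Measure.ae_ne volume u₀] with x hx hxm
    rw [uIoc_of_le hu₀0] at hxm
    have h1 : 0 < s - 2 / ℓ * x := by
      have h2 : x < v := (lt_of_le_of_ne hxm.2 hx).trans_le hu₀v
      have h3 : 2 / ℓ * x < 2 / ℓ * v := mul_lt_mul_of_pos_left h2 (by positivity)
      linarith
    simp only [hg, hχ]
    rw [sieveF_eq_fExt h1]
    field_simp
  have e4 : |∫ x in u₀..ℓ, g (s - 2 / ℓ * x)| ≤ 2 * F ^ 2 := by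
    rw [← norm_eq_abs]
    rcases le_total v (log m) with hvm | hvm
    · have h0 : u₀ = v := min_eq_left hvm
      refine (intervalIntegral.norm_integral_le_of_norm_le_const (C := 0) fun x hx => ?_).trans
        (by rw [zero_mul]; positivity)
      rw [uIoc_of_le hu₀ℓ, h0] at hx
      have h1 : s ≤ 2 / ℓ * x := mul_le_mul_of_nonneg_left hx.1.le (by positivity)
      simp only [hg]
      rw [sieveF_spec.zero _ (by linarith), zero_mul, norm_zero]
    · have h0 : u₀ = log m := min_eq_right hvm
      refine (intervalIntegral.norm_integral_le_of_norm_le_const (C := 2 * F ^ 2)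
        fun x hx => ?_).trans ?_
      · rw [uIoc_of_le hu₀ℓ] at hx
        have h1 : s - 2 / ℓ * x ≤ s := by
          have : 0 ≤ 2 / ℓ * x := mul_nonneg (by positivity) (hu₀0.trans hx.1.le)
          linarith
        have h2 := sieveF_le_fExt h1
        have h3 := sieveF_nonneg (s - 2 / ℓ * x)
        simp only [hg]
        rw [norm_eq_abs, abs_of_nonneg (mul_nonneg h3 (by linarith))]
        calc _ ≤ F * (2 * F) := mul_le_mul (h2.trans hcF) (by linarith) (by linarith) (by linarith)
          _ = _ := by ring
      · rw [h0, abs_of_nonneg (by linarith)]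
        nlinarith [sq_nonneg F]
  have e5 : 2 * ℓ / a ^ 2 * shiftMean s = 2 * (∫ x in (0 : ℝ)..u₀, χ x) +
      2 / a ^ 2 * ∫ x in u₀..ℓ, g (s - 2 / ℓ * x) := by
    have h1 := integral_add_adjacent_intervals (hgi 0 u₀) (hgi u₀ ℓ)
    rw [← e2, e3] at h1
    calc _ = 2 / a ^ 2 * (ℓ * shiftMean s) := by ring
      _ = _ := by rw [← h1]; field_simp
  rw [e1, e5, ← sub_sub]
  refine (abs_sub _ _).trans (add_le_add (key.trans ?_) ?_)
  · gcongr
    · have h1 := hmem u₀ ⟨hu₀0, le_rfl⟩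
      have h2 := hfF _ h1.2
      have h3 := two_le_fExt (s - 2 / ℓ * u₀)
      simp only [hχ]
      set A := fExt (s - 2 / ℓ * u₀)
      have h4 : A ≤ c := monotone_fExt (by
        have : 0 ≤ 2 / ℓ * u₀ := by positivity
        linarith)
      rw [abs_of_nonneg (mul_nonneg (by positivity) (mul_nonneg (by linarith) (by linarith))),
        one_div_mul_eq_div]
      exact div_le_div_of_nonneg_right (by nlinarith) (by positivity)
    · have h1 : 2 / ℓ * u₀ ≤ 2 := by
        rw [div_mul_eq_mul_div, div_le_iff₀ hℓ0]
        linarith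
      calc _ = 1 / a ^ 2 * (2 * F * K) * (2 / ℓ * u₀) := by ring
        _ ≤ 1 / a ^ 2 * (2 * F * K) * 2 := by gcongr
        _ = _ := by ring
  · rw [abs_mul, abs_of_pos (by positivity)]
    gcongr

theorem SieveHyp.exists_approxOne (H : SieveHyp h Hstar L c₀) (HΨ : BumpHyp Ψ) {a : ℝ}
    (ha : 0 < a) (hHa : Hstar 1 = a) (n : ℕ) {η : ℝ} (hη : 0 < η) :
    ∃ r₀ : ℝ, ∀ z r : ℝ, 3 ≤ z → r₀ ≤ r → r ≤ n * log z →
      |approxOne h ⌈z⌉₊.primesBelow (fun u => fExt (2 * u / log z) / a) r -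
        4 * expGamma / a * log z ^ 2 * r * c₂ (2 * r / log z)| ≤ η * r ^ 3 := by
  obtain ⟨K, hK⟩ := exists_lipschitzOn_shiftMean (2 * n)
  have hw := H.mertensWeight_dens
  obtain ⟨C₁, hC₁, hstep⟩ := hw.exists_sieveOp_step_le
  obtain ⟨E, hE, hsq⟩ := H.exists_sum_sq_le
  obtain ⟨C₂, hC₂, hker⟩ := hw.exists_sum_kerOne ha n
  set F := fExt (2 * n) / a with hF
  have hF0 : 0 < F := div_pos (by linarith [two_le_fExt (2 * n)]) ha
  set Q := 4 * K / a ^ 2 + 1 with hQ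
  have hQ0 : 0 < Q := by positivity
  obtain ⟨r₀, h1⟩ := H.exists_sieveOp_integral HΨ ha hHa n (by positivity : 0 < η / (2 * Q))
  set B := 4 * (E * (3 * F ^ 2 * C₁) + C₂ * C₁) with hB
  have hB0 : 0 ≤ B := by positivity
  refine ⟨max 1 (max r₀ (2 * B / η)), fun z r hz hr hrn => ?_⟩
  have hr1 : 1 ≤ r := (le_max_left _ _).trans hr
  have hrB : 2 * B / η ≤ r := (le_max_right _ _).trans ((le_max_right _ _).trans hr)
  have hℓ0 : 0 < log z := log_pos (by linarith)
  set ℓ := log z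
  set S := ⌈z⌉₊.primesBelow
  have hS : ∀ p ∈ S, p.Prime := fun p => prime_of_mem_primesBelow
  set φ := fun u => fExt (2 * u / ℓ) / a with hφ
  have hj := H.dens_nonneg
  have hφ0 : ∀ u, 0 ≤ φ u := fun u => div_nonneg (by linarith [two_le_fExt (2 * u / ℓ)]) ha.le
  have hφF : ∀ u ≤ r, φ u ≤ F := fun u hu => by
    refine div_le_div_of_nonneg_right (monotone_fExt ?_) ha.le
    rw [div_le_iff₀ hℓ0]
    linarith
  have hkF : ∀ x, 0 ≤ x → ∀ v ≤ r, |kerOne φ x v| ≤ 0 * expStep 0 v + 3 * F ^ 2 * expStep 0 v := by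
    intro x hx v hv
    rw [kerOne, expStep_zero, zero_mul, zero_add]
    split_ifs with h2 h3 h3
    · have h4 := hφF v hv
      have h5 := hφF (v - x) (by linarith)
      have h6 := hφ0 v
      have h7 := hφ0 (v - x)
      rw [abs_mul, abs_of_nonneg h7, mul_one]
      have : |2 * φ v - φ (v - x)| ≤ 3 * F := abs_le.2 ⟨by linarith, by linarith⟩
      calc _ ≤ F * (3 * F) := by gcongr
        _ = _ := by ring
    · linarith
    · rw [abs_zero]
      positivity
    · simp
  have hr2 : (1 + r) ^ 2 ≤ 4 * r ^ 2 := by nlinarith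
  set A := ∑ p ∈ S, dens h p * log p * sieveOp (dens h) (kerOne φ (log p)) S r with hA
  have hstepA : |approxOne h S φ r - A| ≤ E * (3 * F ^ 2 * C₁) * (4 * r ^ 2) := by
    rw [approxOne, hA, ← sum_sub_distrib]
    have h2 : ∀ p ∈ S, |dens h p * log p * sieveOp (dens h) (kerOne φ (log p))
        (S.erase p) r - dens h p * log p * sieveOp (dens h) (kerOne φ (log p)) S r| ≤
        dens h p ^ 2 * (p : ℝ) ^ c₀ * log p * (3 * F ^ 2 * C₁ * (4 * r ^ 2)) := by
      intro p hp
      have hlog := log_natCast_nonneg p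
      have h3 : sieveOp (dens h) (kerOne φ (log p)) S r =
          sieveOp (dens h) (kerOne φ (log p)) (S.erase p) r + dens h p *
            sieveOp (dens h) (kerOne φ (log p)) (S.erase p) (r - log p) := by
        rw [← sieveOp_insert _ _ (notMem_erase p S), Finset.insert_erase hp]
      have h4 : |sieveOp (dens h) (kerOne φ (log p)) (S.erase p) (r - log p)| ≤
          3 * F ^ 2 * C₁ * (4 * r ^ 2) := by
        refine (abs_sieveOp_le hj (k' := fun v => 0 * expStep 0 v + 3 * F ^ 2 * expStep 0 v)
          (fun v hv => hkF _ hlog v (by linarith)) _).trans ?_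
        rw [sieveOp_add_smul, zero_mul, zero_add, mul_assoc _ C₁]
        refine mul_le_mul_of_nonneg_left ?_ (by positivity : 0 ≤ 3 * F ^ 2)
        rcases lt_or_ge (r - log p) 0 with h5 | h5
        · rw [sieveOp_of_neg _ (fun v hv => expStep_of_neg 0 hv) _ h5]
          positivity
        · refine (hstep _ (fun q hq => hS q (Finset.mem_of_mem_erase hq)) _ h5).trans ?_
          gcongr
          refine le_trans ?_ hr2
          gcongr
          linarith
      rw [h3, ← mul_sub, sub_add_cancel_left, abs_mul (dens h p * log p), abs_neg,
        abs_mul (dens h p) (sieveOp _ _ _ _), abs_of_nonneg (mul_nonneg (hj p) hlog), abs_of_nonneg (hj p)]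
      have h5 := one_le_prime_rpow (hS p hp) H.c_pos.le
      calc _ ≤ dens h p * log p * (dens h p * (3 * F ^ 2 * C₁ * (4 * r ^ 2))) := by
            have := hj p
            gcongr
        _ = dens h p ^ 2 * 1 * log p * (3 * F ^ 2 * C₁ * (4 * r ^ 2)) := by ring
        _ ≤ _ := by gcongr
    refine (abs_sum_le_sum_abs _ _).trans ((sum_le_sum h2).trans ?_)
    rw [← sum_mul]
    exact (mul_le_mul_of_nonneg_right (hsq S hS) (by positivity)).trans_eq (by ring)
  set ψ := fun v => 2 * ℓ / a ^ 2 * shiftMean (2 / ℓ * v) with hψ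
  have hA2 : A = sieveOp (dens h)
      (fun v => ∑ p ∈ S, dens h p * log p * kerOne φ (log p) v) S r := by
    rw [hA]
    simp only [sieveOp, mul_sum]
    rw [Finset.sum_comm]
    exact sum_congr rfl fun t _ => sum_congr rfl fun p _ => by ring
  have hstepB : |A - sieveOp (dens h) (fun v => if 0 ≤ v then ψ v else 0) S r| ≤
      C₂ * C₁ * (4 * r ^ 2) := by
    have h2 : A - sieveOp (dens h) (fun v => if 0 ≤ v then ψ v else 0) S r = sieveOp (dens h)
        (fun v => 1 * (∑ p ∈ S, dens h p * log p * kerOne φ (log p) v) +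
          -1 * (if 0 ≤ v then ψ v else 0)) S r := by
      rw [sieveOp_add_smul, hA2]
      ring
    rw [h2]
    refine (abs_sieveOp_le hj (k' := fun v => 0 * expStep 0 v + C₂ * expStep 0 v)
      (fun v hv => ?_) S).trans ?_
    · rw [expStep_zero]
      split_ifs with h3
      · have := hker z v hz h3 (hv.trans hrn)
        simp only [hψ, one_mul, neg_one_mul, ← sub_eq_add_neg, zero_add, mul_one]
        exact this
      · rw [Finset.sum_eq_zero fun p _ => ?_]
        · simp
        · rw [kerOne, if_neg (by linarith [log_natCast_nonneg p]), mul_zero]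
    · rw [sieveOp_add_smul, zero_mul, zero_add, mul_assoc]
      have := (hstep S hS r (by linarith)).trans (mul_le_mul_of_nonneg_left hr2 hC₁.le)
      gcongr
  have hcr : 2 / ℓ * r ≤ 2 * n := by
    rw [div_mul_eq_mul_div, div_le_iff₀ hℓ0]
    linarith
  have hD := h1 z r hz ((le_max_left _ _).trans ((le_max_right _ _).trans hr)) hrn ψ _
    (lipschitzOnWith_scale hK (by positivity) (by positivity : 0 ≤ 2 * ℓ / a ^ 2) hcr)
  have e2 : 4 * expGamma / a * ℓ ^ 2 * r * c₂ (2 * r / ℓ) = 2 * a * expGamma * ℓ * r *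
      ∫ u in (0 : ℝ)..1, deriv sieveSigma ((1 - u) * (2 * r / ℓ)) * ψ (r * u) := by
    rw [c₂_eq (by positivity), ← intervalIntegral.integral_const_mul,
      ← intervalIntegral.integral_const_mul]
    refine intervalIntegral.integral_congr fun u _ => ?_
    simp only [hψ]
    rw [show 2 / ℓ * (r * u) = 2 * r / ℓ * u by ring]
    field_simp
    ring
  rw [← e2] at hD
  have h3 : |ψ 0| = 0 := by
    simp only [hψ]
    rw [mul_zero, shiftMean_zero, mul_zero, abs_zero]
  have h4 : ((2 * ℓ / a ^ 2 * K * (2 / ℓ)).toNNReal : ℝ) ≤ Q := by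
    rw [coe_toNNReal _ (by positivity), hQ]
    have : 2 * ℓ / a ^ 2 * K * (2 / ℓ) = 4 * K / a ^ 2 := by
      field_simp
      ring
    linarith
  rw [h3, zero_add] at hD
  have h5 : η / (2 * Q) * r ^ 2 * (((2 * ℓ / a ^ 2 * K * (2 / ℓ)).toNNReal : ℝ) * r) ≤
      η / 2 * r ^ 3 := by
    calc _ ≤ η / (2 * Q) * r ^ 2 * (Q * r) := by gcongr
      _ = _ := by field_simp
  have h6 : B * r ^ 2 ≤ η / 2 * r ^ 3 := by
    rw [div_le_iff₀ hη] at hrB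
    nlinarith [mul_le_mul_of_nonneg_right hrB (sq_nonneg r)]
  have h7 := abs_sub_le (approxOne h S φ r) A (4 * expGamma / a * ℓ ^ 2 * r * c₂ (2 * r / ℓ))
  have h8 := abs_sub_le A (sieveOp (dens h) (fun v => if 0 ≤ v then ψ v else 0) S r)
    (4 * expGamma / a * ℓ ^ 2 * r * c₂ (2 * r / ℓ))
  rw [hB] at h6
  linarith

theorem shiftMean_nonneg (s : ℝ) : 0 ≤ shiftMean s := by
  rw [← shiftMean_eq]
  refine intervalIntegral.integral_nonneg zero_le_one fun w hw => ?_
  have h1 := sieveF_nonneg (s - 2 * w)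
  have h2 : sieveF (s - 2 * w) ≤ fExt s := sieveF_le_fExt (by linarith [hw.1])
  exact mul_nonneg h1 (by linarith)

theorem c₂_nonneg {τ : ℝ} (hτ : 0 < τ) : 0 ≤ c₂ τ := by
  rw [c₂_eq hτ]
  exact intervalIntegral.integral_nonneg zero_le_one fun u _ =>
    mul_nonneg monotone_sieveSigma.deriv_nonneg (shiftMean_nonneg _)

theorem four_mul_le_c₁ {τ : ℝ} (hτ : 0 < τ) : 4 * τ * sigmaRatio τ ≤ c₁ τ := by
  obtain ⟨K, hK⟩ := exists_lipschitzOn_sieveSigma 0 τ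
  have hac : AbsolutelyContinuousOnInterval sieveSigma 0 τ :=
    LipschitzOnWith.absolutelyContinuousOnInterval (by rwa [uIcc_of_le hτ.le])
  have h1 : ∀ u : ℝ, (1 - u) * τ = τ - τ * u := fun u => by ring
  have hi : IntervalIntegrable (fun u => deriv sieveSigma (τ - τ * u)) volume 0 1 := by
    have h2 := (hac.intervalIntegrable_deriv.symm.comp_sub_left τ).comp_mul_left (c := τ)
    simpa [hτ.ne'] using h2
  rw [c₁_eq hτ]
  simp only [h1]
  have hint : ∫ u in (0 : ℝ)..1, deriv sieveSigma (τ - τ * u) * 4 = 4 * τ * sigmaRatio τ := by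
    rw [intervalIntegral.integral_mul_const,
      integral_comp_sub_mul _ hτ.ne', mul_one, sub_self, mul_zero, sub_zero,
      hac.integral_deriv_eq_sub, sieveSigma_spec.zero 0 le_rfl, sieveSigma_eq, max_eq_left hτ.le,
      smul_eq_mul]
    field_simp
    ring
  rw [← hint]
  refine intervalIntegral.integral_mono_on zero_le_one (hi.mul_const 4)
    (hi.mul_continuousOn (by have := continuous_fExt; fun_prop)) fun u _ => ?_
  exact mul_le_mul_of_nonneg_left (by nlinarith [two_le_fExt (τ * u)])
    monotone_sieveSigma.deriv_nonneg

theorem sigmaRatio_pos (s : ℝ) : 0 < sigmaRatio s :=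
  div_pos (sieveSigma_pos (lt_max_of_lt_right two_pos)) (by positivity)

theorem abs_scale_sub_le {T₁ T₂ q x δ : ℝ} (h₁ : 0 ≤ T₁) (h₂ : 0 ≤ T₂) (hq : 1 ≤ q)
    (hqδ : q ≤ 1 + δ) (hδ : δ ≤ 1) (hx : |x| ≤ δ) :
    |T₁ * (q ^ 2 * (1 + x)) + T₂ * q - (T₁ + T₂)| ≤ 7 * δ * (T₁ + T₂) := by
  rw [abs_le] at hx
  have hδ0 : 0 ≤ δ := by linarith
  have hq2 : q ^ 2 ≤ 1 + 3 * δ := by nlinarith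
  have hq1 : 1 ≤ q ^ 2 := by nlinarith
  have h3 : |q ^ 2 * (1 + x) - 1| ≤ 7 * δ := by
    rw [abs_le]
    constructor <;> nlinarith
  have h4 : |q - 1| ≤ 7 * δ := by
    rw [abs_le]
    constructor <;> linarith
  calc _ = |T₁ * (q ^ 2 * (1 + x) - 1) + T₂ * (q - 1)| := by ring_nf
    _ ≤ T₁ * (7 * δ) + T₂ * (7 * δ) := by
      refine (abs_add_le _ _).trans (add_le_add ?_ ?_)
      · rw [abs_mul, abs_of_nonneg h₁]
        gcongr
      · rw [abs_mul, abs_of_nonneg h₂]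
        gcongr
    _ = _ := by ring

theorem abs_main_sub_le {a b v r η A M₀ M₁ m₀ m₁ : ℝ} (ha : 0 < a) (hv : 1 ≤ v) (hr : 0 < r)
    (hA : v ≤ 2 * A * r) (h₀ : |M₀ - m₀| ≤ 2 * η * r ^ 2) (h₁ : |M₁ - m₁| ≤ 2 * η * r ^ 3) :
    |(r ^ 4)⁻¹ * ((a * v + b) * M₀ + a * M₁) - (r ^ 4)⁻¹ * ((a * v + b) * m₀ + a * m₁)| ≤
      η * (8 * A ^ 2 * (a + |b|) + 4 * a * A) / v := by
  have hη : 0 ≤ η := by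
    have := (abs_nonneg _).trans h₀
    have h2 : 0 < 2 * r ^ 2 := by positivity
    nlinarith
  have h2 : |a * v + b| ≤ (a + |b|) * v := by
    refine (abs_add_le _ _).trans ?_
    rw [abs_of_nonneg (by positivity)]
    nlinarith [abs_nonneg b]
  have ht : v / r ≤ 2 * A := by rwa [div_le_iff₀ hr]
  rw [← mul_sub, abs_mul, abs_of_pos (by positivity : 0 < (r ^ 4)⁻¹),
    show (a * v + b) * M₀ + a * M₁ - ((a * v + b) * m₀ + a * m₁) =
      (a * v + b) * (M₀ - m₀) + a * (M₁ - m₁) by ring]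
  calc _ ≤ (r ^ 4)⁻¹ * ((a + |b|) * v * (2 * η * r ^ 2) + a * (2 * η * r ^ 3)) := by
        refine mul_le_mul_of_nonneg_left ((abs_add_le _ _).trans ?_) (by positivity)
        rw [abs_mul, abs_mul, abs_of_pos ha]
        gcongr
    _ = η * (2 * (v / r) ^ 2 * (a + |b|) + 2 * a * (v / r)) / v := by
        field_simp
    _ ≤ η * (2 * (2 * A) ^ 2 * (a + |b|) + 2 * a * (2 * A)) / v := by gcongr
    _ = _ := by ring

theorem SieveHyp.exists_sieveSum_asymp (H : SieveHyp h Hstar L c₀) (HΨ : BumpHyp Ψ) {A : ℝ}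
    (hA : 0 < A) {ε : ℝ} (hε : 0 < ε) : ∃ v₀ : ℝ, ∀ D z v ϑ : ℝ, v₀ ≤ v → 3 ≤ D → 3 ≤ z →
      v ≤ A * log D → v ≤ A * log z → 0 < ϑ → ϑ < 1 / 2 →
      log √D = ϑ * v - √v →
      |sieveSum Ψ h (exp v) D z -
        singularConst ϑ (log D / log z) * (exp v / v)| ≤
      ε * (singularConst ϑ (log D / log z) * (exp v / v)) := by
  obtain ⟨a, b, ha, hHa, hT⟩ := H.exists_smoothSum HΨ
  obtain ⟨C, hC, hsum⟩ := H.exists_sieveSum_sub_le HΨ ha hT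
  set E := expGamma with hE
  have hE0 : 0 < E := exp_pos _
  set κ := 8 * A ^ 2 * (a + |b|) + 4 * a * A with hκ
  have hκ0 : 0 < κ := by positivity
  set m := 16 * E * sigmaRatio A with hm
  have hm0 : 0 < m := mul_pos (by positivity) (sigmaRatio_pos A)
  set η := ε * m / (4 * κ) with hη
  have hη0 : 0 < η := by positivity
  set δ := min 1 (ε / 14) with hδ
  have hδ0 : 0 < δ := by positivity
  set n := ⌈A⌉₊ with hn
  have hAn : A ≤ n := Nat.le_ceil A
  obtain ⟨r₁, hr₁⟩ := H.exists_main_sub_le ha hHa n hη0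
  obtain ⟨r₂, hr₂⟩ := H.exists_approxZero HΨ ha hHa n hη0
  obtain ⟨r₃, hr₃⟩ := H.exists_approxOne HΨ ha hHa n hη0
  set R := max r₁ (max r₂ r₃) with hR
  refine ⟨max 1 (max (2 * A * R) (max ((2 * A / δ) ^ 2) (max (|b| / a / δ) (4 * C / (ε * m))))),
    fun D z v ϑ hv hD hz hvD hvz hϑ0 hϑ hr => ?_⟩
  simp only [max_le_iff] at hv
  obtain ⟨hv1, hvR, hvδ, hvb, hvC⟩ := hv
  have hv0 : 0 < v := by linarith
  have hsq : √v * √v = v := Real.mul_self_sqrt hv0.le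
  have hsq0 : 0 < √v := Real.sqrt_pos.2 hv0
  have hlogD : log D = 2 * log √D := by
    rw [Real.log_sqrt (by linarith)]
    ring
  rw [hlogD] at hvD ⊢
  have hϑv : ϑ * v ≤ v / 2 := by
    have := mul_le_mul_of_nonneg_right hϑ.le hv0.le
    linarith only [this]
  have hvr : v ≤ 2 * A * log √D := by linarith only [hvD]
  have hr0 : 0 < log √D := pos_of_mul_pos_right (hv0.trans_le hvr) (by positivity)
  have hmain := hsum D z v (by linarith only [hD]) hr0 hv1 (by linarith only [hr, hϑv])
  set r := log √D
  set ℓ := log z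
  have hrv : 2 * r ≤ v := by linarith only [hr, hϑv, hsq0]
  have hℓ0 : 0 < ℓ := log_pos (by linarith)
  have hRr : R ≤ r := le_of_mul_le_mul_left (hvR.trans hvr) (by positivity)
  simp only [hR, max_le_iff] at hRr
  obtain ⟨hR1, hR2, hR3⟩ := hRr
  have hrn : r ≤ n * ℓ := by
    have h1 : A * ℓ ≤ n * ℓ := by gcongr
    linarith only [h1, hrv, hvz, hr0]
  set S := ⌈z⌉₊.primesBelow
  set τ := 2 * r / ℓ with hτ
  have hτ0 : 0 < τ := by positivity
  have hτA : τ ≤ A := by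
    rw [hτ, div_le_iff₀ hℓ0]
    linarith only [hrv, hvz]
  obtain ⟨h1, h2⟩ := hr₁ z r hz hR1 hrn
  have h3 : |mainZero h S r - 2 * E / a * ℓ * r * c₁ τ| ≤ 2 * η * r ^ 2 := by
    have := abs_sub_le (mainZero h S r) _ (2 * E / a * ℓ * r * c₁ τ) |>.trans
      (add_le_add h1 (hr₂ z r hz hR2 hrn))
    linarith
  have h4 : |mainOne h S r - 4 * E / a * ℓ ^ 2 * r * c₂ τ| ≤ 2 * η * r ^ 3 := by
    have := abs_sub_le (mainOne h S r) _ (4 * E / a * ℓ ^ 2 * r * c₂ τ) |>.trans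
      (add_le_add h2 (hr₃ z r hz hR3 hrn))
    linarith
  have h5 := abs_main_sub_le (b := b) ha hv1 hr0 hvr h3 h4
  set T₁ := 4 * E * c₁ τ / (τ * ϑ ^ 2 * v) with hT₁
  set T₂ := 16 * E * c₂ τ / (τ ^ 2 * ϑ * v) with hT₂
  set q := ϑ * v / r with hq
  have hsing : singularConst ϑ τ * (exp v / v) = exp v * (T₁ + T₂) := by
    rw [singularConst, hT₁, hT₂, show exp (2 * Real.eulerMascheroniConstant) = E from rfl]
    field_simp
    ring
  have hid : (r ^ 4)⁻¹ * ((a * v + b) * (2 * E / a * ℓ * r * c₁ τ) +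
      a * (4 * E / a * ℓ ^ 2 * r * c₂ τ)) = T₁ * (q ^ 2 * (1 + b / (a * v))) + T₂ * q := by
    rw [hT₁, hT₂, hq]
    generalize c₁ τ = x
    generalize c₂ τ = y
    rw [hτ]
    field_simp
    ring
  have hT₁m : m / v ≤ T₁ := by
    have h6 : 4 * τ * sigmaRatio A ≤ c₁ τ := by
      refine le_trans ?_ (four_mul_le_c₁ hτ0)
      have := antitone_sigmaRatio hτA
      gcongr
    have h7 : ϑ ^ 2 ≤ 1 := pow_le_one₀ hϑ0.le (hϑ.le.trans (by norm_num))
    have h8 := sigmaRatio_pos A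
    rw [hT₁, hm, div_le_div_iff₀ hv0 (by positivity)]
    calc _ ≤ 16 * E * sigmaRatio A * (τ * 1 * v) := by gcongr
      _ = 4 * E * (4 * τ * sigmaRatio A) * v := by ring
      _ ≤ _ := by gcongr
  have hT₂0 : 0 ≤ T₂ := by
    have := c₂_nonneg hτ0
    positivity
  have hT₁0 : 0 ≤ T₁ := le_trans (by positivity) hT₁m
  have hscale := abs_scale_sub_le (q := q) (x := b / (a * v)) (δ := δ) hT₁0 hT₂0
    (by rw [hq, one_le_div hr0]; linarith only [hr, hsq0]) (by
      rw [hq, div_le_iff₀ hr0]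
      have h6 : 2 * A / δ ≤ √v := Real.le_sqrt_of_sq_le hvδ
      rw [div_le_iff₀ hδ0] at h6
      have h7 : √v * √v ≤ √v * (δ * r) := by
        linarith only [mul_le_mul_of_nonneg_right h6 hr0.le, hvr, hsq]
      linarith only [le_of_mul_le_mul_left h7 hsq0, hr]) (min_le_left _ _) (by
      rw [abs_div, abs_of_pos (by positivity : 0 < a * v), div_le_iff₀ (by positivity)]
      rw [div_div, div_le_iff₀ (by positivity)] at hvb
      linarith)
  rw [← hid] at hscale
  have hδε : 7 * δ * (T₁ + T₂) ≤ ε / 2 * (T₁ + T₂) := by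
    have := min_le_right 1 (ε / 14)
    gcongr
    linarith
  have herr : η * κ / v + C / v ^ 2 ≤ ε / 2 * (T₁ + T₂) := by
    have h6 : η * κ = ε * m / 4 := by
      rw [hη]
      field_simp
    have h7 : C / v ≤ ε * m / 4 := by
      rw [div_le_iff₀ (by positivity)] at hvC ⊢
      linarith
    calc _ = (η * κ + C / v) / v := by field_simp
      _ ≤ (ε * m / 4 + ε * m / 4) / v := by rw [h6]; gcongr
      _ = ε / 2 * (m / v) := by ring
      _ ≤ _ := by
        gcongr
        linarith
  rw [hsing]
  have hev := exp_pos v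
  have h9 := (abs_sub_le _ _ _).trans (add_le_add h5 hscale)
  have h10 := mul_le_mul_of_nonneg_left h9 hev.le
  rw [← abs_of_pos hev, ← abs_mul, abs_of_pos hev, mul_sub] at h10
  refine (abs_sub_le _ _ _).trans ((add_le_add hmain h10).trans ?_)
  rw [← mul_add, mul_left_comm]
  refine mul_le_mul_of_nonneg_left ?_ hev.le
  linarith

end SelbergSieve

end

theorem mainTheorem3
    (h : ArithmeticFunction ℝ) (hmul : h.IsMultiplicative) (hnonneg : ∀ n, 0 ≤ h n)
    (Hstar : ℂ → ℂ) (L c₀ : ℝ) (hL : 0 < L) (hc₀ : 0 < c₀)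
    -- absolute convergence of `∑ μ²(n) h(n) n^{-s}` for `Re s > 1`
    (hsummable : ∀ s : ℂ, 1 < s.re →
      LSeriesSummable (fun n => (ArithmeticFunction.moebius n : ℂ) ^ 2 * (h n : ℂ)) s)
    -- factorization `∑ μ²(n) h(n) n^{-s} = ζ(s)² H*(s)`
    (hfactor : ∀ s : ℂ, 1 < s.re →
      LSeries (fun n => (ArithmeticFunction.moebius n : ℂ) ^ 2 * (h n : ℂ)) s
        = riemannZeta s ^ 2 * Hstar s)
    (hhol : DifferentiableOn ℂ Hstar {s : ℂ | 1 - c₀ ≤ s.re})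
    -- non-vanishing and lower bound in the classical region
    (hzerofree : ∀ s : ℂ, 1 - c₀ ≤ s.re → 1 - 1 / (L * Real.log (|s.im| + 2)) ≤ s.re →
      Hstar s ≠ 0 ∧ ‖1 / Hstar s‖ ≤ L)
    (hfirst : ∀ x : ℝ, 3 ≤ x →
      |(∑ p ∈ (Finset.Icc 1 ⌊x⌋₊).filter Nat.Prime, h p * Real.log p / p) - 2 * Real.log x| ≤ L)
    (hsecond : Summable fun p : Nat.Primes => h p ^ 2 * ((p : ℕ) : ℝ) ^ (2 * c₀ - 2))
    (Ψ : ℝ → ℝ) (hΨsmooth : ContDiff ℝ ∞ Ψ) (hΨnonneg : ∀ x, 0 ≤ Ψ x)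
    (hΨsupp : Function.support Ψ ⊆ Set.Icc 1 2) (hΨint : ∫ x, Ψ x = 1) :
    -- `A` bounds the exponents in `X ≤ D^{O(1)}` and `X ≤ z^{O(1)}`; `ε` quantifies `o(1)`
    ∀ A : ℝ, 0 < A → ∀ ε : ℝ, 0 < ε → ∃ X₀ : ℝ, ∀ X D z ϑ : ℝ,
      X₀ ≤ X → 3 ≤ X → 3 ≤ D → 3 ≤ z → X ≤ D ^ A → X ≤ z ^ A →
      0 < ϑ → ϑ < 1 / 2 → √D = X ^ ϑ * Real.exp (-√(Real.log X)) →
      |SelbergSieve.sieveSum Ψ h X D z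
          - SelbergSieve.singularConst ϑ (Real.log D / Real.log z) * (X / Real.log X)|
        ≤ ε * (SelbergSieve.singularConst ϑ (Real.log D / Real.log z) * (X / Real.log X)) := by
  intro A hA ε hε
  have H : SelbergSieve.SieveHyp h Hstar L c₀ :=
    ⟨hmul, hnonneg, hL, hc₀, hsummable, hfactor, hhol, hzerofree, hfirst, hsecond⟩
  obtain ⟨v₀, hv₀⟩ :=
    H.exists_sieveSum_asymp (Ψ := Ψ) ⟨hΨsmooth, hΨnonneg, hΨsupp, hΨint⟩ hA hε
  refine ⟨Real.exp v₀, fun X D z ϑ hX hX3 hD hz hXD hXz hϑ0 hϑ hDϑ => ?_⟩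
  have hX0 : 0 < X := by linarith
  have h1 := hv₀ D z (Real.log X) ϑ ((Real.le_log_iff_exp_le hX0).2 hX) hD hz
    (by rw [← Real.log_rpow (by linarith)]; exact Real.log_le_log hX0 hXD)
    (by rw [← Real.log_rpow (by linarith)]; exact Real.log_le_log hX0 hXz) hϑ0 hϑ
    (by rw [hDϑ, Real.log_mul (by positivity) (by positivity), Real.log_rpow hX0, Real.log_exp,
      ← sub_eq_add_neg])
  rwa [Real.exp_log hX0] at h1
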